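/- **Trees.** Let $N\ge 2$, $k\ge 1$, $0<\delta<1$, and let $\ell_0,\ell_1,\dots>0$ satisfy $\sum_n\ell_n<\infty$ and $\ell_n\ge c_0\delta^n$ for some $c_0>0$ and all $n$. Let $T_1$ be the infinite rooted metric tree whose root $O$ is the upper end of a single edge (of generation $0$), in which below every edge of generation $n$ hang $k$ edges of generation $n+1$, and in which edges of generation $n$ have length $\ell_n$; an edge is parametrised by $\theta\in[0,\ell_n]$, starting at its upper end. Let $\Omega\subset\mathbb R^{N-1}$ and $V\subset\mathbb R^N$ be bounded connected Lipschitz domains containing the origin. Let $\sigma_0,\dots,\sigma_k:\mathbb R^{N-1}\to\mathbb R^N$ be affine isometries such that the sections $S_0=\sigma_0(\Omega)$ and $S_j=\sigma_j(\delta\Omega)$, $1\le j\le k$, are pairwise disjoint subsets of $\partial V$, the vector $\sigma_j(0)$ is orthogonal to the hyperplane of $S_j$, and the segment $[0,\sigma_j(0))$ lies in $V$, $0\le j\le k$. Put $h_j=|\sigma_j(0)|$. For small $\varepsilon>0$ the inflated tree $T_N^\varepsilon$ is obtained by gluing the following flat pieces: for each edge $e$ of generation $n$, the inflated vertex $V^\varepsilon_e=\varepsilon\delta^nV$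 at its lower end and the inflated edge $E^\varepsilon_e=\varepsilon\delta^n\Omega\times(\alpha,\beta)$, where $\beta=\ell_n-\varepsilon\delta^nh_0$, and $\alpha=0$ if $n=0$, $\alpha=\varepsilon\delta^{n-1}h_j$ if $e$ is the $j$-th edge below its parent. The lower face of $E^\varepsilon_e$ is glued isometrically, by means of $\sigma_0$, to the section $\varepsilon\delta^nS_0$ of $V^\varepsilon_e$, and the upper face of the $j$-th edge below $e$ is glued, by means of $\sigma_j$, to $\varepsilon\delta^nS_j\subset\partial V^\varepsilon_e$, the edges pointing out of $V_e^\varepsilon$. The volume of $T_N^\varepsilon$ may be infinite. **Operators.** Let $\rho^*=\delta^{(N-1)n}|\Omega|$ on the edges of generation $n$. Let $H^1_0(T_1)$ be the completion, in the norm $\big(\int_{T_1}(|u'|^2+|u|^2)\rho^*d\theta\big)^{1/2}$, of the continuous complex-valued functions of finite norm on $T_1$ that are $C^1$ on every closed edge and vanish at $O$. Let $H^1_0(T^\varepsilon_N)$ be the completion, in the norm $\big(\int_{T_N^\varepsilon}(|\nabla u|^2+|u|^2)dx\big)^{1/2}$, of the complex-valued $C^1$ functions of finite norm on $T^\varepsilon_N$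 that vanish on the top face $\varepsilon\Omega\times\{0\}$ of the root edge. Let $W_\varepsilon$, $\varepsilon>0$, be real potentials on $T_N^\varepsilon$ that are continuous on each (open) piece and bounded by a constant independent of $\varepsilon$. Let $W$ be a bounded measurable real function on $T_1$ such that for almost every $\theta\in T_1$ the average of $W_\varepsilon$ over the cross section of $T_N^\varepsilon$ at $\theta$ converges to $W(\theta)$ as $\varepsilon\to0$. Let $L_\varepsilon=-\Delta+W_\varepsilon$ be the self-adjoint operator on $L^2(T_N^\varepsilon)$ of the form $\int_{T_N^\varepsilon}(\nabla u\cdot\nabla\bar v+W_\varepsilon u\bar v)\,dx$ with domain $H^1_0(T_N^\varepsilon)$ (Dirichlet condition on the root, Neumann condition on the rest of the boundary), and let $A$, $Au=-\frac1{\rho^*}(\rho^*u')'+Wu$, be the self-adjoint operator on $L^2(T_1,\rho^*d\theta)$ of the form $\int_{T_1}(u'\bar v'+Wu\bar v)\rho^*d\theta$ with domain $H^1_0(T_1)$. **Theorem.** For all sufficiently small $\varepsilon>0$ the spectrum of $L_\varepsilon$ is purely discrete, and so is that of $A$. For each $m\in\mathbb N$, the $m$-th eigenvalue of $L_\varepsilon$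 converges, as $\varepsilon\to0$, to the $m$-th eigenvalue of $A$; eigenvalues are numbered in nondecreasing order and repeated according to multiplicity. The same holds if both spaces $H^1_0$ are replaced by the closures of those of the above functions that vanish from some generation on. -/

import Mathlib

open MeasureTheory Filter Topology Set
open scoped Pointwise ENNReal

noncomputable section

namespace InflatedTree

/-- Euclidean `n`-space. -/
abbrev Eucl (n : ℕ) := EuclideanSpace ℝ (Fin n)

/-- The point `(y, t)` of `ℝ^(d+1) = ℝ^d × ℝ`. -/
def point {d : ℕ} (y : Eucl d) (t : ℝ) : Eucl (d + 1) :=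
  WithLp.toLp 2 (Fin.snoc (α := fun _ => ℝ) (fun i => y i) t)

/-- The component `y` of a point `(y, t)` of `ℝ^(d+1) = ℝ^d × ℝ`. -/
def cross {d : ℕ} (x : Eucl (d + 1)) : Eucl d := WithLp.toLp 2 fun i => x i.castSucc

/-- The component `t` of a point `(y, t)` of `ℝ^(d+1) = ℝ^d × ℝ`. -/
def axial {d : ℕ} (x : Eucl (d + 1)) : ℝ := x (Fin.last d)

/-- Bounded Lipschitz domains: bounded, open, connected, nonempty, and near each boundary point,
in a suitable orthonormal frame, the region above the graph of a Lipschitz function.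
Here `e` is the vertical direction, and a function of the horizontal variables is the same as a
function on the whole space that is invariant under translation in the direction `e`. -/
structure IsLipschitzDomain {n : ℕ} (U : Set (Eucl n)) : Prop where
  isOpen : IsOpen U
  isConnected : IsConnected U
  isBounded : Bornology.IsBounded U
  graph : ∀ p ∈ frontier U, ∃ (e : Eucl n) (φ : Eucl n → ℝ) (K : NNReal) (r : ℝ),
    ‖e‖ = 1 ∧ LipschitzWith K φ ∧ (∀ (x : Eucl n) (t : ℝ), φ (x + t • e) = φ x) ∧ 0 < r ∧
      ∀ x ∈ Metric.ball p r, (x ∈ U ↔ φ x < inner ℝ e x)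

/-! ### The data of the tree and of its inflation -/

/-- The data of a regular rooted metric tree of finite radius and of its inflation in dimension
`N = d + 1`: the edge lengths by generation, the scaling factor `δ`, the cross section `Ω`, the
model vertex `V`, and isometric embeddings of `ℝ^d` in `ℝ^N` placing the `k + 1` sections on the
boundary of `V` (`none` is the section towards the root, `some j` the one of the `j`-th child). -/
structure Data (d k : ℕ) where
  len : ℕ → ℝ
  δ : ℝ
  Ω : Set (Eucl d)
  V : Set (Eucl (d + 1))
  sec : Option (Fin k) → (Eucl d →ᵃⁱ[ℝ] Eucl (d + 1))
  len_pos : ∀ n, 0 < len n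
  /-- the radius of the tree is finite -/
  len_summable : Summable len
  δ_pos : 0 < δ
  δ_lt_one : δ < 1
  /-- inflated vertices of size `ε δ ^ n` fit on the edges of generation `n` for small `ε` -/
  len_ge : ∃ c > 0, ∀ n, c * δ ^ n ≤ len n
  Ω_lipschitz : IsLipschitzDomain Ω
  V_lipschitz : IsLipschitzDomain V
  zero_mem_Ω : (0 : Eucl d) ∈ Ω
  zero_mem_V : (0 : Eucl (d + 1)) ∈ V
  /-- the sections lie on the boundary of `V` -/
  sec_frontier : ∀ j, sec j '' (j.elim Ω fun _ => δ • Ω) ⊆ frontier V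
  /-- the sections are disjoint -/
  sec_disjoint : Pairwise fun i j =>
    Disjoint (sec i '' (i.elim Ω fun _ => δ • Ω)) (sec j '' (j.elim Ω fun _ => δ • Ω))
  /-- the orthogonal projection of the center of `V` to a section is the center of the section -/
  sec_perp : ∀ j (y : Eucl d), inner ℝ (sec j 0) (sec j y - sec j 0) = 0
  /-- the skeleton of `V`: the segments from the center of `V` to the centers of the sections -/
  sec_skeleton : ∀ j, ∀ t ∈ Ico (0 : ℝ) 1, t • sec j 0 ∈ V

variable {d k : ℕ}

/-- Edges of the `k`-ary tree are words in `Fin k`. The empty word is the edge that starts at the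
root, and `j :: w` is the `j`-th edge below `w`. The generation of an edge is the length of the
word. The lower end of the edge `w` is also called `w`; these are all the vertices but the root. -/
abbrev Edge (k : ℕ) := List (Fin k)

/-- The condition at the infinite ends of the tree: none, or approximability by functions that
vanish from some generation on. -/
inductive EndCondition
  | free
  | compactSupport

/-! ### Function spaces and operators given by a form -/

/-- The measure on a disjoint union given by a measure on each piece. -/
def sigmaMeasure {ι X : Type*} [MeasurableSpace X] (μ : ι → Measure X) :
    Measure (Σ _ : ι, X) :=
  Measure.sum fun i => (μ i).map (Sigma.mk i)

section Form

variable {ι X G : Type*} [MeasurableSpace X] [NormedAddCommGroup G] [InnerProductSpace ℂ G]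

/-- The completion in the `H¹` norm of a set `C` of functions on a disjoint union of pieces, of
which those of finite norm are used; `D` is the gradient on a piece. It is realised as the closure
in `L² × L²` of the set of pairs of a function and its gradient. -/
def sobolev (μ : ι → Measure X) (D : (X → ℂ) → X → G) (C : Set (ι → X → ℂ)) :
    Set (Lp ℂ 2 (sigmaMeasure μ) × Lp G 2 (sigmaMeasure μ)) :=
  closure {p | ∃ f ∈ C, p.1 =ᵐ[sigmaMeasure μ] (fun x => f x.1 x.2) ∧
    p.2 =ᵐ[sigmaMeasure μ] (fun x => D (f x.1) x.2)}

/-- The graph of the operator that belongs to the form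
`E(u, v) = ∫ (∇u · conj ∇v + W u conj v)` with domain `S`: `u` is mapped to `f` when `u` is in the
form domain and `E(u, v) = ⟨f, v⟩` for all `v` in the form domain. -/
def operatorGraph (μ : ι → Measure X)
    (S : Set (Lp ℂ 2 (sigmaMeasure μ) × Lp G 2 (sigmaMeasure μ))) (W : ι → X → ℝ) :
    Set (Lp ℂ 2 (sigmaMeasure μ) × Lp ℂ 2 (sigmaMeasure μ)) :=
  {p | ∃ g, (p.1, g) ∈ S ∧ ∀ q ∈ S,
    inner ℂ q.2 g + ∫ x, (W x.1 x.2 : ℂ) * inner ℂ (q.1 x) (p.1 x) ∂sigmaMeasure μ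
      = inner ℂ q.1 p.2}

/-- The spectrum of the operator is purely discrete and `ev 0 ≤ ev 1 ≤ …` are its eigenvalues,
repeated according to multiplicity: there is a Hilbert basis of `L²` made of eigenvectors, with
the eigenvalues `ev m` in nondecreasing order, tending to infinity. -/
def HasEigenvalues (μ : ι → Measure X)
    (A : Set (Lp ℂ 2 (sigmaMeasure μ) × Lp ℂ 2 (sigmaMeasure μ))) (ev : ℕ → ℝ) : Prop :=
  Monotone ev ∧ Tendsto ev atTop atTop ∧
    ∃ b : HilbertBasis ℕ ℂ (Lp ℂ 2 (sigmaMeasure μ)), ∀ m, (b m, (ev m : ℂ) • b m) ∈ A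

end Form

namespace Data

variable (T : Data d k)

/-! ### The one-dimensional tree -/

/-- The weight `ρ*` on an edge: `δ ^ ((N - 1) gen) |Ω|`. -/
def weight (w : Edge k) : ℝ≥0∞ := ENNReal.ofReal (T.δ ^ (d * w.length)) * volume T.Ω

/-- The measure `ρ* dθ` on the edges; each edge is parametrised by `θ` from its upper end. -/
def treeMeasure (w : Edge k) : Measure ℝ :=
  T.weight w • volume.restrict (Ioo 0 (T.len w.length))

/-- Functions on the one-dimensional tree that are continuous, `C¹` on each closed edge and zero
at the root, with the given condition at the ends. -/
structure IsTreeTest (c : EndCondition) (f : Edge k → ℝ → ℂ) : Prop where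
  contDiff : ∀ w, ContDiffOn ℝ 1 (f w) (Icc 0 (T.len w.length))
  continuous : ∀ w j, f (j :: w) 0 = f w (T.len w.length)
  root : f [] 0 = 0
  ends : c = .compactSupport →
    ∃ n, ∀ w : Edge k, n ≤ w.length → ∀ θ ∈ Icc 0 (T.len w.length), f w θ = 0

/-- The width-weighted operator `-(1/ρ*) (ρ* u')' + W u` on the one-dimensional tree. -/
def treeOperator (c : EndCondition) (W : Edge k → ℝ → ℝ) :
    Set (Lp ℂ 2 (sigmaMeasure T.treeMeasure) × Lp ℂ 2 (sigmaMeasure T.treeMeasure)) :=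
  operatorGraph T.treeMeasure (sobolev T.treeMeasure deriv {f | T.IsTreeTest c f}) W

/-! ### The inflated tree -/

/-- The pieces of the inflated tree: inflated edges and inflated vertices. -/
inductive Piece (k : ℕ)
  | edge (w : Edge k)
  | vertex (w : Edge k)

/-- The size of the inflated edge `w` and of the inflated vertex at its lower end. -/
def scale (ε : ℝ) (w : Edge k) : ℝ := ε * T.δ ^ w.length

/-- The part of the edge coordinate at which the inflated edge starts: the upper end of the edge
is at the root or in an inflated vertex, whose skeleton is left out. -/
def start (ε : ℝ) : Edge k → ℝ
  | [] => 0
  | j :: w => T.scale ε w * ‖T.sec (some j) 0‖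

/-- The edge coordinate at which the inflated edge ends. -/
def finish (ε : ℝ) (w : Edge k) : ℝ := T.len w.length - T.scale ε w * ‖T.sec none 0‖

/-- The pieces as open sets in their coordinates: an inflated edge is a cylinder with coordinates
`(s, θ)`, and an inflated vertex is a multiple of `V`. -/
def region (ε : ℝ) : Piece k → Set (Eucl (d + 1))
  | .edge w => {x | cross x ∈ T.scale ε w • T.Ω ∧ axial x ∈ Ioo (T.start ε w) (T.finish ε w)}
  | .vertex w => T.scale ε w • T.V

/-- The pieces together with the sections along which they are glued (and the section at the
root). -/
def closedRegion (ε : ℝ) : Piece k → Set (Eucl (d + 1))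
  | .edge w => {x | cross x ∈ T.scale ε w • T.Ω ∧ axial x ∈ Icc (T.start ε w) (T.finish ε w)}
  | .vertex w => T.scale ε w • (T.V ∪ ⋃ j, T.sec j '' (j.elim T.Ω fun _ => T.δ • T.Ω))

/-- The Lebesgue measure on each piece. -/
def inflatedMeasure (ε : ℝ) (i : Piece k) : Measure (Eucl (d + 1)) :=
  volume.restrict (T.region ε i)

/-- The unit normal of a section of `V` that points out of `V`. -/
def normal (j : Option (Fin k)) : Eucl (d + 1) := ‖T.sec j 0‖⁻¹ • T.sec j 0

/-- `C¹` functions on the inflated tree that vanish on the section at the root, with the given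
condition at the ends. The function is `C¹` on each piece up to the sections, and its values and
derivatives agree where pieces are glued: the lower end of the edge `w` is glued to the section
`none` of the vertex `w`, and the upper end of the edge `j :: w` to its section `some j`. -/
structure IsInflatedTest (ε : ℝ) (c : EndCondition) (f : Piece k → Eucl (d + 1) → ℂ) : Prop where
  contDiff : ∀ i, ContDiffOn ℝ 1 (f i) (T.closedRegion ε i)
  value_lower : ∀ w, ∀ y ∈ T.Ω,
    f (.edge w) (point (T.scale ε w • y) (T.finish ε w)) =
      f (.vertex w) (T.scale ε w • T.sec none y)
  value_upper : ∀ w j, ∀ y ∈ T.δ • T.Ω,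
    f (.edge (j :: w)) (point (T.scale ε w • y) (T.start ε (j :: w))) =
      f (.vertex w) (T.scale ε w • T.sec (some j) y)
  deriv_lower : ∀ w, ∀ y ∈ T.Ω, ∀ (a : Eucl d) (t : ℝ),
    fderivWithin ℝ (f (.edge w)) (T.closedRegion ε (.edge w))
        (point (T.scale ε w • y) (T.finish ε w)) (point a t) =
      fderivWithin ℝ (f (.vertex w)) (T.closedRegion ε (.vertex w))
        (T.scale ε w • T.sec none y) ((T.sec none).linear a - t • T.normal none)
  deriv_upper : ∀ w j, ∀ y ∈ T.δ • T.Ω, ∀ (a : Eucl d) (t : ℝ),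
    fderivWithin ℝ (f (.edge (j :: w))) (T.closedRegion ε (.edge (j :: w)))
        (point (T.scale ε w • y) (T.start ε (j :: w))) (point a t) =
      fderivWithin ℝ (f (.vertex w)) (T.closedRegion ε (.vertex w))
        (T.scale ε w • T.sec (some j) y)
        ((T.sec (some j)).linear a + t • T.normal (some j))
  root : ∀ y ∈ T.Ω, f (.edge []) (point (T.scale ε [] • y) 0) = 0
  ends : c = .compactSupport → ∃ n, ∀ w : Edge k, n ≤ w.length →
    (∀ x ∈ T.closedRegion ε (.edge w), f (.edge w) x = 0) ∧
      ∀ x ∈ T.closedRegion ε (.vertex w), f (.vertex w) x = 0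

/-- The gradient of a complex-valued function. -/
def grad (f : Eucl (d + 1) → ℂ) (x : Eucl (d + 1)) : EuclideanSpace ℂ (Fin (d + 1)) :=
  WithLp.toLp 2 fun i => fderiv ℝ f x (EuclideanSpace.single i 1)

/-- The Schrödinger operator `-Δ + W` on the inflated tree, with the Dirichlet condition at the
root and the Neumann condition on the rest of the boundary. -/
def inflatedOperator (ε : ℝ) (c : EndCondition) (W : Piece k → Eucl (d + 1) → ℝ) :
    Set (Lp ℂ 2 (sigmaMeasure (T.inflatedMeasure ε)) ×
      Lp ℂ 2 (sigmaMeasure (T.inflatedMeasure ε))) :=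
  operatorGraph (T.inflatedMeasure ε)
    (sobolev (T.inflatedMeasure ε) grad {f | T.IsInflatedTest ε c f}) W

/-- The average of a function on the inflated tree over the cross section of the edge `w` at `θ`. -/
def sectionAverage (ε : ℝ) (W : Piece k → Eucl (d + 1) → ℝ) (w : Edge k) (θ : ℝ) : ℝ :=
  ⨍ s in T.scale ε w • T.Ω, W (.edge w) (point s θ)

end Data

end InflatedTree

end

open MeasureTheory Filter Topology Set
open scoped Pointwise ENNReal

noncomputable section

set_option linter.unusedSectionVars false

open ENNReal (ofReal ofReal_mul ofReal_le_ofReal ofReal_ne_top ofReal_add tsum_add tsum_le_tsum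
  ofReal_ofNat coe_toNNReal mul_top ofReal_pow ofReal_one le_tsum mul_ne_top ofReal_toReal
  rpow_two toReal_mul toReal_ofReal rpow_mul)
open Metric (ball mem_ball mem_ball_self ball_subset_ball)
open MeasureTheory.Measure (restrict_apply_univ restrict_mono)
open Filter.Eventually (of_forall)
open Real (volume_Ioo toNNReal norm_eq_abs sq_sqrt sqrt)
open Module (finrank)
open Finset (mul_sum sum_congr sum_le_sum sum_add_distrib sum_nonneg)
open Function (update_of_ne uncurry comp_apply update_self update)
open EuclideanSpace (norm_eq norm_sq_eq)
open WithLp (toLp)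
open Complex (norm_real add_re ofReal_re ofReal_zero conj_ofReal conj_mul')

namespace InflatedTree

/-- The squared norm in the extended nonnegative reals. -/
notation "‖" x "‖²" => ‖x‖ₑ ^ 2

/-- Functions on the pieces of an inflated tree. -/
abbrev PieceFun (d k : ℕ) := Data.Piece k → Eucl (d + 1) → ℂ

/-- Functions on the edges of a tree. -/
abbrev EdgeFun (k : ℕ) := Edge k → ℝ → ℂ

/-- The edges of a generation. -/
abbrev Word (k n : ℕ) := List.Vector (Fin k) n

notation "ℓ(" T "," w ")" => Data.len T (List.length w)
notation "I(" T "," w ")" => Ioo 0 (Data.len T (List.length w))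
notation "J(" T "," ε "," w ")" => Ioo (Data.start T ε w) (Data.finish T ε w)
notation "Λ(" T "," ε "," w ")" => (Data.finish T ε w - Data.start T ε w)
notation "∇" => fderiv ℝ
notation "E(" T "," ε "," w ")" => Data.region T ε (Data.Piece.edge w)
notation "V(" T "," ε "," w ")" => Data.region T ε (Data.Piece.vertex w)
notation "L²(" μ ")" => Lp ℂ 2 (sigmaMeasure μ)
notation "M(" T "," ε ")" => sigmaMeasure (Data.inflatedMeasure T ε)

theorem etsum_mul {ι : Type*} {a : ENNReal} {f : ι → ENNReal} : ∑' i, a * f i = a * ∑' i, f i :=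
  ENNReal.tsum_mul_left

/-! ### Enumeration of a family of reals with finite sublevel sets -/

theorem exists_equiv_nat_monotone {ι : Type*} [Countable ι] [Infinite ι] (f : ι → ℝ)
    (hf : ∀ r, {i | f i ≤ r}.Finite) :
    ∃ e : ℕ ≃ ι, Monotone (f ∘ e) ∧ Tendsto (f ∘ e) atTop atTop := by
  obtain ⟨c, hc⟩ := exists_injective_nat ι
  let key : ι → ℝ ×ₗ ℕ := fun i => toLex (f i, c i)
  have hkey : Function.Injective key := fun i j h => hc (congrArg (fun p => (ofLex p).2) h)
  have hle : ∀ {i j}, key i < key j → f i ≤ f j := fun {i j} h => by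
    rcases (Prod.Lex.lt_iff).1 h with h | h
    · exact h.le
    · exact h.1.le
  have hfin : ∀ j, {i | key i < key j}.Finite := fun j => (hf (f j)).subset fun i hi => hle hi
  let rank : ι → ℕ := fun j => {i | key i < key j}.ncard
  have hrank : ∀ {i j}, key i < key j → rank i < rank j := fun {i j} h => by
    refine Set.ncard_lt_ncard ⟨fun l hl => lt_trans hl h, fun hs => ?_⟩ (hfin j)
    exact lt_irrefl (key i) (hs h)
  have hinj : Function.Injective rank := fun i j h => by
    by_contra hne
    rcases lt_or_gt_of_ne (fun h' => hne (hkey h')) with h' | h'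
    · exact (hrank h').ne h
    · exact (hrank h').ne' h
  have hsurj_aux : ∀ n j, rank j = n → ∀ m < n, ∃ i, rank i = m := fun n => by
    induction n with
    | zero => intro j _ m hm; omega
    | succ n ih =>
      intro j hj m hm
      have hne : {i | key i < key j}.Nonempty := by
        rw [← Set.ncard_pos (hfin j)]; change 0 < rank j; omega
      obtain ⟨i, hi, hmax⟩ := Set.exists_max_image _ key (hfin j) hne
      have hcard : rank i = n := by
        have : {l | key l < key j} = insert i {l | key l < key i} := by
          ext l
          constructor
          · intro hl
            rcases (hmax l hl).lt_or_eq with h | h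
            · exact Or.inr h
            · exact Or.inl (hkey h)
          · rintro (rfl | hl)
            · exact hi
            · exact lt_trans (hl) (show key i < key j from hi)
        have h2 : rank j = rank i + 1 := by
          have hni : i ∉ {l | key l < key i} := fun h => lt_irrefl (key i) h
          change {l | key l < key j}.ncard = _
          rw [this, Set.ncard_insert_of_notMem hni (hfin i)]
        omega
      rcases Nat.lt_succ_iff_lt_or_eq.1 hm with h | h
      · exact ih i hcard m h
      · exact ⟨i, hcard.trans h.symm⟩
  have hsurj : Function.Surjective rank := fun m => by
    obtain ⟨_, ⟨j, rfl⟩, hj⟩ := (Set.infinite_range_of_injective hinj).exists_gt m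
    exact hsurj_aux _ j rfl m hj
  let e : ι ≃ ℕ := Equiv.ofBijective rank ⟨hinj, hsurj⟩
  have hmono : Monotone (f ∘ e.symm) := fun m n hmn => by
    by_contra! h
    have h1 : key (e.symm n) < key (e.symm m) := Prod.Lex.lt_iff.2 (Or.inl h)
    have h2 := hrank h1
    have h3 : ∀ l, rank (e.symm l) = l := e.apply_symm_apply
    rw [h3, h3] at h2
    omega
  refine ⟨e.symm, hmono, tendsto_atTop_atTop_of_monotone hmono fun r => ?_⟩
  by_contra! h
  refine Set.infinite_univ (((hf r).preimage e.symm.injective.injOn).subset ?_)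
  intro n _
  exact (h n).le

/-! ### Compactness and the spectral theorem for forms -/

section Abstract

variable {E H K : Type*} [NormedAddCommGroup E] [InnerProductSpace ℂ E] [NormedAddCommGroup H]
  [InnerProductSpace ℂ H] [NormedAddCommGroup K] [InnerProductSpace ℂ K]

theorem re_inner_self_eq (x : H) : (inner ℂ x x).re = ‖x‖ ^ 2 := inner_self_eq_norm_sq (𝕜 := ℂ) x

theorem isCompactOperator_of_finite_rank_bound [CompleteSpace H] (A : E →L[ℂ] H)
    (h : ∀ η > 0, ∃ (n : ℕ) (F : E →L[ℂ] (Fin n → ℂ)), ∀ x, ‖A x‖ ^ 2 ≤ η * ‖x‖ ^ 2 + ‖F x‖ ^ 2) :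
    IsCompactOperator A := by
  refine (isCompactOperator_iff_isCompact_closure_image_closedBall (A : E →ₗ[ℂ] H) zero_lt_one).2 ?_
  refine TotallyBounded.isCompact_of_isClosed (TotallyBounded.closure ?_) isClosed_closure
  rw [Metric.totallyBounded_iff]
  intro r hr
  obtain ⟨n, F, hF⟩ := h (r ^ 2 / 16) (by positivity)
  have hb : TotallyBounded (F '' Metric.closedBall 0 1) := by
    have := F.lipschitz.isBounded_image (Metric.isBounded_closedBall (x := 0) (r := 1))
    exact this.isCompact_closure.totallyBounded.subset subset_closure
  obtain ⟨t, hts, htf, hcov⟩ := Metric.finite_approx_of_totallyBounded hb (r / 4) (by positivity)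
  have hts' : ∀ y ∈ t, ∃ x ∈ Metric.closedBall 0 1, F x = y := hts
  choose! g hg hFg using hts'
  refine ⟨(A ∘ g) '' t, htf.image _, ?_⟩
  rintro _ ⟨x, hx, rfl⟩
  obtain ⟨y, hy, hxy⟩ := mem_iUnion₂.1 (hcov ⟨x, hx, rfl⟩)
  refine mem_iUnion₂.2 ⟨A (g y), ⟨y, hy, rfl⟩, ?_⟩
  have h1 := hF (x - g y)
  have h2 : ‖x - g y‖ ≤ 2 := by
    have := norm_sub_le x (g y)
    have ha := mem_closedBall_zero_iff.1 hx
    have hb := mem_closedBall_zero_iff.1 (hg y hy)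
    linarith
  have h3 : ‖F (x - g y)‖ < r / 4 := by rw [map_sub, ← dist_eq_norm, hFg y hy]; exact hxy
  rw [map_sub] at h1
  have h4 : ‖A x - A (g y)‖ ^ 2 < r ^ 2 := by
    have : ‖x - g y‖ ^ 2 ≤ 4 := by nlinarith [norm_nonneg (x - g y)]
    have : ‖F (x - g y)‖ ^ 2 ≤ (r / 4) ^ 2 := by gcongr
    nlinarith
  change dist (A x) (A (g y)) < r
  rw [dist_eq_norm]
  exact lt_of_pow_lt_pow_left₀ 2 hr.le h4

/-- A compact symmetric positive injective operator on an infinite-dimensional Hilbert space has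
an orthonormal basis of eigenvectors, with eigenvalues decreasing to zero. -/
theorem exists_hilbertBasis_eigenvectors [CompleteSpace H]
    (hH : ¬ FiniteDimensional ℂ H) (A : H →L[ℂ] H) (hA : IsCompactOperator A)
    (hs : (A : H →ₗ[ℂ] H).IsSymmetric) (hpos : ∀ x, x ≠ 0 → 0 < (inner ℂ (A x) x).re) :
    ∃ (b : HilbertBasis ℕ ℂ H) (l : ℕ → ℝ), (∀ m, 0 < l m) ∧ Monotone l ∧
      Tendsto l atTop atTop ∧ ∀ m, A (b m) = (((l m)⁻¹ : ℝ) : ℂ) • b m := by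
  let I := {μ : ℂ // μ ≠ 0}
  let V : I → Submodule ℂ H := fun μ => Module.End.eigenspace A μ
  have hV : OrthogonalFamily ℂ (fun μ => V μ) fun μ => (V μ).subtypeₗᵢ :=
    hs.orthogonalFamily_eigenspaces.comp Subtype.val_injective
  have : ∀ μ, FiniteDimensional ℂ (V μ) := fun μ =>
    A.finite_dimensional_eigenspace hA μ.1 μ.2
  let ι := Σ μ : I, Fin (finrank ℂ (V μ))
  let v : ι → H := fun a => (stdOrthonormalBasis ℂ (V a.1) a.2 : H)
  have hv : Orthonormal ℂ v :=
    hV.orthonormal_sigma_orthonormal (fun μ => (stdOrthonormalBasis ℂ (V μ)).orthonormal)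
  have hAv : ∀ a, A (v a) = (a.1 : ℂ) • v a := fun a =>
    Module.End.mem_eigenspace_iff.1 (stdOrthonormalBasis ℂ (V a.1) a.2).2
  have hinner : ∀ a, inner ℂ (A (v a)) (v a) = (starRingEnd ℂ) (a.1 : ℂ) := fun a => by
    rw [hAv, inner_smul_left, inner_self_eq_norm_sq_to_K, hv.1 a]; simp
  have hre : ∀ a : ι, ((a.1 : ℂ).re : ℂ) = a.1 := fun a => by
    rw [← Complex.conj_eq_iff_re, ← hinner, show inner ℂ (A (v a)) (v a) = inner ℂ (v a) (A (v a))
      from hs _ _, hAv, inner_smul_right, inner_self_eq_norm_sq_to_K, hv.1 a]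
    simp
  have hrepos : ∀ a : ι, 0 < (a.1 : ℂ).re := fun a => by
    have := hpos (v a) (hv.ne_zero a)
    rwa [hinner, Complex.conj_re] at this
  have hspan : (Submodule.span ℂ (range v))ᗮ = ⊥ := by
    rw [← le_bot_iff, ← ContinuousLinearMap.orthogonalComplement_iSup_eigenspaces_eq_bot hA hs]
    refine Submodule.orthogonal_le (iSup_le fun μ => ?_)
    by_cases hμ : μ = 0
    · intro x hx
      rw [Module.End.mem_eigenspace_iff, hμ, zero_smul] at hx
      by_contra hx'
      have h0 := hpos x (fun h => hx' (h ▸ Submodule.zero_mem _))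
      rw [show A x = 0 from hx] at h0
      simp at h0
    · intro x hx
      rw [← show _ = x from (congrArg (Subtype.val) ((stdOrthonormalBasis ℂ (V ⟨μ, hμ⟩)).sum_repr
        ⟨x, hx⟩))]
      rw [Submodule.coe_sum]
      refine Submodule.sum_mem _ fun i _ => ?_
      exact Submodule.smul_mem _ _ (Submodule.subset_span ⟨⟨⟨μ, hμ⟩, i⟩, rfl⟩)
  let f : ι → ℝ := fun a => ((a.1 : ℂ).re)⁻¹
  have hfin : ∀ r, {a | f a ≤ r}.Finite := fun r => by
    by_contra hinf
    have hinf : {a | f a ≤ r}.Infinite := hinf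
    let g := hinf.natEmbedding
    have hgr := fun n => (g n).2
    have hr := (inv_pos.2 (hrepos (g 0))).trans_le (hgr 0)
    obtain ⟨C, hC, hAC⟩ := IsCompactOperator.image_closedBall_subset_compact hA 1
    have hmem : ∀ n, A (v (g n)) ∈ C := fun n => hAC ⟨v (g n), by simp [hv.1], rfl⟩
    obtain ⟨x, _, φ, hφ, hlim⟩ := hC.tendsto_subseq hmem
    have hc := hlim.cauchySeq
    rw [Metric.cauchySeq_iff'] at hc
    obtain ⟨N, hN⟩ := hc r⁻¹ (inv_pos.2 hr)
    have h1 := hN (N + 1) (by omega)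
    have hne : (g (φ (N + 1)) : ι) ≠ g (φ N) := fun h => by
      exact (hφ (Nat.lt_succ_self N)).ne' (g.injective (Subtype.ext h))
    have horth : inner ℂ (A (v (g (φ (N + 1))))) (A (v (g (φ N)))) = 0 := by
      rw [hAv, hAv, inner_smul_left, inner_smul_right, hv.2 hne]; simp
    have h2 := norm_sub_sq (𝕜 := ℂ) (A (v (g (φ (N + 1))))) (A (v (g (φ N))))
    rw [horth] at h2
    rw [comp_apply, comp_apply, dist_eq_norm] at h1
    have h3 : r⁻¹ ≤ ‖A (v (g (φ (N + 1))))‖ := by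
      rw [hAv, norm_smul, hv.1, mul_one]
      exact ((fun n => inv_le_of_inv_le₀ (hrepos _) (hgr n)) _).trans (Complex.re_le_norm _)
    have h4 := inv_pos.2 hr
    simp at h2
    nlinarith [sq_nonneg ‖A (v (g (φ N)))‖, norm_nonneg (A (v (g (φ (N + 1)))) - A (v (g (φ N))))]
  have : Countable ι := by
    rw [← Set.countable_univ_iff]
    refine (Set.countable_iUnion fun n : ℕ => (hfin n).countable).mono fun a _ => ?_
    exact mem_iUnion.2 (exists_nat_ge (f a))
  let b₀ : HilbertBasis ι ℂ H := HilbertBasis.mkOfOrthogonalEqBot hv hspan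
  have : Infinite ι := by
    by_contra hfi
    rw [not_infinite_iff_finite] at hfi
    have := Fintype.ofFinite ι
    exact hH (b₀.toOrthonormalBasis.toBasis.finiteDimensional_of_finite)
  obtain ⟨e, he1, he2⟩ := exists_equiv_nat_monotone f hfin
  refine ⟨HilbertBasis.mkOfOrthogonalEqBot (hv.comp e e.injective) ?_, f ∘ e, fun m =>
    inv_pos.2 (hrepos _), he1, he2, fun m => ?_⟩
  · rw [← hspan, e.surjective.range_comp]
  · rw [HilbertBasis.coe_mkOfOrthogonalEqBot, comp_apply, comp_apply, hAv]
    simp only [f, inv_inv]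
    rw [hre]

theorem exists_hilbertBasis_of_compact_embedding [CompleteSpace E] [CompleteSpace H]
    (hH : ¬ FiniteDimensional ℂ H) (J : E →L[ℂ] H) (hJc : IsCompactOperator J)
    (hdense : ∀ x : H, (∀ p, inner ℂ (J p) x = 0) → x = 0)
    (B : H →L[ℂ] H) (hB : (B : H →ₗ[ℂ] H).IsSymmetric) :
    ∃ (b : HilbertBasis ℕ ℂ H) (l : ℕ → ℝ), Monotone l ∧ Tendsto l atTop atTop ∧
      ∀ m, ∃ e : E, J e = b m ∧
        ∀ q, inner ℂ q e + inner ℂ (J q) (B (b m)) = (1 + l m : ℂ) * inner ℂ (J q) (b m) := by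
  obtain ⟨M, hM⟩ : ∃ M, ∀ x, ‖inner ℂ x (B x)‖ ≤ M * ‖x‖ ^ 2 := by
    refine ⟨‖B‖, fun x => (norm_inner_le_norm _ _).trans ?_⟩
    nlinarith [B.le_opNorm x, norm_nonneg x]
  let A₀ : E →L[ℂ] E :=
    ContinuousLinearMap.id ℂ E + J.adjoint ∘L (B + M • ContinuousLinearMap.id ℂ H) ∘L J
  have hA₀ : ∀ p q, inner ℂ p (A₀ q) = inner ℂ p q
      + inner ℂ (J p) (B (J q)) + M * inner ℂ (J p) (J q) := fun p q => by
    have h3 : A₀ q = q + J.adjoint (B (J q) + (M : ℂ) • J q) := rfl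
    rw [h3, inner_add_right, J.adjoint_inner_right, inner_add_right, inner_smul_right, add_assoc]
  have hBre : ∀ x, 0 ≤ (inner ℂ x (B x)).re + M * ‖x‖ ^ 2 := fun x => by
    have h1 := hM x
    have h2 := Complex.abs_re_le_norm (inner ℂ x (B x))
    have := neg_abs_le (inner ℂ x (B x)).re
    linarith
  have hA₀pos : ∀ p, ‖p‖ ^ 2 ≤ (inner ℂ p (A₀ p)).re := fun p => by
    rw [hA₀]
    have := hBre (J p)
    rw [add_re, add_re, Complex.re_ofReal_mul, re_inner_self_eq, re_inner_self_eq]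
    linarith
  have hB' : ∀ x y, inner ℂ (B x) y = inner ℂ x (B y) := hB
  have hA₀s : ∀ p q, inner ℂ (A₀ p) q = inner ℂ p (A₀ q) := fun p q => by
    rw [← inner_conj_symm, hA₀, hA₀]
    simp only [map_add, map_mul, inner_conj_symm, conj_ofReal, hB']
  have hunit : IsUnit A₀ := by
    refine ContinuousLinearMap.isUnit_of_forall_le_norm_inner_map A₀ one_pos fun p => ?_
    rw [NNReal.coe_one, mul_one, norm_inner_symm]
    exact (hA₀pos p).trans (Complex.re_le_norm _)
  obtain ⟨U, hU⟩ := hunit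
  let R : E →L[ℂ] E := (U⁻¹ : (E →L[ℂ] E)ˣ)
  have hAR : ∀ p, A₀ (R p) = p := fun p => by
    have := congrArg (fun F => F p) U.mul_inv
    rw [hU] at this
    exact this
  have hJinj : ∀ x, J.adjoint x = 0 → x = 0 := fun x hx => by
    refine hdense x fun p => ?_
    rw [← J.adjoint_inner_right, hx, inner_zero_right]
  let A : H →L[ℂ] H := J ∘L R ∘L J.adjoint
  have hAinner : ∀ x y, inner ℂ (A x) y = inner ℂ (R (J.adjoint x)) (A₀ (R (J.adjoint y))) := by
    intro x y
    rw [hAR, J.adjoint_inner_right]; rfl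
  obtain ⟨b, l, hl, hmono, htend, hb⟩ := exists_hilbertBasis_eigenvectors hH A
    (hJc.comp_clm (R ∘L J.adjoint))
    (fun x y => by
      change inner ℂ (A x) y = inner ℂ x (A y)
      rw [← inner_conj_symm x, hAinner x, hAinner y, ← hA₀s, hAR (J.adjoint x), inner_conj_symm])
    (fun x hx => by
      rw [hAinner]
      refine lt_of_lt_of_le ?_ (hA₀pos _)
      have : R (J.adjoint x) ≠ 0 := fun h => hx (hJinj x (by rw [← hAR (J.adjoint x), h, map_zero]))
      have := norm_pos_iff.2 this
      positivity)
  refine ⟨b, fun m => l m - 1 - M, fun i j h => by have := hmono h; simp only; linarith, ?_,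
    fun m => ?_⟩
  · exact tendsto_atTop_add_const_right _ (-M) (tendsto_atTop_add_const_right _ (-1) htend) |>.congr
      fun m => by ring
  · let e : E := (l m : ℂ) • R (J.adjoint (b m))
    have he1 : J e = b m := by
      rw [map_smul]
      change (l m : ℂ) • A (b m) = b m
      rw [hb, smul_smul, ← Complex.ofReal_mul, mul_inv_cancel₀ (hl m).ne', Complex.ofReal_one,
        one_smul]
    refine ⟨e, he1, fun q => ?_⟩
    have h1 := hA₀ q e
    rw [show A₀ e = (l m : ℂ) • J.adjoint (b m) by rw [map_smul, hAR], inner_smul_right,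
      J.adjoint_inner_right, he1] at h1
    push_cast
    linear_combination -h1

/-- `x` is an eigenvector with eigenvalue `l` of the operator of the form
`⟪∇p, ∇q⟫ + ⟪p, B q⟫` with domain `S`. -/
def IsFormEigenvector (S : Submodule ℂ (H × K)) (B : H →L[ℂ] H) (l : ℝ) (x : H) : Prop :=
  ∃ g, (x, g) ∈ S ∧ ∀ q ∈ S, inner ℂ q.2 g + inner ℂ q.1 (B x) = inner ℂ q.1 ((l : ℂ) • x)

theorem exists_hilbertBasis_formEigenvectors [CompleteSpace H] [CompleteSpace K]
    (hH : ¬ FiniteDimensional ℂ H) (D : Submodule ℂ (H × K))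
    (B : H →L[ℂ] H) (hB : (B : H →ₗ[ℂ] H).IsSymmetric)
    (hdense : ∀ x : H, (∀ p ∈ D, inner ℂ p.1 x = 0) → x = 0)
    (hcomp : ∀ η > 0, ∃ (n : ℕ) (h : Fin n → H), ∀ p ∈ D,
      ‖p.1‖ ^ 2 ≤ η * (‖p.1‖ ^ 2 + ‖p.2‖ ^ 2) + ∑ i, ‖inner ℂ (h i) p.1‖ ^ 2) :
    ∃ (b : HilbertBasis ℕ ℂ H) (l : ℕ → ℝ), Monotone l ∧ Tendsto l atTop atTop ∧
      ∀ m, IsFormEigenvector D.topologicalClosure B (l m) (b m) := by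
  let S₀ : Submodule ℂ (WithLp 2 (H × K)) :=
    D.topologicalClosure.comap (WithLp.prodContinuousLinearEquiv 2 ℂ H K).toLinearMap
  have hS₀ :=
    D.isClosed_topologicalClosure.preimage (WithLp.prodContinuousLinearEquiv 2 ℂ H K).continuous
  have : CompleteSpace S₀ := hS₀.completeSpace_coe
  let J : S₀ →L[ℂ] H := (ContinuousLinearMap.fst ℂ H K ∘L
    (WithLp.prodContinuousLinearEquiv 2 ℂ H K).toContinuousLinearMap) ∘L S₀.subtypeL
  have hnorm : ∀ p : S₀, ‖p‖ ^ 2 = ‖p.1.fst‖ ^ 2 + ‖p.1.snd‖ ^ 2 := fun p =>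
    WithLp.prod_norm_sq_eq_of_L2 _
  have hJc : IsCompactOperator J := by
    refine isCompactOperator_of_finite_rank_bound J fun η hη => ?_
    obtain ⟨n, h, hh⟩ := hcomp η hη
    have hcl : ∀ p ∈ D.topologicalClosure,
        ‖p.1‖ ^ 2 ≤ η * (‖p.1‖ ^ 2 + ‖p.2‖ ^ 2) + ∑ i, ‖inner ℂ (h i) p.1‖ ^ 2 := fun p hp => by
      have hclosed : IsClosed {p : H × K | ‖p.1‖ ^ 2 ≤
          η * (‖p.1‖ ^ 2 + ‖p.2‖ ^ 2) + ∑ i, ‖inner ℂ (h i) p.1‖ ^ 2} :=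
        isClosed_le (by fun_prop) (by fun_prop)
      exact closure_minimal hh hclosed hp
    refine ⟨n, (sqrt n : ℂ) • (ContinuousLinearMap.pi fun i => (innerSL ℂ (h i)) ∘L J), fun p => ?_⟩
    have h3 : ∑ i, ‖inner ℂ (h i) p.1.fst‖ ^ 2 ≤ n * ‖fun i => inner ℂ (h i) p.1.fst‖ ^ 2 := by
      refine (Finset.sum_le_card_nsmul Finset.univ _ (‖fun i => inner ℂ (h i) p.1.fst‖ ^ 2)
        fun i _ => by gcongr; exact (fun i => norm_le_pi_norm (fun i => inner ℂ (h i) p.1.fst) i) i).trans ?_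
      simp
    have h4 : ((sqrt n : ℂ) • (ContinuousLinearMap.pi fun i => (innerSL ℂ (h i)) ∘L J)) p
      = (sqrt n : ℂ) • fun i => inner ℂ (h i) p.1.fst := rfl
    rw [h4, norm_smul, mul_pow, norm_real, Real.norm_of_nonneg (Real.sqrt_nonneg _),
      sq_sqrt (Nat.cast_nonneg n), hnorm]
    exact (hcl _ p.2).trans (add_le_add le_rfl h3)
  obtain ⟨b, l, h1, h2, h3⟩ := exists_hilbertBasis_of_compact_embedding hH J hJc
    (fun x hx => hdense x fun p hp => hx ⟨toLp 2 p, D.le_topologicalClosure hp⟩) B hB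
  refine ⟨b, l, h1, h2, fun m => ?_⟩
  obtain ⟨e, he, heq⟩ := h3 m
  refine ⟨e.1.snd, ?_, fun q hq => ?_⟩
  · rw [← he]; exact e.2
  · have h5 : inner ℂ q.1 (b m) + inner ℂ q.2 e.1.snd + inner ℂ q.1 (B (b m))
      = (1 + l m : ℂ) * inner ℂ q.1 (b m) := by
      refine Eq.trans ?_ (heq ⟨toLp 2 q, hq⟩)
      rw [← he]
      exact congrArg (· + inner ℂ q.1 (B (J e))) (WithLp.prod_inner_apply (toLp 2 q) e.1).symm
    rw [inner_smul_right]
    linear_combination h5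

/-- The quadratic form `‖∇p‖² + ⟪p, (B + M) p⟫`. -/
def formEnergy (B : H →L[ℂ] H) (M : ℝ) (p : H × K) : ℝ :=
  ‖p.2‖ ^ 2 + (inner ℂ p.1 (B p.1)).re + M * ‖p.1‖ ^ 2

theorem continuous_formEnergy (B : H →L[ℂ] H) (M : ℝ) :
    Continuous (formEnergy B M : H × K → ℝ) := by unfold formEnergy; fun_prop

theorem norm_sq_le_formEnergy {B : H →L[ℂ] H} {M : ℝ}
    (hM : ∀ x, ‖x‖ ^ 2 ≤ (inner ℂ x (B x)).re + M * ‖x‖ ^ 2) (p : H × K) :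
    ‖p.2‖ ^ 2 + ‖p.1‖ ^ 2 ≤ formEnergy B M p := by
  have := hM p.1
  unfold formEnergy; linarith

theorem formEnergy_sum_eigenvectors {S : Submodule ℂ (H × K)} {B : H →L[ℂ] H} {M : ℝ} {n : ℕ}
    (b : Fin n → H) (hb : Orthonormal ℂ b) (l : Fin n → ℝ) (g : Fin n → K)
    (hS : ∀ i, (b i, g i) ∈ S)
    (hg : ∀ i, ∀ q ∈ S, inner ℂ q.2 (g i) + inner ℂ q.1 (B (b i))
      = inner ℂ q.1 ((l i : ℂ) • b i)) (c : Fin n → ℂ) :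
    formEnergy B M (∑ i, c i • (b i, g i)) = ∑ i, (l i + M) * ‖c i‖ ^ 2 := by
  have hfst : (∑ i, c i • (b i, g i)).1 = ∑ i, c i • b i := by simp [Prod.fst_sum]
  have hsnd : (∑ i, c i • (b i, g i)).2 = ∑ i, c i • g i := by simp [Prod.snd_sum]
  have hmem : (∑ i, c i • (b i, g i)) ∈ S := S.sum_mem fun i _ => S.smul_mem _ (hS i)
  have h1 : ∀ i, inner ℂ (∑ i, c i • g i) (g i) + inner ℂ (∑ i, c i • b i) (B (b i))
      = (l i : ℂ) * (starRingEnd ℂ) (c i) := fun i => by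
    have := hg i _ hmem
    rw [hfst, hsnd] at this
    rw [this, inner_smul_right, hb.inner_left_fintype]
  have hn : ‖∑ i, c i • b i‖ ^ 2 = ∑ i, ‖c i‖ ^ 2 := by
    rw [← re_inner_self_eq, hb.inner_sum]
    simp [conj_mul', ← Complex.ofReal_pow]
  have h2 : inner ℂ (∑ i, c i • g i) (∑ i, c i • g i)
      + inner ℂ (∑ i, c i • b i) (B (∑ i, c i • b i)) = ∑ i, ((l i * ‖c i‖ ^ 2 : ℝ) : ℂ) := by
    rw [map_sum, inner_sum, inner_sum, ← sum_add_distrib]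
    refine sum_congr rfl fun i _ => ?_
    rw [map_smul, inner_smul_right, inner_smul_right, ← mul_add, h1]
    push_cast
    rw [← Complex.mul_conj']
    ring
  unfold formEnergy
  rw [hfst, hsnd, hn, ← re_inner_self_eq, ← add_re, h2, mul_sum, Complex.re_sum, ← sum_add_distrib]
  refine sum_congr rfl fun i _ => ?_
  rw [ofReal_re]; ring

theorem mul_norm_sq_le_formEnergy [CompleteSpace H] {S : Submodule ℂ (H × K)} {B : H →L[ℂ] H}
    (hB : (B : H →ₗ[ℂ] H).IsSymmetric) {M : ℝ}
    (hM : ∀ x, ‖x‖ ^ 2 ≤ (inner ℂ x (B x)).re + M * ‖x‖ ^ 2) (b : HilbertBasis ℕ ℂ H) {l : ℕ → ℝ}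
    (hl : Monotone l) (hb : ∀ m, IsFormEigenvector S B (l m) (b m)) (m : ℕ) {u : H × K}
    (hu : u ∈ S) (horth : ∀ i < m, inner ℂ (b i) u.1 = 0) :
    (l m + M) * ‖u.1‖ ^ 2 ≤ formEnergy B M u := by
  choose g hgS hg using hb
  let α : H × K → H × K → ℂ := fun p q =>
    inner ℂ p.2 q.2 + inner ℂ p.1 (B q.1) + M * inner ℂ p.1 q.1
  have hα : ∀ p, (α p p).re = formEnergy B M p := fun p => by
    simp only [α, formEnergy, add_re, Complex.re_ofReal_mul, re_inner_self_eq]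
  have hαe : ∀ p ∈ S, ∀ i, α p (b i, g i) = (l i + M) * inner ℂ p.1 (b i) := fun p hp i => by
    simp only [α]; rw [hg i p hp, inner_smul_right]; ring
  have hB' : ∀ x y, inner ℂ (B x) y = inner ℂ x (B y) := hB
  have hαsymm : ∀ p q, (starRingEnd ℂ) (α p q) = α q p := fun p q => by
    simp only [α, map_add, map_mul, inner_conj_symm, conj_ofReal, hB']
  let c : ℕ → ℂ := fun i => inner ℂ (b i) u.1
  have key : ∀ N, ∑ i ∈ Finset.range N, (l i + M) * ‖c i‖ ^ 2 ≤ formEnergy B M u := fun N => by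
    let e : H × K := ∑ i ∈ Finset.range N, c i • (b i, g i)
    have he : e ∈ S := S.sum_mem fun i _ => S.smul_mem _ (hgS i)
    have he1 : e.1 = ∑ i ∈ Finset.range N, c i • b i := by simp [e, Prod.fst_sum]
    have hαl : ∀ p, α p e = ∑ i ∈ Finset.range N, c i * α p (b i, g i) := fun p => by
      have he2 : e.2 = ∑ i ∈ Finset.range N, c i • g i := by simp [e, Prod.snd_sum]
      simp only [α, he1, he2, map_sum, inner_sum, map_smul, inner_smul_right, mul_sum,
        ← sum_add_distrib]
      exact sum_congr rfl fun i _ => by ring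
    have hw0 : α (u - e) e = 0 := by
      rw [hαl]
      refine Finset.sum_eq_zero fun i hi => ?_
      rw [hαe _ (S.sub_mem hu he)]
      have : inner ℂ (u - e).1 (b i) = 0 := by
        rw [Prod.fst_sub, inner_sub_left, he1, b.orthonormal.inner_left_sum _ hi]
        simp [c]
      rw [this]; ring
    have h1 : α u e = ∑ i ∈ Finset.range N, (((l i + M) * ‖c i‖ ^ 2 : ℝ) : ℂ) := by
      rw [hαl]
      refine sum_congr rfl fun i _ => ?_
      rw [hαe u hu]
      push_cast
      rw [← Complex.mul_conj']
      simp only [c, inner_conj_symm]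
      ring
    have h2 : α (u - e) (u - e) = α u u - α e u := by
      have : α (u - e) (u - e) = α u u - α e u - α (u - e) e := by
        simp only [α, Prod.fst_sub, Prod.snd_sub, inner_sub_left, inner_sub_right, map_sub]
        ring
      rw [this, hw0, sub_zero]
    have h3 : 0 ≤ (α (u - e) (u - e)).re := by
      rw [hα]
      exact le_trans (by positivity) (norm_sq_le_formEnergy hM _)
    rw [h2, ← hαsymm u e, h1, Complex.sub_re, hα, Complex.conj_re, Complex.re_sum] at h3
    simp only [ofReal_re] at h3
    linarith
  have hsum : HasSum (fun i => ‖c i‖ ^ 2) (‖u.1‖ ^ 2) := by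
    have h1 := (b.hasSum_inner_mul_inner u.1 u.1).mapL Complex.reCLM
    simp only [Complex.reCLM_apply, re_inner_self_eq] at h1
    convert h1 using 2 with i
    rw [← inner_conj_symm u.1, conj_mul', ← Complex.ofReal_pow, ofReal_re]
  refine le_of_tendsto (hsum.tendsto_sum_nat.const_mul _) (of_forall fun N => ?_)
  refine le_trans ?_ (key N)
  rw [mul_sum]
  refine sum_le_sum fun i _ => ?_
  by_cases him : i < m
  · simp [c, horth i him]
  · have := hl (not_lt.1 him)
    gcongr

theorem IsFormEigenvector.one_le {S : Submodule ℂ (H × K)} {B : H →L[ℂ] H} {M l : ℝ}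
    (hM : ∀ x, ‖x‖ ^ 2 ≤ (inner ℂ x (B x)).re + M * ‖x‖ ^ 2) {x : H} (hx : ‖x‖ = 1)
    (h : IsFormEigenvector S B l x) : 1 ≤ l + M := by
  obtain ⟨g, hg, h⟩ := h
  have h1 := congrArg Complex.re (h _ hg)
  rw [inner_smul_right, Complex.re_ofReal_mul, add_re, re_inner_self_eq, re_inner_self_eq] at h1
  have h2 := hM x
  rw [hx] at *
  nlinarith

/-- Comparison of the eigenvalues of two forms related by a linear relation that almost preserves
the norm and almost decreases the energy, up to a common factor. -/
theorem formEigenvalue_comparison {H' K' : Type*} [NormedAddCommGroup H'] [InnerProductSpace ℂ H']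
    [NormedAddCommGroup K'] [InnerProductSpace ℂ K'] [CompleteSpace H']
    {S : Submodule ℂ (H × K)} {B : H →L[ℂ] H} {M : ℝ}
    (hM : ∀ x, ‖x‖ ^ 2 ≤ (inner ℂ x (B x)).re + M * ‖x‖ ^ 2) {b : ℕ → H} (hb : Orthonormal ℂ b)
    {l : ℕ → ℝ} (hl : Monotone l) (hbl : ∀ m, IsFormEigenvector S B (l m) (b m))
    {S' : Submodule ℂ (H' × K')} {B' : H' →L[ℂ] H'} (hB' : (B' : H' →ₗ[ℂ] H').IsSymmetric)
    (hM' : ∀ x, ‖x‖ ^ 2 ≤ (inner ℂ x (B' x)).re + M * ‖x‖ ^ 2) (b' : HilbertBasis ℕ ℂ H')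
    {l' : ℕ → ℝ} (hl' : Monotone l') (hbl' : ∀ m, IsFormEigenvector S' B' (l' m) (b' m))
    (R : Submodule ℂ ((H × K) × (H' × K')))
    (hRS : (S : Set (H × K)) ⊆ closure (Prod.fst '' (R : Set ((H × K) × (H' × K')))))
    (hRS' : ∀ r ∈ R, r.2 ∈ S') {s η : ℝ} (hs : 0 < s) (hη : 0 ≤ η)
    (hnorm : ∀ r ∈ R, ‖r.1.1‖ ^ 2 - η * formEnergy B M r.1 ≤ s * ‖r.2.1‖ ^ 2)
    (henergy : ∀ r ∈ R, s * formEnergy B' M r.2 ≤ (1 + η) * formEnergy B M r.1) (m : ℕ) :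
    0 < l m + M ∧ 0 < l' m + M ∧ ((l m + M)⁻¹ - η) * (l' m + M) ≤ 1 + η := by
  have hlM := fun i => (hbl i).one_le hM (hb.1 i)
  have hlM' := fun i => (hbl' i).one_le hM' (b'.orthonormal.1 i)
  refine ⟨by linarith [hlM m], by linarith [hlM' m], ?_⟩
  by_contra! hcon
  have hpos : 0 < l m + M := by linarith [hlM m]
  have hpos' : 0 < l' m + M := by linarith [hlM' m]
  set μ := (l m + M)⁻¹ with hμ
  have hμη : 0 < μ - η := by
    by_contra! h
    nlinarith
  obtain ⟨κ, hκ0, hκμ, hκ⟩ : ∃ κ, η < κ ∧ κ < μ ∧ 1 + η < (κ - η) * (l' m + M) := by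
    have hlim : Tendsto (fun κ => (κ - η) * (l' m + M)) (𝓝[<] μ) (𝓝 ((μ - η) * (l' m + M))) :=
      tendsto_nhdsWithin_of_tendsto_nhds (by fun_prop : Continuous _).continuousAt
    have h1 := hlim.eventually (lt_mem_nhds hcon)
    have h2 : ∀ᶠ κ in 𝓝[<] μ, κ ∈ Ioo η μ := Ioo_mem_nhdsLT (by linarith)
    obtain ⟨κ, h1, h2⟩ := (h1.and h2).exists
    exact ⟨κ, h2.1, h2.2, h1⟩
  choose g hgS hg using hbl
  let comb : (Fin (m + 1) → H × K) → (Fin (m + 1) → ℂ) → H × K := fun p c => ∑ i, c i • p i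
  let F : (Fin (m + 1) → H × K) × (Fin (m + 1) → ℂ) → ℝ := fun x =>
    ‖(comb x.1 x.2).1‖ ^ 2 - κ * formEnergy B M (comb x.1 x.2)
  have hcomb : Continuous fun x : (Fin (m + 1) → H × K) × (Fin (m + 1) → ℂ) => comb x.1 x.2 := by
    simp only [comb]; fun_prop
  have hF : Continuous F := by
    have := (continuous_formEnergy B M).comp hcomb
    exact (hcomb.fst.norm.pow 2).sub (continuous_const.mul this)
  let e : Fin (m + 1) → H × K := fun i => (b i, g i)
  have hinj : Function.Injective (fun i : Fin (m + 1) => (i : ℕ)) := Fin.val_injective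
  have hFe : ∀ c ∈ Metric.sphere 0 1, 0 < F (e, c) := fun c hc => by
    have h1 : formEnergy B M (comb e c) = ∑ i : Fin (m + 1), (l i + M) * ‖c i‖ ^ 2 :=
      formEnergy_sum_eigenvectors (fun i => b i) (hb.comp _ hinj) (fun i => l i)
        (fun i => g i) (fun i => hgS i) (fun i => hg i) c
    have h2 : ‖(comb e c).1‖ ^ 2 = ∑ i, ‖c i‖ ^ 2 := by
      have : (comb e c).1 = ∑ i : Fin (m + 1), c i • b i := by simp [comb, e, Prod.fst_sum]
      have hbo : Orthonormal ℂ (fun i : Fin (m + 1) => b i) := hb.comp _ hinj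
      rw [this, ← re_inner_self_eq, hbo.inner_sum c c]
      simp [conj_mul', ← Complex.ofReal_pow]
    have h3 : formEnergy B M (comb e c) ≤ (l m + M) * ∑ i, ‖c i‖ ^ 2 := by
      rw [h1, mul_sum]
      refine sum_le_sum fun i _ => ?_
      have := hl (Nat.lt_succ_iff.1 i.2)
      gcongr
    have h4 : 0 < ∑ i, ‖c i‖ ^ 2 := by
      obtain ⟨i, hi⟩ : ∃ i, c i ≠ 0 := by
        by_contra! h
        have : c = 0 := funext h
        simp [this] at hc
      exact Finset.sum_pos' (fun _ _ => by positivity) ⟨i, Finset.mem_univ _, by positivity⟩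
    have h5 : κ * (l m + M) < 1 := by rw [← inv_mul_cancel₀ hpos.ne', ← hμ]; gcongr
    change 0 < ‖(comb e c).1‖ ^ 2 - κ * formEnergy B M (comb e c)
    rw [h2]
    nlinarith
  obtain ⟨u, v, hu, -, heu, hcv, huv⟩ := generalized_tube_lemma (isCompact_singleton)
    (isCompact_sphere 0 1) (isOpen_lt continuous_const hF)
    (by
      rintro ⟨p, c⟩ ⟨hp, hc⟩
      obtain rfl : p = e := hp
      exact hFe c hc)
  have hecl : e ∈ closure (Set.pi univ fun _ => Prod.fst '' (R : Set ((H × K) × (H' × K')))) := by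
    rw [closure_pi_set]
    exact fun i _ => hRS (hgS i)
  obtain ⟨p, hpu, hpR⟩ := mem_closure_iff.1 hecl u hu (heu rfl)
  choose r hrR hrp using (fun i => hpR i trivial)
  let Q : (Fin (m + 1) → ℂ) →ₗ[ℂ] (Fin m → ℂ) :=
    LinearMap.pi fun j => (innerₛₗ ℂ (b' j)) ∘ₗ LinearMap.fst ℂ H' K' ∘ₗ
      (Fintype.linearCombination ℂ fun i => (r i).2)
  obtain ⟨c₀, hc₀, hc₀ne⟩ := (Submodule.ne_bot_iff _).1
    (LinearMap.ker_ne_bot_of_finrank_lt (f := Q) (by simp))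
  let c : Fin (m + 1) → ℂ := ((‖c₀‖ : ℂ)⁻¹) • c₀
  have hc : c ∈ Metric.sphere 0 1 := by
    have : ‖c₀‖ ≠ 0 := norm_ne_zero_iff.2 hc₀ne
    simp [c, norm_smul, this]
  have hQc : Q c = 0 := by simp only [c, map_smul, LinearMap.mem_ker.1 hc₀, smul_zero]
  have hFp : 0 < F (p, c) := huv (mk_mem_prod hpu (hcv hc))
  let ρ : (H × K) × (H' × K') := ∑ i, c i • r i
  have hρ : ρ ∈ R := R.sum_mem fun i _ => R.smul_mem _ (hrR i)
  have hρ1 : ρ.1 = comb p c := by simp only [ρ, comb, Prod.fst_sum, Prod.smul_fst, hrp]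
  have hρ2 : ρ.2 = Fintype.linearCombination ℂ (fun i => (r i).2) c := by
    simp only [ρ, Prod.snd_sum, Prod.smul_snd, Fintype.linearCombination_apply]
  have horth : ∀ i < m, inner ℂ (b' i) ρ.2.1 = 0 := fun i hi => by
    rw [hρ2]
    exact congrFun hQc ⟨i, hi⟩
  have h1 := mul_norm_sq_le_formEnergy hB' hM' b' hl' hbl' m (hRS' ρ hρ) horth
  have h2 := hnorm ρ hρ
  have h3 := henergy ρ hρ
  have h4 : κ * formEnergy B M ρ.1 < ‖ρ.1.1‖ ^ 2 := by rw [hρ1]; linarith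
  have h5 := norm_sq_le_formEnergy hM ρ.1
  have h6 : 0 < formEnergy B M ρ.1 := by
    have h8 := lt_of_le_of_lt (mul_nonneg (hη.trans hκ0.le) (le_trans (by positivity) h5)) h4
    linarith [sq_nonneg ‖ρ.1.2‖]
  have h7 : (κ - η) * formEnergy B M ρ.1 ≤ s * ‖ρ.2.1‖ ^ 2 := by linarith
  have h8 : (l' m + M) * (s * ‖ρ.2.1‖ ^ 2) ≤ (1 + η) * formEnergy B M ρ.1 := by nlinarith
  have h9 := mul_le_mul_of_nonneg_left h7 hpos'.le
  nlinarith

end Abstract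

/-! ### Integral inequalities -/

theorem sq_lintegral_le {α : Type*} [MeasurableSpace α] {ν : Measure α} {f : α → ENNReal}
    (hf : AEMeasurable f ν) : (∫⁻ x, f x ∂ν) ^ 2 ≤ ν univ * ∫⁻ x, f x ^ 2 ∂ν := by
  have h := ENNReal.lintegral_mul_le_Lp_mul_Lq ν Real.HolderConjugate.two_two
    (aemeasurable_const (b := 1)) hf
  simp only [Pi.mul_apply, one_mul, one_pow, lintegral_const, rpow_two] at h
  calc (∫⁻ x, f x ∂ν) ^ 2
      ≤ (ν univ ^ (1 / 2 : ℝ) * (∫⁻ x, f x ^ 2 ∂ν) ^ (1 / 2 : ℝ)) ^ 2 := by gcongr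
    _ = ν univ * ∫⁻ x, f x ^ 2 ∂ν := by
      rw [mul_pow, ← rpow_two, ← rpow_two, ← rpow_mul, ← rpow_mul]
      norm_num

theorem enorm_add_sq_le {F : Type*} [NormedAddCommGroup F] (a b : F) :
    ‖a + b‖² ≤ 2 * ‖a‖² + 2 * ‖b‖² := by
  have h : ‖a + b‖ ^ 2 ≤ 2 * ‖a‖ ^ 2 + 2 * ‖b‖ ^ 2 := by
    have := norm_add_le a b
    nlinarith [sq_nonneg (‖a‖ - ‖b‖), norm_nonneg (a + b)]
  have h2 := ofReal_le_ofReal h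
  rw [ofReal_add (by positivity) (by positivity), ofReal_mul (by norm_num),
    ofReal_mul (by norm_num), ofReal_pow (norm_nonneg _),
    ofReal_pow (norm_nonneg _), ofReal_pow (norm_nonneg _)] at h2
  simpa using h2

theorem enorm_sub_sq_le {F : Type*} [NormedAddCommGroup F] (a b c : F) :
    ‖a - c‖² ≤ 2 * ‖a - b‖² + 2 * ‖b - c‖² := by
  rw [← sub_add_sub_cancel a b c]; exact enorm_add_sq_le _ _

theorem memLp_two_iff {α F : Type*} [MeasurableSpace α] {ν : Measure α}
    [NormedAddCommGroup F] {f : α → F} (hf : AEStronglyMeasurable f ν) :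
    MemLp f 2 ν ↔ ∫⁻ x, ‖f x‖² ∂ν < ∞ := by
  rw [MemLp, and_iff_right hf, eLpNorm_lt_top_iff_lintegral_rpow_enorm_lt_top (by norm_num)
    (by norm_num)]
  simp

theorem ofReal_integral_norm_sq {α F : Type*} [MeasurableSpace α] {ν : Measure α}
    [NormedAddCommGroup F] {f : α → F} (hf : MemLp f 2 ν) :
    ofReal (∫ x, ‖f x‖ ^ 2 ∂ν) = ∫⁻ x, ‖f x‖² ∂ν := by
  rw [ofReal_integral_eq_lintegral_ofReal ((memLp_two_iff_integrable_sq_norm hf.1).1 hf)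
    (of_forall fun x => by positivity)]
  simp_rw [ofReal_pow (norm_nonneg _), ofReal_norm]

theorem enorm_average_sub_sq_le {α : Type*} [MeasurableSpace α] {ν : Measure α}
    [IsFiniteMeasure ν] [NeZero ν] {u : α → ℂ} (hu : Integrable u ν) (c : ℂ) :
    ‖(⨍ y, u y ∂ν) - c‖² ≤ (ν univ)⁻¹ * ∫⁻ y, ‖u y - c‖² ∂ν := by
  have hν0 : ν univ ≠ 0 := NeZero.ne _
  have hνt : ν univ ≠ ∞ := measure_ne_top _ _
  have hreal : ν.real univ ≠ 0 := ENNReal.toReal_ne_zero.2 ⟨hν0, hνt⟩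
  have h2 : (⨍ y, u y ∂ν) - c = ⨍ y, (u y - c) ∂ν := by
    rw [average_eq, average_eq, integral_sub hu (integrable_const c), integral_const,
      smul_sub, smul_smul, inv_mul_cancel₀ hreal, one_smul]
  rw [h2, average_eq, enorm_smul, mul_pow]
  have h4 : ‖((ν.real univ)⁻¹ : ℝ)‖ₑ = (ν univ)⁻¹ := by
    rw [Real.enorm_eq_ofReal (by positivity), Measure.real, ENNReal.ofReal_inv_of_pos
      (ENNReal.toReal_pos hν0 hνt), ofReal_toReal hνt]
  rw [h4]
  calc _ ≤ (ν univ)⁻¹ ^ 2 * (ν univ * ∫⁻ y, ‖u y - c‖² ∂ν) := by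
        gcongr
        refine (pow_le_pow_left' (enorm_integral_le_lintegral_enorm _) 2).trans ?_
        exact sq_lintegral_le (hu.sub (integrable_const c)).1.enorm
    _ = _ := by rw [sq, mul_assoc, ← mul_assoc _ (ν univ), ENNReal.inv_mul_cancel hν0 hνt, one_mul]

theorem enorm_sub_sq_le_lintegral_deriv {g : ℝ → ℂ} {a b : ℝ} (hab : a ≤ b)
    (hc : ContinuousOn g (Icc a b)) (hd : ∀ x ∈ Ioo a b, DifferentiableAt ℝ g x) :
    ‖g b - g a‖² ≤ ofReal (b - a) * ∫⁻ x in Ioo a b, ‖deriv g x‖² := by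
  rcases hab.eq_or_lt with rfl | hlt
  · simp
  by_cases hfin : ∫⁻ x in Ioo a b, ‖deriv g x‖² = ∞
  · rw [hfin, mul_top (by simpa using hlt)]; exact le_top
  have hm : AEStronglyMeasurable (deriv g) (volume.restrict (Ioo a b)) :=
    (stronglyMeasurable_deriv g).aestronglyMeasurable
  have hL2 := (memLp_two_iff hm).2 (lt_top_iff_ne_top.2 hfin)
  have h1 := intervalIntegral.integral_eq_sub_of_hasDerivAt_of_le hab hc
    (fun x hx => (hd x hx).hasDerivAt)
    ((intervalIntegrable_iff_integrableOn_Ioo_of_le hab).2 (hL2.integrable (by norm_num)))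
  rw [intervalIntegral.integral_of_le hab, integral_Ioc_eq_integral_Ioo] at h1
  rw [← h1]
  calc _ ≤ (∫⁻ x in Ioo a b, ‖deriv g x‖ₑ) ^ 2 := by
        gcongr; exact enorm_integral_le_lintegral_enorm _
    _ ≤ _ := by
      refine (sq_lintegral_le hm.enorm).trans_eq ?_
      simp

section Domain

variable {E : Type*} [NormedAddCommGroup E] [NormedSpace ℝ E]

theorem deriv_comp_line {u : E → ℂ} {x v : E} {t : ℝ} (hu : DifferentiableAt ℝ u (x + t • v)) :
    HasDerivAt (fun s : ℝ => u (x + s • v)) (∇ u (x + t • v) v) t := by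
  have h2 : HasDerivAt (fun s => x + s • v) v t := by
    simpa using ((hasDerivAt_id t).smul_const v).const_add x
  exact hu.hasFDerivAt.comp_hasDerivAt t h2

theorem enorm_sub_sq_le_line {u : E → ℂ} {x v : E} {a b : ℝ} (hab : a ≤ b)
    (hc : ContinuousOn u ((fun s : ℝ => x + s • v) '' Icc a b))
    (hu : ∀ t ∈ Ioo a b, DifferentiableAt ℝ u (x + t • v)) :
    ‖u (x + b • v) - u (x + a • v)‖² ≤ ofReal (b - a) *
      (‖v‖² * ∫⁻ t in Ioo a b, ‖∇ u (x + t • v)‖²) := by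
  have h1 := enorm_sub_sq_le_lintegral_deriv (g := fun s => u (x + s • v)) hab
    (hc.comp (by fun_prop) (fun s hs => mem_image_of_mem _ hs))
    (fun t ht => (deriv_comp_line (hu t ht)).differentiableAt)
  refine h1.trans ?_
  gcongr
  rw [← lintegral_const_mul' _ _ (by simp)]
  refine setLIntegral_mono' measurableSet_Ioo fun t ht => ?_
  rw [(deriv_comp_line (hu t ht)).deriv, ← mul_pow, mul_comm]
  gcongr
  exact ContinuousLinearMap.le_opENorm _ _

variable [FiniteDimensional ℝ E] [MeasurableSpace E] [BorelSpace E] (μ : Measure E)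
  [μ.IsAddHaarMeasure]

theorem lintegral_comp_add_smul (F : E → ENNReal) (c : E) {t : ℝ} (ht : 0 < t) :
    ∫⁻ y, F (c + t • y) ∂μ = ofReal ((t ^ finrank ℝ E)⁻¹) * ∫⁻ y, F y ∂μ := by
  have hemb : MeasurableEmbedding (fun y => c + t • y) :=
    (((Homeomorph.smulOfNeZero t ht.ne').trans (Homeomorph.addLeft c))).measurableEmbedding
  have hmap : μ.map (fun y => c + t • y) = ofReal ((t ^ finrank ℝ E)⁻¹) • μ := by
    rw [show (fun y => c + t • y) = (fun y => c + y) ∘ (fun y => t • y) from rfl,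
      ← Measure.map_map (by fun_prop) (by fun_prop), Measure.map_addHaar_smul _ ht.ne',
      Measure.map_smul, map_add_left_eq_self, abs_of_pos (by positivity)]
  rw [← hemb.lintegral_map, hmap, lintegral_smul_measure, smul_eq_mul]

theorem lintegral_lintegral_enorm_sub_sq_le {U A : Set E} (hA : Convex ℝ A) (hAm : MeasurableSet A)
    (hU : IsOpen U) (hAU : A ⊆ U) {r : ℝ} (hr : ∀ x ∈ A, ∀ y ∈ A, ‖x - y‖ ≤ r)
    {u : E → ℂ} (hu : ContDiffOn ℝ 1 u U) :
    ∫⁻ x in A, ∫⁻ y in A, ‖u x - u y‖² ∂μ ∂μ ≤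
      ofReal (2 ^ finrank ℝ E * r ^ 2) * (μ A * ∫⁻ x in A, ‖∇ u x‖² ∂μ)
      := by
  have hdiff : ∀ x ∈ A, DifferentiableAt ℝ u x := fun x hx =>
    (hu.differentiableOn one_ne_zero).differentiableAt (hU.mem_nhds (hAU hx))
  let G : E → ENNReal := A.indicator fun x => ‖∇ u x‖²
  have hG := ((measurable_fderiv ℝ u).enorm.pow_const 2).indicator hAm
  let Φ : E → E → ENNReal := fun x y => ∫⁻ t in Ioo (1 / 2 : ℝ) 1, G ((1 - t) • x + t • y)
  have hΦm : Measurable (uncurry Φ) := by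
    refine Measurable.lintegral_prod_right' (f := fun p : (E × E) × ℝ =>
      G ((1 - p.2) • p.1.1 + p.2 • p.1.2)) (hG.comp ?_)
    fun_prop
  have hhalf : ∀ x ∈ A, ∀ y ∈ A, ‖u y - u ((1 / 2 : ℝ) • x + (1 / 2 : ℝ) • y)‖²
      ≤ ofReal (r ^ 2 / 2) * Φ x y := fun x hx y hy => by
    have hline : ∀ t ∈ Icc (1 / 2 : ℝ) 1, x + t • (y - x) ∈ A := fun t ht => by
      have := hA hx hy (a := 1 - t) (by linarith [ht.2]) (by linarith [ht.1]) (by ring)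
      convert this using 1; module
    have h1 := enorm_sub_sq_le_line (by norm_num) (fun z hz => by
        obtain ⟨t, ht, rfl⟩ := hz
        exact (hdiff _ (hline t ht)).continuousAt.continuousWithinAt)
      (fun t ht => hdiff _ (hline t ⟨ht.1.le, ht.2.le⟩))
    have h2 : x + (1 : ℝ) • (y - x) = y := by module
    have h3 : x + (1 / 2 : ℝ) • (y - x) = (1 / 2 : ℝ) • x + (1 / 2 : ℝ) • y := by module
    rw [h2, h3] at h1
    refine h1.trans ?_
    have h4 : ‖y - x‖² ≤ ofReal (r ^ 2) := by
      rw [← ofReal_norm, ← ofReal_pow (norm_nonneg _)]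
      exact ofReal_le_ofReal (by have := hr y hy x hx; gcongr)
    have h5 : ∫⁻ t in Ioo (1 / 2 : ℝ) 1, ‖∇ u (x + t • (y - x))‖² ≤ Φ x y := by
      refine setLIntegral_mono' measurableSet_Ioo fun t ht => ?_
      have h6 : x + t • (y - x) = (1 - t) • x + t • y := by module
      have h7 := hline t ⟨ht.1.le, ht.2.le⟩
      rw [h6] at h7 ⊢
      simp only [G, indicator_of_mem h7, le_refl]
    calc _ ≤ ofReal (1 - 1 / 2) * (ofReal (r ^ 2) * Φ x y) := by gcongr
      _ = _ := by
        rw [← mul_assoc, ← ofReal_mul (by norm_num)]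
        congr 2; ring
  have hpt : ∀ x ∈ A, ∀ y ∈ A, ‖u x - u y‖² ≤
      ofReal (r ^ 2) * (Φ x y + Φ y x) := fun x hx y hy => by
    refine (enorm_sub_sq_le _ (u ((1 / 2 : ℝ) • x + (1 / 2 : ℝ) • y)) _).trans ?_
    have h1 := hhalf x hx y hy
    have h2 := hhalf y hy x hx
    rw [add_comm ((1 / 2) • y)] at h2
    rw [enorm_sub_rev _ (u y)]
    calc _ ≤ 2 * (ofReal (r ^ 2 / 2) * Φ y x) + 2 * (ofReal (r ^ 2 / 2) * Φ x y) := by gcongr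
      _ = (2 * ofReal (r ^ 2 / 2)) * (Φ x y + Φ y x) := by ring
      _ = _ := by
        rw [show 2 = ofReal 2 by simp, ← ofReal_mul (by norm_num)]
        congr 2; ring
  have hΦint : ∫⁻ x in A, ∫⁻ y in A, Φ x y ∂μ ∂μ ≤ ofReal (2 ^ finrank ℝ E / 2) *
        (μ A * ∫⁻ x in A, ‖∇ u x‖² ∂μ) := by
    have hin : ∀ x, ∫⁻ y in A, Φ x y ∂μ ≤ ofReal (2 ^ finrank ℝ E / 2) *
        ∫⁻ x in A, ‖∇ u x‖² ∂μ := fun x => by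
      calc ∫⁻ y in A, Φ x y ∂μ ≤ ∫⁻ y, Φ x y ∂μ := setLIntegral_le_lintegral _ _
        _ = ∫⁻ t in Ioo (1 / 2 : ℝ) 1, ∫⁻ y, G ((1 - t) • x + t • y) ∂μ := by
          refine lintegral_lintegral_swap ?_
          exact (hG.comp (by fun_prop)).aemeasurable
        _ ≤ ∫⁻ t in Ioo (1 / 2 : ℝ) 1, ofReal (2 ^ finrank ℝ E) * ∫⁻ y, G y ∂μ := by
          refine setLIntegral_mono' measurableSet_Ioo fun t ht => ?_
          have ht0 : 0 < t := by linarith [ht.1]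
          rw [lintegral_comp_add_smul μ G _ ht0]
          gcongr
          rw [← inv_pow]
          have : t⁻¹ ≤ 2 := by rw [inv_le_comm₀ ht0 (by norm_num)]; linarith [ht.1]
          gcongr
        _ = _ := by
          rw [lintegral_const, restrict_apply_univ, volume_Ioo, mul_right_comm,
            ← ofReal_mul (by positivity), lintegral_indicator hAm]
          congr 2; ring
    calc _ ≤ ∫⁻ x in A, ofReal (2 ^ finrank ℝ E / 2) *
        ∫⁻ x in A, ‖∇ u x‖² ∂μ ∂μ := lintegral_mono fun x => hin x
      _ = _ := by rw [lintegral_const, restrict_apply_univ]; ring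
  have hsymm : ∫⁻ x in A, ∫⁻ y in A, Φ y x ∂μ ∂μ = ∫⁻ x in A, ∫⁻ y in A, Φ x y ∂μ ∂μ :=
    lintegral_lintegral_swap (hΦm.comp measurable_swap).aemeasurable
  calc _ ≤ ∫⁻ x in A, ∫⁻ y in A, ofReal (r ^ 2) * (Φ x y + Φ y x) ∂μ ∂μ :=
        setLIntegral_mono' hAm fun x hx => setLIntegral_mono' hAm fun y hy => hpt x hx y hy
    _ = ofReal (r ^ 2) * ((∫⁻ x in A, ∫⁻ y in A, Φ x y ∂μ ∂μ) +
        ∫⁻ x in A, ∫⁻ y in A, Φ y x ∂μ ∂μ) := by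
      have hm1 : ∀ x, Measurable (fun y => Φ x y) := fun x => hΦm.comp measurable_prodMk_left
      have e1 : ∀ x, ∫⁻ y in A, ofReal (r ^ 2) * (Φ x y + Φ y x) ∂μ =
          ofReal (r ^ 2) * ((∫⁻ y in A, Φ x y ∂μ) + ∫⁻ y in A, Φ y x ∂μ) := fun x => by
        rw [lintegral_const_mul' _ _ ofReal_ne_top, lintegral_add_left (hm1 x)]
      have hm2 : Measurable (fun x => ∫⁻ y in A, Φ x y ∂μ) := Measurable.lintegral_prod_right' hΦm
      simp_rw [e1]
      rw [lintegral_const_mul' _ _ ofReal_ne_top, lintegral_add_left hm2]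
    _ ≤ ofReal (r ^ 2) * (ofReal (2 ^ finrank ℝ E / 2) *
        (μ A * ∫⁻ x in A, ‖∇ u x‖² ∂μ) + ofReal (2 ^ finrank ℝ E / 2) *
        (μ A * ∫⁻ x in A, ‖∇ u x‖² ∂μ)) := by rw [hsymm]; gcongr
    _ = _ := by
      rw [← add_mul, ← ofReal_add (by positivity) (by positivity), ← mul_assoc,
        ← ofReal_mul (by positivity)]
      congr 2; ring

theorem lintegral_enorm_sub_average_sq_le {α : Type*} [MeasurableSpace α] {ν : Measure α}
    [IsFiniteMeasure ν] {u : α → ℂ} (hu : AEStronglyMeasurable u ν) (c : ℂ) :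
    ∫⁻ x, ‖u x - ⨍ y, u y ∂ν‖² ∂ν ≤ ∫⁻ x, ‖u x - c‖² ∂ν := by
  rcases eq_zero_or_neZero ν with rfl | hν
  · simp
  by_cases htop : ∫⁻ x, ‖u x - c‖² ∂ν = ∞
  · rw [htop]; exact le_top
  have hv : MemLp (fun x => u x - c) 2 ν :=
    (memLp_two_iff (hu.sub aestronglyMeasurable_const)).2 (lt_top_iff_ne_top.2 htop)
  have huL : MemLp u 2 ν := by
    have := hv.add (memLp_const c)
    rwa [show (fun x => u x - c) + (fun _ => c) = u from funext fun x => sub_add_cancel _ _] at this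
  set m := ⨍ y, u y ∂ν with hm
  have hw : MemLp (fun x => u x - m) 2 ν := huL.sub (memLp_const m)
  have hw1 := hw.integrable (by norm_num)
  have hint0 : ∫ x, (u x - m) ∂ν = 0 := by rw [hm]; exact integral_sub_average ν u
  rw [← ofReal_integral_norm_sq hv, ← ofReal_integral_norm_sq hw]
  refine ofReal_le_ofReal ?_
  have hpt : ∀ x, ‖u x - c‖ ^ 2 = ‖u x - m‖ ^ 2 + 2 * (inner ℝ (m - c) (u x - m)) + ‖m - c‖ ^
    2 := by
    intro x
    rw [show u x - c = (u x - m) + (m - c) by ring, norm_add_sq_real, real_inner_comm]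
  have hsq := (memLp_two_iff_integrable_sq_norm hw.1).1 hw
  have hin : Integrable (fun x => inner ℝ (m - c) (u x - m)) ν := hw1.const_inner (m - c)
  simp_rw [hpt]
  have hadd : Integrable (fun x => ‖u x - m‖ ^ 2 + 2 * inner ℝ (m - c) (u x - m)) ν :=
    hsq.add (hin.const_mul 2)
  rw [integral_add hadd (integrable_const _), integral_add hsq (hin.const_mul 2),
    integral_const_mul, integral_inner hw1, hint0, inner_zero_right]
  have : 0 ≤ ∫ _, ‖m - c‖ ^ 2 ∂ν := integral_nonneg fun _ => by positivity
  linarith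

theorem aesm_of_contDiffOn {U : Set E} (hU : IsOpen U) {u : E → ℂ}
    (hu : ContDiffOn ℝ 1 u U) : AEStronglyMeasurable u (μ.restrict U) :=
  hu.continuousOn.aestronglyMeasurable hU.measurableSet

theorem lintegral_enorm_sub_average_le_of_convex {U A : Set E} (hA : Convex ℝ A)
    (hAm : MeasurableSet A) (hU : IsOpen U) (hAU : A ⊆ U) {r : ℝ}
    (hr : ∀ x ∈ A, ∀ y ∈ A, ‖x - y‖ ≤ r) (hμA : μ A ≠ ∞) {u : E → ℂ} (hu : ContDiffOn ℝ 1 u U) :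
    ∫⁻ x in A, ‖u x - ⨍ y in A, u y ∂μ‖² ∂μ ≤
      ofReal (2 ^ finrank ℝ E * r ^ 2) * ∫⁻ x in A, ‖∇ u x‖² ∂μ := by
  rcases eq_or_ne (μ A) 0 with h0 | h0
  · rw [Measure.restrict_eq_zero.2 h0]; simp
  have : IsFiniteMeasure (μ.restrict A) := isFiniteMeasure_restrict.2 hμA
  have h1 : μ A * ∫⁻ x in A, ‖u x - ⨍ y in A, u y ∂μ‖² ∂μ ≤
      ∫⁻ x in A, ∫⁻ y in A, ‖u x - u y‖² ∂μ ∂μ := by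
    calc _ = ∫⁻ _ in A, ∫⁻ x in A, ‖u x - ⨍ y in A, u y ∂μ‖² ∂μ ∂μ := by
          rw [lintegral_const, restrict_apply_univ, mul_comm]
      _ ≤ _ := by
          refine lintegral_mono fun x => ?_
          simp_rw [enorm_sub_rev (u x)]
          exact lintegral_enorm_sub_average_sq_le ((aesm_of_contDiffOn μ hU hu).mono_set hAU) (u x)
  have h2 := h1.trans (lintegral_lintegral_enorm_sub_sq_le μ hA hAm hU hAU hr hu)
  rw [mul_left_comm] at h2
  exact (ENNReal.mul_le_mul_iff_right h0 hμA).1 h2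

theorem exists_enorm_average_sub_average_le {U A Q : Set E} (hA : Convex ℝ A)
    (hAm : MeasurableSet A) (hU : IsOpen U) (hAU : A ⊆ U) (hQA : Q ⊆ A)
    (hAb : Bornology.IsBounded A) (hQ : μ Q ≠ 0) :
    ∃ C : NNReal, ∀ u : E → ℂ, ContDiffOn ℝ 1 u U → MemLp u 2 (μ.restrict U) →
      ‖(⨍ y in A, u y ∂μ) - ⨍ y in Q, u y ∂μ‖² ≤ C * ∫⁻ x in U, ‖∇ u x‖² ∂μ := by
  obtain ⟨r, hr⟩ := Metric.isBounded_iff.1 hAb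
  have hμA : μ A ≠ ∞ := hAb.measure_lt_top.ne
  have hμQ : μ Q ≠ ∞ := ((measure_mono hQA).trans_lt hAb.measure_lt_top).ne
  refine ⟨((μ Q)⁻¹ * ofReal (2 ^ finrank ℝ E * r ^ 2)).toNNReal, fun u hu huL => ?_⟩
  rw [coe_toNNReal (by finiteness)]
  have hr' : ∀ x ∈ A, ∀ y ∈ A, ‖x - y‖ ≤ r := fun x hx y hy => by
    rw [← dist_eq_norm]; exact hr hx hy
  set m := ⨍ y in A, u y ∂μ
  have : IsFiniteMeasure (μ.restrict Q) := isFiniteMeasure_restrict.2 hμQ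
  have huQ := (huL.mono_measure (restrict_mono (hQA.trans hAU) le_rfl)).integrable (by norm_num)
  have : NeZero (μ.restrict Q) := ⟨fun h => hQ (Measure.restrict_eq_zero.1 h)⟩
  have h3 := enorm_average_sub_sq_le huQ m
  rw [restrict_apply_univ, enorm_sub_rev] at h3
  refine h3.trans ?_
  rw [mul_assoc]
  gcongr
  calc ∫⁻ y in Q, ‖u y - m‖² ∂μ ≤ ∫⁻ y in A, ‖u y - m‖² ∂μ := lintegral_mono_set hQA
    _ ≤ _ := lintegral_enorm_sub_average_le_of_convex μ hA hAm hU hAU hr' hμA hu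
    _ ≤ _ := by gcongr

theorem exists_finite_convex_cover {U K : Set E} (hU : IsOpen U) (hK : IsCompact K) (hKU : K ⊆ U)
    {r : ℝ} (hr : 0 < r) :
    ∃ (n : ℕ) (Q : Fin n → Set E), (∀ i, Convex ℝ (Q i)) ∧ (∀ i, MeasurableSet (Q i)) ∧
      (∀ i, ∃ y ρ, 0 < ρ ∧ Q i ⊆ ball y ρ ∧ ball y ρ ⊆ U) ∧
      (∀ i, ∀ x ∈ Q i, ∀ y ∈ Q i, ‖x - y‖ ≤ r) ∧
      Pairwise (Function.onFun Disjoint Q) ∧ K ⊆ ⋃ i, Q i := by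
  obtain ⟨ρ, hρ, hρU⟩ := hK.exists_thickening_subset_open hU hKU
  let L := (Module.finBasis ℝ E).equivFun.toContinuousLinearEquiv
  set n := finrank ℝ E
  let s := min r ρ / (2 * (‖(L.symm : (Fin n → ℝ) →L[ℝ] E)‖ + 1))
  have hs : 0 < s := by positivity
  let cell : (Fin n → ℤ) → Set E := fun m => {x | ∀ i, ⌊L x i / s⌋ = m i}
  have hcell : ∀ m x, x ∈ cell m ↔ ∀ i, s * m i ≤ L x i ∧ L x i < s * (m i + 1) := fun m x => by
    refine forall_congr' fun i => ?_
    rw [Int.floor_eq_iff, le_div_iff₀ hs, div_lt_iff₀ hs, mul_comm s, mul_comm s]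
  have hdiam : ∀ m, ∀ x ∈ cell m, ∀ y ∈ cell m, ‖x - y‖ < min r ρ := fun m x hx y hy => by
    rw [hcell] at hx hy
    have h1 : ‖L x - L y‖ ≤ s := by
      refine (pi_norm_le_iff_of_nonneg hs.le).2 fun i => ?_
      rw [Pi.sub_apply, norm_eq_abs, abs_le]
      constructor <;> nlinarith [hx i, hy i]
    have h2 : x - y = L.symm (L x - L y) := by simp
    rw [h2]
    refine lt_of_le_of_lt ((L.symm : (Fin n → ℝ) →L[ℝ] E).le_opNorm (L x - L y)) ?_
    have h4 : s * (2 * (‖(L.symm : (Fin n → ℝ) →L[ℝ] E)‖ + 1)) = min r ρ :=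
      div_mul_cancel₀ _ (by positivity)
    have h5 := lt_min hr hρ
    nlinarith [norm_nonneg (L.symm : (Fin n → ℝ) →L[ℝ] E)]
  have hconv : ∀ m, Convex ℝ (cell m) := fun m x hx y hy a b ha hb hab => by
    rw [hcell] at *
    intro i
    have h1 : L (a • x + b • y) i = a * L x i + b * L y i := by simp
    have hx' := hx i
    have hy' := hy i
    have hb' : b = 1 - a := by linarith
    rw [h1]
    subst hb'
    constructor
    · nlinarith
    · rcases ha.eq_or_lt with h | h
      · subst h; simpa using hy'.2
      · nlinarith
  have hmeas : ∀ m, MeasurableSet (cell m) := fun m => by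
    refine MeasurableSet.iInter (f := fun i => {x | ⌊L x i / s⌋ = m i}) ?_ |>.congr ?_
    · intro i
      exact (Int.measurable_floor.comp ((((continuous_apply i).comp L.continuous).div_const
        s).measurable)) (measurableSet_singleton (m i))
    · ext x; simp [cell]
  have hfin : {m | (cell m ∩ K).Nonempty}.Finite := by
    obtain ⟨R, hR⟩ := ((hK.image L.continuous).isBounded).exists_norm_le
    refine (Set.finite_Icc (fun _ => ⌊-R / s⌋) (fun _ => ⌊R / s⌋)).subset ?_
    rintro m ⟨x, hx, hxK⟩
    have h2 := fun i => (norm_le_pi_norm (L x) i).trans (hR _ (mem_image_of_mem L hxK))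
    constructor
    · intro i
      rw [← show _ = m i from hx i]
      exact Int.floor_le_floor (by gcongr; exact (abs_le.1 (h2 i)).1)
    · intro i
      rw [← show _ = m i from hx i]
      exact Int.floor_le_floor (by gcongr; exact (abs_le.1 (h2 i)).2)
  obtain ⟨N, e⟩ := hfin.fin_embedding
  obtain ⟨e, he⟩ := e
  refine ⟨N, fun i => cell (e i), fun i => hconv _, fun i => hmeas _, fun i => ?_,
    fun i x hx y hy => (hdiam _ x hx y hy).le.trans (min_le_left _ _), fun i j hij => ?_,
    fun x hx => ?_⟩
  · obtain ⟨y, hy, hyK⟩ := (fun i => show e i ∈ {m | (cell m ∩ K).Nonempty} from he ▸ mem_range_self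
      i) i
    refine ⟨y, ρ, hρ, fun x hx => ?_, (Metric.ball_subset_thickening hyK ρ).trans hρU⟩
    rw [mem_ball, dist_eq_norm]
    exact (hdiam _ x hx y hy).trans_le (min_le_right _ _)
  · refine Set.disjoint_left.2 fun x hx hy => hij (e.injective (funext fun l => ?_))
    rw [← show _ = e i l from hx l, ← show _ = e j l from hy l]
  · have hm : (fun i => ⌊L x i / s⌋) ∈ range e := he ▸ ⟨x, fun i => rfl, hx⟩
    obtain ⟨i, hi⟩ := hm
    refine mem_iUnion.2 ⟨i, ?_⟩
    rw [hi]; exact fun _ => rfl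

theorem measurable_indicator {U : Set E} (hU : MeasurableSet U) {u : E → ℂ}
    (hu : ContinuousOn u U) : Measurable (U.indicator u) :=
  measurable_of_restrict_of_restrict_compl hU (by
      have : U.domRestrict (U.indicator u) = U.domRestrict u := by
        ext x; exact indicator_of_mem x.2 _
      rw [this]
      exact (continuousOn_iff_continuous_domRestrict.1 hu).measurable)
    (by
      have : Uᶜ.domRestrict (U.indicator u) = fun _ => 0 := by
        ext x; exact indicator_of_notMem x.2 _
      rw [this]
      exact measurable_const)

theorem lintegral_lintegral_shift_le [SecondCountableTopology E] [SFinite μ] {L : Set E}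
    (hL : MeasurableSet L) (e : E)
    {ρ τ : ℝ} (hτ : ∀ y, volume {t | t ∈ Ioo 0 ρ ∧ y - t • e ∈ L} ≤ ofReal τ)
    {H : E → ENNReal} (hH : Measurable H) :
    ∫⁻ x in L, (∫⁻ t in Ioo 0 ρ, H (x + t • e)) ∂μ ≤ ofReal τ * ∫⁻ y, H y ∂μ := by
  have hm : Measurable (uncurry fun x (t : ℝ) =>
      L.indicator 1 x * H (x + t • e)) :=
    ((measurable_one.indicator hL).comp measurable_fst).mul (hH.comp (by fun_prop))
  have hm2 : Measurable (uncurry fun y (t : ℝ) =>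
      (L.indicator 1 (y - t • e) : ENNReal) * H y) :=
    ((measurable_one.indicator hL).comp (by fun_prop)).mul (hH.comp measurable_fst)
  calc _ = ∫⁻ x, (∫⁻ t in Ioo 0 ρ, L.indicator 1 x * H (x + t • e)) ∂μ := by
        rw [← lintegral_indicator hL]
        refine lintegral_congr fun x => ?_
        by_cases hx : x ∈ L <;> simp [hx]
    _ = ∫⁻ t in Ioo 0 ρ, ∫⁻ x, L.indicator 1 x * H (x + t • e) ∂μ :=
        lintegral_lintegral_swap hm.aemeasurable
    _ = ∫⁻ t in Ioo 0 ρ, ∫⁻ y, (L.indicator 1 (y - t • e) : ENNReal) * H y ∂μ := by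
        refine lintegral_congr fun t => ?_
        rw [← lintegral_add_right_eq_self (fun y => (L.indicator 1 (y - t • e) : ENNReal) * H y)
          (t • e)]
        simp
    _ = ∫⁻ y, (∫⁻ t in Ioo 0 ρ, (L.indicator 1 (y - t • e) : ENNReal) * H y) ∂μ :=
        (lintegral_lintegral_swap hm2.aemeasurable).symm
    _ ≤ ∫⁻ y, ofReal τ * H y ∂μ := by
        refine lintegral_mono fun y => ?_
        have hS : MeasurableSet {t : ℝ | y - t • e ∈ L} := hL.preimage (by fun_prop)
        have h1 : Measurable fun t : ℝ => (L.indicator 1 (y - t • e) : ENNReal) :=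
          (measurable_one.indicator hL).comp (by fun_prop)
        rw [lintegral_mul_const _ h1]
        gcongr
        refine le_trans (le_of_eq ?_) (hτ y)
        have h2 : (fun t => (L.indicator 1 (y - t • e) : ENNReal))
            = {t : ℝ | y - t • e ∈ L}.indicator 1 := by
          ext t; by_cases ht : y - t • e ∈ L <;> simp [ht]
        rw [h2, lintegral_indicator_one hS, Measure.restrict_apply hS]
        congr 1; ext t; exact and_comm
    _ = _ := lintegral_const_mul _ hH

theorem ofReal_mul_lintegral_layer_le {U L : Set E} (hU : IsOpen U) (hL : MeasurableSet L)
    {e : E} {ρ τ : ℝ} (hρ : 0 < ρ) (hLU : ∀ x ∈ L, ∀ t ∈ Icc 0 ρ, x + t • e ∈ U)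
    (hτ : ∀ y, volume {t | t ∈ Ioo 0 ρ ∧ y - t • e ∈ L} ≤ ofReal τ)
    {u : E → ℂ} (hu : ContDiffOn ℝ 1 u U) :
    ofReal ρ * ∫⁻ x in L, ‖u x‖² ∂μ ≤ ofReal τ *
      (2 * ∫⁻ x in U, ‖u x‖² ∂μ + ofReal (2 * (ρ * ‖e‖) ^ 2) * ∫⁻ x in U, ‖∇ u x‖² ∂μ) := by
  let H₁ : E → ENNReal := fun x => ‖U.indicator u x‖²
  let H₂ : E → ENNReal := U.indicator fun x => ‖∇ u x‖²
  have hH₁ := (measurable_indicator hU.measurableSet hu.continuousOn).enorm.pow_const 2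
  have hH₂ := ((measurable_fderiv ℝ u).enorm.pow_const 2).indicator hU.measurableSet
  have hint₁ : ∫⁻ y, H₁ y ∂μ = ∫⁻ x in U, ‖u x‖² ∂μ := by
    rw [← lintegral_indicator hU.measurableSet]
    refine lintegral_congr fun x => ?_
    by_cases hx : x ∈ U <;> simp [H₁, hx]
  have hint₂ : ∫⁻ y, H₂ y ∂μ = ∫⁻ x in U, ‖∇ u x‖² ∂μ :=
    lintegral_indicator hU.measurableSet _
  let c := ofReal (2 * (ρ * ‖e‖) ^ 2)
  have hpt : ∀ x ∈ L, ofReal ρ * ‖u x‖² ≤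
      2 * (∫⁻ t in Ioo 0 ρ, H₁ (x + t • e)) + c * ∫⁻ t in Ioo 0 ρ, H₂ (x + t • e) := fun x hx => by
    have h1 : ∀ t ∈ Ioo 0 ρ, ‖u x‖² ≤ 2 * H₁ (x + t • e) +
        ofReal (2 * ρ * ‖e‖ ^ 2) * ∫⁻ s in Ioo 0 ρ, H₂ (x + s • e) := fun t ht => by
      have h2 := enorm_sub_sq_le_line ht.1.le (fun z hz => by
          obtain ⟨s, hs, rfl⟩ := hz
          exact (hu.continuousOn.continuousAt (hU.mem_nhds
            (hLU x hx s ⟨hs.1, hs.2.trans ht.2.le⟩))).continuousWithinAt)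
        (fun s hs => (hu.differentiableOn one_ne_zero).differentiableAt (hU.mem_nhds
            (hLU x hx s ⟨hs.1.le, (hs.2.trans ht.2).le⟩)))
      rw [zero_smul, add_zero, sub_zero] at h2
      have h3 := enorm_add_sq_le (u (x + t • e)) (u x - u (x + t • e))
      rw [add_sub_cancel, enorm_sub_rev] at h3
      have h4 : H₁ (x + t • e) = ‖u (x + t • e)‖² := by simp [H₁, hLU x hx t ⟨ht.1.le, ht.2.le⟩]
      rw [h4]
      refine h3.trans (add_le_add le_rfl ?_)
      have h5 : ∫⁻ s in Ioo 0 t, ‖∇ u (x + s • e)‖² ≤ ∫⁻ s in Ioo 0 ρ, H₂ (x + s • e) := by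
        refine (setLIntegral_mono' measurableSet_Ioo fun s hs => ?_).trans
          (lintegral_mono_set (Ioo_subset_Ioo_right ht.2.le))
        simp [H₂, hLU x hx s ⟨hs.1.le, (hs.2.trans ht.2).le⟩]
      calc _ ≤ 2 * (ofReal ρ * (‖e‖² * ∫⁻ s in Ioo 0 ρ, H₂ (x + s • e))) := by
            refine mul_le_mul_right (h2.trans ?_) 2
            gcongr
            exact ht.2.le
        _ = _ := by
            rw [ofReal_mul (by positivity), ofReal_mul (by positivity),
              ofReal_pow (norm_nonneg _), ofReal_norm, ofReal_ofNat]
            ring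
    have h6 := setLIntegral_mono' (μ := volume) measurableSet_Ioo h1
    rw [lintegral_const, restrict_apply_univ, volume_Ioo, sub_zero, mul_comm] at h6
    refine h6.trans_eq ?_
    rw [lintegral_add_left (by fun_prop), lintegral_const_mul _ (by fun_prop), lintegral_const,
      restrict_apply_univ, volume_Ioo, sub_zero, mul_right_comm,
      ← ofReal_mul (by positivity)]
    congr 3
    ring
  calc _ = ∫⁻ x in L, ofReal ρ * ‖u x‖² ∂μ := (lintegral_const_mul' _ _ ofReal_ne_top).symm
    _ ≤ ∫⁻ x in L, (2 * (∫⁻ t in Ioo 0 ρ, H₁ (x + t • e)) +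
        c * ∫⁻ t in Ioo 0 ρ, H₂ (x + t • e)) ∂μ := setLIntegral_mono' hL hpt
    _ = 2 * (∫⁻ x in L, (∫⁻ t in Ioo 0 ρ, H₁ (x + t • e)) ∂μ) +
        c * ∫⁻ x in L, (∫⁻ t in Ioo 0 ρ, H₂ (x + t • e)) ∂μ := by
      have hm : ∀ {H : E → ENNReal}, Measurable H →
          Measurable fun x => ∫⁻ t in Ioo 0 ρ, H (x + t • e) := fun {H} hH =>
        Measurable.lintegral_prod_right' (f := fun p => H (p.1 + p.2 • e)) (hH.comp (by fun_prop))
      rw [lintegral_add_left ((hm hH₁).const_mul 2), lintegral_const_mul _ (hm hH₁),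
        lintegral_const_mul _ (hm hH₂)]
    _ ≤ 2 * (ofReal τ * ∫⁻ y, H₁ y ∂μ) + c * (ofReal τ * ∫⁻ y, H₂ y ∂μ) := by
      gcongr
      · exact lintegral_lintegral_shift_le μ hL e hτ hH₁
      · exact lintegral_lintegral_shift_le μ hL e hτ hH₂
    _ = _ := by rw [hint₁, hint₂]; ring

/-- Near the boundary of `U` the `L²` norm is controlled by a small multiple of the `H¹` norm. -/
def HasCompactCore (U : Set E) : Prop :=
  ∀ η > 0, ∃ K, IsCompact K ∧ K ⊆ U ∧ ∀ u : E → ℂ, ContDiffOn ℝ 1 u U →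
    ∫⁻ x in U \ K, ‖u x‖² ∂μ ≤ ofReal η * (∫⁻ x in U, ‖u x‖² ∂μ + ∫⁻ x in U, ‖∇ u x‖² ∂μ)

variable {μ} in
theorem exists_layer_thickness {U : Set E} (hU : IsOpen U) (e : E) {ρ η : ℝ} (hρ : 0 < ρ)
    (hη : 0 < η) :
    ∃ τ > 0, ∀ L, MeasurableSet L → (∀ x ∈ L, ∀ t ∈ Icc 0 ρ, x + t • e ∈ U) →
      (∀ y, volume {t | t ∈ Ioo 0 ρ ∧ y - t • e ∈ L} ≤ ofReal τ) →
      ∀ u : E → ℂ, ContDiffOn ℝ 1 u U → ∫⁻ x in L, ‖u x‖² ∂μ ≤ ofReal η *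
        (∫⁻ x in U, ‖u x‖² ∂μ + ∫⁻ x in U, ‖∇ u x‖² ∂μ) := by
  let c := 2 + 2 * (ρ * ‖e‖) ^ 2
  have hc : 0 < c := by positivity
  refine ⟨η * ρ / c, by positivity, fun L hL hLU hτ u hu => ?_⟩
  rw [← ENNReal.mul_le_mul_iff_right (ENNReal.ofReal_pos.2 hρ).ne' ofReal_ne_top]
  refine (ofReal_mul_lintegral_layer_le μ hU hL hρ hLU hτ hu).trans ?_
  calc _ ≤ ofReal (η * ρ / c) * (ofReal c * ∫⁻ x in U, ‖u x‖² ∂μ +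
        ofReal c * ∫⁻ x in U, ‖∇ u x‖² ∂μ) := by
        gcongr
        · rw [← ofReal_ofNat]
          exact ofReal_le_ofReal (le_add_of_nonneg_right (by positivity))
        · exact le_add_of_nonneg_left (by norm_num)
    _ = _ := by
        rw [← mul_add, ← mul_assoc, ← ofReal_mul (by positivity), ← mul_assoc,
          ← ofReal_mul hρ.le, div_mul_cancel₀ _ hc.ne', mul_comm η]

end Domain

theorem IsLipschitzDomain.hasCompactCore {n : ℕ} {U : Set (Eucl n)} (hU : IsLipschitzDomain U) :
    HasCompactCore volume U := by
  have hUo := hU.isOpen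
  let P : Set (Eucl n) → Prop := fun s => ∀ η > 0, ∃ K, IsCompact K ∧ K ⊆ U ∧
    ∀ u : Eucl n → ℂ, ContDiffOn ℝ 1 u U → ∫⁻ x in (s ∩ U) \ K, ‖u x‖² ≤ ofReal η *
      ((∫⁻ x in U, ‖u x‖²) + ∫⁻ x in U, ‖∇ u x‖²)
  have hP : P (closure U) := by
    refine IsCompact.induction_on hU.isBounded.isCompact_closure ?_ ?_ ?_ ?_
    · exact fun η _ => ⟨∅, isCompact_empty, empty_subset _, fun u _ => by simp⟩
    · intro s t hst ht η hη
      obtain ⟨K, hK, hKU, h⟩ := ht η hη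
      refine ⟨K, hK, hKU, fun u hu => (lintegral_mono_set ?_).trans (h u hu)⟩
      gcongr
    · intro s t hs ht η hη
      obtain ⟨K, hK, hKU, h⟩ := hs (η / 2) (by positivity)
      obtain ⟨K', hK', hKU', h'⟩ := ht (η / 2) (by positivity)
      refine ⟨K ∪ K', hK.union hK', union_subset hKU hKU', fun u hu => ?_⟩
      calc ∫⁻ x in ((s ∪ t) ∩ U) \ (K ∪ K'), ‖u x‖²
          ≤ ∫⁻ x in ((s ∩ U) \ K) ∪ ((t ∩ U) \ K'), ‖u x‖² := by
            refine lintegral_mono_set fun x hx => ?_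
            simp at hx ⊢
            tauto
        _ ≤ _ := lintegral_union_le _ _ _
        _ ≤ _ := add_le_add (h u hu) (h' u hu)
        _ = _ := by rw [← add_mul, ← ofReal_add (by positivity) (by positivity), add_halves]
    · intro p hp
      by_cases hpU : p ∈ U
      · obtain ⟨r, hr, hrU⟩ := Metric.nhds_basis_closedBall.mem_iff.1 (hUo.mem_nhds hpU)
        refine ⟨Metric.closedBall p r, mem_nhdsWithin_of_mem_nhds (Metric.closedBall_mem_nhds p hr),
          fun η _ => ⟨_, isCompact_closedBall p r, hrU, fun u _ => ?_⟩⟩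
        rw [sdiff_eq_empty.2 inter_subset_left]; simp
      · obtain ⟨e, φ, C, r, he, hφ, hinv, hr, hgraph⟩ := hU.graph p (hUo.frontier_eq ▸ ⟨hp, hpU⟩)
        have hφc := hφ.continuous
        refine ⟨ball p (r / 3), mem_nhdsWithin_of_mem_nhds
          (Metric.ball_mem_nhds p (by positivity)), fun η hη => ?_⟩
        obtain ⟨τ, hτ, h⟩ := exists_layer_thickness (μ := volume) hUo e (ρ := r / 3)
          (by positivity) hη
        refine ⟨Metric.closedBall p (r / 3) ∩ {x | φ x + τ ≤ inner ℝ e x},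
          (isCompact_closedBall _ _).inter_right (isClosed_le (by fun_prop) (by fun_prop)),
          fun x hx => ?_, fun u hu => ?_⟩
        · refine (hgraph x (Metric.closedBall_subset_ball (by linarith) hx.1)).2 ?_
          have := hx.2
          simp at this
          linarith
        · refine (lintegral_mono_set ?_).trans (h (ball p (r / 3) ∩
            {x | φ x < inner ℝ e x ∧ inner ℝ e x < φ x + τ}) ?_ ?_ ?_ u hu)
          · rintro x ⟨⟨hx, hxU⟩, hxK⟩
            refine ⟨hx, (hgraph x (ball_subset_ball (by linarith) hx)).1 hxU, ?_⟩
            by_contra! hcon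
            exact hxK ⟨Metric.ball_subset_closedBall hx, hcon⟩
          · have h1 : IsOpen {x | φ x < inner ℝ e x} := isOpen_lt (by fun_prop) (by fun_prop)
            have h2 : IsOpen {x | inner ℝ e x < φ x + τ} := isOpen_lt (by fun_prop) (by fun_prop)
            exact Metric.isOpen_ball.measurableSet.inter (h1.inter h2).measurableSet
          · rintro x ⟨hx, hx1, hx2⟩ t ht
            refine (hgraph _ ?_).2 ?_
            · rw [mem_ball, dist_eq_norm] at *
              have h1 : x + t • e - p = (x - p) + t • e := by abel
              have h2 := norm_add_le (x - p) (t • e)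
              rw [norm_smul, he, mul_one, Real.norm_of_nonneg ht.1] at h2
              rw [h1]; linarith [ht.2]
            · rw [hinv, inner_add_right, inner_smul_right, real_inner_self_eq_norm_sq, he]
              nlinarith [ht.1]
          · intro y
            refine (measure_mono (t := Ioo (inner ℝ e y - φ y - τ) (inner ℝ e y - φ y)) ?_).trans ?_
            · rintro t ⟨-, -, h1, h2⟩
              have h3 : φ (y - t • e) = φ y := by rw [sub_eq_add_neg, ← neg_smul, hinv]
              rw [h3, inner_sub_right, inner_smul_right, real_inner_self_eq_norm_sq, he] at h1 h2
              constructor <;> linarith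
            · rw [volume_Ioo]; ring_nf; exact le_rfl
  intro η hη
  obtain ⟨K, hK, hKU, h⟩ := hP η hη
  refine ⟨K, hK, hKU, fun u hu => ?_⟩
  have := h u hu
  rwa [inter_eq_right.2 subset_closure] at this

theorem hasCompactCore_Ioo (a b : ℝ) : HasCompactCore volume (Ioo a b) := by
  intro η hη
  rcases le_or_gt b a with hab | hab
  · exact ⟨∅, isCompact_empty, empty_subset _, fun u _ => by simp [Ioo_eq_empty hab.not_gt]⟩
  obtain ⟨τ, hτ, h⟩ := exists_layer_thickness (μ := volume) (isOpen_Ioo) (1 : ℝ)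
    (ρ := (b - a) / 3) (by linarith) (half_pos hη)
  obtain ⟨τ', hτ', h'⟩ := exists_layer_thickness (μ := volume) (isOpen_Ioo)
    (-1 : ℝ) (ρ := (b - a) / 3) (by linarith) (half_pos hη)
  let σ := min τ ((b - a) / 3)
  let σ' := min τ' ((b - a) / 3)
  have hσ : σ ≤ τ ∧ σ ≤ (b - a) / 3 := ⟨min_le_left _ _, min_le_right _ _⟩
  have hσ' : σ' ≤ τ' ∧ σ' ≤ (b - a) / 3 := ⟨min_le_left _ _, min_le_right _ _⟩
  have hσ0 : 0 < σ := lt_min hτ (by linarith)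
  have hσ0' : 0 < σ' := lt_min hτ' (by linarith)
  refine ⟨Icc (a + σ) (b - σ'), isCompact_Icc, fun x hx => ⟨by linarith [hx.1], by linarith [hx.2]⟩,
    fun u hu => ?_⟩
  calc ∫⁻ x in Ioo a b \ Icc (a + σ) (b - σ'), ‖u x‖²
      ≤ ∫⁻ x in Ioo a (a + σ) ∪ Ioo (b - σ') b, ‖u x‖² := by
        refine lintegral_mono_set fun x hx => ?_
        simp only [Set.mem_sdiff, mem_Ioo, mem_Icc, mem_union, not_and_or, not_le] at hx ⊢
        tauto
    _ ≤ _ := lintegral_union_le _ _ _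
    _ ≤ _ := by
      refine add_le_add (h _ measurableSet_Ioo ?_ ?_ u hu) (h' _ measurableSet_Ioo ?_ ?_ u hu)
      · intro x hx t ht
        simp
        constructor <;> linarith [hx.1, hx.2, ht.1, ht.2]
      · intro y
        refine (measure_mono (t := Ioo (y - a - σ) (y - a)) ?_).trans ?_
        · rintro t ⟨-, h1, h2⟩
          simp at h1 h2
          constructor <;> linarith
        · rw [volume_Ioo]; exact ofReal_le_ofReal (by linarith)
      · intro x hx t ht
        simp
        constructor <;> linarith [hx.1, hx.2, ht.1, ht.2]
      · intro y
        refine (measure_mono (t := Ioo (b - y - σ') (b - y)) ?_).trans ?_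
        · rintro t ⟨-, h1, h2⟩
          simp at h1 h2
          constructor <;> linarith
        · rw [volume_Ioo]; exact ofReal_le_ofReal (by linarith)
    _ = _ := by rw [← add_mul, ← ofReal_add (by positivity) (by positivity), add_halves]

section Domain

variable {E : Type*} [NormedAddCommGroup E] [NormedSpace ℝ E] [FiniteDimensional ℝ E]
  [MeasurableSpace E] [BorelSpace E] (μ : Measure E) [μ.IsAddHaarMeasure]

theorem average_sub_const {Q : Set E} (hQ0 : μ Q ≠ 0) (hQ : μ Q ≠ ∞) {u : E → ℂ}
    (hu : IntegrableOn u Q μ) (c : ℂ) : (⨍ y in Q, (u y - c) ∂μ) = (⨍ y in Q, u y ∂μ) - c := by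
  have : IsFiniteMeasure (μ.restrict Q) := isFiniteMeasure_restrict.2 hQ
  have hreal : (μ.restrict Q).real univ ≠ 0 :=
    ENNReal.toReal_ne_zero.2 ⟨by simpa using hQ0, measure_ne_top _ _⟩
  rw [average_eq, average_eq, integral_sub hu (integrable_const c), integral_const,
      smul_sub, smul_smul, inv_mul_cancel₀ hreal, one_smul]

theorem lintegral_enorm_sq_le_average {Q : Set E} {u : E → ℂ} : ∫⁻ x in Q, ‖u x‖² ∂μ ≤
      2 * (∫⁻ x in Q, ‖u x - ⨍ y in Q, u y ∂μ‖² ∂μ) + 2 * μ Q * ‖⨍ y in Q, u y ∂μ‖² := by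
  set m := ⨍ y in Q, u y ∂μ
  calc ∫⁻ x in Q, ‖u x‖² ∂μ ≤ ∫⁻ x in Q, (2 * ‖u x - m‖² + 2 * ‖m‖²) ∂μ := by
        refine lintegral_mono fun x => ?_
        have := enorm_add_sq_le (u x - m) m
        rwa [sub_add_cancel] at this
    _ = _ := by
        rw [lintegral_add_right' _ aemeasurable_const, lintegral_const_mul' _ _ (by simp),
          lintegral_const, restrict_apply_univ, mul_right_comm]

/-- Up to a small multiple of the `H¹` norm, the `L²` norm is controlled by finitely many means. -/
theorem HasCompactCore.exists_averages {U : Set E} (hU : IsOpen U) (h : HasCompactCore μ U)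
    {η : ℝ} (hη : 0 < η) :
    ∃ (n : ℕ) (Q : Fin n → Set E), (∀ i, MeasurableSet (Q i)) ∧
      (∀ i, ∃ y ρ, 0 < ρ ∧ Q i ⊆ ball y ρ ∧ ball y ρ ⊆ U) ∧
      ∀ u : E → ℂ, ContDiffOn ℝ 1 u U → ∫⁻ x in U, ‖u x‖² ∂μ ≤ ofReal η *
          (∫⁻ x in U, ‖u x‖² ∂μ + ∫⁻ x in U, ‖∇ u x‖² ∂μ) +
          ∑ i, 2 * μ (Q i) * ‖⨍ y in Q i, u y ∂μ‖² := by
  obtain ⟨K, hK, hKU, hKu⟩ := h (η / 2) (half_pos hη)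
  set c := 2 * (2 : ℝ) ^ finrank ℝ E
  have hc : 0 < c := by positivity
  obtain ⟨n, Q, hconv, hmeas, hball, hdiam, hdisj, hcov⟩ :=
    exists_finite_convex_cover hU hK hKU (r := sqrt (η / 2 / c)) (by positivity)
  have hQU : ∀ i, Q i ⊆ U := fun i => by
    obtain ⟨y, ρ, -, h1, h2⟩ := hball i
    exact h1.trans h2
  refine ⟨n, Q, hmeas, hball, fun u hu => ?_⟩
  have hfin : ∀ i, μ (Q i) ≠ ∞ := fun i => by
    obtain ⟨y, ρ, -, h1, -⟩ := hball i
    exact (measure_mono h1).trans_lt measure_ball_lt_top |>.ne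
  have hQ : ∀ i, ∫⁻ x in Q i, ‖u x‖² ∂μ ≤ ofReal (η / 2) * (∫⁻ x in Q i, ‖∇ u x‖² ∂μ) +
        2 * μ (Q i) * ‖⨍ y in Q i, u y ∂μ‖² := fun i => by
    refine (lintegral_enorm_sq_le_average μ).trans (add_le_add ?_ le_rfl)
    have h1 := lintegral_enorm_sub_average_le_of_convex μ (hconv i) (hmeas i) hU (hQU i)
      (hdiam i) (hfin i) hu
    calc _ ≤ 2 * (ofReal (2 ^ finrank ℝ E * sqrt (η / 2 / c) ^ 2) *
            ∫⁻ x in Q i, ‖∇ u x‖² ∂μ) := by gcongr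
      _ = _ := by
        rw [← mul_assoc, ← ofReal_ofNat, ← ofReal_mul (by norm_num),
          sq_sqrt (by positivity), ← mul_assoc, mul_div_cancel₀ _ hc.ne']
  have hsum : ∑ i, ∫⁻ x in Q i, ‖∇ u x‖² ∂μ ≤ ∫⁻ x in U, ‖∇ u x‖² ∂μ := by
    rw [← tsum_fintype (L := SummationFilter.unconditional _), ← lintegral_iUnion hmeas hdisj]
    exact lintegral_mono_set (iUnion_subset hQU)
  calc ∫⁻ x in U, ‖u x‖² ∂μ ≤ ∫⁻ x in (U \ K) ∪ ⋃ i, Q i, ‖u x‖² ∂μ := by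
        refine lintegral_mono_set fun x hx => ?_
        by_cases hxK : x ∈ K
        · exact Or.inr (hcov hxK)
        · exact Or.inl ⟨hx, hxK⟩
    _ ≤ (∫⁻ x in U \ K, ‖u x‖² ∂μ) + ∫⁻ x in ⋃ i, Q i, ‖u x‖² ∂μ := lintegral_union_le _ _ _
    _ = (∫⁻ x in U \ K, ‖u x‖² ∂μ) + ∑ i, ∫⁻ x in Q i, ‖u x‖² ∂μ := by
        rw [lintegral_iUnion hmeas hdisj, tsum_fintype]
    _ ≤ ofReal (η / 2) * (∫⁻ x in U, ‖u x‖² ∂μ + ∫⁻ x in U, ‖∇ u x‖² ∂μ) +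
        ∑ i, (ofReal (η / 2) * (∫⁻ x in Q i, ‖∇ u x‖² ∂μ) +
          2 * μ (Q i) * ‖⨍ y in Q i, u y ∂μ‖²) :=
        add_le_add (hKu u hu) (sum_le_sum fun i _ => hQ i)
    _ ≤ ofReal (η / 2) * (∫⁻ x in U, ‖u x‖² ∂μ + ∫⁻ x in U, ‖∇ u x‖² ∂μ) +
        (ofReal (η / 2) * (∫⁻ x in U, ‖u x‖² ∂μ + ∫⁻ x in U, ‖∇ u x‖² ∂μ) +
          ∑ i, 2 * μ (Q i) * ‖⨍ y in Q i, u y ∂μ‖²) := by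
        rw [sum_add_distrib, ← mul_sum]
        gcongr
        exact hsum.trans le_add_self
    _ = _ := by
        rw [← add_assoc, ← add_mul, ← ofReal_add (by positivity) (by positivity), add_halves]

/-- The means over two subsets of `U` differ by a multiple of the norm of the gradient. -/
def MeansLinked (U A B : Set E) : Prop :=
  ∃ C : NNReal, ∀ u : E → ℂ, ContDiffOn ℝ 1 u U → MemLp u 2 (μ.restrict U) →
    ‖(⨍ y in A, u y ∂μ) - ⨍ y in B, u y ∂μ‖² ≤ C * ∫⁻ x in U, ‖∇ u x‖² ∂μ

variable {μ} in
theorem MeansLinked.symm {U A B : Set E} (h : MeansLinked μ U A B) : MeansLinked μ U B A := by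
  obtain ⟨C, hC⟩ := h
  exact ⟨C, fun u hu hu' => by rw [enorm_sub_rev]; exact hC u hu hu'⟩

variable {μ} in
theorem MeansLinked.trans {U A B D : Set E} (h : MeansLinked μ U A B) (h' : MeansLinked μ U B D) :
    MeansLinked μ U A D := by
  obtain ⟨C, hC⟩ := h
  obtain ⟨C', hC'⟩ := h'
  refine ⟨2 * C + 2 * C', fun u hu hu' => ?_⟩
  refine (enorm_sub_sq_le _ (⨍ y in B, u y ∂μ) _).trans ?_
  push_cast
  rw [add_mul, mul_assoc, mul_assoc]
  exact add_le_add (mul_le_mul_right (hC u hu hu') _) (mul_le_mul_right (hC' u hu hu') _)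

theorem meansLinked_ball {U Q : Set E} (hU : IsOpen U) {x : E} {r : ℝ}
    (hr : ball x r ⊆ U) (hQ : Q ⊆ ball x r) (hQ0 : μ Q ≠ 0) :
    MeansLinked μ U (ball x r) Q :=
  exists_enorm_average_sub_average_le μ (convex_ball x r) measurableSet_ball hU hr hQ
    Metric.isBounded_ball hQ0

theorem meansLinked_balls {U : Set E} (hU : IsOpen U) (hc : IsPreconnected U) {x y : E} {r s : ℝ}
    (hr : 0 < r) (hs : 0 < s) (hxU : ball x r ⊆ U) (hyU : ball y s ⊆ U) :
    MeansLinked μ U (ball x r) (ball y s) := by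
  have hpos : ∀ z {ρ : ℝ}, 0 < ρ → μ (ball z ρ) ≠ 0 := fun z ρ hρ =>
    (Metric.measure_ball_pos μ z hρ).ne'
  let P : E → E → Prop := fun x y => ∀ r > 0, ∀ s > 0, ball x r ⊆ U →
    ball y s ⊆ U → MeansLinked μ U (ball x r) (ball y s)
  refine hc.induction₂ P ?_ ?_ ?_ (hxU (mem_ball_self hr)) (hyU (mem_ball_self hs))
    r hr s hs hxU hyU
  · intro x hx
    obtain ⟨R, hR, hRU⟩ := Metric.isOpen_iff.1 hU x hx
    filter_upwards [mem_nhdsWithin_of_mem_nhds (Metric.ball_mem_nhds x hR)] with y hy r hr s hs h1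
      h2
    have hd : 0 < R - dist y x := by simpa using hy
    have hm1 := lt_min hr hR
    have hm2 := lt_min hs hd
    have a3 := meansLinked_ball μ hU hRU
      (Metric.ball_subset_ball' (by linarith [min_le_right s (R - dist y x)])) (hpos y hm2)
    exact (meansLinked_ball μ hU h1 (ball_subset_ball (min_le_left r R)) (hpos x hm1)).trans
      ((meansLinked_ball μ hU hRU (ball_subset_ball (min_le_right r R)) (hpos x hm1)).symm.trans
      (a3.trans (meansLinked_ball μ hU h2 (ball_subset_ball (min_le_left s (R - dist y x)))
      (hpos y hm2)).symm))
  · intro x y z _ hy _ hxy hyz r hr s hs h1 h2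
    obtain ⟨R, hR, hRU⟩ := Metric.isOpen_iff.1 hU y hy
    exact (hxy r hr R hR h1 hRU).trans (hyz R hR s hs hRU h2)
  · exact fun x y _ _ h r hr s hs h1 h2 => (h s hs r hr h2 h1).symm

/-- The Poincaré inequality on `U` with constant `C`. -/
def HasPoincare (U : Set E) (C : ENNReal) : Prop :=
  ∀ u : E → ℂ, ContDiffOn ℝ 1 u U → MemLp u 2 (μ.restrict U) →
    ∫⁻ x in U, ‖u x - ⨍ y in U, u y ∂μ‖² ∂μ ≤ C * ∫⁻ x in U, ‖∇ u x‖² ∂μ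

variable {μ} in
theorem HasCompactCore.exists_hasPoincare {U : Set E} (hU : IsOpen U) (hc : IsConnected U)
    (hb : Bornology.IsBounded U) (h : HasCompactCore μ U) :
    ∃ C : NNReal, HasPoincare μ U C := by
  obtain ⟨x₀, hx₀⟩ := hc.nonempty
  obtain ⟨r₀, hr₀, hrU⟩ := Metric.isOpen_iff.1 hU x₀ hx₀
  obtain ⟨n, Q, hQm, hQb, hQ⟩ := h.exists_averages μ hU (η := 1 / 2) (by norm_num)
  have hUfin : μ U ≠ ∞ := hb.measure_lt_top.ne
  have : IsFiniteMeasure (μ.restrict U) := isFiniteMeasure_restrict.2 hUfin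
  have hQU : ∀ i, Q i ⊆ U := fun i => by
    obtain ⟨y, ρ, -, h1, h2⟩ := hQb i
    exact h1.trans h2
  have hQfin : ∀ i, μ (Q i) ≠ ∞ := fun i => ((measure_mono (hQU i)).trans_lt hb.measure_lt_top).ne
  have hlink : ∀ i, ∃ C : NNReal, ∀ u : E → ℂ, ContDiffOn ℝ 1 u U → MemLp u 2 (μ.restrict U) →
      2 * μ (Q i) * ‖⨍ y in Q i, (u y - ⨍ y in ball x₀ r₀, u y ∂μ) ∂μ‖² ≤
        C * ∫⁻ x in U, ‖∇ u x‖² ∂μ := fun i => by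
    rcases eq_or_ne (μ (Q i)) 0 with h0 | h0
    · exact ⟨0, fun u _ _ => by simp [h0]⟩
    obtain ⟨y, ρ, hρ, h1, h2⟩ := hQb i
    obtain ⟨C, hC⟩ := ((meansLinked_ball μ hU h2 h1 h0).symm.trans
      (meansLinked_balls μ hU hc.isPreconnected hρ hr₀ h2 hrU))
    refine ⟨2 * (μ (Q i)).toNNReal * C, fun u hu huL => ?_⟩
    have := isFiniteMeasure_restrict.2 (hQfin i)
    rw [average_sub_const μ h0 (hQfin i) ((huL.mono_measure
      (restrict_mono (hQU i) le_rfl)).integrable (by norm_num))]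
    push_cast
    rw [coe_toNNReal (hQfin i), mul_assoc _ (C : ENNReal)]
    exact mul_le_mul_right (hC u hu huL) _
  choose C hC using hlink
  refine ⟨1 + 2 * ∑ i, C i, fun u hu huL => ?_⟩
  have hum := aesm_of_contDiffOn μ hU hu
  set c := ⨍ y in ball x₀ r₀, u y ∂μ
  refine (lintegral_enorm_sub_average_sq_le hum c).trans ?_
  have h1 := hQ (fun x => u x - c) (hu.sub contDiffOn_const)
  simp only [fderiv_sub_const] at h1
  set X := ∫⁻ x in U, ‖u x - c‖² ∂μ
  set D := ∫⁻ x in U, ‖∇ u x‖² ∂μ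
  have h2 : X ≤ ofReal (1 / 2) * (X + D) + (∑ i, (C i : ENNReal)) * D := by
    refine h1.trans (add_le_add le_rfl ?_)
    rw [Finset.sum_mul]
    exact sum_le_sum fun i _ => hC i u hu huL
  have hhalf : ofReal (1 / 2) = 2⁻¹ := by
    rw [one_div, ENNReal.ofReal_inv_of_pos (by norm_num), ofReal_ofNat]
  rw [hhalf] at h2
  have h3 : X + X ≤ X + (D + 2 * (∑ i, (C i : ENNReal)) * D) := by
    calc X + X = 2 * X := (two_mul X).symm
      _ ≤ 2 * (2⁻¹ * (X + D) + (∑ i, (C i : ENNReal)) * D) := by gcongr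
      _ = _ := by
        rw [mul_add, ← mul_assoc, ENNReal.mul_inv_cancel (by norm_num) (by norm_num), one_mul,
          add_assoc, ← mul_assoc]
  refine (ENNReal.le_of_add_le_add_left (((memLp_two_iff (hum.sub aestronglyMeasurable_const)).1
    (huL.sub (memLp_const c))).ne) h3).trans (le_of_eq ?_)
  push_cast
  rw [add_mul, one_mul]

end Domain

section Point

variable {d : ℕ}

/-- The cylinder of the points with cross component in `A` and axial component in `I`. -/
def slab (A : Set (Eucl d)) (I : Set ℝ) : Set (Eucl (d + 1)) := {x | cross x ∈ A ∧ axial x ∈ I}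

/-- The axial unit vector. -/
def axis (d : ℕ) : Eucl (d + 1) := point 0 1

@[simp] theorem point_castSucc (y : Eucl d) (t : ℝ) (i : Fin d) : point y t i.castSucc = y i := by
  simp [point]

@[simp] theorem point_last (y : Eucl d) (t : ℝ) : point y t (Fin.last d) = t := by simp [point]

@[simp] theorem cross_point (y : Eucl d) (t : ℝ) : cross (point y t) = y := by ext i; simp [cross]

@[simp] theorem axial_point (y : Eucl d) (t : ℝ) : axial (point y t) = t := by simp [axial]

@[simp] theorem point_cross_axial (x : Eucl (d + 1)) : point (cross x) (axial x) = x := by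
  ext i
  refine Fin.lastCases ?_ (fun j => ?_) i
  · simp [axial]
  · simp [cross]

theorem point_ext {x y : Eucl (d + 1)} (h : cross x = cross y) (h' : axial x = axial y) : x =
    y := by
  rw [← point_cross_axial x, h, h', point_cross_axial]

@[simp] theorem cross_add (x y : Eucl (d + 1)) : cross (x + y) = cross x + cross y := by
  ext i; simp [cross]

@[simp] theorem axial_add (x y : Eucl (d + 1)) : axial (x + y) = axial x + axial y := by
  simp [axial]

@[simp] theorem cross_smul (c : ℝ) (x : Eucl (d + 1)) : cross (c • x) = c • cross x := by
  ext i; simp [cross]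

@[simp] theorem axial_smul (c : ℝ) (x : Eucl (d + 1)) : axial (c • x) = c * axial x := by
  simp [axial]

@[simp] theorem cross_axis : cross (axis d) = 0 := cross_point _ _

@[simp] theorem axial_axis : axial (axis d) = 1 := axial_point _ _

theorem point_add (y z : Eucl d) (s t : ℝ) : point (y + z) (s + t) = point y s + point z t :=
  point_ext (by simp) (by simp)

theorem point_smul (c : ℝ) (y : Eucl d) (s : ℝ) : point (c • y) (c * s) = c • point y s :=
  point_ext (by simp) (by simp)

theorem norm_sq_point (y : Eucl d) (t : ℝ) : ‖point y t‖ ^ 2 = ‖y‖ ^ 2 + t ^ 2 := by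
  rw [norm_sq_eq, norm_sq_eq, Fin.sum_univ_castSucc]
  simp

theorem norm_axis : ‖axis d‖ = 1 := by
  have h := norm_sq_point (0 : Eucl d) 1
  rw [norm_zero] at h
  change ‖axis d‖ ^ 2 = _ at h
  nlinarith [norm_nonneg (axis d)]

/-- The inclusion of the hyperplane. -/
def crossIncl (d : ℕ) : Eucl d →ₗᵢ[ℝ] Eucl (d + 1) where
  toFun y := point y 0
  map_add' y z := by rw [← point_add, add_zero]
  map_smul' c y := by rw [RingHom.id_apply, ← point_smul, mul_zero]
  norm_map' y := by
    have h := norm_sq_point y 0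
    simp only [ne_eq, OfNat.ofNat_ne_zero, not_false_eq_true, zero_pow, add_zero] at h
    exact (pow_left_inj₀ (norm_nonneg _) (norm_nonneg _) two_ne_zero).1 h

theorem crossIncl_apply (y : Eucl d) : crossIncl d y = point y 0 := rfl

theorem point_eq_add (y : Eucl d) (t : ℝ) : point y t = crossIncl d y + t • axis d :=
  point_ext (by simp [crossIncl_apply]) (by simp [crossIncl_apply])

theorem continuous_point : Continuous fun p : Eucl d × ℝ => point p.1 p.2 := by
  simp_rw [point_eq_add]
  exact ((crossIncl d).continuous.comp continuous_fst).add (continuous_snd.smul continuous_const)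

theorem continuous_cross : Continuous (cross (d := d)) := by unfold cross; fun_prop

theorem continuous_axial : Continuous (axial (d := d)) := by unfold axial; fun_prop

theorem measurePreserving_point : MeasurePreserving (fun p : Eucl d × ℝ => point p.1 p.2) := by
  have h1 : MeasurePreserving (Prod.map (MeasurableEquiv.toLp 2 (Fin d → ℝ)).symm (id : ℝ → ℝ)) :=
    (EuclideanSpace.volume_preserving_symm_measurableEquiv_toLp (Fin d)).prod
      (MeasurePreserving.id volume)
  have h2 : MeasurePreserving (Prod.swap : (Fin d → ℝ) × ℝ → ℝ × (Fin d → ℝ)) :=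
    Measure.measurePreserving_swap
  have h5 := ((EuclideanSpace.volume_preserving_symm_measurableEquiv_toLp (Fin (d + 1))).symm).comp
    (((volume_preserving_piFinSuccAbove (fun _ => ℝ) (Fin.last d)).symm).comp (h2.comp h1))
  convert h5 using 1
  funext p
  ext i
  refine Fin.lastCases ?_ (fun j => ?_) i
  · simp
  · simp

theorem measEmb_point : MeasurableEmbedding (fun p : Eucl d × ℝ => point p.1 p.2) :=
  (MeasurableEquiv.mk ⟨fun p => point p.1 p.2, fun x => (cross x, axial x),
    fun p => by simp, fun x => by simp⟩ continuous_point.measurable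
    (continuous_cross.prodMk continuous_axial).measurable).measurableEmbedding

theorem point_preimage_slab (A : Set (Eucl d)) (I : Set ℝ) :
    (fun p : Eucl d × ℝ => point p.1 p.2) ⁻¹' slab A I = A ×ˢ I := by ext p; simp [slab]

theorem point_slab (A : Set (Eucl d)) (I : Set ℝ) :
    MeasurePreserving (fun p : Eucl d × ℝ => point p.1 p.2)
      ((volume.restrict A).prod (volume.restrict I)) (volume.restrict (slab A I)) := by
  have := measurePreserving_point.restrict_preimage_emb measEmb_point (slab A I)
  rwa [point_preimage_slab, Measure.volume_eq_prod, ← Measure.prod_restrict] at this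

theorem lintegral_slab {A : Set (Eucl d)} {I : Set ℝ} {F : Eucl (d + 1) → ENNReal}
    (hF : AEMeasurable F (volume.restrict (slab A I))) :
    ∫⁻ x in slab A I, F x = ∫⁻ θ in I, ∫⁻ y in A, F (point y θ) := by
  have h := point_slab A I
  rw [← h.lintegral_comp_emb measEmb_point, lintegral_prod_symm]
  exact hF.comp_quasiMeasurePreserving h.quasiMeasurePreserving

theorem volume_slab (A : Set (Eucl d)) (I : Set ℝ) : volume (slab A I) = volume A * volume I := by
  have := (point_slab A I).measure_preimage_emb measEmb_point univ
  rw [preimage_univ, restrict_apply_univ, ← univ_prod_univ, Measure.prod_prod,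
    restrict_apply_univ, restrict_apply_univ] at this
  exact this.symm

theorem isOpen_slab {A : Set (Eucl d)} {I : Set ℝ} (hA : IsOpen A) (hI : IsOpen I) :
    IsOpen (slab A I) :=
  (hA.preimage continuous_cross).inter (hI.preimage continuous_axial)

theorem measurableSet_slab {A : Set (Eucl d)} {I : Set ℝ} (hA : MeasurableSet A)
    (hI : MeasurableSet I) : MeasurableSet (slab A I) :=
  (continuous_cross.measurable hA).inter (continuous_axial.measurable hI)

theorem slab_eq_image (A : Set (Eucl d)) (I : Set ℝ) :
    slab A I = (fun p : Eucl d × ℝ => point p.1 p.2) '' A ×ˢ I := by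
  ext x
  constructor
  · intro hx; exact ⟨(cross x, axial x), hx, point_cross_axial x⟩
  · rintro ⟨p, hp, rfl⟩; simpa [slab] using hp

theorem slab_mono {A A' : Set (Eucl d)} {I I' : Set ℝ} (hA : A ⊆ A') (hI : I ⊆ I') :
    slab A I ⊆ slab A' I' := fun _ hx => ⟨hA hx.1, hI hx.2⟩

theorem isConnected_slab {A : Set (Eucl d)} {I : Set ℝ} (hA : IsConnected A) (hI : IsConnected I) :
    IsConnected (slab A I) := by
  rw [slab_eq_image]; exact (hA.prod hI).image _ continuous_point.continuousOn

theorem isBounded_slab {A : Set (Eucl d)} {I : Set ℝ} (hA : Bornology.IsBounded A)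
    (hI : Bornology.IsBounded I) : Bornology.IsBounded (slab A I) := by
  have h : IsCompact (slab (closure A) (closure I)) := by
    rw [slab_eq_image]
    exact (hA.isCompact_closure.prod hI.isCompact_closure).image continuous_point
  exact h.isBounded.subset (slab_mono subset_closure subset_closure)

theorem contDiff_point_left (t : ℝ) : ContDiff ℝ 1 fun y : Eucl d => point y t := by
  simp_rw [point_eq_add]
  exact (crossIncl d).contDiff.add contDiff_const

theorem enorm_fderiv_slice_le {u : Eucl (d + 1) → ℂ} {y : Eucl d} {t : ℝ}
    (hu : DifferentiableAt ℝ u (point y t)) :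
    ‖∇ (fun z => u (point z t)) y‖ₑ ≤ ‖∇ u (point y t)‖ₑ := by
  have h1 : HasFDerivAt (fun z => point z t) (crossIncl d).toContinuousLinearMap y := by
    have : (fun z => point z t) = fun z => crossIncl d z + t • axis d := by
      funext z; rw [point_eq_add]
    rw [this]
    exact (crossIncl d).toContinuousLinearMap.hasFDerivAt.add_const _
  rw [HasFDerivAt.fderiv (f := fun z => u (point z t)) (hu.hasFDerivAt.comp y h1), ← ofReal_norm, ←
    ofReal_norm]
  refine ofReal_le_ofReal ((ContinuousLinearMap.opNorm_comp_le _ _).trans ?_)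
  exact mul_le_of_le_one_right (norm_nonneg _) (crossIncl d).norm_toContinuousLinearMap_le

theorem HasCompactCore.slab {Ω : Set (Eucl d)} (hΩ : IsOpen Ω) (h : HasCompactCore volume Ω)
    (α β : ℝ) : HasCompactCore volume (slab Ω (Ioo α β)) := fun η hη => by
  rcases le_or_gt β α with hab | hab
  · refine ⟨∅, isCompact_empty, empty_subset _, fun u _ => ?_⟩
    have : InflatedTree.slab Ω (Ioo α β) = ∅ := by
      rw [Ioo_eq_empty hab.not_gt]; ext x; simp [InflatedTree.slab]
    simp [this]
  have hU : IsOpen (InflatedTree.slab Ω (Ioo α β)) := isOpen_slab hΩ isOpen_Ioo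
  set U := InflatedTree.slab Ω (Ioo α β)
  have hη3 : 0 < η / 3 := by positivity
  obtain ⟨K, hK, hKΩ, hKu⟩ := h (η / 3) hη3
  obtain ⟨τ, hτ, hl⟩ := exists_layer_thickness (μ := volume) hU (axis d)
    (ρ := (β - α) / 3) (by linarith) hη3
  obtain ⟨τ', hτ', hl'⟩ := exists_layer_thickness (μ := volume) hU (-axis d)
    (ρ := (β - α) / 3) (by linarith) hη3
  let σ := min τ ((β - α) / 3)
  let σ' := min τ' ((β - α) / 3)
  have hσ : σ ≤ τ ∧ σ ≤ (β - α) / 3 := ⟨min_le_left _ _, min_le_right _ _⟩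
  have hσ' : σ' ≤ τ' ∧ σ' ≤ (β - α) / 3 := ⟨min_le_left _ _, min_le_right _ _⟩
  have hσ0 : 0 < σ := lt_min hτ (by linarith)
  have hσ0' : 0 < σ' := lt_min hτ' (by linarith)
  refine ⟨InflatedTree.slab K (Icc (α + σ) (β - σ')), ?_, slab_mono hKΩ fun x hx =>
    ⟨by linarith [hx.1], by linarith [hx.2]⟩, fun u hu => ?_⟩
  · rw [slab_eq_image]; exact (hK.prod isCompact_Icc).image continuous_point
  have hmeas := (aesm_of_contDiffOn volume hU hu).enorm.pow_const 2
  have hmeas' : AEMeasurable (fun x => ‖∇ u x‖²) (volume.restrict U) :=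
    ((measurable_fderiv ℝ u).enorm.pow_const 2).aemeasurable
  have hside : ∫⁻ x in InflatedTree.slab (Ω \ K) (Ioo α β), ‖u x‖² ≤ ofReal (η / 3) *
      ((∫⁻ x in U, ‖u x‖²) + ∫⁻ x in U, ‖∇ u x‖²) := by
    rw [lintegral_slab (hmeas.mono_set (slab_mono sdiff_subset Subset.rfl)), lintegral_slab hmeas,
      lintegral_slab hmeas', ← lintegral_add_left' (AEMeasurable.lintegral_prod_left ?_),
      ← lintegral_const_mul' _ _ ofReal_ne_top]
    · refine setLIntegral_mono' measurableSet_Ioo fun θ hθ => ?_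
      refine (hKu (fun y => u (point y θ)) (hu.comp (contDiff_point_left θ).contDiffOn
        fun y hy => ⟨by simpa using hy, by simpa using hθ⟩)).trans ?_
      refine mul_le_mul_right (add_le_add le_rfl (setLIntegral_mono' hΩ.measurableSet
        fun y hy => ?_)) _
      gcongr
      exact enorm_fderiv_slice_le ((hu.differentiableOn one_ne_zero).differentiableAt
        (hU.mem_nhds ⟨by simpa using hy, by simpa using hθ⟩))
    · exact hmeas.comp_quasiMeasurePreserving (point_slab Ω (Ioo α β)).quasiMeasurePreserving
  calc ∫⁻ x in U \ InflatedTree.slab K (Icc (α + σ) (β - σ')), ‖u x‖²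
      ≤ ∫⁻ x in (InflatedTree.slab Ω (Ioo α (α + σ)) ∪ InflatedTree.slab Ω (Ioo (β - σ') β)) ∪
          InflatedTree.slab (Ω \ K) (Ioo α β), ‖u x‖² := by
        refine lintegral_mono_set fun x hx => ?_
        simp only [U, InflatedTree.slab, Set.mem_sdiff, mem_ofPred_eq, mem_Ioo, mem_Icc, mem_union,
          not_and_or, not_le] at hx ⊢
        tauto
    _ ≤ _ := lintegral_union_le _ _ _
    _ ≤ _ := add_le_add (lintegral_union_le _ _ _) le_rfl
    _ ≤ _ := by
      refine add_le_add (add_le_add (hl _ (measurableSet_slab hΩ.measurableSet measurableSet_Ioo)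
        ?_ ?_ u hu) (hl' _ (measurableSet_slab hΩ.measurableSet measurableSet_Ioo) ?_ ?_ u hu))
          hside
      · rintro x ⟨hx, hx'⟩ t ht
        refine ⟨by simpa using hx, ?_⟩
        simp
        constructor <;> linarith [hx'.1, hx'.2, ht.1, ht.2]
      · intro y
        refine (measure_mono (t := Ioo (axial y - α - σ) (axial y - α)) ?_).trans ?_
        · rintro t ⟨-, -, h1, h2⟩
          simp only [sub_eq_add_neg, ← neg_smul, axial_add, axial_smul, axial_axis, mul_one] at h1 h2
          constructor <;> linarith
        · rw [volume_Ioo]; exact ofReal_le_ofReal (by linarith)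
      · rintro x ⟨hx, hx'⟩ t ht
        rw [smul_neg, ← neg_smul]
        refine ⟨by rwa [cross_add, cross_smul, cross_axis, smul_zero, add_zero], ?_⟩
        simp only [axial_add, axial_smul, axial_axis, mul_one, mem_Ioo]
        constructor <;> linarith [hx'.1, hx'.2, ht.1, ht.2]
      · intro y
        refine (measure_mono (t := Ioo (β - axial y - σ') (β - axial y)) ?_).trans ?_
        · rintro t ⟨-, -, h1, h2⟩
          rw [smul_neg, sub_neg_eq_add] at h1 h2
          simp at h1 h2
          constructor <;> linarith
        · rw [volume_Ioo]; exact ofReal_le_ofReal (by linarith)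
    _ = _ := by
        rw [← add_mul, ← add_mul, ← ofReal_add (by positivity) (by positivity),
          ← ofReal_add (by positivity) (by positivity)]
        congr 2
        ring

end Point

section Similarity

variable {n : ℕ}

/-- The similarity `x ↦ c + t R x`. -/
def sim (c : Eucl n) (t : ℝ) (R : Eucl n ≃ₗᵢ[ℝ] Eucl n) (x : Eucl n) : Eucl n := c + t • R x

variable (c : Eucl n) {t : ℝ} (R : Eucl n ≃ₗᵢ[ℝ] Eucl n)

theorem measEmb_sim (ht : t ≠ 0) : MeasurableEmbedding (sim c t R) := (R.toHomeomorph.trans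
    ((Homeomorph.smulOfNeZero t ht).trans (Homeomorph.addLeft c))).measurableEmbedding

theorem contDiff_sim {m : WithTop ℕ∞} : ContDiff ℝ m (sim c t R) :=
  contDiff_const.add (R.toContinuousLinearEquiv.contDiff.const_smul t)

theorem isOpen_image_sim (ht : t ≠ 0) {A : Set (Eucl n)} (hA : IsOpen A) :
    IsOpen (sim c t R '' A) :=
  (R.toHomeomorph.trans
    ((Homeomorph.smulOfNeZero t ht).trans (Homeomorph.addLeft c))).isOpenMap A hA

theorem map_sim (ht : 0 < t) (A : Set (Eucl n)) : (volume.restrict A).map (sim c t R) =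
      ofReal ((t ^ n)⁻¹) • volume.restrict (sim c t R '' A) := by
  have hemb := measEmb_sim c R ht.ne'
  have hmap : volume.map (sim c t R) = ofReal ((t ^ n)⁻¹) • volume := by
    have h1 : sim c t R = (fun y => c + y) ∘ (fun y => t • y) ∘ R := rfl
    rw [h1, ← Measure.map_map (by fun_prop) (by fun_prop), ← Measure.map_map (by fun_prop)
      R.continuous.measurable, R.measurePreserving.map_eq, Measure.map_addHaar_smul _ ht.ne',
      Measure.map_smul, map_add_left_eq_self, finrank_euclideanSpace_fin,
      abs_of_pos (by positivity)]
  have h := hemb.restrict_map volume (sim c t R '' A)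
  rw [preimage_image_eq _ hemb.injective, hmap, Measure.restrict_smul] at h
  exact h.symm

theorem lintegral_image_sim (ht : 0 < t) (A : Set (Eucl n)) (F : Eucl n → ENNReal) :
    ∫⁻ x in sim c t R '' A, F x = ofReal (t ^ n) * ∫⁻ x in A, F (sim c t R x) := by
  rw [← (measEmb_sim c R ht.ne').lintegral_map, map_sim c R ht,
    lintegral_smul_measure, smul_eq_mul, ← mul_assoc, ← ofReal_mul (by positivity),
    mul_inv_cancel₀ (by positivity), ofReal_one, one_mul]

theorem volume_image_sim (ht : 0 < t) (A : Set (Eucl n)) :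
    volume (sim c t R '' A) = ofReal (t ^ n) * volume A := by
  have := lintegral_image_sim c R ht A fun _ => 1
  simpa using this

theorem average_image_sim (ht : 0 < t) (A : Set (Eucl n)) (u : Eucl n → ℂ) :
    ⨍ x in sim c t R '' A, u x = ⨍ x in A, u (sim c t R x) := by
  have h1 := (measEmb_sim c R ht.ne').integral_map (μ := volume.restrict A) u
  rw [map_sim c R ht, integral_smul_measure, toReal_ofReal (by positivity)] at h1
  rw [average_eq, average_eq, ← h1, Measure.real, Measure.real, restrict_apply_univ,
    restrict_apply_univ, volume_image_sim c R ht, toReal_mul,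
    toReal_ofReal (by positivity), smul_smul, mul_inv, mul_comm (t ^ n)⁻¹]

theorem memLp_comp_sim (ht : 0 < t) {A : Set (Eucl n)} {u : Eucl n → ℂ}
    (hu : MemLp u 2 (volume.restrict (sim c t R '' A))) :
    MemLp (fun x => u (sim c t R x)) 2 (volume.restrict A) := by
  refine ((measEmb_sim c R ht.ne').memLp_map_measure_iff).1 ?_
  rw [map_sim c R ht]
  exact hu.smul_measure ofReal_ne_top

theorem enorm_fderiv_comp_sim (ht : 0 < t) {u : Eucl n → ℂ} {x : Eucl n}
    (hu : DifferentiableAt ℝ u (sim c t R x)) :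
    ‖∇ (fun x => u (sim c t R x)) x‖ₑ = ofReal t * ‖∇ u (sim c t R x)‖ₑ := by
  have h1 : HasFDerivAt (sim c t R) (t • (R.toContinuousLinearEquiv : Eucl n →L[ℝ] Eucl n)) x :=
    ((R.toContinuousLinearEquiv.hasFDerivAt).const_smul t).const_add c
  rw [HasFDerivAt.fderiv (f := fun x => u (sim c t R x)) (hu.hasFDerivAt.comp x h1),
    ContinuousLinearMap.comp_smul, enorm_smul, Real.enorm_of_nonneg ht.le]
  congr 1
  rw [← ofReal_norm, ← ofReal_norm]
  congr 1
  exact ContinuousLinearMap.opNorm_comp_linearIsometryEquiv _ R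

theorem lintegral_fderiv_comp_sim (ht : 0 < t) {A : Set (Eucl n)}
    (hA : MeasurableSet A) {u : Eucl n → ℂ}
    (hu : ∀ x ∈ sim c t R '' A, DifferentiableAt ℝ u x) :
    ofReal (t ^ n) * ∫⁻ x in A, ‖∇ (fun x => u (sim c t R x)) x‖² =
      ofReal (t ^ 2) * ∫⁻ x in sim c t R '' A, ‖∇ u x‖² := by
  rw [lintegral_image_sim c R ht, mul_left_comm]
  congr 1
  rw [← lintegral_const_mul' _ _ ofReal_ne_top]
  refine setLIntegral_congr_fun hA fun x hx => ?_
  rw [enorm_fderiv_comp_sim c R ht (hu _ (mem_image_of_mem _ hx)), mul_pow, ofReal_pow ht.le]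

theorem HasPoincare.image_sim (ht : 0 < t) {A : Set (Eucl n)} (hA : IsOpen A) {C : ENNReal}
    (h : HasPoincare volume A C) :
    HasPoincare volume (sim c t R '' A) (ofReal (t ^ 2) * C) := fun u hu huL => by
  rw [lintegral_image_sim c R ht, average_image_sim c R ht, mul_right_comm,
    ← lintegral_fderiv_comp_sim c R ht hA.measurableSet
      (fun x hx => (hu.differentiableOn one_ne_zero).differentiableAt
        ((isOpen_image_sim c R ht.ne' hA).mem_nhds hx)), mul_assoc, mul_comm _ C]
  exact mul_le_mul_right (h _ (hu.comp (contDiff_sim c R).contDiffOn (mapsTo_image _ _))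
    (memLp_comp_sim c R ht huL)) _

theorem HasCompactCore.image_sim (ht : 0 < t) {A : Set (Eucl n)} (hA : IsOpen A)
    (h : HasCompactCore volume A) : HasCompactCore volume (sim c t R '' A) := fun η hη => by
  obtain ⟨K, hK, hKA, hKu⟩ := h (η / (1 + t ^ 2)) (by positivity)
  refine ⟨sim c t R '' K, hK.image (contDiff_sim c R (m := 0)).continuous,
    image_mono hKA, fun u hu => ?_⟩
  rw [← image_sdiff (measEmb_sim c R ht.ne').injective, lintegral_image_sim c R ht]
  refine (mul_le_mul_right (hKu _ (hu.comp (contDiff_sim c R).contDiffOn (mapsTo_image _ _)))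
    _).trans ?_
  simp only [Function.comp_def]
  rw [mul_left_comm, mul_add, ← lintegral_image_sim c R ht A fun x => ‖u x‖²,
    lintegral_fderiv_comp_sim c R ht hA.measurableSet
      (fun x hx => (hu.differentiableOn one_ne_zero).differentiableAt
        ((isOpen_image_sim c R ht.ne' hA).mem_nhds hx))]
  set X := ∫⁻ x in sim c t R '' A, ‖u x‖²
  set D := ∫⁻ x in sim c t R '' A, ‖∇ u x‖²
  have h2 : 1 ≤ ofReal (1 + t ^ 2) := by
    rw [← ofReal_one]; exact ofReal_le_ofReal (by linarith [sq_nonneg t])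
  calc _ ≤ ofReal (η / (1 + t ^ 2)) * (ofReal (1 + t ^ 2) * X + ofReal (1 + t ^ 2) * D) := by
        gcongr
        · exact le_mul_of_one_le_left' h2
        · linarith
    _ = _ := by
        rw [← mul_add, ← mul_assoc, ← ofReal_mul (by positivity), div_mul_cancel₀ _ (by positivity)]

theorem smul_eq_image_sim (t : ℝ) (A : Set (Eucl n)) :
    t • A = sim 0 t (LinearIsometryEquiv.refl ℝ _) '' A := by ext x; simp [sim, mem_smul_set]

end Similarity

section Trace

variable {d : ℕ}

theorem slab_eq_image_sim (A : Set (Eucl d)) (L a : ℝ) {t : ℝ} (ht : 0 < t) :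
    slab (t • A) (Ioo a (a + t * L)) =
      sim (point 0 a) t (LinearIsometryEquiv.refl ℝ _) '' slab A (Ioo 0 L) := by
  ext x
  constructor
  · rintro ⟨⟨y, hy, hyx⟩, h1, h2⟩
    refine ⟨point y ((axial x - a) / t), ⟨by simpa using hy, ?_⟩, ?_⟩
    · rw [axial_point]
      exact ⟨div_pos (by linarith) ht, by rw [div_lt_iff₀ ht]; linarith⟩
    · refine point_ext ?_ ?_
      · simpa [sim] using hyx
      · simp [sim]; field_simp; ring
  · rintro ⟨z, ⟨hz, h1, h2⟩, rfl⟩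
    refine ⟨⟨cross z, hz, by simp [sim]⟩, ?_⟩
    simp only [sim, LinearIsometryEquiv.coe_refl, id, axial_add, axial_point, axial_smul, mem_Ioo]
    constructor <;> nlinarith

theorem lintegral_enorm_sub_trace_sq_le {B : Set (Eucl d)} (hB : IsOpen B) {r : ℝ}
    {v : Eucl (d + 1) → ℂ} (hv : ContDiffOn ℝ 1 v (slab B (Ioo 0 r)))
    (hc : ContinuousOn v (slab B (Ico 0 r))) :
    ∫⁻ x in slab B (Ioo 0 r), ‖v x - v (point (cross x) 0)‖² ≤
      ofReal (r ^ 2) * ∫⁻ x in slab B (Ioo 0 r), ‖∇ v x‖² := by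
  rcases le_or_gt r 0 with hr | hr
  · have : slab B (Ioo 0 r) = ∅ := by rw [Ioo_eq_empty hr.not_gt]; ext x; simp [slab]
    simp [this]
  have hD := isOpen_slab hB (isOpen_Ioo (a := 0) (b := r))
  have hm1 : AEMeasurable (fun x => ‖v x - v (point (cross x) 0)‖²)
      (volume.restrict (slab B (Ioo 0 r))) := by
    refine ((ContinuousOn.sub (hc.mono (slab_mono Subset.rfl Ioo_subset_Ico_self)) ?_
      ).aestronglyMeasurable hD.measurableSet).enorm.pow_const 2
    refine hc.comp (continuous_point.comp (continuous_cross.prodMk continuous_const)).continuousOn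
      ?_
    intro x hx
    exact ⟨by simpa using hx.1, by simpa using hr⟩
  have hm2 : AEMeasurable (fun x => ‖∇ v x‖²) (volume.restrict (slab B (Ioo 0 r))) :=
    ((measurable_fderiv ℝ v).enorm.pow_const 2).aemeasurable
  have hm3 := ((measurable_fderiv ℝ v).comp
      (continuous_point.measurable.comp measurable_swap)).enorm.pow_const 2
  rw [lintegral_slab hm1, lintegral_slab hm2]
  simp
  calc _ ≤ ∫⁻ θ in Ioo 0 r, ∫⁻ y in B, ofReal r * ∫⁻ σ in Ioo 0 r, ‖∇ v (point y σ)‖² := by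
        refine setLIntegral_mono' measurableSet_Ioo fun θ hθ =>
          setLIntegral_mono' hB.measurableSet fun y hy => ?_
        have h1 := enorm_sub_sq_le_line (u := v) (x := crossIncl d y) (v := axis d) hθ.1.le ?_ ?_
        · rw [zero_smul, add_zero, sub_zero, ← point_eq_add, crossIncl_apply] at h1
          refine h1.trans ?_
          have h2 : ‖axis d‖ₑ = 1 := by rw [← ofReal_norm, norm_axis, ofReal_one]
          rw [h2, one_pow, one_mul]
          simp_rw [← crossIncl_apply, ← point_eq_add]
          gcongr
          · exact hθ.2.le
          · exact hθ.2.le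
        · refine hc.mono ?_
          rintro _ ⟨s, hs, rfl⟩
          simp only [← point_eq_add]
          exact ⟨by simpa using hy, by rw [axial_point]; exact ⟨hs.1, hs.2.trans_lt hθ.2⟩⟩
        · intro s hs
          rw [← point_eq_add]
          exact (hv.differentiableOn one_ne_zero).differentiableAt (hD.mem_nhds
            ⟨by simpa using hy, by rw [axial_point]; exact ⟨hs.1, hs.2.trans hθ.2⟩⟩)
    _ = ofReal r * (ofReal r * ∫⁻ y in B, ∫⁻ σ in Ioo 0 r, ‖∇ v (point y σ)‖²) := by
        rw [lintegral_const, restrict_apply_univ, volume_Ioo, sub_zero,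
          lintegral_const_mul' _ _ ofReal_ne_top, mul_comm]
    _ = _ := by
        rw [lintegral_lintegral_swap (f := fun y σ => ‖∇ v (point y σ)‖²)
          (hm3.comp measurable_swap).aemeasurable, ← mul_assoc, ← ofReal_mul hr.le, sq]

theorem volume_mul_average_sub_le {α : Type*} [MeasurableSpace α] {μ : Measure α}
    {Q : Set α} (hQ : μ Q ≠ ∞) {u : α → ℂ} (hu : IntegrableOn u Q μ) (c : ℂ) :
    μ Q * ‖(⨍ y in Q, u y ∂μ) - c‖² ≤ ∫⁻ y in Q, ‖u y - c‖² ∂μ := by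
  rcases eq_or_ne (μ Q) 0 with h0 | h0
  · simp [h0]
  have := isFiniteMeasure_restrict.2 hQ
  have : NeZero (μ.restrict Q) := ⟨fun h => h0 (Measure.restrict_eq_zero.1 h)⟩
  have h := enorm_average_sub_sq_le hu c
  rw [restrict_apply_univ] at h
  refine (mul_le_mul_right h _).trans_eq ?_
  rw [← mul_assoc, ENNReal.mul_inv_cancel h0 hQ, one_mul]

theorem HasPoincare.volume_mul_average_sub_le {n : ℕ} {U Q : Set (Eucl n)} {C : ENNReal}
    (h : HasPoincare volume U C) (hQU : Q ⊆ U) (hQ : volume Q ≠ ∞) {u : Eucl n → ℂ}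
    (hu : ContDiffOn ℝ 1 u U) (huL : MemLp u 2 (volume.restrict U)) :
    volume Q * ‖(⨍ y in Q, u y) - ⨍ y in U, u y‖² ≤ C * ∫⁻ x in U, ‖∇ u x‖² := by
  have := isFiniteMeasure_restrict.2 hQ
  refine (InflatedTree.volume_mul_average_sub_le hQ ((huL.mono_measure
    (restrict_mono hQU le_rfl)).integrable (by norm_num)) _).trans ?_
  exact (lintegral_mono_set hQU).trans (h u hu huL)

theorem volume_mul_enorm_average_sub_average_le {B : Set (Eucl d)} (hB : IsOpen B)
    (hBb : Bornology.IsBounded B) {r : ℝ} {t : ℝ} (ht : 0 < t) {c₁ c₂ : Eucl (d + 1)}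
    {R₁ R₂ : Eucl (d + 1) ≃ₗᵢ[ℝ] Eucl (d + 1)} {u₁ u₂ : Eucl (d + 1) → ℂ}
    (h₁ : ContDiffOn ℝ 1 u₁ (sim c₁ t R₁ '' slab B (Ioo 0 r)))
    (h₁c : ContinuousOn u₁ (sim c₁ t R₁ '' slab B (Ico 0 r)))
    (h₁L : MemLp u₁ 2 (volume.restrict (sim c₁ t R₁ '' slab B (Ioo 0 r))))
    (h₂ : ContDiffOn ℝ 1 u₂ (sim c₂ t R₂ '' slab B (Ioo 0 r)))
    (h₂c : ContinuousOn u₂ (sim c₂ t R₂ '' slab B (Ico 0 r)))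
    (h₂L : MemLp u₂ 2 (volume.restrict (sim c₂ t R₂ '' slab B (Ioo 0 r))))
    (heq : ∀ y ∈ B, u₁ (sim c₁ t R₁ (point y 0)) = u₂ (sim c₂ t R₂ (point y 0))) :
    ofReal (t ^ (d + 1)) * volume (slab B (Ioo 0 r)) *
      ‖(⨍ x in sim c₁ t R₁ '' slab B (Ioo 0 r), u₁ x) -
        ⨍ x in sim c₂ t R₂ '' slab B (Ioo 0 r), u₂ x‖² ≤
      ofReal (2 * r ^ 2 * t ^ 2) * ((∫⁻ x in sim c₁ t R₁ '' slab B (Ioo 0 r), ‖∇ u₁ x‖²) +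
          ∫⁻ x in sim c₂ t R₂ '' slab B (Ioo 0 r), ‖∇ u₂ x‖²) := by
  set D := slab B (Ioo 0 r)
  have hDo : IsOpen D := isOpen_slab hB isOpen_Ioo
  have hDfin : volume D ≠ ∞ := (isBounded_slab hBb (Metric.isBounded_Ioo 0 r)).measure_lt_top.ne
  have := isFiniteMeasure_restrict.2 hDfin
  rw [average_image_sim c₁ R₁ ht, average_image_sim c₂ R₂ ht]
  set v₁ := fun x => u₁ (sim c₁ t R₁ x)
  set v₂ := fun x => u₂ (sim c₂ t R₂ x)
  have hv₁L : MemLp v₁ 2 (volume.restrict D) := memLp_comp_sim c₁ R₁ ht h₁L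
  have hv₂L : MemLp v₂ 2 (volume.restrict D) := memLp_comp_sim c₂ R₂ ht h₂L
  have hv₁ := lintegral_enorm_sub_trace_sq_le hB (v := v₁)
    (h₁.comp (contDiff_sim c₁ R₁).contDiffOn (mapsTo_image _ _))
    (h₁c.comp (contDiff_sim c₁ R₁ (m := 0)).continuous.continuousOn (mapsTo_image _ _))
  have hv₂ := lintegral_enorm_sub_trace_sq_le hB (v := v₂)
    (h₂.comp (contDiff_sim c₂ R₂).contDiffOn (mapsTo_image _ _))
    (h₂c.comp (contDiff_sim c₂ R₂ (m := 0)).continuous.continuousOn (mapsTo_image _ _))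
  have hdiff : (⨍ x in D, v₁ x) - ⨍ x in D, v₂ x = (⨍ x in D, (v₁ x - v₂ x)) - 0 := by
    rw [average_eq, average_eq, average_eq, integral_sub (hv₁L.integrable (by norm_num))
      (hv₂L.integrable (by norm_num)), smul_sub, sub_zero]
  have h3 : volume D * ‖(⨍ x in D, v₁ x) - ⨍ x in D, v₂ x‖² ≤ ∫⁻ x in D, ‖v₁ x - v₂ x‖² := by
    rw [hdiff]
    refine (InflatedTree.volume_mul_average_sub_le hDfin
      ((hv₁L.sub hv₂L).integrable (by norm_num)) 0).trans_eq ?_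
    simp
  have hm : AEMeasurable (fun x => 2 * ‖v₁ x - v₁ (point (cross x) 0)‖²) (volume.restrict D) := by
    refine (((hv₁L.1.sub (ContinuousOn.aestronglyMeasurable ?_
      hDo.measurableSet)).enorm.pow_const 2).const_mul 2)
    refine (h₁c.comp (contDiff_sim c₁ R₁ (m := 0)).continuous.continuousOn (mapsTo_image _ _)).comp
      (continuous_point.comp (continuous_cross.prodMk continuous_const)).continuousOn ?_
    intro x hx
    exact ⟨by simpa using hx.1, by simpa using hx.2.1.trans hx.2.2⟩
  have h4 : ∫⁻ x in D, ‖v₁ x - v₂ x‖² ≤ ofReal (2 * r ^ 2) *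
      ((∫⁻ x in D, ‖∇ v₁ x‖²) + ∫⁻ x in D, ‖∇ v₂ x‖²) := by
    calc ∫⁻ x in D, ‖v₁ x - v₂ x‖² ≤ ∫⁻ x in D, (2 * ‖v₁ x - v₁ (point (cross x) 0)‖² +
            2 * ‖v₂ x - v₂ (point (cross x) 0)‖²) := by
          refine setLIntegral_mono' hDo.measurableSet fun x hx => ?_
          have h5 := enorm_sub_sq_le (v₁ x) (v₁ (point (cross x) 0)) (v₂ x)
          rw [show v₁ (point (cross x) 0) = v₂ (point (cross x) 0) from heq _ hx.1] at h5 ⊢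
          rwa [enorm_sub_rev (v₂ (point (cross x) 0))] at h5
      _ = 2 * (∫⁻ x in D, ‖v₁ x - v₁ (point (cross x) 0)‖²) +
            2 * ∫⁻ x in D, ‖v₂ x - v₂ (point (cross x) 0)‖² := by
          rw [lintegral_add_left' hm, lintegral_const_mul' _ _ (by norm_num),
            lintegral_const_mul' _ _ (by norm_num)]
      _ ≤ 2 * (ofReal (r ^ 2) * ∫⁻ x in D, ‖∇ v₁ x‖²) +
            2 * (ofReal (r ^ 2) * ∫⁻ x in D, ‖∇ v₂ x‖²) := by gcongr
      _ = _ := by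
          rw [ofReal_mul (by norm_num), ofReal_ofNat]
          ring
  have hd₁ := lintegral_fderiv_comp_sim c₁ R₁ ht hDo.measurableSet
    (fun x hx => (h₁.differentiableOn one_ne_zero).differentiableAt
        ((isOpen_image_sim c₁ R₁ ht.ne' hDo).mem_nhds hx))
  have hd₂ := lintegral_fderiv_comp_sim c₂ R₂ ht hDo.measurableSet
    (fun x hx => (h₂.differentiableOn one_ne_zero).differentiableAt
        ((isOpen_image_sim c₂ R₂ ht.ne' hDo).mem_nhds hx))
  rw [mul_assoc]
  refine (mul_le_mul_right (h3.trans h4) _).trans_eq ?_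
  rw [mul_left_comm, mul_add, hd₁, hd₂, ← mul_add, ← mul_assoc, ← ofReal_mul (by positivity)]

end Trace

/-- Near a flat piece of the boundary a Lipschitz domain is a half-space. -/
theorem IsLipschitzDomain.exists_halfSpace {m : ℕ} {U : Set (Eucl m)} (hU : IsLipschitzDomain U)
    {p n : Eucl m} {r₀ : ℝ} (hr₀ : 0 < r₀)
    (hflat : ∀ q ∈ ball p r₀, inner ℝ (q - p) n = 0 → q ∈ frontier U) :
    ∃ r > 0, (∀ x ∈ ball p r, x ∈ U ↔ inner ℝ (x - p) n < 0) ∨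
      (∀ x ∈ ball p r, x ∈ U ↔ 0 < inner ℝ (x - p) n) := by
  obtain ⟨e, φ, K, r₁, he, hφ, hinv, hr₁, hgraph⟩ := hU.graph p
    (hflat p (mem_ball_self hr₀) (by simp))
  have hφc := hφ.continuous
  have hon : ∀ q ∈ ball p r₀, q ∈ ball p r₁ → inner ℝ (q - p) n = 0 →
      φ q = inner ℝ e q := fun q hq hq1 hqn => by
    have hqf := hflat q hq hqn
    rw [hU.isOpen.frontier_eq] at hqf
    refine le_antisymm (not_lt.1 fun h => ?_) (not_lt.1 fun h => hqf.2 ((hgraph q hq1).2 h))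
    have hopen : IsOpen (ball p r₁ ∩ {x | inner ℝ e x < φ x}) :=
      Metric.isOpen_ball.inter (isOpen_lt (by fun_prop) (by fun_prop))
    obtain ⟨x, hx, hxU⟩ := mem_closure_iff.1 hqf.1 _ hopen ⟨hq1, h⟩
    exact lt_asymm ((hgraph x hx.1).1 hxU) hx.2
  have hee : inner ℝ e e = 1 := by rw [real_inner_self_eq_norm_sq, he, one_pow]
  set a : ℝ := inner ℝ e n with ha_def
  have ha : a ≠ 0 := fun ha => by
    have hs : 0 < min r₀ r₁ / 2 := by positivity
    have hmem : ∀ ρ, min r₀ r₁ ≤ ρ → p + (min r₀ r₁ / 2) • e ∈ ball p ρ := fun ρ hρ => by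
      rw [mem_ball, dist_eq_norm, add_sub_cancel_left, norm_smul, he, mul_one,
        Real.norm_of_nonneg hs.le]
      linarith
    have h1 := hon _ (hmem r₀ (min_le_left _ _)) (hmem r₁ (min_le_right _ _))
      (by rw [add_sub_cancel_left, real_inner_smul_left, ← ha_def, ha, mul_zero])
    rw [hinv, hon p (mem_ball_self hr₀) (mem_ball_self hr₁) (by simp), inner_add_right, real_inner_smul_right, hee] at h1
    linarith
  have hpos : 0 < 1 + |a|⁻¹ * ‖n‖ := by positivity
  refine ⟨min r₀ r₁ / (1 + |a|⁻¹ * ‖n‖), by positivity, ?_⟩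
  have key : ∀ x ∈ ball p (min r₀ r₁ / (1 + |a|⁻¹ * ‖n‖)),
      x ∈ U ↔ 0 < inner ℝ (x - p) n / a := fun x hx => by
    rw [mem_ball, dist_eq_norm, lt_div_iff₀ hpos] at hx
    set s : ℝ := inner ℝ (x - p) n with hs_def
    have hs : |s / a| ≤ ‖x - p‖ * (|a|⁻¹ * ‖n‖) := by
      rw [abs_div, div_eq_mul_inv]
      calc |s| * |a|⁻¹ ≤ (‖x - p‖ * ‖n‖) * |a|⁻¹ := by gcongr; exact abs_real_inner_le_norm _ _
        _ = _ := by ring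
    have hq : ‖x - (s / a) • e - p‖ < min r₀ r₁ := by
      have h1 : x - (s / a) • e - p = (x - p) - (s / a) • e := by abel
      rw [h1]
      refine (norm_sub_le _ _).trans_lt ?_
      rw [norm_smul, he, mul_one, norm_eq_abs]
      linarith
    have hx1 : x ∈ ball p r₁ := by
      rw [mem_ball, dist_eq_norm]
      have : 0 ≤ ‖x - p‖ * (|a|⁻¹ * ‖n‖) := by positivity
      linarith [min_le_right r₀ r₁]
    have h1 := hon (x - (s / a) • e) (mem_ball_iff_norm.2 (hq.trans_le (min_le_left _ _)))
      (mem_ball_iff_norm.2 (hq.trans_le (min_le_right _ _))) (by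
        have h2 : x - (s / a) • e - p = (x - p) - (s / a) • e := by abel
        rw [h2, inner_sub_left, real_inner_smul_left, ← hs_def, ← ha_def, div_mul_cancel₀ _ ha,
          sub_self])
    rw [sub_eq_add_neg, ← neg_smul, hinv, inner_add_right, real_inner_smul_right, hee] at h1
    rw [hgraph x hx1, h1]
    constructor <;> intro h <;> linarith
  rcases lt_or_gt_of_ne ha with ha | ha
  · left
    intro x hx
    rw [key x hx, div_pos_iff]
    exact ⟨fun h => h.elim (fun h => absurd h.2 ha.not_gt) And.left, fun h => Or.inr ⟨h, ha⟩⟩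
  · right
    intro x hx
    rw [key x hx, div_pos_iff_of_pos_right ha]

namespace Data

variable {d k : ℕ} (T : Data d k)

/-- The unscaled sections as subsets of the hyperplane. -/
def secSet (j : Option (Fin k)) : Set (Eucl d) := j.elim T.Ω fun _ => T.δ • T.Ω

theorem isOpen_Ω : IsOpen T.Ω := T.Ω_lipschitz.isOpen

theorem isOpen_V : IsOpen T.V := T.V_lipschitz.isOpen

theorem isOpen_secSet (j : Option (Fin k)) : IsOpen (T.secSet j) := by
  cases j with
  | none => exact T.isOpen_Ω
  | some j => exact T.isOpen_Ω.smul₀ T.δ_pos.ne'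

theorem zero_mem_secSet (j : Option (Fin k)) : (0 : Eucl d) ∈ T.secSet j := by
  cases j with
  | none => exact T.zero_mem_Ω
  | some j => exact ⟨0, T.zero_mem_Ω, smul_zero _⟩

theorem sec_mem_frontier {j : Option (Fin k)} {y : Eucl d} (hy : y ∈ T.secSet j) :
    T.sec j y ∈ frontier T.V := T.sec_frontier j (mem_image_of_mem _ hy)

theorem sec_zero_ne (j : Option (Fin k)) : T.sec j 0 ≠ 0 := by
  intro h
  have h1 := T.sec_mem_frontier (T.zero_mem_secSet j)
  rw [h, T.isOpen_V.frontier_eq] at h1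
  exact h1.2 T.zero_mem_V

theorem norm_normal (j : Option (Fin k)) : ‖T.normal j‖ = 1 := by
  rw [normal, norm_smul, norm_inv, norm_norm, inv_mul_cancel₀
    (norm_pos_iff.2 (T.sec_zero_ne j)).ne']

theorem sec_apply (j : Option (Fin k)) (y : Eucl d) :
    T.sec j y = T.sec j 0 + (T.sec j).linearIsometry y := by
  have h := (T.sec j).map_vadd 0 y
  simp at h
  exact h.trans (add_comm _ _)

theorem inner_normal_linear (j : Option (Fin k)) (y : Eucl d) :
    inner ℝ (T.normal j) ((T.sec j).linearIsometry y) = 0 := by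
  have h := T.sec_perp j y
  rw [T.sec_apply j y, add_sub_cancel_left] at h
  rw [normal, real_inner_smul_left, h, mul_zero]

/-- The frame at a section: the hyperplane of the section and the inner normal. -/
def frame (j : Option (Fin k)) : Eucl (d + 1) ≃ₗᵢ[ℝ] Eucl (d + 1) :=
  LinearIsometry.toLinearIsometryEquiv
    { toFun := fun x => (T.sec j).linearIsometry (cross x) - axial x • T.normal j
      map_add' := fun x y => by rw [cross_add, axial_add, map_add, add_smul]; abel
      map_smul' := fun c x => by
        rw [cross_smul, axial_smul, map_smul, mul_smul, ← smul_sub, RingHom.id_apply]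
      norm_map' := fun x => by
        refine (pow_left_inj₀ (norm_nonneg _) (norm_nonneg _) two_ne_zero).1 ?_
        simp only [LinearMap.coe_mk, AddHom.coe_mk]
        rw [@norm_sub_sq_real, inner_smul_right, real_inner_comm, T.inner_normal_linear, norm_smul,
          T.norm_normal, (T.sec j).linearIsometry.norm_map, ← point_cross_axial x, norm_sq_point]
        simp } rfl

theorem frame_apply (j : Option (Fin k)) (x : Eucl (d + 1)) :
    T.frame j x = (T.sec j).linearIsometry (cross x) - axial x • T.normal j := rfl

theorem inner_frame_normal (j : Option (Fin k)) (x : Eucl (d + 1)) :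
    inner ℝ (T.frame j x) (T.normal j) = -axial x := by
  rw [frame_apply, inner_sub_left, real_inner_comm, T.inner_normal_linear, real_inner_smul_left,
    real_inner_self_eq_norm_sq, T.norm_normal]
  ring

theorem sim_frame_point (j : Option (Fin k)) (t : ℝ) (y : Eucl d) (s : ℝ) :
    sim (t • T.sec j 0) t (T.frame j) (point y s) = t • (T.sec j y - s • T.normal j) := by
  rw [sim, frame_apply, cross_point, axial_point, T.sec_apply j y, ← smul_add]
  congr 1
  abel

theorem sec_flat {j : Option (Fin k)} {y : Eucl d} (hy : y ∈ T.secSet j) :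
    ∃ r > 0, ∀ q ∈ ball (T.sec j y) r, inner ℝ (q - T.sec j y) (T.normal j) = 0 →
      q ∈ frontier T.V := by
  obtain ⟨r, hr, hrΩ⟩ := Metric.isOpen_iff.1 (T.isOpen_secSet j) y hy
  refine ⟨r, hr, fun q hq hqn => ?_⟩
  obtain ⟨x, hx⟩ := (T.frame j).surjective (q - T.sec j y)
  rw [← hx, T.inner_frame_normal, neg_eq_zero] at hqn
  rw [mem_ball, dist_eq_norm, ← hx, (T.frame j).norm_map] at hq
  have h1 : ‖cross x‖ = ‖x‖ := by
    refine (pow_left_inj₀ (norm_nonneg _) (norm_nonneg _) two_ne_zero).1 ?_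
    conv_rhs => rw [← point_cross_axial x, norm_sq_point, hqn]
    simp
  have h2 : q = T.sec j (y + cross x) := by
    rw [T.sec_apply, map_add, ← add_assoc, ← T.sec_apply, ← sub_eq_iff_eq_add', ← hx, frame_apply,
      hqn, zero_smul, sub_zero]
  rw [h2]
  refine T.sec_mem_frontier (hrΩ ?_)
  rw [mem_ball, dist_eq_norm, add_sub_cancel_left, h1]
  exact hq

theorem exists_halfSpace {j : Option (Fin k)} {y : Eucl d} (hy : y ∈ T.secSet j) :
    ∃ r > 0, (∀ x ∈ ball (T.sec j y) r, x ∈ T.V ↔ inner ℝ (x - T.sec j y) (T.normal j) < 0) ∨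
      (∀ x ∈ ball (T.sec j y) r, x ∈ T.V ↔ 0 < inner ℝ (x - T.sec j y) (T.normal j)) := by
  obtain ⟨r, hr, h⟩ := T.sec_flat hy
  exact T.V_lipschitz.exists_halfSpace hr h

theorem exists_cylinder (j : Option (Fin k)) {L : ℝ} (hL : 0 < L) :
    ∃ r > 0, r ≤ L ∧ ball 0 r ⊆ T.secSet j ∧
      ∀ y ∈ ball (0 : Eucl d) r, ∀ s ∈ Ioo 0 r, T.sec j y - s • T.normal j ∈ T.V := by
  obtain ⟨r₁, hr₁, hrΩ⟩ := Metric.isOpen_iff.1 (T.isOpen_secSet j) 0 (T.zero_mem_secSet j)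
  obtain ⟨r, hr, h⟩ := T.exists_halfSpace (T.zero_mem_secSet j)
  have hneg : ∀ x ∈ ball (T.sec j 0) r, x ∈ T.V ↔ inner ℝ (x - T.sec j 0) (T.normal j) < 0 := by
    refine h.resolve_right fun h => ?_
    have hn := norm_pos_iff.2 (T.sec_zero_ne j)
    set τ := min 1 (r / (2 * ‖T.sec j 0‖))
    have hτ : 0 < τ := by positivity
    have hτ1 : τ ≤ 1 := min_le_left _ _
    have h1 := T.sec_skeleton j (1 - τ) ⟨by linarith, by linarith⟩
    have h2 : (1 - τ) • T.sec j 0 - T.sec j 0 = (-τ) • T.sec j 0 := by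
      rw [sub_smul, one_smul, sub_sub_cancel_left, neg_smul]
    rw [h, h2, normal, real_inner_smul_left, real_inner_smul_right, real_inner_self_eq_norm_sq] at h1
    · have : 0 < τ * (‖T.sec j 0‖⁻¹ * ‖T.sec j 0‖ ^ 2) := by positivity
      linarith
    · rw [mem_ball, dist_eq_norm, h2, norm_smul, norm_neg, Real.norm_of_nonneg hτ.le]
      calc τ * ‖T.sec j 0‖ ≤ r / (2 * ‖T.sec j 0‖) * ‖T.sec j 0‖ := by
            gcongr; exact min_le_right _ _
        _ = r / 2 := by field_simp
        _ < r := by linarith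
  refine ⟨min (min r₁ L) (r / 2), by positivity, (min_le_left _ _).trans (min_le_right _ _),
    (ball_subset_ball ((min_le_left _ _).trans (min_le_left _ _))).trans hrΩ,
    fun y hy s hs => ?_⟩
  have h1 : T.sec j y - s • T.normal j - T.sec j 0 = T.frame j (point y s) := by
    rw [frame_apply, cross_point, axial_point, T.sec_apply j y]; abel
  rw [mem_ball_zero_iff] at hy
  have hy' := hy.trans_le (min_le_right _ _)
  have hs' := hs.2.trans_le (min_le_right _ _)
  rw [hneg, h1, T.inner_frame_normal, axial_point]
  · linarith [hs.1]
  · rw [mem_ball, dist_eq_norm, h1, (T.frame j).norm_map]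
    refine (pow_lt_pow_iff_left₀ (norm_nonneg _) hr.le two_ne_zero).1 ?_
    rw [norm_sq_point]
    nlinarith [norm_nonneg y, hs.1]

theorem region_edge (ε : ℝ) (w : Edge k) : E(T, ε, w) = slab (T.scale ε w • T.Ω) (J(T, ε, w)) := rfl

theorem region_vertex (ε : ℝ) (w : Edge k) : V(T, ε, w) = T.scale ε w • T.V := rfl

theorem scale_pos {ε : ℝ} (hε : 0 < ε) (w : Edge k) : 0 < T.scale ε w :=
  mul_pos hε (pow_pos T.δ_pos _)

theorem scale_cons (ε : ℝ) (j : Fin k) (w : Edge k) : T.scale ε (j :: w) = T.scale ε w * T.δ := by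
  rw [scale, scale, List.length_cons, pow_succ, mul_assoc]

theorem isOpen_region {ε : ℝ} (hε : 0 < ε) (i : Piece k) : IsOpen (T.region ε i) := by
  cases i with
  | edge w => exact isOpen_slab (T.isOpen_Ω.smul₀ (T.scale_pos hε w).ne') isOpen_Ioo
  | vertex w => exact T.isOpen_V.smul₀ (T.scale_pos hε w).ne'

theorem isBounded_region (ε : ℝ) (i : Piece k) : Bornology.IsBounded (T.region ε i) := by
  cases i with
  | edge w => exact isBounded_slab (T.Ω_lipschitz.isBounded.smul₀ _) (Metric.isBounded_Ioo _ _)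
  | vertex w => exact T.V_lipschitz.isBounded.smul₀ _

theorem region_subset (ε : ℝ) (i : Piece k) : T.region ε i ⊆ T.closedRegion ε i := by
  cases i with
  | edge w => exact slab_mono Subset.rfl Ioo_subset_Icc_self
  | vertex w => exact smul_set_mono subset_union_left

theorem uniqueDiffOn_closedRegion {ε : ℝ} (hε : 0 < ε) (hfit : ∀ w, T.start ε w < T.finish ε w)
    (i : Piece k) : UniqueDiffOn ℝ (T.closedRegion ε i) := by
  cases i with
  | edge w =>
    intro x hx
    obtain ⟨r, hr, hrΩ⟩ := Metric.isOpen_iff.1 (T.isOpen_Ω.smul₀ (T.scale_pos hε w).ne') _ hx.1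
    have h1 : slab (ball (cross x) r) (Icc (T.start ε w) (T.finish ε w)) ⊆
      T.closedRegion ε (.edge w) := slab_mono hrΩ Subset.rfl
    refine (uniqueDiffWithinAt_convex ?_ ?_ ?_).mono h1
    · intro y hy z hz a b ha hb hab
      refine ⟨?_, ?_⟩
      · rw [cross_add, cross_smul, cross_smul]
        exact convex_ball _ _ hy.1 hz.1 ha hb hab
      · rw [axial_add, axial_smul, axial_smul]
        exact convex_Icc _ _ hy.2 hz.2 ha hb hab
    · refine Set.Nonempty.mono (interior_maximal (slab_mono Subset.rfl Ioo_subset_Icc_self)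
        (isOpen_slab Metric.isOpen_ball isOpen_Ioo)) ?_
      obtain ⟨θ, hθ⟩ := nonempty_Ioo.2 (hfit w)
      exact ⟨point (cross x) θ, by simpa using hr, by simpa using hθ⟩
    · exact subset_closure ⟨mem_ball_self hr, hx.2⟩
  | vertex w =>
    have ht := T.scale_pos hε w
    rintro _ ⟨x, hx, rfl⟩
    rcases hx with hx | hx
    · exact ((T.isOpen_V.smul₀ ht.ne').uniqueDiffWithinAt (smul_mem_smul_set hx)).mono
        (smul_set_mono subset_union_left)
    · obtain ⟨j, y, hy, rfl⟩ := mem_iUnion.1 hx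
      obtain ⟨r, hr, h⟩ := T.exists_halfSpace hy
      obtain ⟨s, hs, hH⟩ : ∃ s, s ≠ 0 ∧ ∀ x ∈ ball (T.sec j y) r,
          0 < s * inner ℝ (x - T.sec j y) (T.normal j) → x ∈ T.V := by
        rcases h with h | h
        · exact ⟨-1, by norm_num, fun x hx hx' => (h x hx).2 (by linarith)⟩
        · exact ⟨1, by norm_num, fun x hx hx' => (h x hx).2 (by linarith)⟩
      set p := T.sec j y
      let H : Set (Eucl (d + 1)) := ball p r ∩ {x | 0 < s * inner ℝ (x - p) (T.normal j)}
      have hHo : IsOpen H := Metric.isOpen_ball.inter (isOpen_lt (by fun_prop) (by fun_prop))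
      have hHc : Convex ℝ H := by
        refine (convex_ball p r).inter fun x hx z hz a b ha hb hab => ?_
        have h1 : a • x + b • z - p = a • (x - p) + b • (z - p) := by
          rw [smul_sub, smul_sub, sub_add_sub_comm, ← add_smul, hab, one_smul]
        simp at hx hz ⊢
        rw [h1, inner_add_left, real_inner_smul_left, real_inner_smul_left]
        rcases ha.eq_or_lt with h | h
        · subst h; rw [zero_add] at hab; subst hab; linarith
        · nlinarith
      have hpath : ∀ τ ∈ Ioo 0 (r / |s|), p + (τ * s) • T.normal j ∈ H := fun τ hτ => by
        refine ⟨?_, ?_⟩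
        · rw [mem_ball, dist_eq_norm, add_sub_cancel_left, norm_smul, T.norm_normal, mul_one,
            norm_eq_abs, abs_mul, abs_of_pos hτ.1]
          exact (lt_div_iff₀ (abs_pos.2 hs)).1 hτ.2
        · simp only [mem_ofPred_eq]
          rw [add_sub_cancel_left, real_inner_smul_left, real_inner_self_eq_norm_sq, T.norm_normal]
          have := sq_pos_of_ne_zero hs
          nlinarith [mul_pos hτ.1 this]
      have hrs := div_pos hr (abs_pos.2 hs)
      have hcl : p ∈ closure H := by
        have hlim : Tendsto (fun τ => p + (τ * s) • T.normal j) (𝓝[>] 0) (𝓝 p) := by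
          have hc : Continuous (fun τ => p + (τ * s) • T.normal j) := by fun_prop
          have := (hc.tendsto 0).mono_left (nhdsWithin_le_nhds (s := Ioi 0))
          simpa using this
        exact mem_closure_of_tendsto hlim (eventually_of_mem (Ioo_mem_nhdsGT hrs) hpath)
      have hsub : T.scale ε w • H ⊆ T.closedRegion ε (.vertex w) :=
        smul_set_mono fun x hx => Or.inl (hH x hx.1 hx.2)
      refine (uniqueDiffWithinAt_convex (hHc.smul _) ?_ ?_).mono hsub
      · rw [(hHo.smul₀ ht.ne').interior_eq]
        exact Set.Nonempty.smul_set ⟨_, hpath (r / |s| / 2) ⟨by linarith, by linarith⟩⟩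
      · exact image_closure_subset_closure_image (continuous_const_smul _) ⟨p, hcl, rfl⟩

end Data

theorem enorm_sub_sq_le_three {F : Type*} [NormedAddCommGroup F] (a b c e : F) :
    ‖a - e‖² ≤ 4 * (‖a - b‖² + ‖b - c‖² + ‖c - e‖²) := by
  refine (enorm_sub_sq_le a b e).trans ?_
  calc _ ≤ 2 * ‖a - b‖² + 2 * (2 * ‖b - c‖² + 2 * ‖c - e‖²) := by
        gcongr; exact enorm_sub_sq_le b c e
    _ ≤ 4 * ‖a - b‖² + 2 * (2 * ‖b - c‖² + 2 * ‖c - e‖²) := by gcongr; norm_num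
    _ = _ := by ring

namespace Data

variable {d k : ℕ} (T : Data d k)

/-- The size of the edge below a section, relative to that of the vertex. -/
def secLen (j : Option (Fin k)) : ℝ := j.elim 1 fun _ => T.δ

theorem secLen_pos (j : Option (Fin k)) : 0 < T.secLen j := by
  cases j with
  | none => exact one_pos
  | some j => exact T.δ_pos

theorem secSet_eq (j : Option (Fin k)) : T.secSet j = T.secLen j • T.Ω := by
  cases j with
  | none => exact (one_smul ℝ T.Ω).symm
  | some j => rfl

theorem hasCompactCore_smul_Ω {t : ℝ} (ht : 0 < t) : HasCompactCore volume (t • T.Ω) := by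
  rw [smul_eq_image_sim]
  exact T.Ω_lipschitz.hasCompactCore.image_sim _ _ ht T.isOpen_Ω

theorem hasCompactCore_region {ε : ℝ} (hε : 0 < ε) (i : Piece k) :
    HasCompactCore volume (T.region ε i) := by
  cases i with
  | edge w =>
    exact (T.hasCompactCore_smul_Ω (T.scale_pos hε w)).slab
      (T.isOpen_Ω.smul₀ (T.scale_pos hε w).ne') _ _
  | vertex w =>
    rw [region_vertex, smul_eq_image_sim]
    exact T.V_lipschitz.hasCompactCore.image_sim _ _ (T.scale_pos hε w) T.isOpen_V

theorem exists_hasPoincare_vertex :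
    ∃ P : NNReal, ∀ t > 0, HasPoincare volume (t • T.V) (ofReal (t ^ 2) * P) := by
  obtain ⟨P, hP⟩ := T.V_lipschitz.hasCompactCore.exists_hasPoincare T.isOpen_V
    T.V_lipschitz.isConnected T.V_lipschitz.isBounded
  refine ⟨P, fun t ht => ?_⟩
  rw [smul_eq_image_sim]
  exact hP.image_sim _ _ ht T.isOpen_V

theorem exists_hasPoincare_cylinder (j : Option (Fin k)) :
    ∃ P : NNReal, ∀ t > 0, ∀ c R, HasPoincare volume
      (sim c t R '' slab (T.secSet j) (Ioo 0 (T.secLen j))) (ofReal (t ^ 2) * P) := by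
  have hΩ := T.isOpen_secSet j
  have hcore : HasCompactCore volume (slab (T.secSet j) (Ioo 0 (T.secLen j))) := by
    rw [T.secSet_eq]
    exact (T.hasCompactCore_smul_Ω (T.secLen_pos j)).slab
      (T.isOpen_Ω.smul₀ (T.secLen_pos j).ne') _ _
  obtain ⟨P, hP⟩ := hcore.exists_hasPoincare (isOpen_slab hΩ isOpen_Ioo) (isConnected_slab (by
      rw [T.secSet_eq]
      exact T.Ω_lipschitz.isConnected.image _ (continuous_const_smul _).continuousOn)
      (isConnected_Ioo (T.secLen_pos j)))
    (isBounded_slab (by rw [T.secSet_eq]; exact T.Ω_lipschitz.isBounded.smul₀ _)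
      (Metric.isBounded_Ioo _ _))
  exact ⟨P, fun t ht c R => hP.image_sim c R ht (isOpen_slab hΩ isOpen_Ioo)⟩

/-- Comparison of the mean over a vertex with the mean over the end of an edge glued to it. -/
theorem exists_average_vertex_sub_le (j : Option (Fin k)) :
    ∃ C : NNReal, ∀ t > 0, ∀ (c : Eucl (d + 1)) (R : Eucl (d + 1) ≃ₗᵢ[ℝ] Eucl (d + 1))
      (u g : Eucl (d + 1) → ℂ), ContDiffOn ℝ 1 u (t • T.V) →
      ContinuousOn u (t • (T.V ∪ ⋃ j, T.sec j '' T.secSet j)) →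
      MemLp u 2 (volume.restrict (t • T.V)) →
      ContDiffOn ℝ 1 g (sim c t R '' slab (T.secSet j) (Ioo 0 (T.secLen j))) →
      ContinuousOn g (sim c t R '' slab (T.secSet j) (Ico 0 (T.secLen j))) →
      MemLp g 2 (volume.restrict (sim c t R '' slab (T.secSet j) (Ioo 0 (T.secLen j)))) →
      (∀ y ∈ T.secSet j, u (t • T.sec j y) = g (sim c t R (point y 0))) →
      ofReal (t ^ (d + 1)) * ‖(⨍ x in t • T.V, u x) -
          ⨍ x in sim c t R '' slab (T.secSet j) (Ioo 0 (T.secLen j)), g x‖² ≤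
        C * (ofReal (t ^ 2) * ((∫⁻ x in t • T.V, ‖∇ u x‖²) +
          ∫⁻ x in sim c t R '' slab (T.secSet j) (Ioo 0 (T.secLen j)), ‖∇ g x‖²)) := by
  obtain ⟨r, hr, hrL, hrΩ, hrV⟩ := T.exists_cylinder j (T.secLen_pos j)
  obtain ⟨P, hP⟩ := T.exists_hasPoincare_vertex
  obtain ⟨P', hP'⟩ := T.exists_hasPoincare_cylinder j
  set B := ball (0 : Eucl d) r
  set D := slab B (Ioo 0 r)
  have hB : IsOpen B := Metric.isOpen_ball
  have hDo : IsOpen D := isOpen_slab hB isOpen_Ioo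
  have hDb : Bornology.IsBounded D := isBounded_slab Metric.isBounded_ball
    (Metric.isBounded_Ioo 0 r)
  have hD0 : volume D ≠ 0 := by
    refine (hDo.measure_pos volume ⟨point 0 (r / 2), ?_, ?_⟩).ne'
    · rw [cross_point]; exact mem_ball_self hr
    · rw [axial_point]; constructor <;> linarith
  have hDt : volume D ≠ ∞ := hDb.measure_lt_top.ne
  refine ⟨4 * ((volume D)⁻¹.toNNReal * (P + toNNReal (2 * r ^ 2) + P')),
    fun t ht c R u g hu huc huL hg hgc hgL heq => ?_⟩
  set W := sim c t R '' slab (T.secSet j) (Ioo 0 (T.secLen j))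
  set ψ := sim (t • T.sec j 0) t (T.frame j)
  have hVD : ψ '' D ⊆ t • T.V := by
    rintro _ ⟨x, hx, rfl⟩
    rw [← point_cross_axial x]
    simp only [ψ]
    rw [T.sim_frame_point]
    exact smul_mem_smul_set (hrV _ hx.1 _ hx.2)
  have hVDc : ψ '' slab B (Ico 0 r) ⊆ t • (T.V ∪ ⋃ j, T.sec j '' T.secSet j) := by
    rintro _ ⟨x, hx, rfl⟩
    rw [← point_cross_axial x]
    simp only [ψ]
    rw [T.sim_frame_point]
    refine smul_mem_smul_set ?_
    rcases hx.2.1.eq_or_lt with h | h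
    · right
      rw [← h, zero_smul, sub_zero]
      exact mem_iUnion.2 ⟨j, mem_image_of_mem _ (hrΩ hx.1)⟩
    · exact Or.inl (hrV _ hx.1 _ ⟨h, hx.2.2⟩)
  have hWD : sim c t R '' D ⊆ W := image_mono (slab_mono hrΩ (Ioo_subset_Ioo_right hrL))
  have hWDc : sim c t R '' slab B (Ico 0 r) ⊆ sim c t R '' slab (T.secSet j) (Ico 0 (T.secLen j)) :=
    image_mono (slab_mono hrΩ (Ico_subset_Ico_right hrL))
  have hvol₁ : volume (ψ '' D) = ofReal (t ^ (d + 1)) * volume D := volume_image_sim _ _ ht D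
  have hvol₂ : volume (sim c t R '' D) = ofReal (t ^ (d + 1)) * volume D :=
    volume_image_sim _ _ ht D
  have h1 := (hP t ht).volume_mul_average_sub_le hVD (by rw [hvol₁]; finiteness) hu huL
  have h2 := (hP' t ht c R).volume_mul_average_sub_le hWD (by rw [hvol₂]; finiteness) hg hgL
  have h3 := volume_mul_enorm_average_sub_average_le hB Metric.isBounded_ball ht
   
    (hu.mono hVD) (huc.mono hVDc) (huL.mono_measure (restrict_mono hVD le_rfl))
    (hg.mono hWD) (hgc.mono hWDc) (hgL.mono_measure (restrict_mono hWD le_rfl))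
    (fun y hy => by rw [T.sim_frame_point, zero_smul, sub_zero]; exact heq y (hrΩ hy))
  rw [hvol₁] at h1
  rw [hvol₂] at h2
  set I := ∫⁻ x in t • T.V, ‖∇ u x‖²
  set I' := ∫⁻ x in W, ‖∇ g x‖²
  set τ := ofReal (t ^ (d + 1))
  have h3' :=
    h3.trans (mul_le_mul_right (add_le_add (lintegral_mono_set hVD) (lintegral_mono_set hWD)) _)
  rw [enorm_sub_rev] at h1
  refine (mul_le_mul_right (enorm_sub_sq_le_three _ (⨍ x in ψ '' D, u x)
    (⨍ x in sim c t R '' D, g x) _) τ).trans ?_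
  refine (ENNReal.mul_le_mul_iff_right hD0 hDt).1 ?_
  calc _ = 4 * (τ * volume D * ‖(⨍ x in t • T.V, u x) - ⨍ x in ψ '' D, u x‖² +
        τ * volume D * ‖(⨍ x in ψ '' D, u x) - ⨍ x in sim c t R '' D, g x‖² +
        τ * volume D * ‖(⨍ x in sim c t R '' D, g x) - ⨍ x in W, g x‖²) := by ring
    _ ≤ 4 * (ofReal (t ^ 2) * P * (I + I') + ofReal (2 * r ^ 2 * t ^ 2) * (I + I') +
        ofReal (t ^ 2) * P' * (I + I')) := by
        refine mul_le_mul_right (add_le_add (add_le_add (h1.trans ?_) h3') (h2.trans ?_)) _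
        · exact mul_le_mul_right le_self_add _
        · exact mul_le_mul_right le_add_self _
    _ = (volume D * (volume D)⁻¹) * (4 * (P + ofReal (2 * r ^ 2) + P')) *
        (ofReal (t ^ 2) * (I + I')) := by
        rw [ENNReal.mul_inv_cancel hD0 hDt, ofReal_mul (by positivity)]
        ring
    _ = _ := by
        push_cast
        rw [coe_toNNReal (by simpa using hD0)]
        simp only [ofReal]
        ring

end Data

section Steklov

variable {d : ℕ} {A : Set (Eucl d)}

theorem lintegral_Ioo_window_le {a b p q : ℝ} {F : Eucl (d + 1) → ENNReal} (hF : Measurable F)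
    (I : Set ℝ) :
    ∫⁻ σ in I, (∫⁻ x in slab A (Ioo (σ + p) (σ + q) ∩ Ioo a b), F x) ≤
      ofReal (q - p) * ∫⁻ x in slab A (Ioo a b), F x := by
  let S : Set (ℝ × Eucl (d + 1)) := {z | axial z.2 ∈ Ioo (z.1 + p) (z.1 + q)}
  have hax : Continuous fun z : ℝ × Eucl (d + 1) => axial z.2 := continuous_axial.comp
    continuous_snd
  have hS : MeasurableSet S := by
    have h1 : MeasurableSet {z : ℝ × Eucl (d + 1) | z.1 + p < axial z.2} :=
      (isOpen_lt (by fun_prop) hax).measurableSet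
    have h2 : MeasurableSet {z : ℝ × Eucl (d + 1) | axial z.2 < z.1 + q} :=
      (isOpen_lt hax (by fun_prop)).measurableSet
    exact h1.inter h2
  calc _ = ∫⁻ σ in I, ∫⁻ x in slab A (Ioo a b), S.indicator 1 (σ, x) * F x := by
        refine lintegral_congr fun σ => ?_
        have hset : slab A (Ioo (σ + p) (σ + q) ∩ Ioo a b) =
            {x | (σ, x) ∈ S} ∩ slab A (Ioo a b) := by
          ext x; simp only [slab, S, mem_ofPred_eq, mem_inter_iff]; tauto
        have hS' : MeasurableSet {x | (σ, x) ∈ S} := measurable_prodMk_left hS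
        rw [hset, ← Measure.restrict_restrict hS', ← lintegral_indicator hS']
        refine lintegral_congr fun x => ?_
        by_cases hx : (σ, x) ∈ S <;> simp [indicator, hx]
    _ = ∫⁻ x in slab A (Ioo a b), ∫⁻ σ in I, S.indicator 1 (σ, x) * F x :=
        lintegral_lintegral_swap ((measurable_one.indicator hS).mul
          (hF.comp measurable_snd)).aemeasurable
    _ ≤ ∫⁻ x in slab A (Ioo a b), ofReal (q - p) * F x := by
        refine lintegral_mono fun x => ?_
        have hS' : MeasurableSet {σ | (σ, x) ∈ S} := measurable_prodMk_right hS
        have h1 : Measurable fun σ : ℝ => (S.indicator 1 (σ, x) : ENNReal) :=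
          (measurable_one.indicator hS).comp measurable_prodMk_right
        rw [lintegral_mul_const _ h1]
        gcongr
        have h2 : (fun σ => (S.indicator 1 (σ, x) : ENNReal)) = {σ | (σ, x) ∈ S}.indicator 1 := by
          ext σ; by_cases hσ : (σ, x) ∈ S <;> simp [indicator, hσ]
        rw [h2, lintegral_indicator_one hS']
        refine (Measure.restrict_apply_le _ _).trans ((measure_mono (t := Ioo (axial x - q)
          (axial x - p)) fun σ hσ => ⟨by linarith [hσ.2], by linarith [hσ.1]⟩).trans ?_)
        rw [volume_Ioo]; apply le_of_eq; congr 1; ring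
    _ = _ := lintegral_const_mul _ hF

/-- The mean of a function on a cylinder over the window of length `t` from `σ` on. -/
def windowMean (A : Set (Eucl d)) (t : ℝ) (u : Eucl (d + 1) → ℂ) (σ : ℝ) : ℂ :=
  ⨍ x in slab A (Ioo σ (σ + t)), u x

variable {a b t : ℝ} {u : Eucl (d + 1) → ℂ}

theorem volume_slab_singleton (A : Set (Eucl d)) (s : ℝ) : volume (slab A {s}) = 0 := by
  rw [volume_slab, Real.volume_singleton, mul_zero]

theorem continuous_setIntegral_window (hA : MeasurableSet A) (t : ℝ) {F : Eucl (d + 1) → ℂ}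
    (hF : Integrable F) : Continuous fun σ => ∫ x in slab A (Ioo σ (σ + t)), F x := by
  have hm : ∀ σ, MeasurableSet (slab A (Ioo σ (σ + t))) := fun σ =>
    measurableSet_slab hA measurableSet_Ioo
  simp_rw [← fun σ => integral_indicator (f := F) (μ := volume) (hm σ)]
  refine continuous_iff_continuousAt.2 fun σ₀ => continuousAt_of_dominated ?_ ?_ hF.norm ?_
  · exact of_forall fun σ => (hF.1.indicator (hm σ))
  · exact of_forall fun σ => of_forall fun x => norm_indicator_le_norm_self _ _
  · have h1 : ∀ s, ∀ᵐ x : Eucl (d + 1), axial x ≠ s := fun s => by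
      rw [ae_iff]
      refine measure_mono_null (t := slab univ {s}) (fun x hx => ?_) (volume_slab_singleton _ s)
      exact ⟨mem_univ _, not_not.1 hx⟩
    filter_upwards [h1 σ₀, h1 (σ₀ + t)] with x hx1 hx2
    refine ContinuousAt.congr (f := fun _ => (slab A (Ioo σ₀ (σ₀ + t))).indicator F x)
      continuousAt_const ?_
    have e1 : ∀ᶠ σ in 𝓝 σ₀, (σ < axial x ↔ σ₀ < axial x) := by
      rcases lt_or_gt_of_ne hx1 with h | h
      · filter_upwards [lt_mem_nhds h] with σ hσ
        exact ⟨fun h' => absurd h' hσ.not_gt, fun h' => absurd h' h.not_gt⟩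
      · filter_upwards [gt_mem_nhds h] with σ hσ
        exact ⟨fun _ => h, fun _ => hσ⟩
    have hc : Tendsto (fun σ => σ + t) (𝓝 σ₀) (𝓝 (σ₀ + t)) :=
      (continuous_id.add continuous_const).tendsto σ₀
    have e2 : ∀ᶠ σ in 𝓝 σ₀, (axial x < σ + t ↔ axial x < σ₀ + t) := by
      rcases lt_or_gt_of_ne hx2 with h | h
      · filter_upwards [hc.eventually (lt_mem_nhds h)] with σ hσ
        exact ⟨fun _ => h, fun _ => hσ⟩
      · filter_upwards [hc.eventually (gt_mem_nhds h)] with σ hσ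
        exact ⟨fun h' => absurd h' hσ.not_gt, fun h' => absurd h' h.not_gt⟩
    filter_upwards [e1, e2] with σ h1 h2
    by_cases hx : x ∈ slab A (Ioo σ₀ (σ₀ + t))
    · have hx' : x ∈ slab A (Ioo σ (σ + t)) := ⟨hx.1, h1.2 hx.2.1, h2.2 hx.2.2⟩
      rw [indicator_of_mem hx, indicator_of_mem hx']
    · have hx' : x ∉ slab A (Ioo σ (σ + t)) := fun h => hx ⟨h.1, h1.1 h.2.1, h2.1 h.2.2⟩
      rw [indicator_of_notMem hx, indicator_of_notMem hx']

theorem image_add_slab (A : Set (Eucl d)) (σ t : ℝ) : slab A (Ioo σ (σ + t)) =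
      sim (σ • axis d) 1 (LinearIsometryEquiv.refl ℝ _) '' slab A (Ioo 0 t) := by
  have h := slab_eq_image_sim A t σ one_pos
  rw [one_smul, one_mul] at h
  rw [h]
  congr 2
  refine point_ext (by simp) (by simp)

theorem setIntegral_window_eq (A : Set (Eucl d)) (σ t : ℝ) (F : Eucl (d + 1) → ℂ) :
    ∫ x in slab A (Ioo σ (σ + t)), F x = ∫ x in slab A (Ioo 0 t), F (x + σ • axis d) := by
  have h := (measEmb_sim (σ • axis d) (LinearIsometryEquiv.refl ℝ _) one_ne_zero).integral_map
    (μ := volume.restrict (slab A (Ioo 0 t))) F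
  rw [map_sim _ _ one_pos, ← image_add_slab] at h
  simp at h
  rw [h]
  refine integral_congr_ae (of_forall fun x => ?_)
  simp [sim, add_comm]

theorem exists_contDiff_windowMean (hA : IsOpen A) (hAb : Bornology.IsBounded A)
    (htb : a ≤ b - t) (hu : ContDiffOn ℝ 1 u (slab A (Ioo a b)))
    (huL : IntegrableOn u (slab A (Ioo a b)))
    (hdu : IntegrableOn (fun x => ∇ u x (axis d)) (slab A (Ioo a b))) :
    ∃ M : ℝ → ℂ, ContDiff ℝ 1 M ∧ ∀ σ ∈ Icc a (b - t), windowMean A t u σ = M σ ∧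
      deriv M σ = windowMean A t (fun x => ∇ u x (axis d)) σ := by
  set U := slab A (Ioo a b)
  have hUo : IsOpen U := isOpen_slab hA isOpen_Ioo
  set D := slab A (Ioo 0 t)
  have hDo : IsOpen D := isOpen_slab hA isOpen_Ioo
  set g : Eucl (d + 1) → ℂ := U.indicator fun x => ∇ u x (axis d)
  have hgI := hdu.integrable_indicator hUo.measurableSet
  have hgm := (measurable_fderiv_apply_const ℝ u (axis d)).indicator hUo.measurableSet
  have hDU : ∀ σ ∈ Icc a (b - t), ∀ x ∈ D, x + σ • axis d ∈ U := fun σ hσ x hx => by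
    refine ⟨by simpa using hx.1, ?_⟩
    simp
    constructor <;> linarith [hx.2.1, hx.2.2, hσ.1, hσ.2]
  have hwU : ∀ σ ∈ Icc a (b - t), slab A (Ioo σ (σ + t)) ⊆ U := fun σ hσ =>
    slab_mono Subset.rfl (Ioo_subset_Ioo hσ.1 (by linarith [hσ.2]))
  set N : ℝ → ℂ := fun σ => ∫ x in slab A (Ioo σ (σ + t)), g x
  have hN := continuous_setIntegral_window hA.measurableSet t hgI
  set c : ℝ := (volume D).toReal⁻¹
  have hmean : ∀ F σ, windowMean A t F σ = c • ∫ x in slab A (Ioo σ (σ + t)), F x := fun F σ => by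
    rw [windowMean, setAverage_eq, Measure.real, volume_slab, volume_Ioo, add_sub_cancel_left]
    simp only [c, D, volume_slab, volume_Ioo, sub_zero]
  have hFTC : ∀ σ ∈ Icc a (b - t), ∀ x ∈ D,
      u (x + σ • axis d) - u (x + a • axis d) = ∫ τ in a..σ, g (x + τ • axis d) := by
    intro σ hσ x hx
    have hτ : ∀ τ ∈ uIcc a σ, x + τ • axis d ∈ U := fun τ hτ => by
      rw [uIcc_of_le hσ.1] at hτ
      exact hDU τ ⟨hτ.1, hτ.2.trans hσ.2⟩ x hx
    rw [eq_comm]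
    refine intervalIntegral.integral_eq_sub_of_hasDerivAt (f := fun τ => u (x + τ • axis d))
      (fun τ hτ' => ?_) (ContinuousOn.intervalIntegrable ?_)
    · simp only [g]
      rw [indicator_of_mem (hτ τ hτ')]
      exact deriv_comp_line ((hu.differentiableOn one_ne_zero).differentiableAt
        (hUo.mem_nhds (hτ τ hτ')))
    · have h1 : ContinuousOn (fun x => ∇ u x (axis d)) U :=
        (hu.continuousOn_fderiv_of_isOpen hUo le_rfl).clm_apply continuousOn_const
      refine ContinuousOn.congr (h1.comp (by fun_prop) hτ) fun τ hτ' => ?_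
      simp only [g, comp_apply]
      rw [indicator_of_mem (hτ τ hτ')]
  have hDfin : volume D ≠ ∞ := (isBounded_slab hAb (Metric.isBounded_Ioo 0 t)).measure_lt_top.ne
  have hint : ∀ σ ∈ Icc a (b - t), Integrable (fun x => u (x + σ • axis d)) (volume.restrict
    D) := by
    intro σ hσ
    have h1 := huL.mono_set (hwU σ hσ)
    rw [image_add_slab] at h1
    have h2 := (measEmb_sim (σ • axis d) (LinearIsometryEquiv.refl ℝ _)
      one_ne_zero).integrable_map_iff (μ := volume.restrict D) (g := u)
    rw [map_sim _ _ one_pos] at h2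
    simp at h2
    refine (h2.1 h1).congr (of_forall fun x => ?_)
    simp [sim, add_comm]
  have hjoint : ∀ σ ∈ Icc a (b - t), Integrable (uncurry fun τ x => g (x + τ • axis d))
      ((volume.restrict (uIoc a σ)).prod (volume.restrict D)) := fun σ hσ => by
    have hm : Measurable (uncurry fun (τ : ℝ) x => g (x + τ • axis d)) := hgm.comp (by fun_prop)
    refine ⟨hm.aestronglyMeasurable, ?_⟩
    rw [hasFiniteIntegral_iff_enorm, lintegral_prod _ hm.enorm.aemeasurable]
    calc _ ≤ ∫⁻ τ in uIoc a σ, ∫⁻ x, ‖g x‖ₑ := by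
          refine lintegral_mono fun τ => ?_
          refine (setLIntegral_le_lintegral _ _).trans_eq ?_
          exact lintegral_add_right_eq_self (fun x => ‖g x‖ₑ) (τ • axis d)
      _ < ∞ := by
          rw [lintegral_const, restrict_apply_univ, Real.volume_uIoc]
          exact ENNReal.mul_lt_top hgI.2 ENNReal.ofReal_lt_top
  refine ⟨fun σ => windowMean A t u a + c • ∫ τ in a..σ, N τ, ?_, fun σ hσ => ⟨?_, ?_⟩⟩
  · have h1 : ∀ σ, HasDerivAt (fun σ => windowMean A t u a + c • ∫ τ in a..σ, N τ) (c • N σ) σ :=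
      fun σ => ((intervalIntegral.integral_hasDerivAt_right (hN.intervalIntegrable _ _)
        (hN.stronglyMeasurableAtFilter _ _) hN.continuousAt).const_smul c).const_add _
    rw [contDiff_one_iff_deriv]
    refine ⟨fun σ => (h1 σ).differentiableAt, ?_⟩
    rw [show deriv _ = fun σ => c • N σ from funext fun σ => (h1 σ).deriv]
    exact hN.const_smul c
  · change windowMean A t u σ = windowMean A t u a + c • ∫ τ in a..σ, N τ
    rw [hmean, hmean, ← smul_add]
    congr 1
    rw [← sub_eq_iff_eq_add', setIntegral_window_eq, setIntegral_window_eq, ← integral_sub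
      (hint σ hσ)
      (hint a ⟨le_rfl, htb⟩)]
    calc _ = ∫ x in D, ∫ τ in a..σ, g (x + τ • axis d) :=
          setIntegral_congr_fun hDo.measurableSet fun x hx => hFTC σ hσ x hx
      _ = ∫ τ in a..σ, ∫ x in D, g (x + τ • axis d) :=
          (intervalIntegral_integral_swap (hjoint σ hσ)).symm
      _ = _ := by simp_rw [N, setIntegral_window_eq]; rfl
  · have h1 : HasDerivAt (fun σ => windowMean A t u a + c • ∫ τ in a..σ, N τ) (c • N σ) σ :=
      ((intervalIntegral.integral_hasDerivAt_right (hN.intervalIntegrable _ _)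
        (hN.stronglyMeasurableAtFilter _ _) hN.continuousAt).const_smul c).const_add _
    rw [h1.deriv, hmean]
    congr 1
    exact setIntegral_congr_fun (measurableSet_slab hA.measurableSet measurableSet_Ioo) fun x hx =>
      indicator_of_mem (hwU σ hσ hx) _

theorem lintegral_windowMean_le (hA : IsOpen A) (hAb : Bornology.IsBounded A)
    (ht : 0 < t) {F : Eucl (d + 1) → ℂ} (hFm : Measurable ((slab A (Ioo a b)).indicator F))
    (hFi : IntegrableOn F (slab A (Ioo a b))) :
    volume A * ∫⁻ σ in Ioo a (b - t), ‖windowMean A t F σ‖² ≤ ∫⁻ x in slab A (Ioo a b), ‖F x‖² := by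
  set U := slab A (Ioo a b)
  have hU : MeasurableSet U := (isOpen_slab hA isOpen_Ioo).measurableSet
  set H : Eucl (d + 1) → ENNReal := fun x => ‖U.indicator F x‖²
  have hHF : ∀ S ⊆ U, MeasurableSet S → ∫⁻ x in S, H x = ∫⁻ x in S, ‖F x‖² := fun S hS hSm =>
    setLIntegral_congr_fun hSm fun x hx => by simp [H, hS hx]
  have hAfin : volume A ≠ ∞ := hAb.measure_lt_top.ne
  have hpt : ∀ σ ∈ Ioo a (b - t), ofReal t * (volume A * ‖windowMean A t F σ‖²) ≤
      ∫⁻ x in slab A (Ioo (σ + 0) (σ + t) ∩ Ioo a b), H x := fun σ hσ => by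
    have hsub : Ioo σ (σ + t) ⊆ Ioo a b := Ioo_subset_Ioo hσ.1.le (by linarith [hσ.2])
    rw [add_zero, inter_eq_left.2 hsub, hHF _ (slab_mono Subset.rfl hsub)
      (measurableSet_slab hA.measurableSet measurableSet_Ioo)]
    have hv : volume (slab A (Ioo σ (σ + t))) = ofReal t * volume A := by
      rw [volume_slab, volume_Ioo, add_sub_cancel_left, mul_comm]
    have h := InflatedTree.volume_mul_average_sub_le (by rw [hv]; finiteness)
      (hFi.mono_set (slab_mono Subset.rfl hsub)) 0
    simp at h
    rwa [hv, mul_assoc] at h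
  have h1 := setLIntegral_mono' (μ := volume) measurableSet_Ioo hpt
  rw [lintegral_const_mul' _ _ ofReal_ne_top, lintegral_const_mul' _ _ hAfin] at h1
  have h2 := h1.trans (lintegral_Ioo_window_le (hFm.enorm.pow_const 2) _)
  rw [sub_zero, hHF U Subset.rfl hU] at h2
  exact (ENNReal.mul_le_mul_iff_right (ENNReal.ofReal_pos.2 ht).ne' ofReal_ne_top).1 h2

/-- A function on a cylinder is close to the mean over a nearby window. -/
theorem lintegral_enorm_sub_windowMean_le (hA : IsOpen A) (hAb : Bornology.IsBounded A)
    (ht : 0 < t) {P : ENNReal} (hP : ∀ σ, HasPoincare volume (slab A (Ioo σ (σ + t))) P)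
    (hu : ContDiffOn ℝ 1 u (slab A (Ioo a b))) (huL : MemLp u 2
      (volume.restrict (slab A (Ioo a b))))
    {ξ : ℝ → ℝ} {r : ℝ} (hr : 0 < r) (hξ : ∀ θ ∈ Ioo a b, a ≤ ξ θ ∧ ξ θ + t ≤ b ∧
      θ - r ≤ ξ θ ∧ ξ θ + t ≤ θ + r)
    (hc : ContinuousOn (fun θ => windowMean A t u (ξ θ)) (Ioo a b)) (hPt : P ≠ ∞) :
    ofReal t * ∫⁻ x in slab A (Ioo a b), ‖u x - windowMean A t u (ξ (axial x))‖² ≤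
      ofReal (2 * r) * (2 * (ofReal (t * r) + P)) * ∫⁻ x in slab A (Ioo a b), ‖∇ u x‖² := by
  set U := slab A (Ioo a b)
  have hUo : IsOpen U := isOpen_slab hA isOpen_Ioo
  have hAm := hA.measurableSet
  set H : Eucl (d + 1) → ENNReal := fun x => ‖∇ u x‖²
  have hH := (measurable_fderiv ℝ u).enorm.pow_const 2
  have hAfin : volume A ≠ ∞ := hAb.measure_lt_top.ne
  have hind := measurable_indicator hUo.measurableSet hu.continuousOn
  have hslice : ∀ s ∈ Ioo a b, AEMeasurable (fun y => u (point y s)) (volume.restrict A) := by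
    intro s hs
    refine ((hu.continuousOn.comp (contDiff_point_left s).continuous.continuousOn
      fun y hy => ?_).aestronglyMeasurable hAm).aemeasurable
    exact ⟨by simpa using hy, by simpa using hs⟩
  have hpt : ∀ θ ∈ Ioo a b, ofReal t * (∫⁻ y in A, ‖u (point y θ) - windowMean A t u (ξ θ)‖²) ≤
      2 * (ofReal (t * r) + P) * ∫⁻ x in slab A (Ioo (θ + (-r)) (θ + r) ∩ Ioo a b), H x := by
    intro θ hθ
    obtain ⟨h1, h2, h3, h4⟩ := hξ θ hθ
    set m := windowMean A t u (ξ θ)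
    have hwU := Ioo_subset_Ioo h1 h2
    have hwr : Ioo (ξ θ) (ξ θ + t) ⊆ Ioo (θ + (-r)) (θ + r) := Ioo_subset_Ioo (by linarith) h4
    set S := Ioo (θ + (-r)) (θ + r) ∩ Ioo a b
    have hSm : MeasurableSet S := measurableSet_Ioo.inter measurableSet_Ioo
    have hline : ∀ y ∈ A, ∀ s ∈ Ioo (ξ θ) (ξ θ + t),
        ‖u (point y θ) - u (point y s)‖² ≤ ofReal r * ∫⁻ σ in S, H (point y σ) := by
      intro y hy s hs
      have key : ∀ p ∈ S, ∀ q ∈ S, p ≤ q → q - p ≤ r →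
          ‖u (point y q) - u (point y p)‖² ≤ ofReal r * ∫⁻ σ in S, H (point y σ) := by
        intro p hp q hq hpq hqp
        have hmem : ∀ σ ∈ Icc p q, point y σ ∈ U := fun σ hσ => ⟨by simpa using hy, by
          rw [axial_point]; exact ⟨hp.2.1.trans_le hσ.1, hσ.2.trans_lt hq.2.2⟩⟩
        have h5 := enorm_sub_sq_le_line (x := crossIncl d y) (v := axis d) hpq
          (hu.continuousOn.mono (by
            rintro _ ⟨σ, hσ, rfl⟩
            simp only [← point_eq_add]
            exact hmem σ hσ))
          (fun σ hσ => by
            rw [← point_eq_add]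
            exact (hu.differentiableOn one_ne_zero).differentiableAt
              (hUo.mem_nhds (hmem σ (Ioo_subset_Icc_self hσ))))
        have h6 : ‖axis d‖ₑ = 1 := by rw [← ofReal_norm, norm_axis, ofReal_one]
        rw [h6, one_pow, one_mul] at h5
        simp_rw [← point_eq_add] at h5
        refine h5.trans (mul_le_mul' (ofReal_le_ofReal hqp) (lintegral_mono_set ?_))
        exact fun σ hσ => ⟨⟨hp.1.1.trans hσ.1, hσ.2.trans hq.1.2⟩,
          ⟨hp.2.1.trans hσ.1, hσ.2.trans hq.2.2⟩⟩
      have hsS : s ∈ S := ⟨hwr hs, hwU hs⟩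
      have hθS : θ ∈ S := ⟨⟨by linarith, by linarith⟩, hθ⟩
      rcases le_total s θ with hsθ | hsθ
      · exact key s hsS θ hθS hsθ (by linarith [hsS.1.1])
      · rw [enorm_sub_rev]
        exact key θ hθS s hsS hsθ (by linarith [hsS.1.2])
    have hHm : ∀ I, AEMeasurable H (volume.restrict (slab A I)) := fun I => hH.aemeasurable
    have huw := huL.mono_measure (restrict_mono (slab_mono Subset.rfl hwU) le_rfl)
    have hcore : ∀ s ∈ Ioo (ξ θ) (ξ θ + t),
        ∫⁻ y in A, ‖u (point y θ) - m‖² ≤ ofReal (2 * r) * (∫⁻ x in slab A S, H x) +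
          2 * ∫⁻ y in A, ‖u (point y s) - m‖² := fun s hs => by
      calc _ ≤ ∫⁻ y in A, (2 * (ofReal r * ∫⁻ σ in S, H (point y σ)) +
            2 * ‖u (point y s) - m‖²) := by
            refine setLIntegral_mono' hAm fun y hy => ?_
            refine (enorm_sub_sq_le _ (u (point y s)) _).trans ?_
            exact add_le_add (mul_le_mul_right (hline y hy s hs) 2) le_rfl
        _ = _ := by
            rw [lintegral_add_right', lintegral_const_mul' _ _ (by norm_num),
              lintegral_const_mul' _ _ ofReal_ne_top, lintegral_const_mul' _ _ (by norm_num),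
              lintegral_slab (hHm S), lintegral_lintegral_swap (f := fun y σ => H (point y σ))
                (hH.comp continuous_point.measurable).aemeasurable,
              ofReal_mul (by norm_num), ofReal_ofNat, mul_assoc]
            exact (((hslice s (hwU hs)).sub aemeasurable_const).enorm.pow_const 2).const_mul 2
    have h7 := setLIntegral_mono' (μ := volume) measurableSet_Ioo hcore
    rw [lintegral_const, restrict_apply_univ, volume_Ioo, add_sub_cancel_left, mul_comm,
      lintegral_add_left' aemeasurable_const, lintegral_const, restrict_apply_univ,
      volume_Ioo, add_sub_cancel_left, lintegral_const_mul' _ _ (by norm_num),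
      ← lintegral_slab (F := fun x => ‖u x - m‖²)
        ((huw.1.sub aestronglyMeasurable_const).enorm.pow_const 2)] at h7
    refine h7.trans ?_
    have h8 := (hP (ξ θ) u (hu.mono (slab_mono Subset.rfl hwU)) huw).trans
      (mul_le_mul_right (lintegral_mono_set (slab_mono Subset.rfl (subset_inter hwr hwU))) P)
    calc _ ≤ ofReal (2 * r) * (∫⁻ x in slab A S, H x) * ofReal t +
          2 * (P * ∫⁻ x in slab A S, H x) := add_le_add le_rfl (mul_le_mul_right h8 2)
      _ = _ := by
          rw [ofReal_mul (by norm_num), ofReal_mul ht.le, ofReal_ofNat]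
          ring
  have hcyl : ∫⁻ x in U, ‖u x - windowMean A t u (ξ (axial x))‖² =
      ∫⁻ θ in Ioo a b, ∫⁻ y in A, ‖u (point y θ) - windowMean A t u (ξ θ)‖² := by
    rw [lintegral_slab]
    · simp
    · have h9 : ContinuousOn (fun x => windowMean A t u (ξ (axial x))) U :=
        hc.comp continuous_axial.continuousOn fun x hx => hx.2
      exact (huL.1.sub (h9.aestronglyMeasurable hUo.measurableSet)).enorm.pow_const 2
  calc _ ≤ ofReal t * ∫⁻ θ in Ioo a b, ∫⁻ y in A,
        ‖u (point y θ) - windowMean A t u (ξ θ)‖² := by rw [hcyl]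
    _ = ∫⁻ θ in Ioo a b, ofReal t * ∫⁻ y in A, ‖u (point y θ) - windowMean A t u (ξ θ)‖² :=
        (lintegral_const_mul' _ _ ofReal_ne_top).symm
    _ ≤ ∫⁻ θ in Ioo a b, 2 * (ofReal (t * r) + P) *
        ∫⁻ x in slab A (Ioo (θ + (-r)) (θ + r) ∩ Ioo a b), H x :=
        setLIntegral_mono' measurableSet_Ioo hpt
    _ = 2 * (ofReal (t * r) + P) * ∫⁻ θ in Ioo a b,
        ∫⁻ x in slab A (Ioo (θ + (-r)) (θ + r) ∩ Ioo a b), H x :=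
        lintegral_const_mul' _ _ (by finiteness)
    _ ≤ 2 * (ofReal (t * r) + P) * (ofReal (r - -r) * ∫⁻ x in U, H x) := by
        gcongr
        exact lintegral_Ioo_window_le hH _
    _ = _ := by rw [sub_neg_eq_add, ← two_mul]; ring

end Steklov

section Sigma

variable {ι X : Type*} [MeasurableSpace X] {μ : ι → Measure X}

theorem measurableSet_sigma {s : Set (Σ _ : ι, X)} :
    MeasurableSet s ↔ ∀ i, MeasurableSet (Sigma.mk i ⁻¹' s) :=
  MeasurableSpace.measurableSet_iInf

theorem measEmb_sigmaMk (i : ι) : MeasurableEmbedding (Sigma.mk (β := fun _ : ι => X) i) where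
  injective := sigma_mk_injective
  measurable := fun _ hs => measurableSet_sigma.1 hs i
  measurableSet_image' := fun {s} hs => by
    refine measurableSet_sigma.2 fun j => ?_
    rcases eq_or_ne i j with rfl | hij
    · rwa [preimage_image_eq _ sigma_mk_injective]
    · convert MeasurableSet.empty
      ext x
      simp [hij]

theorem lintegral_sigma (F : (Σ _ : ι, X) → ENNReal) :
    ∫⁻ x, F x ∂sigmaMeasure μ = ∑' i, ∫⁻ x, F ⟨i, x⟩ ∂μ i := by
  rw [sigmaMeasure, lintegral_sum_measure]
  exact tsum_congr fun i => (measEmb_sigmaMk i).lintegral_map F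

theorem sigmaMeasure_image_mk (i : ι) (s : Set X) :
    sigmaMeasure μ (Sigma.mk (β := fun _ : ι => X) i '' s) = μ i s := by
  classical
  have hm : ∀ j, (μ j).map (Sigma.mk (β := fun _ => X) j) (Sigma.mk i '' s) =
      if j = i then μ i s else 0 := fun j => by
    rw [(measEmb_sigmaMk j).map_apply]
    split_ifs with h
    · subst h; rw [preimage_image_eq _ sigma_mk_injective]
    · convert measure_empty (μ := μ j)
      ext x
      simp [Ne.symm h]
  refine le_antisymm ?_ ?_
  · obtain ⟨t, hst, ht, hμt⟩ := exists_measurable_superset (μ i) s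
    calc _ ≤ sigmaMeasure μ (Sigma.mk i '' t) := by gcongr
      _ = ∑' j, (μ j).map (Sigma.mk (β := fun _ => X) j) (Sigma.mk i '' t) :=
          Measure.sum_apply _ ((measEmb_sigmaMk i).measurableSet_image.2 ht)
      _ = μ i t := by
        rw [tsum_eq_single i]
        · rw [(measEmb_sigmaMk i).map_apply, preimage_image_eq _ sigma_mk_injective]
        · intro j hj
          rw [(measEmb_sigmaMk j).map_apply]
          convert measure_empty (μ := μ j)
          ext x
          simp [Ne.symm hj]
      _ = μ i s := hμt
  · have h := Measure.le_sum (fun i => (μ i).map (Sigma.mk i)) i (Sigma.mk i '' s)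
    rw [hm i, if_pos rfl] at h
    exact h

section Countable

variable [Countable ι]

theorem ae_sigma_iff {p : (Σ _ : ι, X) → Prop} :
    (∀ᵐ x ∂sigmaMeasure μ, p x) ↔ ∀ i, ∀ᵐ x ∂μ i, p ⟨i, x⟩ := by
  rw [sigmaMeasure, Measure.ae_sum_iff]
  exact forall_congr' fun i => (measEmb_sigmaMk i).ae_map_iff

theorem aesm_sigma_iff {F : Type*} [NormedAddCommGroup F]
    {f : (Σ _ : ι, X) → F} : AEStronglyMeasurable f (sigmaMeasure μ) ↔
      ∀ i, AEStronglyMeasurable (fun x => f ⟨i, x⟩) (μ i) := by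
  rw [sigmaMeasure, aestronglyMeasurable_sum_measure_iff]
  exact forall_congr' fun i => (measEmb_sigmaMk i).aestronglyMeasurable_map_iff

theorem memLp_two_sigma {F : Type*} [NormedAddCommGroup F] {f : (Σ _ : ι, X) → F}
    (hf : ∀ i, AEStronglyMeasurable (fun x => f ⟨i, x⟩) (μ i))
    (hfin : ∑' i, ∫⁻ x, ‖f ⟨i, x⟩‖² ∂μ i < ∞) : MemLp f 2 (sigmaMeasure μ) := by
  rw [memLp_two_iff (aesm_sigma_iff.2 hf), lintegral_sigma]
  exact hfin

theorem memLp_sigma_mk {F : Type*} [NormedAddCommGroup F] {f : (Σ _ : ι, X) → F}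
    (hf : MemLp f 2 (sigmaMeasure μ)) (i : ι) : MemLp (fun x => f ⟨i, x⟩) 2 (μ i) := by
  exact (measEmb_sigmaMk i).memLp_map_measure_iff.1 ((hf.mono_measure
    (Measure.le_sum (fun i => (μ i).map (Sigma.mk i)) i)))

theorem hasSum_integral_sigma {F : Type*} [NormedAddCommGroup F] [NormedSpace ℝ F]
    {f : (Σ _ : ι, X) → F} (hf : Integrable f (sigmaMeasure μ)) :
    HasSum (fun i => ∫ x, f ⟨i, x⟩ ∂μ i) (∫ x, f x ∂sigmaMeasure μ) := by
  change HasSum _ (∫ x, f x ∂Measure.sum fun i => (μ i).map (Sigma.mk i))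
  simpa only [(measEmb_sigmaMk _).integral_map] using (hasSum_integral_measure hf)

end Countable

theorem enorm_sq_eq_lintegral {α F : Type*} [MeasurableSpace α] {ν : Measure α}
    [NormedAddCommGroup F] (p : Lp F 2 ν) : ‖p‖² = ∫⁻ x, ‖p x‖² ∂ν := by
  rw [Lp.enorm_def, eLpNorm_eq_lintegral_rpow_enorm_toReal (by norm_num) (by norm_num),
    ← rpow_two, ← rpow_mul]
  simp

theorem enorm_sq_sigma [Countable ι] {F : Type*} [NormedAddCommGroup F]
    {p : Lp F 2 (sigmaMeasure μ)} {f : ι → X → F}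
    (hp : p =ᵐ[sigmaMeasure μ] fun x => f x.1 x.2) :
    ‖p‖² = ∑' i, ∫⁻ x, ‖f i x‖² ∂μ i := by
  rw [enorm_sq_eq_lintegral, lintegral_sigma]
  refine tsum_congr fun i => lintegral_congr_ae ?_
  filter_upwards [ae_sigma_iff.1 hp i] with x hx
  rw [hx]

theorem le_of_enorm_sq_le {a b : ℝ} (hb : 0 ≤ b) (h : ofReal a ≤ ofReal b) :
    a ≤ b := (ENNReal.ofReal_le_ofReal_iff hb).1 h

theorem ofReal_norm_sq {F : Type*} [NormedAddCommGroup F] (p : F) : ofReal (‖p‖ ^ 2) = ‖p‖² := by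
  rw [ofReal_pow (norm_nonneg _), ofReal_norm]

end Sigma

section LinearRelation

variable {V α F : Type*} [AddCommGroup V] [Module ℂ V] [MeasurableSpace α]
  [NormedAddCommGroup F] [NormedSpace ℂ F]

/-- Maps into functions that are linear up to null sets. -/
def IsAELinearOn (C : Submodule ℂ V) (ν : Measure α) (a : V → α → F) : Prop :=
  ∀ f ∈ C, ∀ g ∈ C, ∀ c : ℂ, a (f + c • g) =ᵐ[ν] a f + c • a g

/-- The graph in `V × L²` of a map into functions that is linear up to null sets. -/
def aeGraph (C : Submodule ℂ V) (ν : Measure α) (a : V → α → F) (h : IsAELinearOn C ν a) :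
    Submodule ℂ (V × Lp F 2 ν) where
  carrier := {z | z.1 ∈ C ∧ z.2 =ᵐ[ν] a z.1}
  zero_mem' := by
    refine ⟨C.zero_mem, ?_⟩
    have h1 := h 0 C.zero_mem 0 C.zero_mem (-1)
    rw [smul_zero, add_zero] at h1
    filter_upwards [h1, Lp.coeFn_zero F 2 ν] with x hx hx'
    simp only [Prod.fst_zero, Prod.snd_zero]
    rw [hx', hx]
    simp
  add_mem' := by
    rintro p q ⟨hp, hp'⟩ ⟨hq, hq'⟩
    refine ⟨C.add_mem hp hq, ?_⟩
    have h1 := h p.1 hp q.1 hq 1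
    rw [one_smul, one_smul] at h1
    filter_upwards [h1, Lp.coeFn_add p.2 q.2, hp', hq'] with x hx hx' hp'' hq''
    simp only [Prod.fst_add, Prod.snd_add]
    rw [hx', hx, Pi.add_apply, Pi.add_apply, hp'', hq'']
  smul_mem' := by
    rintro c p ⟨hp, hp'⟩
    refine ⟨C.smul_mem c hp, ?_⟩
    have h0 := h 0 C.zero_mem 0 C.zero_mem (-1)
    have h1 := h 0 C.zero_mem p.1 hp c
    rw [smul_zero, add_zero] at h0
    rw [zero_add] at h1
    filter_upwards [h0, h1, Lp.coeFn_smul c p.2, hp'] with x hx0 hx hx' hp''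
    simp only [Prod.smul_fst, Prod.smul_snd]
    rw [hx', hx, Pi.smul_apply, hp'', Pi.add_apply, hx0]
    simp

/-- The fibre product of two linear relations. -/
def joinRel {M N : Type*} [AddCommGroup M] [Module ℂ M] [AddCommGroup N] [Module ℂ N]
    (Γ : Submodule ℂ (V × M)) (Δ : Submodule ℂ (V × N)) : Submodule ℂ (V × (M × N)) :=
  Γ.comap (LinearMap.prodMap LinearMap.id (LinearMap.fst ℂ M N)) ⊓
    Δ.comap (LinearMap.prodMap LinearMap.id (LinearMap.snd ℂ M N))

theorem mem_joinRel {M N : Type*} [AddCommGroup M] [Module ℂ M] [AddCommGroup N] [Module ℂ N]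
    {Γ : Submodule ℂ (V × M)} {Δ : Submodule ℂ (V × N)} {z : V × (M × N)} :
    z ∈ joinRel Γ Δ ↔ (z.1, z.2.1) ∈ Γ ∧ (z.1, z.2.2) ∈ Δ := Iff.rfl

/-- The range of a linear relation. -/
def rangeRel {M : Type*} [AddCommGroup M] [Module ℂ M] (Γ : Submodule ℂ (V × M)) :
    Submodule ℂ M := Γ.map (LinearMap.snd ℂ V M)

theorem mem_rangeRel {M : Type*} [AddCommGroup M] [Module ℂ M] {Γ : Submodule ℂ (V × M)} {z : M} :
    z ∈ rangeRel Γ ↔ ∃ f, (f, z) ∈ Γ := by simp [rangeRel]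

end LinearRelation

section Multiplication

variable {α : Type*} [MeasurableSpace α] {ν : Measure α}

theorem memLp_mul_of_bounded {W : α → ℝ} (hW : AEStronglyMeasurable W ν) {C : ℝ}
    (hC : ∀ᵐ x ∂ν, |W x| ≤ C) {f : α → ℂ} (hf : MemLp f 2 ν) :
    MemLp (fun x => (W x : ℂ) * f x) 2 ν := by
  refine hf.of_le_mul (c := C)
    ((Complex.continuous_ofReal.comp_aestronglyMeasurable hW).mul hf.1) ?_
  filter_upwards [hC] with x hx
  rw [norm_mul, norm_real, norm_eq_abs]
  gcongr

/-- Multiplication by a bounded real function on `L²`. -/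
def mulOp (W : α → ℝ) (hW : AEStronglyMeasurable W ν) (C : ℝ) (hC : ∀ᵐ x ∂ν, |W x| ≤ C) :
    Lp ℂ 2 ν →L[ℂ] Lp ℂ 2 ν :=
  LinearMap.mkContinuous
    { toFun := fun f => (memLp_mul_of_bounded hW hC (Lp.memLp f)).toLp _
      map_add' := fun f g => by
        rw [← MemLp.toLp_add]
        refine (MemLp.toLp_eq_toLp_iff _ _).2 ?_
        filter_upwards [Lp.coeFn_add f g] with x hx
        simp only [hx, Pi.add_apply, mul_add]
      map_smul' := fun c f => by
        rw [RingHom.id_apply, ← MemLp.toLp_const_smul]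
        refine (MemLp.toLp_eq_toLp_iff _ _).2 ?_
        filter_upwards [Lp.coeFn_smul c f] with x hx
        simp only [hx, Pi.smul_apply, smul_eq_mul]
        ring } |C| (fun f => by
      simp only [LinearMap.coe_mk, AddHom.coe_mk]
      refine Lp.norm_le_mul_norm_of_ae_le_mul ?_
      filter_upwards [(memLp_mul_of_bounded hW hC (Lp.memLp f)).coeFn_toLp, hC] with x hx hx'
      rw [hx, norm_mul, norm_real, norm_eq_abs]
      exact mul_le_mul_of_nonneg_right (hx'.trans (le_abs_self C)) (norm_nonneg _))

variable {W : α → ℝ} {hW : AEStronglyMeasurable W ν} {C : ℝ} {hC : ∀ᵐ x ∂ν, |W x| ≤ C}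

theorem coeFn_mulOp (f : Lp ℂ 2 ν) : mulOp W hW C hC f =ᵐ[ν] fun x => (W x : ℂ) * f x :=
  (memLp_mul_of_bounded hW hC (Lp.memLp f)).coeFn_toLp

theorem inner_mulOp (f g : Lp ℂ 2 ν) :
    inner ℂ f (mulOp W hW C hC g) = ∫ x, (W x : ℂ) * inner ℂ (f x) (g x) ∂ν := by
  rw [L2.inner_def]
  refine integral_congr_ae ?_
  filter_upwards [coeFn_mulOp g] with x hx
  rw [hx, ← smul_eq_mul (W x : ℂ) (g x), inner_smul_right]

theorem isSymmetric_mulOp : (mulOp W hW C hC : Lp ℂ 2 ν →ₗ[ℂ] Lp ℂ 2 ν).IsSymmetric := fun f g => by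
  simp
  rw [inner_mulOp, ← inner_conj_symm, inner_mulOp, ← integral_conj]
  refine integral_congr_ae (of_forall fun x => ?_)
  simp only [map_mul, conj_ofReal, inner_conj_symm]

theorem re_inner_mulOp (f : Lp ℂ 2 ν) :
    (inner ℂ f (mulOp W hW C hC f)).re = ∫ x, W x * ‖f x‖ ^ 2 ∂ν := by
  have h : (fun x => (W x : ℂ) * inner ℂ (f x) (f x)) = fun x => ((W x * ‖f x‖ ^ 2 : ℝ) : ℂ) := by
    funext x
    rw [inner_self_eq_norm_sq_to_K]
    push_cast
    rfl
  rw [inner_mulOp, h, integral_complex_ofReal, ofReal_re]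

theorem integrable_mul_norm_sq {f : α → ℂ} (hW : AEStronglyMeasurable W ν)
    (hC : ∀ᵐ x ∂ν, |W x| ≤ C) (hf : MemLp f 2 ν) : Integrable (fun x => W x * ‖f x‖ ^ 2) ν := by
  refine ((memLp_two_iff_integrable_sq_norm hf.1).1 hf).bdd_mul (c := C) hW ?_
  filter_upwards [hC] with x hx
  rwa [norm_eq_abs]

theorem norm_sq_eq_integral {F : Type*} [NormedAddCommGroup F] (f : Lp F 2 ν) :
    ‖f‖ ^ 2 = ∫ x, ‖f x‖ ^ 2 ∂ν := by
  have h := ofReal_integral_norm_sq (Lp.memLp f)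
  rw [← enorm_sq_eq_lintegral, ← ofReal_norm_sq] at h
  exact ((ENNReal.ofReal_eq_ofReal_iff (integral_nonneg fun x => by positivity)
    (by positivity)).1 h).symm

theorem norm_sq_le_re_inner_mulOp (f : Lp ℂ 2 ν) :
    ‖f‖ ^ 2 ≤ (inner ℂ f (mulOp W hW C hC f)).re + (C + 1) * ‖f‖ ^ 2 := by
  have h1 : -C * ‖f‖ ^ 2 ≤ (inner ℂ f (mulOp W hW C hC f)).re := by
    rw [re_inner_mulOp, norm_sq_eq_integral, ← integral_const_mul]
    refine integral_mono_ae (((memLp_two_iff_integrable_sq_norm (Lp.memLp f).1).1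
      (Lp.memLp f)).const_mul _) (integrable_mul_norm_sq hW hC (Lp.memLp f)) ?_
    filter_upwards [hC] with x hx
    exact mul_le_mul_of_nonneg_right (abs_le.1 hx).1 (by positivity)
  linarith

end Multiplication

theorem tsum_le_of_finset_of_tail {ι : Type*} {η : ℝ} (hη : 0 < η) {a g r : ι → ENNReal}
    {F : Finset ι}
    (hF : ∀ i ∈ F, a i ≤ ofReal (η / 2) * (a i + g i) + r i)
    (htail : ∑' i, (F : Set ι)ᶜ.indicator a i ≤ ofReal (η / 2) * (∑' i, a i + ∑' i, g i)) :
    ∑' i, a i ≤ ofReal η * (∑' i, a i + ∑' i, g i) + ∑ i ∈ F, r i := by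
  have h1 : (∑' i, a i) = (∑ i ∈ F, a i) + ∑' i, (F : Set ι)ᶜ.indicator a i := by
    have h := Summable.tsum_add_tsum_compl (f := a) (s := F) ENNReal.summable ENNReal.summable
    rw [Finset.tsum_subtype' F a, tsum_subtype] at h
    exact h.symm
  have h2 : (∑ i ∈ F, a i) ≤ ofReal (η / 2) * ((∑' i, a i) + ∑' i, g i) + ∑ i ∈ F, r i := by
    refine (sum_le_sum hF).trans ?_
    rw [sum_add_distrib, ← mul_sum, ← tsum_add]
    exact add_le_add_left (mul_le_mul_right (ENNReal.sum_le_tsum F) _) _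
  have h3 : ofReal η = ofReal (η / 2) + ofReal (η / 2) := by
    rw [← ofReal_add (by positivity) (by positivity), add_halves]
  calc (∑' i, a i) = _ := h1
    _ ≤ _ := add_le_add h2 htail
    _ = _ := by rw [h3, add_mul, add_right_comm]

section Functionals

variable {ι X G : Type*} [Countable ι] [MeasurableSpace X] [NormedAddCommGroup G]
  [InnerProductSpace ℂ G] {μ : ι → Measure X}

theorem inner_indicatorConstLp_sigma {i : ι} {Q : Set X}
    (hm : MeasurableSet (Sigma.mk (β := fun _ : ι => X) i '' Q))
    (hf : sigmaMeasure μ (Sigma.mk (β := fun _ : ι => X) i '' Q) ≠ ∞) (hQ : MeasurableSet Q)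
    {p : L²(μ)} {f : ι → X → ℂ}
    (hp : p =ᵐ[sigmaMeasure μ] fun x => f x.1 x.2) :
    inner ℂ (indicatorConstLp 2 hm hf (1 : ℂ)) p = ∫ x in Q, f i x ∂μ i := by
  rw [L2.inner_indicatorConstLp_one, ← integral_indicator hm, ← integral_indicator hQ]
  refine (hasSum_integral_sigma ((integrableOn_Lp_of_measure_ne_top p fact_one_le_two_ennreal.elim
    hf).integrable_indicator hm)).unique ?_
  have h1 : ∫ x, (Sigma.mk i '' Q).indicator p ⟨i, x⟩ ∂μ i = ∫ x, Q.indicator (f i) x ∂μ i := by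
    refine integral_congr_ae ?_
    filter_upwards [ae_sigma_iff.1 hp i] with x hx
    by_cases hxQ : x ∈ Q
    · rw [indicator_of_mem hxQ, indicator_of_mem (mem_image_of_mem _ hxQ), hx]
    · rw [indicator_of_notMem hxQ, indicator_of_notMem]
      rintro ⟨y, hy, hyx⟩
      exact hxQ (sigma_mk_injective hyx ▸ hy)
  rw [← h1]
  refine hasSum_single i fun j hj => ?_
  rw [← integral_zero X ℂ]
  congr 1
  funext x
  rw [indicator_of_notMem]
  rintro ⟨y, hy, hyx⟩
  exact hj (congrArg Sigma.fst hyx).symm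

/-- Small tails and compactness on each piece give compactness on a disjoint union. -/
theorem exists_functionals (D : (X → ℂ) → X → G) (C : Set (ι → X → ℂ))
    (hpiece : ∀ i, ∀ η > 0, ∃ (n : ℕ) (Q : Fin n → Set X) (c : Fin n → NNReal),
      (∀ l, MeasurableSet (Q l) ∧ μ i (Q l) ≠ ∞) ∧ ∀ f ∈ C, MemLp (f i) 2 (μ i) →
        ∫⁻ x, ‖f i x‖² ∂μ i ≤ ofReal η * ((∫⁻ x, ‖f i x‖² ∂μ i) + ∫⁻ x, ‖D (f i) x‖² ∂μ i) +
          ∑ l, c l * ‖∫ x in Q l, f i x ∂μ i‖²)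
    (htail : ∀ η > 0, ∃ F : Finset ι, ∀ f ∈ C, (∀ i, MemLp (f i) 2 (μ i)) →
      ∑' i, (F : Set ι)ᶜ.indicator (fun i => ∫⁻ x, ‖f i x‖² ∂μ i) i ≤ ofReal η *
        ((∑' i, ∫⁻ x, ‖f i x‖² ∂μ i) + ∑' i, ∫⁻ x, ‖D (f i) x‖² ∂μ i))
    {η : ℝ} (hη : 0 < η) :
    ∃ (n : ℕ) (h : Fin n → L²(μ)), ∀ (p : L²(μ) × Lp G 2 (sigmaMeasure μ)) (f : ι → X → ℂ), f ∈ C →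
        p.1 =ᵐ[sigmaMeasure μ] (fun x => f x.1 x.2) →
        p.2 =ᵐ[sigmaMeasure μ] (fun x => D (f x.1) x.2) →
        ‖p.1‖ ^ 2 ≤ η * (‖p.1‖ ^ 2 + ‖p.2‖ ^ 2) + ∑ i, ‖inner ℂ (h i) p.1‖ ^ 2 := by
  classical
  obtain ⟨F, hF⟩ := htail (η / 2) (half_pos hη)
  choose n Q c hQ hbound using fun i => hpiece i (η / 2) (half_pos hη)
  have hQm := fun i l =>
    (measEmb_sigmaMk i).measurableSet_image.2 (hQ i l).1
  have hQf : ∀ i l, sigmaMeasure μ (Sigma.mk i '' Q i l) ≠ ∞ := fun i l => by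
    rw [sigmaMeasure_image_mk]; exact (hQ i l).2
  let J := Σ i : {i // i ∈ F}, Fin (n i.1)
  let h₀ : J → L²(μ) := fun z =>
    ((sqrt (c z.1.1 z.2) : ℝ) : ℂ) • indicatorConstLp 2 (hQm z.1.1 z.2) (hQf z.1.1 z.2) 1
  let e := Fintype.equivFin J
  refine ⟨Fintype.card J, fun i => h₀ (e.symm i), fun p f hf hp1 hp2 => ?_⟩
  rw [Equiv.sum_comp e.symm fun z => ‖inner ℂ (h₀ z) p.1‖ ^ 2]
  have hfL := fun i =>
    (memLp_congr_ae (ae_sigma_iff.1 hp1 i)).1 (memLp_sigma_mk (Lp.memLp p.1) i)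
  have hinner : ∀ z, ‖inner ℂ (h₀ z) p.1‖² =
      (c z.1.1 z.2 : ENNReal) * ‖∫ x in Q z.1.1 z.2, f z.1.1 x ∂μ z.1.1‖² := fun z => by
    rw [inner_smul_left, inner_indicatorConstLp_sigma (hQm z.1.1 z.2) (hQf z.1.1 z.2)
      (hQ z.1.1 z.2).1 hp1,
      enorm_mul, mul_pow]
    congr 1
    rw [conj_ofReal, ← ofReal_norm_sq, norm_real, norm_eq_abs, sq_abs,
      sq_sqrt NNReal.zero_le_coe, ENNReal.ofReal_coe_nnreal]
  have key := tsum_le_of_finset_of_tail hη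
   
    (fun i _ => hbound i f hf (hfL i)) (hF f hf hfL)
  have hsum : ∑ i ∈ F, ∑ l, (c i l : ENNReal) * ‖∫ x in Q i l, f i x ∂μ i‖² =
      ∑ z : J, ‖inner ℂ (h₀ z) p.1‖² := by
    rw [sum_congr rfl fun z _ => hinner z, Fintype.sum_sigma]
    exact (Finset.sum_coe_sort F fun i => ∑ l, (c i l : ENNReal) * ‖∫ x in Q i l, f i x ∂μ i‖²).symm
  rw [hsum, ← enorm_sq_sigma hp1, ← enorm_sq_sigma (f := fun i => D (f i)) hp2] at key
  refine le_of_enorm_sq_le (by positivity) ?_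
  rw [ofReal_add (by positivity) (by positivity), ofReal_mul hη.le,
    ofReal_add (by positivity) (by positivity),
    ENNReal.ofReal_sum_of_nonneg fun i _ => by positivity]
  simpa using key

end Functionals

section Radial

variable {l : ℕ → ℝ} {q : ℝ} {g : ℕ → ℝ → ℝ} {G : ℕ → ℝ} {E : ℝ}

theorem abs_sub_le_sum_sqrt (hl : ∀ n, 0 < l n)
    (hosc : ∀ n, ∀ θ ∈ Icc 0 (l n), ∀ θ' ∈ Icc 0 (l n), |g n θ - g n θ'| ≤ √(l n * G n))
    (hglue : ∀ n, g (n + 1) 0 = g n (l n)) {n m : ℕ} (hnm : n ≤ m) :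
    ∀ θ ∈ Icc 0 (l n), ∀ s ∈ Icc 0 (l m),
      |g n θ - g m s| ≤ ∑ i ∈ Finset.Icc n m, √(l i * G i) := by
  induction m, hnm using Nat.le_induction with
  | base => simpa using hosc n
  | succ m hnm ih =>
    intro θ hθ s hs
    rw [← Finset.insert_Icc_right_eq_Icc_add_one (by omega), Finset.sum_insert (by simp),
      add_comm (√ _)]
    calc |g n θ - g (m + 1) s| ≤ |g n θ - g m (l m)| + |g m (l m) - g (m + 1) s| := abs_sub_le _ _ _
      _ ≤ _ := by
        refine add_le_add (ih θ hθ _ ⟨(hl m).le, le_rfl⟩) ?_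
        rw [← hglue]
        exact hosc (m + 1) _ ⟨le_rfl, (hl _).le⟩ s hs

theorem sq_sum_sqrt_le (hl : ∀ n, 0 < l n) (hq : 0 < q) (hG : ∀ n, 0 ≤ G n)
    (hE : ∀ s : Finset ℕ, ∑ i ∈ s, q ^ i * G i ≤ E) (s : Finset ℕ) :
    (∑ i ∈ s, √(l i * G i)) ^ 2 ≤ (∑ i ∈ s, l i / q ^ i) * E := by
  have h1 : ∑ i ∈ s, √(l i * G i) ≤ √(∑ i ∈ s, l i / q ^ i) * √(∑ i ∈ s, q ^ i * G i) := by
    refine le_trans (le_of_eq (sum_congr rfl fun i _ => ?_)) (Real.sum_sqrt_mul_sqrt_le s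
        (fun i => by have := hl i; positivity) (fun i => by have := hG i; positivity))
    rw [← Real.sqrt_mul (by have := hl i; positivity)]
    congr 1
    field_simp
  have h0 : 0 ≤ ∑ i ∈ s, l i / q ^ i := sum_nonneg fun i _ => by have := hl i; positivity
  have h0' : 0 ≤ ∑ i ∈ s, q ^ i * G i := sum_nonneg fun i _ => by have := hG i; positivity
  calc (∑ i ∈ s, √(l i * G i)) ^ 2 ≤ (√(∑ i ∈ s, l i / q ^ i) * √(∑ i ∈ s, q ^ i * G i)) ^ 2 :=
        pow_le_pow_left₀ (sum_nonneg fun i _ => Real.sqrt_nonneg _) h1 2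
    _ = (∑ i ∈ s, l i / q ^ i) * ∑ i ∈ s, q ^ i * G i := by rw [mul_pow, sq_sqrt h0, sq_sqrt h0']
    _ ≤ _ := mul_le_mul_of_nonneg_left (hE s) h0

theorem exists_radial_bound (hl : ∀ n, 0 < l n) (hs : Summable l) (hq : 0 < q) :
    ∃ b : ℕ → ℝ, (∀ n, 0 ≤ b n) ∧ Summable (fun n => l n * b n) ∧
      ∀ (g : ℕ → ℝ → ℝ) (G m : ℕ → ℝ) (E : ℝ), (∀ n, 0 ≤ G n) →
        (∀ n, ∀ θ ∈ Icc 0 (l n), ∀ θ' ∈ Icc 0 (l n), |g n θ - g n θ'| ≤ √(l n * G n)) →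
        (∀ n, g (n + 1) 0 = g n (l n)) → g 0 0 = 0 →
        (∀ s : Finset ℕ, ∑ i ∈ s, q ^ i * G i ≤ E) → Summable m →
        (∀ i e, 0 ≤ e → (∀ θ ∈ Icc 0 (l i), e ≤ g i θ ^ 2) → q ^ i * l i * e ≤ m i) →
        ∀ n, ∀ θ ∈ Icc 0 (l n), q ^ n * g n θ ^ 2 ≤ b n * E := by
  by_cases hsum : Summable fun n => max 1 q ^ n * l n
  · refine ⟨fun n => max 1 q ^ n * ∑' i, l i, fun n => ?_, ?_, ?_⟩
    · have : 0 ≤ ∑' i, l i := tsum_nonneg fun i => (hl i).le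
      positivity
    · refine (hsum.mul_right (∑' i, l i)).congr fun n => ?_
      ring
    · intro g G m E hG hosc hglue hroot hE _ _ n θ hθ
      have h1 := abs_sub_le_sum_sqrt hl hosc hglue (Nat.zero_le n) 0 ⟨le_rfl, (hl 0).le⟩ θ hθ
      rw [hroot, zero_sub, abs_neg] at h1
      have h3 : g n θ ^ 2 ≤ (∑ i ∈ Finset.Icc 0 n, √(l i * G i)) ^ 2 := by
        rw [← sq_abs]
        exact pow_le_pow_left₀ (abs_nonneg _) h1 2
      have hE0 : 0 ≤ E := by simpa using hE ∅
      calc q ^ n * g n θ ^ 2 ≤ q ^ n * ((∑ i ∈ Finset.Icc 0 n, l i / q ^ i) * E) :=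
            mul_le_mul_of_nonneg_left (h3.trans (sq_sum_sqrt_le hl hq hG hE (Finset.Icc 0 n)))
              (by positivity)
        _ = (∑ i ∈ Finset.Icc 0 n, q ^ n * (l i / q ^ i)) * E := by rw [← mul_assoc, mul_sum]
        _ ≤ (∑ i ∈ Finset.Icc 0 n, max 1 q ^ n * l i) * E := by
            refine mul_le_mul_of_nonneg_right (sum_le_sum fun i hi => ?_) hE0
            have h4 : q ^ n / q ^ i ≤ max 1 q ^ n := by
              rw [div_eq_mul_inv, ← pow_sub₀ _ hq.ne' ((Finset.mem_Icc.1 hi).2)]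
              calc q ^ (n - i) ≤ max 1 q ^ (n - i) := pow_le_pow_left₀ hq.le (le_max_right _ _) _
                _ ≤ max 1 q ^ n := pow_le_pow_right₀ (le_max_left _ _) (Nat.sub_le _ _)
            calc q ^ n * (l i / q ^ i) = q ^ n / q ^ i * l i := by ring
              _ ≤ _ := mul_le_mul_of_nonneg_right h4 (hl i).le
        _ ≤ _ := by
            rw [← mul_sum]
            refine mul_le_mul_of_nonneg_right ?_ hE0
            exact mul_le_mul_of_nonneg_left (hs.sum_le_tsum _ fun i _ => (hl i).le) (by positivity)
  · have hq1 : 1 < q := by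
      by_contra h
      exact hsum (by simpa [max_eq_left (not_lt.1 h)] using hs)
    have hr : ∀ n, 0 ≤ ∑' i, l (i + n) := fun n => tsum_nonneg fun i => (hl _).le
    refine ⟨fun n => 2 * ∑' i, l (i + n), fun n => by have := hr n; positivity, ?_, ?_⟩
    · refine Summable.of_nonneg_of_le (fun n => by have := hr n; have := hl n; positivity)
        (fun n => ?_) (hs.mul_right (2 * ∑' i, l i))
      refine mul_le_mul_of_nonneg_left ?_ (hl n).le
      refine mul_le_mul_of_nonneg_left ?_ zero_le_two
      rw [← hs.sum_add_tsum_nat_add n]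
      exact le_add_of_nonneg_left (sum_nonneg fun i _ => (hl i).le)
    · intro g G m E hG hosc hglue _ hE hm hmass n θ hθ
      have hE0 : 0 ≤ E := by simpa using hE ∅
      rw [max_eq_right hq1.le] at hsum
      have hsmall : ∀ e > 0, ∃ i ≥ n, ∃ s ∈ Icc 0 (l i), g i s ^ 2 < e := fun e he => by
        by_contra! hcon
        refine hsum ((summable_nat_add_iff n).1 ?_)
        refine Summable.of_nonneg_of_le (fun i => by have := hl (i + n); positivity) (fun i => ?_)
          (((summable_nat_add_iff n).2 hm).div_const e)
        rw [le_div_iff₀ he]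
        exact hmass (i + n) e he.le fun θ hθ => hcon (i + n) (by omega) θ hθ
      refine le_of_forall_pos_le_add fun e he => ?_
      obtain ⟨i, hi, s, hs', hgs⟩ := hsmall (e / (2 * q ^ n)) (by positivity)
      have h3 : ∑ j ∈ Finset.Icc n i, l j / q ^ j ≤ (∑' j, l (j + n)) / q ^ n := by
        calc ∑ j ∈ Finset.Icc n i, l j / q ^ j ≤ ∑ j ∈ Finset.Icc n i, l j / q ^ n := by
              refine sum_le_sum fun j hj => ?_
              exact div_le_div_of_nonneg_left (hl j).le (by positivity)
                (pow_le_pow_right₀ hq1.le (Finset.mem_Icc.1 hj).1)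
          _ = (∑ j ∈ Finset.Icc n i, l j) / q ^ n := by rw [Finset.sum_div]
          _ ≤ _ := by
              refine div_le_div_of_nonneg_right ?_ (by positivity)
              rw [← Finset.Ico_add_one_right_eq_Icc, Finset.sum_Ico_eq_sum_range]
              simp_rw [add_comm n]
              exact ((summable_nat_add_iff n).2 hs).sum_le_tsum _ fun i _ => (hl _).le
      have h4 : (g n θ - g i s) ^ 2 ≤ (∑' j, l (j + n)) / q ^ n * E := by
        rw [← sq_abs]
        exact (pow_le_pow_left₀ (abs_nonneg _) (abs_sub_le_sum_sqrt hl hosc hglue hi θ hθ s hs')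
          2).trans
          ((sq_sum_sqrt_le hl hq hG hE (Finset.Icc n i)).trans (mul_le_mul_of_nonneg_right h3 hE0))
      have h5 : g n θ ^ 2 ≤ 2 * (g n θ - g i s) ^ 2 + 2 * g i s ^ 2 := by
        nlinarith [sq_nonneg (g n θ - 2 * g i s)]
      have hqn : 0 < q ^ n := by positivity
      calc q ^ n * g n θ ^ 2
          ≤ q ^ n * (2 * ((∑' j, l (j + n)) / q ^ n * E) + 2 * (e / (2 * q ^ n))) := by
            refine mul_le_mul_of_nonneg_left ?_ hqn.le
            linarith
        _ = _ := by field_simp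

end Radial

theorem tsum_edge {k : ℕ} (F : Edge k → ENNReal) : ∑' w, F w = ∑' n, ∑ w : Word k n, F w.1 := by
  rw [← (Equiv.sigmaFiberEquiv (List.length)).tsum_eq, ENNReal.tsum_sigma']
  refine tsum_congr fun n => ?_
  exact tsum_fintype (L := .unconditional _) (fun w : Word k n => F w.1)

theorem sum_vector_succ {k : ℕ} {M : Type*} [AddCommMonoid M] (n : ℕ) (F : Edge k → M) :
    ∑ w : Word k (n + 1), F w.1 = ∑ w : Word k n, ∑ j, F (j :: w.1) := by
  let e : Word k n × Fin k ≃ Word k (n + 1) :=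
    { toFun := fun p => p.2 ::ᵥ p.1
      invFun := fun v => (v.tail, v.head)
      left_inv := fun p => by simp
      right_inv := fun v => by simp }
  rw [← e.sum_comp, Fintype.sum_prod_type]
  rfl

theorem tsum_indicator_edge_le {k : ℕ} {F : Edge k → ENNReal} {a : ℕ → ENNReal} {E : ENNReal}
    (h : ∀ n, ∑ w : Word k n, F w.1 ≤ a n * E) (N : ℕ) :
    ∑' w, {w : Edge k | N ≤ w.length}.indicator F w ≤ (∑' n, a (n + N)) * E := by
  rw [tsum_edge, ← ENNReal.tsum_mul_right, ← (add_left_injective N).tsum_eq]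
  · refine tsum_le_tsum fun n => le_trans (sum_le_sum fun w _ => ?_) (h (n + N))
    exact indicator_le_self _ _ _
  · intro n hn
    by_contra hn'
    refine hn (Finset.sum_eq_zero fun w _ => indicator_of_notMem ?_ _)
    rw [mem_ofPred_eq, w.2]
    exact fun hle => hn' ⟨n - N, Nat.sub_add_cancel hle⟩

namespace Data

variable {d k : ℕ} (T : Data d k)

theorem volume_Ω_ne_zero : volume T.Ω ≠ 0 :=
  (T.Ω_lipschitz.isOpen.measure_pos volume ⟨0, T.zero_mem_Ω⟩).ne'

theorem volume_Ω_ne_top : volume T.Ω ≠ ∞ := T.Ω_lipschitz.isBounded.measure_lt_top.ne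

theorem weight_ne_top (w : Edge k) : T.weight w ≠ ∞ := mul_ne_top ofReal_ne_top T.volume_Ω_ne_top

theorem weight_ne_zero (w : Edge k) : T.weight w ≠ 0 :=
  mul_ne_zero (ENNReal.ofReal_pos.2 (pow_pos T.δ_pos _)).ne' T.volume_Ω_ne_zero

/-- The squared `L²` norm of a function on the tree. -/
def treeMass (v : EdgeFun k) : ENNReal := ∑' w, ∫⁻ θ, ‖v w θ‖² ∂T.treeMeasure w

/-- The squared `L²` norm of the derivative of a function on the tree. -/
def treeEnergy (v : EdgeFun k) : ENNReal := T.treeMass fun w => deriv (v w)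

theorem lintegral_treeMeasure (w : Edge k) (F : ℝ → ENNReal) :
    ∫⁻ θ, F θ ∂T.treeMeasure w = T.weight w * ∫⁻ θ in I(T, w), F θ :=
  lintegral_smul_measure _ _

variable {T} {c : EndCondition} {v : EdgeFun k}

theorem IsTreeTest.differentiableAt (hv : T.IsTreeTest c v) (w : Edge k) {θ : ℝ}
    (hθ : θ ∈ I(T, w)) : DifferentiableAt ℝ (v w) θ :=
  ((hv.contDiff w).differentiableOn one_ne_zero).differentiableAt (Icc_mem_nhds hθ.1 hθ.2)

theorem IsTreeTest.enorm_sub_sq_le (hv : T.IsTreeTest c v) (w : Edge k) {θ θ' : ℝ}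
    (hθ : θ ∈ Icc 0 ℓ(T, w)) (hθ' : θ' ∈ Icc 0 ℓ(T, w)) :
    ‖v w θ - v w θ'‖² ≤ ofReal |θ - θ'| * ∫⁻ x in I(T, w), ‖deriv (v w) x‖² := by
  wlog h : θ' ≤ θ generalizing θ θ'
  · rw [enorm_sub_rev, abs_sub_comm]
    exact this hθ' hθ (le_of_not_ge h)
  have hsub := Ioo_subset_Ioo hθ'.1 hθ.2
  rw [abs_of_nonneg (sub_nonneg.2 h)]
  refine (enorm_sub_sq_le_lintegral_deriv h ((hv.contDiff w).continuousOn.mono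
    (Icc_subset_Icc hθ'.1 hθ.2)) fun x hx => hv.differentiableAt w (hsub hx)).trans ?_
  exact mul_le_mul_right (lintegral_mono_set hsub) _

variable (T) in
/-- The root mean square of a function on the tree over the points at a given distance to the
root, with a factor. -/
def radial (v : EdgeFun k) (n : ℕ) (θ : ℝ) : ℝ := √((volume T.Ω).toReal / k ^ n) *
    ‖(toLp 2 fun w : Word k n => v w.1 θ : EuclideanSpace ℂ (Word k n))‖

theorem ofReal_radial_sq (hk : 1 ≤ k) (n : ℕ) (θ : ℝ) :
    ofReal ((k * T.δ ^ d) ^ n * T.radial v n θ ^ 2) =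
      ∑ w : Word k n, T.weight w.1 * ‖v w.1 θ‖² := by
  have hk0 : 0 < k := by exact_mod_cast hk
  have hδ := T.δ_pos
  rw [radial, mul_pow (√ _), sq_sqrt (by positivity), norm_sq_eq]
  have h : (k * T.δ ^ d) ^ n * ((volume T.Ω).toReal / k ^ n * ∑ w : Word k n, ‖v w.1 θ‖ ^ 2) =
      ∑ w : Word k n, T.δ ^ (d * n) * (volume T.Ω).toReal * ‖v w.1 θ‖ ^ 2 := by
    rw [← mul_sum, mul_pow, pow_mul]
    field_simp
  rw [h, ENNReal.ofReal_sum_of_nonneg fun w _ => by positivity]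
  refine sum_congr rfl fun w _ => ?_
  rw [ofReal_mul (by positivity), ofReal_mul (by positivity),
    ofReal_toReal T.volume_Ω_ne_top, ofReal_norm_sq, weight, w.2]

theorem abs_radial_sub_le (hk : 1 ≤ k) (hv : T.IsTreeTest c v) (hE : T.treeEnergy v ≠ ∞) (n : ℕ)
    {θ θ' : ℝ} (hθ : θ ∈ Icc 0 (T.len n)) (hθ' : θ' ∈ Icc 0 (T.len n)) :
    |T.radial v n θ - T.radial v n θ'| ≤
      √(T.len n * ((∑ w : Word k n,
        ∫⁻ x, ‖deriv (v w.1) x‖² ∂T.treeMeasure w.1).toReal / (k * T.δ ^ d) ^ n)) := by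
  have hk0 : 0 < k := by exact_mod_cast hk
  have hδ := T.δ_pos
  refine Real.le_sqrt_of_sq_le ?_
  rw [radial, radial, ← mul_sub, abs_mul, mul_pow, sq_abs, sq_sqrt (by positivity)]
  have hfin := fun w =>
    ne_top_of_le_ne_top hE (le_tsum w)
  have h1 : |‖(toLp 2 fun w : Word k n => v w.1 θ : EuclideanSpace ℂ (Word k n))‖ -
      ‖(toLp 2 fun w : Word k n => v w.1 θ' :
      EuclideanSpace ℂ (Word k n))‖| ^ 2 ≤
      ∑ w : Word k n, ‖v w.1 θ - v w.1 θ'‖ ^ 2 := by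
    refine (pow_le_pow_left₀ (abs_nonneg _) (abs_norm_sub_norm_le _ _) 2).trans ?_
    rw [norm_sq_eq]
    rfl
  rw [ENNReal.toReal_sum fun w _ => hfin w.1]
  refine (mul_le_mul_of_nonneg_left h1 (by positivity)).trans ?_
  rw [mul_sum, Finset.sum_div, mul_sum]
  refine sum_le_sum fun w _ => ?_
  have hle : |θ - θ'| ≤ T.len n := abs_le.2 ⟨by linarith [hθ.1, hθ'.2], by linarith [hθ.2, hθ'.1]⟩
  have hf := hfin w.1
  rw [lintegral_treeMeasure] at hf ⊢
  have hf' : ∫⁻ x in Ioo 0 (T.len w.1.length), ‖deriv (v w.1) x‖² ≠ ∞ := fun h =>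
    hf (by rw [h, mul_top (T.weight_ne_zero _)])
  have h3 : ‖v w.1 θ - v w.1 θ'‖ ^ 2 ≤
      T.len n * (∫⁻ x in Ioo 0 (T.len w.1.length), ‖deriv (v w.1) x‖²).toReal := by
    rw [← ENNReal.ofReal_le_ofReal_iff (mul_nonneg (T.len_pos n).le ENNReal.toReal_nonneg),
      ofReal_norm_sq, ofReal_mul (T.len_pos n).le, ofReal_toReal hf']
    exact (hv.enorm_sub_sq_le w.1 (θ := θ) (by rwa [w.2]) (by rwa [w.2])).trans
      (mul_le_mul_left (ofReal_le_ofReal hle) _)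
  have h4 : (T.weight w.1).toReal = T.δ ^ (d * n) * (volume T.Ω).toReal := by
    rw [weight, w.2, toReal_mul, toReal_ofReal (by positivity)]
  refine (mul_le_mul_of_nonneg_left h3 (by positivity)).trans (le_of_eq ?_)
  rw [toReal_mul, h4, mul_pow, pow_mul]
  field_simp

theorem radial_succ_zero (hk : 1 ≤ k) (hv : T.IsTreeTest c v) (n : ℕ) :
    T.radial v (n + 1) 0 = T.radial v n (T.len n) := by
  have hk0 : 0 < k := by exact_mod_cast hk
  rw [radial, radial, norm_eq, norm_eq,
    ← Real.sqrt_mul (by positivity), ← Real.sqrt_mul (by positivity)]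
  congr 1
  have h : ∑ w : Word k (n + 1), ‖v w.1 0‖ ^ 2 = k * ∑ w : Word k n, ‖v w.1 (T.len n)‖ ^ 2 := by
    rw [sum_vector_succ n fun w => ‖v w 0‖ ^ 2, mul_sum]
    refine sum_congr rfl fun w _ => ?_
    simp only [hv.continuous, w.2, Finset.sum_const, Finset.card_univ, Fintype.card_fin,
      nsmul_eq_mul]
  change _ * ∑ w : Word k (n + 1), ‖v w.1 0‖ ^ 2 = _
  rw [h, pow_succ]
  field_simp

theorem radial_zero_zero (hv : T.IsTreeTest c v) : T.radial v 0 0 = 0 := by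
  have h : (toLp 2 fun w : Word k 0 => v w.1 0 : EuclideanSpace ℂ (Word k 0)) = 0 := by
    ext w
    simp [List.length_eq_zero_iff.1 w.2, hv.root]
  rw [radial, h, norm_zero, mul_zero]

variable (T) in
/-- The mean square of a test function over a generation is bounded by its energy, with a factor
that is integrable over the tree. -/
theorem exists_treeBound (hk : 1 ≤ k) : ∃ b : ℕ → ℝ, (∀ n, 0 ≤ b n) ∧
    Summable (fun n => T.len n * b n) ∧ ∀ (c : EndCondition) (v : EdgeFun k),
      T.IsTreeTest c v → T.treeMass v ≠ ∞ → T.treeEnergy v ≠ ∞ →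
      ∀ n, ∀ θ ∈ Icc 0 (T.len n), ∑ w : Word k n, T.weight w.1 * ‖v w.1 θ‖² ≤
        ofReal (b n) * T.treeEnergy v := by
  have hk0 : 0 < k := by exact_mod_cast hk
  have hδ := T.δ_pos
  obtain ⟨b, hb, hbs, hbound⟩ := exists_radial_bound T.len_pos T.len_summable
    (q := k * T.δ ^ d) (by positivity)
  refine ⟨b, hb, hbs, fun c v hv hM hE n θ hθ => ?_⟩
  have hsumfin : ∀ {F : Edge k → ENNReal}, ∑' w, F w ≠ ∞ →
      ∑' n, ∑ w : Word k n, F w.1 ≠ ∞ := fun h => by rwa [← tsum_edge]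
  have hM' := hsumfin hM
  have key := hbound (T.radial v) (fun n => (∑ w : Word k n,
        ∫⁻ x, ‖deriv (v w.1) x‖² ∂T.treeMeasure w.1).toReal / (k * T.δ ^ d) ^ n)
      (fun n => (∑ w : Word k n,
        ∫⁻ x, ‖v w.1 x‖² ∂T.treeMeasure w.1).toReal) (T.treeEnergy v).toReal
      (fun n => by positivity)
      (fun n θ hθ θ' hθ' => abs_radial_sub_le hk hv hE n hθ hθ')
      (radial_succ_zero hk hv) (radial_zero_zero hv) ?_ (ENNReal.summable_toReal hM') ?_ n θ hθ
  · rw [← ofReal_radial_sq hk]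
    refine (ofReal_le_ofReal key).trans (le_of_eq ?_)
    rw [ofReal_mul (hb n), ofReal_toReal hE]
  · intro s
    have h1 : ∀ i, (k * T.δ ^ d) ^ i * ((∑ w : Word k i,
        ∫⁻ x, ‖deriv (v w.1) x‖² ∂T.treeMeasure w.1).toReal / (k * T.δ ^ d) ^ i) =
        (∑ w : Word k i,
          ∫⁻ x, ‖deriv (v w.1) x‖² ∂T.treeMeasure w.1).toReal := fun i => by field_simp
    rw [sum_congr rfl fun i _ => h1 i,
      ← ENNReal.toReal_sum fun i _ => ne_top_of_le_ne_top (hsumfin hE) (le_tsum i)]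
    refine ENNReal.toReal_mono hE ?_
    rw [treeEnergy, treeMass, tsum_edge]
    exact ENNReal.sum_le_tsum s
  · intro i e he hi
    have hfin := ne_top_of_le_ne_top hM' (le_tsum i)
    rw [← ENNReal.ofReal_le_iff_le_toReal hfin]
    have hm : ∀ w : Word k i, AEMeasurable (fun x => T.weight w.1 * ‖v w.1 x‖²)
        (volume.restrict (Ioo 0 (T.len i))) := fun w => by
      have h := (hv.contDiff w.1).continuousOn
      rw [w.2] at h
      exact (((h.mono Ioo_subset_Icc_self).aestronglyMeasurable
        measurableSet_Ioo).enorm.pow_const 2).const_mul _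
    calc ofReal ((k * T.δ ^ d) ^ i * T.len i * e)
        = ∫⁻ θ in Ioo 0 (T.len i), ofReal ((k * T.δ ^ d) ^ i * e) := by
          rw [setLIntegral_const, volume_Ioo, sub_zero, ← ofReal_mul (by positivity)]
          congr 1; ring
      _ ≤ ∫⁻ θ in Ioo 0 (T.len i), ∑ w : Word k i, T.weight w.1 * ‖v w.1 θ‖² := by
          refine setLIntegral_mono' measurableSet_Ioo fun θ hθ => ?_
          rw [← ofReal_radial_sq hk]
          exact ofReal_le_ofReal (mul_le_mul_of_nonneg_left
            (hi θ (Ioo_subset_Icc_self hθ)) (by positivity))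
      _ = _ := by
          rw [lintegral_finsetSum' _ fun w _ => hm w]
          refine sum_congr rfl fun w _ => ?_
          rw [lintegral_treeMeasure, w.2, lintegral_const_mul' _ _ (T.weight_ne_top _)]

variable (T) in
theorem exists_treeTail (hk : 1 ≤ k) : ∃ (b : ℕ → ℝ) (R : ℕ → ENNReal), Tendsto R atTop (𝓝 0) ∧
    (∀ N, R N ≠ ∞) ∧ ∀ (c : EndCondition) (v : EdgeFun k),
      T.IsTreeTest c v → T.treeMass v ≠ ∞ → T.treeEnergy v ≠ ∞ →
      (∀ w, ∀ θ ∈ Icc 0 ℓ(T, w), T.weight w * ‖v w θ‖² ≤ ofReal (b w.length) * T.treeEnergy v) ∧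
      ∀ N, ∑' w, {w : Edge k | N ≤ w.length}.indicator
          (fun w => ∫⁻ x, ‖v w x‖² ∂T.treeMeasure w) w ≤ R N * T.treeEnergy v ∧
        ∑' w, {w : Edge k | N ≤ w.length}.indicator (fun w => ofReal ℓ(T, w) *
            (T.weight w * ‖v w ℓ(T, w)‖²)) w ≤ R N * T.treeEnergy v := by
  obtain ⟨b, hb, hbs, hbound⟩ := T.exists_treeBound hk
  have hfin := hbs.tsum_ofReal_ne_top
  refine ⟨b, fun N => ∑' n, ofReal (T.len (n + N) * b (n + N)),
    ENNReal.tendsto_sum_nat_add _ hfin, fun N => ?_, fun c v hv hM hE => ⟨?_, fun N => ⟨?_, ?_⟩⟩⟩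
  · refine ne_top_of_le_ne_top hfin ?_
    exact ENNReal.tsum_comp_le_tsum_of_injective (add_left_injective N)
      fun n => ofReal (T.len n * b n)
  · intro w θ hθ
    refine le_trans ?_ (hbound c v hv hM hE w.length θ hθ)
    exact Finset.single_le_sum (f := fun w : Word k _ =>
      T.weight w.1 * ‖v w.1 θ‖²) (fun _ _ => zero_le)
      (Finset.mem_univ ⟨w, rfl⟩)
  · refine tsum_indicator_edge_le (a := fun n => ofReal (T.len n * b n)) (fun n => ?_) N
    have hm : ∀ w : Word k n, AEMeasurable (fun x => T.weight w.1 * ‖v w.1 x‖²)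
        (volume.restrict (Ioo 0 (T.len n))) := fun w => by
      have h := (hv.contDiff w.1).continuousOn
      rw [w.2] at h
      exact (((h.mono Ioo_subset_Icc_self).aestronglyMeasurable
        measurableSet_Ioo).enorm.pow_const 2).const_mul _
    calc ∑ w : Word k n, ∫⁻ x, ‖v w.1 x‖² ∂T.treeMeasure w.1
        = ∫⁻ θ in Ioo 0 (T.len n), ∑ w : Word k n, T.weight w.1 * ‖v w.1 θ‖² := by
          rw [lintegral_finsetSum' _ fun w _ => hm w]
          refine sum_congr rfl fun w _ => ?_
          rw [lintegral_treeMeasure, w.2, lintegral_const_mul' _ _ (T.weight_ne_top _)]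
      _ ≤ ∫⁻ θ in Ioo 0 (T.len n), ofReal (b n) * T.treeEnergy v :=
          setLIntegral_mono' measurableSet_Ioo fun θ hθ =>
            hbound c v hv hM hE n θ (Ioo_subset_Icc_self hθ)
      _ = _ := by
          rw [setLIntegral_const, volume_Ioo, sub_zero, ofReal_mul (T.len_pos n).le]
          ring
  · refine tsum_indicator_edge_le (a := fun n => ofReal (T.len n * b n)) (fun n => ?_) N
    rw [ofReal_mul (T.len_pos n).le, mul_assoc]
    have h : ∀ w : Word k n, ofReal (T.len w.1.length) *
        (T.weight w.1 * ‖v w.1 (T.len w.1.length)‖²) =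
        ofReal (T.len n) * (T.weight w.1 * ‖v w.1 (T.len n)‖²) := fun w => by rw [w.2]
    rw [sum_congr rfl fun w _ => h w, ← mul_sum]
    exact mul_le_mul_right (hbound c v hv hM hE n _ ⟨(T.len_pos n).le, le_rfl⟩) _

end Data

theorem ofReal_mul_lintegral_comp_affine_le {m : ℝ} (hm : 0 < m) (a L : ℝ) (F : ℝ → ENNReal) :
    ofReal m * ∫⁻ θ in Ioo 0 L, F (a + m * θ) ≤ ∫⁻ x in Ioo a (a + m * L), F x := by
  have h := lintegral_image_eq_lintegral_abs_deriv_mul (f := fun θ => a + m * θ)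
    (measurableSet_Ioo (a := 0) (b := L))
    (fun x _ => by simpa using (((hasDerivAt_id x).const_mul m).const_add a).hasDerivWithinAt)
    (fun x _ y _ h => by simpa [hm.ne'] using h) F
  simp only [abs_of_pos hm] at h
  rw [← lintegral_const_mul' _ _ ofReal_ne_top, ← h]
  refine lintegral_mono_set ?_
  rintro _ ⟨θ, hθ, rfl⟩
  exact ⟨by nlinarith [hθ.1], by nlinarith [hθ.2]⟩

theorem enorm_mono {E F : Type*} [NormedAddCommGroup E] [NormedAddCommGroup F]
    {a : E} {b : F} (h : ‖a‖ ≤ ‖b‖) : ‖a‖ₑ ≤ ‖b‖ₑ := by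
  rw [← ofReal_norm, ← ofReal_norm]
  exact ofReal_le_ofReal h

/-- Reflection in the last coordinate. -/
def axialReflection (d : ℕ) : Eucl (d + 1) ≃ₗᵢ[ℝ] Eucl (d + 1) where
  toFun x := point (cross x) (-axial x)
  invFun x := point (cross x) (-axial x)
  left_inv x := by simp
  right_inv x := by simp
  map_add' x y := by rw [cross_add, axial_add, neg_add, point_add]
  map_smul' c x := by rw [cross_smul, axial_smul, ← mul_neg, point_smul, RingHom.id_apply]
  norm_map' x := by
    refine (sq_eq_sq₀ (norm_nonneg _) (norm_nonneg _)).1 ?_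
    change ‖point (cross x) (-axial x)‖ ^ 2 = ‖x‖ ^ 2
    conv_rhs => rw [← point_cross_axial x]
    rw [norm_sq_point, norm_sq_point, neg_sq]

theorem sim_refl_point {d : ℕ} (a t : ℝ) (x : Eucl (d + 1)) :
    sim (point 0 a) t (LinearIsometryEquiv.refl ℝ _) x = point (t • cross x) (a + t * axial x) := by
  refine point_ext ?_ ?_ <;> simp [sim]

theorem sim_axialReflection {d : ℕ} (b t : ℝ) (x : Eucl (d + 1)) :
    sim (point 0 b) t (axialReflection d) x = point (t • cross x) (b - t * axial x) := by
  have h : axialReflection d x = point (cross x) (-axial x) := rfl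
  refine point_ext ?_ ?_ <;> simp [sim, h, sub_eq_add_neg]

theorem sim_axialReflection_image {d : ℕ} (A : Set (Eucl d)) (b : ℝ) {t : ℝ} (ht : 0 < t) :
    sim (point 0 b) t (axialReflection d) '' slab A (Ioo 0 1) = slab (t • A) (Ioo (b - t) b) := by
  ext x
  constructor
  · rintro ⟨z, ⟨hz, h1, h2⟩, rfl⟩
    rw [sim_axialReflection]
    refine ⟨by simpa using smul_mem_smul_set hz, ?_⟩
    rw [axial_point]
    exact ⟨by nlinarith, by nlinarith⟩
  · rintro ⟨⟨y, hy, hyx⟩, h1, h2⟩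
    refine ⟨point y ((b - axial x) / t), ⟨by simpa using hy, ?_⟩, ?_⟩
    · rw [axial_point]
      exact ⟨div_pos (by linarith) ht, by rw [div_lt_iff₀ ht]; linarith⟩
    · rw [sim_axialReflection, cross_point, axial_point]
      refine point_ext (by simpa using hyx) ?_
      rw [axial_point]
      field_simp
      ring

namespace Data

variable {d k : ℕ} (T : Data d k)

/-- A bound, relative to the size of an edge, for the parts of the edge coordinate taken up by the
skeletons of the vertices. -/
def slack : ℝ := 1 + (∑ j, ‖T.sec j 0‖) / T.δ

theorem one_le_slack : 1 ≤ T.slack :=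
  le_add_of_nonneg_right (div_nonneg (sum_nonneg fun _ _ => norm_nonneg _) T.δ_pos.le)

theorem norm_sec_le (j : Option (Fin k)) : ‖T.sec j 0‖ / T.δ ≤ T.slack - 1 := by
  rw [slack, add_sub_cancel_left]
  exact div_le_div_of_nonneg_right (Finset.single_le_sum (f := fun j => ‖T.sec j 0‖)
    (fun _ _ => norm_nonneg _) (Finset.mem_univ j)) T.δ_pos.le

/-- The inflated vertices are small compared with the edges. -/
structure Fits (ε : ℝ) : Prop where
  pos : 0 < ε
  small : ∀ w : Edge k, 4 * T.slack * T.scale ε w ≤ ℓ(T, w)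

theorem eventually_fits : ∀ᶠ ε in 𝓝[>] 0, T.Fits ε := by
  obtain ⟨c, hc, h⟩ := T.len_ge
  have hs := T.one_le_slack
  filter_upwards [Ioo_mem_nhdsGT (show 0 < c / (4 * T.slack) by positivity)] with ε hε
  refine ⟨hε.1, fun w => le_trans ?_ (h w.length)⟩
  rw [scale, ← mul_assoc]
  refine mul_le_mul_of_nonneg_right ?_ (pow_pos T.δ_pos w.length).le
  have := (lt_div_iff₀ (by positivity)).1 hε.2
  linarith

theorem start_nonneg {ε : ℝ} (hε : 0 < ε) (w : Edge k) : 0 ≤ T.start ε w := by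
  cases w with
  | nil => exact le_rfl
  | cons j w => exact mul_nonneg (T.scale_pos hε w).le (norm_nonneg _)

theorem start_le {ε : ℝ} (hε : 0 < ε) (w : Edge k) : T.start ε w ≤ (T.slack - 1) * T.scale ε w := by
  cases w with
  | nil =>
    exact mul_nonneg (by linarith [T.one_le_slack]) (T.scale_pos hε _).le
  | cons j w =>
    refine le_trans (le_of_eq ?_) (mul_le_mul_of_nonneg_right (T.norm_sec_le (some j))
      (T.scale_pos hε (j :: w)).le)
    have := T.δ_pos
    rw [start, scale_cons]
    field_simp

theorem finish_le {ε : ℝ} (hε : 0 < ε) (w : Edge k) : T.finish ε w ≤ ℓ(T, w) :=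
  sub_le_self _ (mul_nonneg (T.scale_pos hε w).le (norm_nonneg _))

theorem le_finish {ε : ℝ} (hε : 0 < ε) (w : Edge k) :
    ℓ(T, w) - (T.slack - 1) * T.scale ε w ≤ T.finish ε w := by
  have h1 : ‖T.sec none 0‖ ≤ ‖T.sec none 0‖ / T.δ :=
    le_div_self (norm_nonneg _) T.δ_pos T.δ_lt_one.le
  have h := mul_le_mul_of_nonneg_right (h1.trans (T.norm_sec_le none)) (T.scale_pos hε w).le
  rw [finish]
  linarith

variable {T} {ε : ℝ}

theorem Fits.len_le (h : T.Fits ε) (w : Edge k) :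
    ℓ(T, w) ≤ 2 * (T.finish ε w - T.start ε w - T.scale ε w) := by
  have h1 := T.start_le h.pos w
  have h2 := T.le_finish h.pos w
  have h3 := h.small w
  have h4 := T.scale_pos h.pos w
  nlinarith

theorem Fits.scale_lt (h : T.Fits ε) (w : Edge k) : T.scale ε w < T.finish ε w - T.start ε w := by
  linarith [h.len_le w, T.len_pos w.length]

theorem Fits.start_lt_finish (h : T.Fits ε) (w : Edge k) : T.start ε w < T.finish ε w := by
  linarith [h.scale_lt w, T.scale_pos h.pos w]

variable (T ε) in
/-- The position of the window of an edge that stands for a point of the edge of the tree. -/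
def edgePoint (w : Edge k) (θ : ℝ) : ℝ :=
  T.start ε w + (T.finish ε w - T.start ε w - T.scale ε w) / ℓ(T, w) * θ

theorem edgePoint_zero (w : Edge k) : T.edgePoint ε w 0 = T.start ε w := by simp [edgePoint]

theorem edgePoint_len (w : Edge k) : T.edgePoint ε w ℓ(T, w) = T.finish ε w - T.scale ε w := by
  have := T.len_pos w.length
  rw [edgePoint]
  field_simp
  ring

theorem Fits.slope_pos (h : T.Fits ε) (w : Edge k) :
    0 < (T.finish ε w - T.start ε w - T.scale ε w) / ℓ(T, w) :=
  div_pos (by linarith [h.scale_lt w]) (T.len_pos _)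

theorem Fits.slope_le (h : T.Fits ε) (w : Edge k) :
    (T.finish ε w - T.start ε w - T.scale ε w) / ℓ(T, w) ≤ 1 := by
  rw [div_le_one (T.len_pos _)]
  linarith [T.finish_le h.pos w, T.start_nonneg h.pos w, T.scale_pos h.pos w]

theorem Fits.edgePoint_mem (h : T.Fits ε) (w : Edge k) {θ : ℝ} (hθ : θ ∈ Icc 0 ℓ(T, w)) :
    T.edgePoint ε w θ ∈ Icc (T.start ε w) (T.finish ε w - T.scale ε w) := by
  have h1 := h.slope_pos w
  refine ⟨le_add_of_nonneg_right (mul_nonneg h1.le hθ.1), ?_⟩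
  rw [← edgePoint_len, edgePoint, edgePoint]
  have := mul_le_mul_of_nonneg_left hθ.2 h1.le
  linarith

theorem Fits.edgePoint_near (h : T.Fits ε) (w : Edge k) {θ : ℝ} (hθ : θ ∈ Icc 0 ℓ(T, w)) :
    θ - 2 * T.slack * T.scale ε w ≤ T.edgePoint ε w θ ∧
      T.edgePoint ε w θ + T.scale ε w ≤ θ + 2 * T.slack * T.scale ε w := by
  have h1 := T.start_le h.pos w
  have h2 := T.le_finish h.pos w
  have h3 := h.slope_le w
  have h4 := T.scale_pos h.pos w
  have h5 := T.one_le_slack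
  have h6 : T.edgePoint ε w θ = T.finish ε w - T.scale ε w -
      (T.finish ε w - T.start ε w - T.scale ε w) / ℓ(T, w) * (ℓ(T, w) - θ) := by
    rw [← edgePoint_len, edgePoint, edgePoint]; ring
  constructor
  · rw [h6]
    have := mul_le_mul_of_nonneg_right h3 (sub_nonneg.2 hθ.2)
    nlinarith
  · rw [edgePoint]
    have := mul_le_mul_of_nonneg_right h3 hθ.1
    nlinarith

variable (T ε) in
/-- The test functions on the inflated tree of finite `H¹` norm on each piece. -/
structure FiniteTest (c : EndCondition) (f : PieceFun d k) : Prop where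
  test : T.IsInflatedTest ε c f
  memLp : ∀ i, MemLp (f i) 2 (volume.restrict (T.region ε i))
  memLp_grad : ∀ i, MemLp (grad (f i)) 2 (volume.restrict (T.region ε i))

theorem norm_fderiv_le_grad (f : Eucl (d + 1) → ℂ) (x : Eucl (d + 1)) :
    ‖∇ f x‖ ≤ ‖grad f x‖ := by
  refine ContinuousLinearMap.opNorm_le_bound _ (norm_nonneg _) fun h => ?_
  have h1 : ∇ f x h = ∑ i, h i • ∇ f x (EuclideanSpace.single i 1) := by
    conv_lhs => rw [← (EuclideanSpace.basisFun (Fin (d + 1)) ℝ).sum_repr h]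
    rw [map_sum]
    simp
  rw [h1, mul_comm, norm_eq, norm_eq]
  refine (norm_sum_le _ _).trans ?_
  simp_rw [norm_smul]
  exact Real.sum_mul_le_sqrt_mul_sqrt _ _ _

theorem enorm_fderiv_axis_le (f : Eucl (d + 1) → ℂ) (x : Eucl (d + 1)) :
    ‖∇ f x (axis d)‖ ≤ ‖∇ f x‖ := by
  simpa [norm_axis] using (∇ f x).le_opNorm (axis d)

variable {c : EndCondition} {u : PieceFun d k}

variable (T ε) in
/-- The energy of a function on a piece of the inflated tree. -/
def pieceEnergy (u : PieceFun d k) (i : Piece k) : ENNReal := ∫⁻ x in T.region ε i, ‖grad (u i) x‖²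

theorem le_pieceEnergy {i : Piece k} {S : Set (Eucl (d + 1))}
    (hS : S ⊆ T.region ε i) : ∫⁻ x in S, ‖∇ (u i) x‖² ≤ T.pieceEnergy ε u i := by
  refine (lintegral_mono_set hS).trans (lintegral_mono fun x => ?_)
  gcongr
  exact enorm_mono (norm_fderiv_le_grad _ _)

theorem FiniteTest.contDiffOn (hu : T.FiniteTest ε c u) (i : Piece k) :
    ContDiffOn ℝ 1 (u i) (T.region ε i) :=
  (hu.test.contDiff i).mono (T.region_subset ε i)

theorem FiniteTest.integrableOn (hu : T.FiniteTest ε c u) (i : Piece k) :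
    IntegrableOn (u i) (T.region ε i) := by
  have : IsFiniteMeasure (volume.restrict (T.region ε i)) :=
    isFiniteMeasure_restrict.2 (T.isBounded_region ε i).measure_lt_top.ne
  exact (hu.memLp i).integrable (by norm_num)

theorem FiniteTest.integrableOn_fderiv (hu : T.FiniteTest ε c u) (i : Piece k) :
    IntegrableOn (fun x => ∇ (u i) x (axis d)) (T.region ε i) := by
  have : IsFiniteMeasure (volume.restrict (T.region ε i)) :=
    isFiniteMeasure_restrict.2 (T.isBounded_region ε i).measure_lt_top.ne
  refine ((hu.memLp_grad i).integrable (by norm_num)).mono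
    (measurable_fderiv_apply_const ℝ (u i) (axis d)).aestronglyMeasurable ?_
  exact of_forall fun x =>
    (enorm_fderiv_axis_le _ _).trans (norm_fderiv_le_grad _ _)

variable (T ε) in
/-- The mean over the window of an edge that stands for a point of the edge of the tree. -/
def edgeMean (u : PieceFun d k) (w : Edge k) (θ : ℝ) : ℂ :=
  windowMean (T.scale ε w • T.Ω) (T.scale ε w) (u (.edge w)) (T.edgePoint ε w θ)

theorem isOpen_smul_Ω (hε : 0 < ε) (w : Edge k) : IsOpen (T.scale ε w • T.Ω) :=
  T.isOpen_Ω.smul₀ (T.scale_pos hε w).ne'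

theorem isBounded_smul_Ω (w : Edge k) : Bornology.IsBounded (T.scale ε w • T.Ω) :=
  T.Ω_lipschitz.isBounded.smul₀ _

theorem FiniteTest.exists_contDiff (hu : T.FiniteTest ε c u) (h : T.Fits ε)
    (w : Edge k) : ∃ M : ℝ → ℂ, ContDiff ℝ 1 M ∧
      ∀ θ ∈ Icc 0 ℓ(T, w), T.edgeMean ε u w θ = M (T.edgePoint ε w θ) ∧
        deriv M (T.edgePoint ε w θ) = windowMean (T.scale ε w • T.Ω) (T.scale ε w)
          (fun x => ∇ (u (.edge w)) x (axis d)) (T.edgePoint ε w θ) := by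
  obtain ⟨M, hM, hMu⟩ := exists_contDiff_windowMean (isOpen_smul_Ω h.pos w) (isBounded_smul_Ω w)
    (t := T.scale ε w) (by linarith [h.scale_lt w])
    (hu.contDiffOn (.edge w)) (hu.integrableOn (.edge w)) (hu.integrableOn_fderiv (.edge w))
  exact ⟨M, hM, fun θ hθ => hMu _ (h.edgePoint_mem w hθ)⟩

theorem contDiff_edgePoint (w : Edge k) : ContDiff ℝ 1 (T.edgePoint ε w) :=
  contDiff_const.add (contDiff_const.mul contDiff_id)

theorem FiniteTest.contDiffOn_edgeMean (hu : T.FiniteTest ε c u)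
    (h : T.Fits ε) (w : Edge k) : ContDiffOn ℝ 1 (T.edgeMean ε u w) (Icc 0 ℓ(T, w)) := by
  obtain ⟨M, hM, hMu⟩ := hu.exists_contDiff h w
  exact (hM.comp (contDiff_edgePoint w)).contDiffOn.congr fun θ hθ => (hMu θ hθ).1

theorem FiniteTest.deriv_edgeMean (hu : T.FiniteTest ε c u)
    (h : T.Fits ε) (w : Edge k) {θ : ℝ} (hθ : θ ∈ I(T, w)) :
    deriv (T.edgeMean ε u w) θ = ((T.finish ε w - T.start ε w - T.scale ε w) / ℓ(T, w)) •
        windowMean (T.scale ε w • T.Ω) (T.scale ε w)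
          (fun x => ∇ (u (.edge w)) x (axis d)) (T.edgePoint ε w θ) := by
  obtain ⟨M, hM, hMu⟩ := hu.exists_contDiff h w
  have h1 : T.edgeMean ε u w =ᶠ[𝓝 θ] M ∘ T.edgePoint ε w := by
    filter_upwards [Ioo_mem_nhds hθ.1 hθ.2] with x hx
    exact (hMu x (Ioo_subset_Icc_self hx)).1
  have h2 : HasDerivAt (T.edgePoint ε w)
      ((T.finish ε w - T.start ε w - T.scale ε w) / ℓ(T, w)) θ := by
    exact (((hasDerivAt_id' θ).const_mul _).const_add (T.start ε w)).congr_deriv (mul_one _)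
  rw [h1.deriv_eq, ((hM.differentiable one_ne_zero (T.edgePoint ε w θ)).hasDerivAt.scomp θ
    h2).deriv, (hMu θ (Ioo_subset_Icc_self hθ)).2]

theorem volume_smul_Ω (hε : 0 < ε) (w : Edge k) :
    volume (T.scale ε w • T.Ω) = ofReal (ε ^ d) * T.weight w := by
  rw [smul_eq_image_sim, volume_image_sim _ _ (T.scale_pos hε w), weight, scale,
    mul_pow, ← pow_mul, mul_comm w.length, ofReal_mul (by positivity), mul_assoc]

theorem FiniteTest.lintegral_deriv_edgeMean_le (hu : T.FiniteTest ε c u)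
    (h : T.Fits ε) (w : Edge k) :
    volume (T.scale ε w • T.Ω) * ∫⁻ θ in I(T, w), ‖deriv (T.edgeMean ε u w) θ‖² ≤
      T.pieceEnergy ε u (.edge w) := by
  set m := (T.finish ε w - T.start ε w - T.scale ε w) / ℓ(T, w)
  have hm := h.slope_pos w
  set F := fun x => ∇ (u (.edge w)) x (axis d)
  have h1 := lintegral_windowMean_le (isOpen_smul_Ω h.pos w) (isBounded_smul_Ω w)
    (T.scale_pos h.pos w)
    ((measurable_fderiv_apply_const ℝ (u (.edge w)) (axis d)).indicator
      (T.isOpen_region h.pos (.edge w)).measurableSet) (hu.integrableOn_fderiv (.edge w))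
  have h2 := ofReal_mul_lintegral_comp_affine_le hm (T.start ε w) ℓ(T, w)
    fun σ => ‖windowMean (T.scale ε w • T.Ω) (T.scale ε w) F σ‖²
  have h3 : T.start ε w + m * ℓ(T, w) = T.finish ε w - T.scale ε w := edgePoint_len w
  rw [h3] at h2
  have h4 : ∫⁻ θ in I(T, w), ‖deriv (T.edgeMean ε u w) θ‖² ≤ ofReal m * ∫⁻ θ in I(T, w),
        ‖windowMean (T.scale ε w • T.Ω) (T.scale ε w) F (T.start ε w + m * θ)‖² := by
    rw [← lintegral_const_mul' _ _ ofReal_ne_top]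
    refine setLIntegral_mono' measurableSet_Ioo fun θ hθ => ?_
    rw [hu.deriv_edgeMean h w hθ, enorm_smul, mul_pow]
    refine mul_le_mul_left ?_ _
    rw [Real.enorm_eq_ofReal hm.le, sq]
    exact mul_le_of_le_one_right' (ENNReal.ofReal_le_one.2 (h.slope_le w))
  refine ((mul_le_mul_right (h4.trans h2) _).trans h1).trans ?_
  refine lintegral_mono fun x => ?_
  gcongr
  exact enorm_mono ((enorm_fderiv_axis_le _ _).trans (norm_fderiv_le_grad _ _))

theorem FiniteTest.lintegral_edgeMean_le (hu : T.FiniteTest ε c u) (h : T.Fits ε) (w : Edge k) :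
    volume (T.scale ε w • T.Ω) * ∫⁻ θ in I(T, w), ‖T.edgeMean ε u w θ‖² ≤
      2 * ∫⁻ x in E(T, ε, w), ‖u (.edge w) x‖² := by
  set m := (T.finish ε w - T.start ε w - T.scale ε w) / ℓ(T, w)
  have h1 := lintegral_windowMean_le (isOpen_smul_Ω h.pos w) (isBounded_smul_Ω w)
    (T.scale_pos h.pos w)
    (measurable_indicator (T.isOpen_region h.pos (.edge w)).measurableSet
      (hu.contDiffOn (.edge w)).continuousOn) (hu.integrableOn (.edge w))
  have h2 := ofReal_mul_lintegral_comp_affine_le (h.slope_pos w) (T.start ε w) ℓ(T, w)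
    fun σ => ‖windowMean (T.scale ε w • T.Ω) (T.scale ε w) (u (.edge w)) σ‖²
  have h3 : T.start ε w + m * ℓ(T, w) = T.finish ε w - T.scale ε w := edgePoint_len w
  rw [h3] at h2
  have h4 : 1 ≤ 2 * ofReal m := by
    rw [← ofReal_ofNat, ← ofReal_mul zero_le_two, ← ofReal_one]
    refine ofReal_le_ofReal ?_
    rw [← mul_div_assoc, one_le_div (T.len_pos _)]
    exact h.len_le w
  calc _ ≤ volume (T.scale ε w • T.Ω) * ((2 * ofReal m) * ∫⁻ θ in I(T, w), ‖T.edgeMean ε u w θ‖²) :=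
        mul_le_mul_right (le_mul_of_one_le_left' h4) _
    _ ≤ volume (T.scale ε w • T.Ω) * (2 * ∫⁻ σ in Ioo (T.start ε w) (T.finish ε w - T.scale ε w),
          ‖windowMean (T.scale ε w • T.Ω) (T.scale ε w) (u (.edge w)) σ‖²) := by
        rw [mul_assoc]
        exact mul_le_mul_right (mul_le_mul_right h2 _) _
    _ ≤ _ := by
        rw [mul_left_comm]
        exact mul_le_mul_right h1 _

end Data

theorem enorm_add_sq_le_of_pos {F : Type*} [NormedAddCommGroup F] (a b : F) {s : ℝ} (hs : 0 < s) :
    ‖a + b‖² ≤ ofReal (1 + s) * ‖a‖² + ofReal (1 + 1 / s) * ‖b‖² := by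
  rw [← ofReal_norm_sq, ← ofReal_norm_sq, ← ofReal_norm_sq, ← ofReal_mul (by positivity),
    ← ofReal_mul (by positivity), ← ofReal_add (by positivity) (by positivity)]
  refine ofReal_le_ofReal ?_
  have h1 := pow_le_pow_left₀ (norm_nonneg _) (norm_add_le a b) 2
  have h2 : 0 ≤ (s * ‖a‖ - ‖b‖) ^ 2 / s := by positivity
  have h3 : (1 + s) * ‖a‖ ^ 2 + (1 + 1 / s) * ‖b‖ ^ 2 - (‖a‖ + ‖b‖) ^ 2 =
      (s * ‖a‖ - ‖b‖) ^ 2 / s := by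
    field_simp
    ring
  linarith

variable {d k : ℕ} {T : Data d k} {ε : ℝ} {c : EndCondition} {u : PieceFun d k} {v : EdgeFun k}

namespace Data

variable (T) in
/-- An estimate with a constant `C` that depends only on the tree. -/
def Uniformly (P : NNReal → ℝ → PieceFun d k → Prop) : Prop :=
  ∃ C, ∀ ε, T.Fits ε → ∀ c u, T.FiniteTest ε c u → P C ε u

variable (T) in
theorem exists_average_sub_edgeMean_zero_le : T.Uniformly fun C ε u => ∀ w j, ofReal
    (T.scale ε w ^ (d + 1)) *
      ‖(⨍ x in T.scale ε w • T.V, u (.vertex w) x) - T.edgeMean ε u (j :: w) 0‖² ≤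
      C * (ofReal (T.scale ε w ^ 2) *
        (T.pieceEnergy ε u (.vertex w) + T.pieceEnergy ε u (.edge (j :: w)))) := by
  choose C hC using fun j : Fin k => T.exists_average_vertex_sub_le (some j)
  refine ⟨∑ j, C j, fun ε h c u hu w j => ?_⟩
  set t := T.scale ε w
  have ht := T.scale_pos h.pos w
  set a := T.start ε (j :: w)
  have hscale := T.scale_cons ε j w
  have himg : sim (point 0 a) t (LinearIsometryEquiv.refl ℝ _) ''
      slab (T.secSet (some j)) (Ioo 0 (T.secLen (some j))) =
      slab (T.scale ε (j :: w) • T.Ω) (Ioo a (a + T.scale ε (j :: w))) := by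
    rw [hscale, ← smul_smul]
    exact (slab_eq_image_sim (T.δ • T.Ω) T.δ a ht).symm
  have hsub : slab (T.scale ε (j :: w) • T.Ω) (Ioo a (a + T.scale ε (j :: w))) ⊆
      T.region ε (.edge (j :: w)) :=
    slab_mono Subset.rfl (Ioo_subset_Ioo_right (by linarith [h.scale_lt (j :: w)]))
  have hmem : ∀ x ∈ slab (T.secSet (some j)) (Ico 0 (T.secLen (some j))),
      sim (point 0 a) t (LinearIsometryEquiv.refl ℝ _) x ∈
        T.closedRegion ε (.edge (j :: w)) := fun x hx => by
    rw [sim_refl_point]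
    refine ⟨?_, ?_⟩
    · rw [cross_point, hscale, ← smul_smul]
      exact smul_mem_smul_set hx.1
    · rw [axial_point]
      have h1 := h.scale_lt (j :: w)
      have h2 : axial x < T.δ := hx.2.2
      rw [hscale] at h1
      exact ⟨le_add_of_nonneg_right (mul_nonneg ht.le hx.2.1), by
        have := mul_le_mul_of_nonneg_left h2.le ht.le
        linarith⟩
  have key := hC j t ht (point 0 a) (LinearIsometryEquiv.refl ℝ _) (u (.vertex w))
    (u (.edge (j :: w))) (hu.contDiffOn (.vertex w)) (hu.test.contDiff (.vertex w)).continuousOn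
    (hu.memLp (.vertex w)) (by rw [himg]; exact (hu.contDiffOn _).mono hsub)
    ((hu.test.contDiff (.edge (j :: w))).continuousOn.mono (by
      rintro _ ⟨x, hx, rfl⟩; exact hmem x hx))
    (by rw [himg]; exact (hu.memLp (.edge (j :: w))).mono_measure (restrict_mono hsub le_rfl))
    (fun y hy => by
      rw [sim_refl_point, cross_point, axial_point, mul_zero, add_zero]
      exact (hu.test.value_upper w j y hy).symm)
  rw [himg] at key
  rw [edgeMean, edgePoint_zero]
  refine key.trans (mul_le_mul' ?_ (mul_le_mul_right (add_le_add ?_ ?_) _))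
  · exact_mod_cast Finset.single_le_sum (fun _ _ => zero_le) (Finset.mem_univ j)
  · exact le_pieceEnergy Subset.rfl
  · exact le_pieceEnergy hsub

variable (T) in
theorem exists_average_sub_edgeMean_len_le : T.Uniformly fun C ε u => ∀ w, ofReal
    (T.scale ε w ^ (d + 1)) *
      ‖(⨍ x in T.scale ε w • T.V, u (.vertex w) x) - T.edgeMean ε u w ℓ(T, w)‖² ≤
      C * (ofReal (T.scale ε w ^ 2) *
        (T.pieceEnergy ε u (.vertex w) + T.pieceEnergy ε u (.edge w))) := by
  obtain ⟨C, hC⟩ := T.exists_average_vertex_sub_le none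
  refine ⟨C, fun ε h c u hu w => ?_⟩
  set t := T.scale ε w
  have ht := T.scale_pos h.pos w
  set b := T.finish ε w
  have himg : sim (point 0 b) t (axialReflection d) ''
      slab (T.secSet none) (Ioo 0 (T.secLen none)) = slab (t • T.Ω) (Ioo (b - t) b) :=
    sim_axialReflection_image T.Ω b ht
  have hsub : slab (t • T.Ω) (Ioo (b - t) b) ⊆ E(T, ε, w) :=
    slab_mono Subset.rfl (Ioo_subset_Ioo_left (by linarith [h.scale_lt w]))
  have hmem : ∀ x ∈ slab (T.secSet none) (Ico 0 (T.secLen none)),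
      sim (point 0 b) t (axialReflection d) x ∈ T.closedRegion ε (.edge w) := fun x hx => by
    rw [sim_axialReflection]
    refine ⟨?_, ?_⟩
    · rw [cross_point]
      exact smul_mem_smul_set hx.1
    · rw [axial_point]
      have h1 := h.scale_lt w
      have h2 : axial x < 1 := hx.2.2
      exact ⟨by
        have := mul_le_mul_of_nonneg_left h2.le ht.le
        linarith, sub_le_self _ (mul_nonneg ht.le hx.2.1)⟩
  have key := hC t ht (point 0 b) (axialReflection d) (u (.vertex w))
    (u (.edge w)) (hu.contDiffOn (.vertex w)) (hu.test.contDiff (.vertex w)).continuousOn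
    (hu.memLp (.vertex w)) (by rw [himg]; exact (hu.contDiffOn _).mono hsub)
    ((hu.test.contDiff (.edge w)).continuousOn.mono (by rintro _ ⟨x, hx, rfl⟩; exact hmem x hx))
    (by rw [himg]; exact (hu.memLp (.edge w)).mono_measure (restrict_mono hsub le_rfl))
    (fun y hy => by
      rw [sim_axialReflection, cross_point, axial_point, mul_zero, sub_zero]
      exact (hu.test.value_lower w y hy).symm)
  rw [himg] at key
  rw [edgeMean, edgePoint_len, windowMean, sub_add_cancel]
  refine key.trans (mul_le_mul_right (mul_le_mul_right (add_le_add ?_ ?_) _) _)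
  · exact le_pieceEnergy Subset.rfl
  · exact le_pieceEnergy hsub

theorem enorm_edgeMean_root_le (h : T.Fits ε) (hu : T.FiniteTest ε c u) :
    volume (T.scale ε [] • T.Ω) * ‖T.edgeMean ε u [] 0‖² ≤
      ofReal (T.scale ε ([] : Edge k)) * T.pieceEnergy ε u (.edge []) := by
  set t := T.scale ε ([] : Edge k)
  have ht : 0 < t := T.scale_pos h.pos _
  have hlt := h.scale_lt []
  have hs0 : T.start ε ([] : Edge k) = 0 := rfl
  rw [hs0, sub_zero] at hlt
  set Q := slab (t • T.Ω) (Ioo 0 t) with hQ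
  have hsub : Q ⊆ T.region ε (.edge []) := slab_mono Subset.rfl (Ioo_subset_Ioo hs0.le hlt.le)
  have hvol : volume Q = ofReal t * volume (t • T.Ω) := by
    rw [hQ, volume_slab, volume_Ioo, sub_zero, mul_comm]
  have hfin : volume Q ≠ ∞ := by
    rw [hvol]
    exact mul_ne_top ofReal_ne_top (isBounded_smul_Ω _).measure_lt_top.ne
  have h1 := volume_mul_average_sub_le hfin ((hu.integrableOn (.edge [])).mono_set hsub) 0
  have h2 := lintegral_enorm_sub_trace_sq_le (isOpen_smul_Ω h.pos ([] : Edge k))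
    ((hu.contDiffOn (.edge [])).mono hsub)
    ((hu.test.contDiff (.edge [])).continuousOn.mono
      (slab_mono Subset.rfl fun x hx => ⟨hs0.le.trans hx.1, hx.2.le.trans hlt.le⟩))
  have h3 : ∫⁻ x in Q, ‖u (.edge []) x - u (.edge []) (point (cross x) 0)‖² =
      ∫⁻ x in Q, ‖u (.edge []) x - 0‖² := by
    refine setLIntegral_congr_fun (measurableSet_slab (isOpen_smul_Ω h.pos _).measurableSet
      measurableSet_Ioo) fun x hx => ?_
    obtain ⟨y, hy, hyx⟩ := hx.1
    have h4 := hu.test.root y hy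
    rw [show T.scale ε [] • y = cross x from hyx] at h4
    simp only [h4]
  have h5 : T.edgeMean ε u [] 0 = ⨍ x in Q, u (.edge []) x := by
    rw [edgeMean, edgePoint_zero, hs0, windowMean, zero_add]
  rw [← h3, sub_zero, ← h5, hvol] at h1
  have h6 := h1.trans (h2.trans (mul_le_mul_right (le_pieceEnergy hsub) _))
  refine (ENNReal.mul_le_mul_iff_right ((ENNReal.ofReal_pos.2 ht).ne') ofReal_ne_top).1 ?_
  rw [sq t, ofReal_mul ht.le, mul_assoc, mul_assoc] at h6
  exact h6

variable (T ε) in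
/-- The difference between the mean over the lower end of the parent and the mean over the upper
end of an edge; at the root, the former is replaced by zero. -/
def jump (u : PieceFun d k) : Edge k → ℂ
  | [] => -T.edgeMean ε u [] 0
  | j :: w => T.edgeMean ε u w ℓ(T, w) - T.edgeMean ε u (j :: w) 0

/-- The total over the pieces of the inflated tree that meet the upper end of an edge. -/
def near (F : Piece k → ENNReal) : Edge k → ENNReal
  | [] => F (.edge [])
  | j :: w => F (.edge (j :: w)) + F (.vertex w) + F (.edge w)

theorem edge_le_near (F : Piece k → ENNReal) (w : Edge k) : F (.edge w) ≤ near F w := by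
  cases w with
  | nil => exact le_rfl
  | cons j w => rw [near, add_assoc]; exact le_self_add

variable (T) in
theorem exists_enorm_jump_le : T.Uniformly fun C ε u => ∀ w, volume (T.scale ε w • T.Ω) * ‖T.jump ε
    u w‖² ≤
      C * (ofReal (T.scale ε w) * near (T.pieceEnergy ε u) w) := by
  obtain ⟨C₁, h₁⟩ := T.exists_average_sub_edgeMean_zero_le
  obtain ⟨C₂, h₂⟩ := T.exists_average_sub_edgeMean_len_le
  set K : ENNReal := volume T.Ω * (4 * (C₁ + C₂)) * ofReal T.δ⁻¹
  have hK : K ≠ ∞ := by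
    have := T.volume_Ω_ne_top
    finiteness
  refine ⟨1 + K.toNNReal, fun ε h c u hu w => ?_⟩
  push_cast
  rw [coe_toNNReal hK]
  cases w with
  | nil =>
    rw [jump, enorm_neg]
    exact (enorm_edgeMean_root_le h hu).trans (le_mul_of_one_le_left' le_self_add)
  | cons j w =>
    set t := T.scale ε w
    have ht := T.scale_pos h.pos w
    have hδ := T.δ_pos
    have hscale : T.scale ε (j :: w) = t * T.δ := T.scale_cons ε j w
    set G := near (T.pieceEnergy ε u) (j :: w)
    have hG1 : T.pieceEnergy ε u (.vertex w) + T.pieceEnergy ε u (.edge (j :: w)) ≤ G := by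
      change _ ≤ _ + _ + _
      rw [add_comm]; exact le_self_add
    have hG2 : T.pieceEnergy ε u (.vertex w) + T.pieceEnergy ε u (.edge w) ≤ G := by
      change _ ≤ _ + _ + _
      rw [add_assoc]; exact le_add_self
    have h3 : ofReal (t ^ d) * ‖T.jump ε u (j :: w)‖² ≤ 4 * (C₁ + C₂) * (ofReal t * G) := by
      refine (ENNReal.mul_le_mul_iff_right ((ENNReal.ofReal_pos.2 ht).ne') ofReal_ne_top).1 ?_
      calc _ = ofReal (t ^ (d + 1)) * ‖T.jump ε u (j :: w)‖² := by
            rw [← mul_assoc, ← ofReal_mul ht.le, pow_succ' t]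
        _ ≤ ofReal (t ^ (d + 1)) *
            (2 * ‖(⨍ x in t • T.V, u (.vertex w) x) - T.edgeMean ε u w ℓ(T, w)‖² +
            2 * ‖(⨍ x in t • T.V, u (.vertex w) x) - T.edgeMean ε u (j :: w) 0‖²) := by
            refine mul_le_mul_right ?_ _
            rw [← enorm_sub_rev (T.edgeMean ε u w ℓ(T, w))]
            exact InflatedTree.enorm_sub_sq_le _ _ _
        _ = 2 * (ofReal (t ^ (d + 1)) * ‖(⨍ x in t • T.V, u (.vertex w) x) -
              T.edgeMean ε u w ℓ(T, w)‖²) +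
            2 * (ofReal (t ^ (d + 1)) * ‖(⨍ x in t • T.V, u (.vertex w) x) -
              T.edgeMean ε u (j :: w) 0‖²) := by ring
        _ ≤ 2 * (C₂ * (ofReal (t ^ 2) * G)) + 2 * (C₁ * (ofReal (t ^ 2) * G)) := by
            refine add_le_add (mul_le_mul_right ((h₂ ε h c u hu w).trans ?_) _)
              (mul_le_mul_right ((h₁ ε h c u hu w j).trans ?_) _)
            · exact mul_le_mul_right (mul_le_mul_right hG2 _) _
            · exact mul_le_mul_right (mul_le_mul_right hG1 _) _
        _ = 2 * (C₁ + C₂) * (ofReal (t ^ 2) * G) := by ring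
        _ ≤ 4 * (C₁ + C₂) * (ofReal (t ^ 2) * G) := by
            refine mul_le_mul_left (mul_le_mul_left ?_ _) _
            norm_num
        _ = _ := by
            rw [sq t, ofReal_mul ht.le]
            ring
    have h4 : volume (T.scale ε (j :: w) • T.Ω) ≤ volume T.Ω * ofReal (t ^ d) := by
      rw [smul_eq_image_sim, volume_image_sim _ _ (T.scale_pos h.pos _), mul_comm]
      refine mul_le_mul_right (ofReal_le_ofReal ?_) _
      rw [hscale]
      exact pow_le_pow_left₀ (by positivity) (mul_le_of_le_one_right ht.le T.δ_lt_one.le) _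
    have h5 : ofReal t = ofReal T.δ⁻¹ * ofReal (T.scale ε (j :: w)) := by
      rw [hscale, ← ofReal_mul (by positivity)]
      congr 1
      field_simp
    calc _ ≤ volume T.Ω * (ofReal (t ^ d) * ‖T.jump ε u (j :: w)‖²) := by
          rw [← mul_assoc]; exact mul_le_mul_left h4 _
      _ ≤ volume T.Ω * (4 * (C₁ + C₂) * (ofReal t * G)) := mul_le_mul_right h3 _
      _ = K * (ofReal (T.scale ε (j :: w)) * G) := by rw [h5]; ring
      _ ≤ _ := mul_le_mul_left le_add_self _

variable (T ε) in
/-- The function on the one-dimensional tree that belongs to a function on the inflated tree: the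
means over windows of the edges, made continuous. -/
def project (u : PieceFun d k) (w : Edge k) (θ : ℝ) : ℂ :=
  T.edgeMean ε u w θ + ((1 - θ / ℓ(T, w) : ℝ) : ℂ) * T.jump ε u w

theorem project_len (w : Edge k) : T.project ε u w ℓ(T, w) = T.edgeMean ε u w ℓ(T, w) := by
  rw [project, div_self (T.len_pos _).ne']
  simp

theorem contDiff_ramp (T : Data d k) (w : Edge k) :
    ContDiff ℝ 1 fun θ : ℝ => ((1 - θ / ℓ(T, w) : ℝ) : ℂ) :=
  Complex.ofRealCLM.contDiff.comp (contDiff_const.sub (contDiff_id.div_const _))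

theorem windowMean_eq_zero {A : Set (Eucl d)} {t σ : ℝ} {f : Eucl (d + 1) → ℂ}
    (h : ∀ x ∈ slab A (Ioo σ (σ + t)), f x = 0) : windowMean A t f σ = 0 := by
  rw [windowMean, average_eq, setIntegral_eq_zero_of_forall_eq_zero h, smul_zero]

theorem Fits.window_subset (h : T.Fits ε) (w : Edge k) {θ : ℝ} (hθ : θ ∈ Icc 0 ℓ(T, w)) :
    slab (T.scale ε w • T.Ω) (Ioo (T.edgePoint ε w θ) (T.edgePoint ε w θ + T.scale ε w)) ⊆
      E(T, ε, w) := by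
  have := h.edgePoint_mem w hθ
  exact slab_mono Subset.rfl (Ioo_subset_Ioo this.1 (by linarith [this.2]))

theorem FiniteTest.isTreeTest_project (hu : T.FiniteTest ε c u)
    (h : T.Fits ε) : T.IsTreeTest c (T.project ε u) where
  contDiff w := (hu.contDiffOn_edgeMean h w).add
    ((contDiff_ramp T w).contDiffOn.mul contDiffOn_const)
  continuous w j := by
    rw [project_len, project, jump]
    simp
  root := by rw [project, jump]; simp
  ends hc := by
    obtain ⟨n, hn⟩ := hu.test.ends hc
    have h0 : ∀ w : Edge k, n ≤ w.length → ∀ θ ∈ Icc 0 ℓ(T, w),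
        T.edgeMean ε u w θ = 0 := fun w hw θ hθ => windowMean_eq_zero fun x hx =>
      (hn w hw).1 x (T.region_subset ε _ (h.window_subset w hθ hx))
    refine ⟨n + 1, fun w hw θ hθ => ?_⟩
    rw [project, h0 w (by omega) θ hθ]
    cases w with
    | nil => simp at hw
    | cons j w =>
      rw [List.length_cons] at hw
      rw [jump, h0 w (by omega) _ ⟨(T.len_pos _).le, le_rfl⟩,
        h0 (j :: w) (by simp; omega) 0 ⟨le_rfl, (T.len_pos _).le⟩]
      simp

theorem FiniteTest.edgeMean_add_smul {f g : PieceFun d k}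
    (hf : T.FiniteTest ε c f) (hg : T.FiniteTest ε c g) (h : T.Fits ε) (z : ℂ)
    (w : Edge k) {θ : ℝ} (hθ : θ ∈ Icc 0 ℓ(T, w)) :
    T.edgeMean ε (f + z • g) w θ = T.edgeMean ε f w θ + z * T.edgeMean ε g w θ := by
  simp only [edgeMean, windowMean, average_eq, Pi.add_apply, Pi.smul_apply]
  rw [show (∫ x in slab (T.scale ε w • T.Ω) (Ioo (T.edgePoint ε w θ)
    (T.edgePoint ε w θ + T.scale ε w)), (f (.edge w) x + z • g (.edge w) x)) = _ from
    integral_add ((hf.integrableOn _).mono_set (h.window_subset w hθ))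
      (((hg.integrableOn _).mono_set (h.window_subset w hθ)).smul z)]
  rw [integral_smul, smul_add, smul_comm, smul_eq_mul z]

theorem FiniteTest.project_add_smul {f g : PieceFun d k}
    (hf : T.FiniteTest ε c f) (hg : T.FiniteTest ε c g) (h : T.Fits ε) (z : ℂ)
    (w : Edge k) {θ : ℝ} (hθ : θ ∈ Icc 0 ℓ(T, w)) :
    T.project ε (f + z • g) w θ = T.project ε f w θ + z * T.project ε g w θ := by
  have h0 : ∀ w : Edge k, 0 ∈ Icc 0 ℓ(T, w) := fun w => ⟨le_rfl, (T.len_pos _).le⟩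
  have h1 : ∀ w : Edge k, ℓ(T, w) ∈ Icc 0 ℓ(T, w) := fun w => ⟨(T.len_pos _).le, le_rfl⟩
  have hj : T.jump ε (f + z • g) w = T.jump ε f w + z * T.jump ε g w := by
    cases w with
    | nil => simp only [jump, hf.edgeMean_add_smul hg h z [] (h0 _)]; ring
    | cons j w =>
      simp only [jump, hf.edgeMean_add_smul hg h z w (h1 _),
        hf.edgeMean_add_smul hg h z (j :: w) (h0 _)]
      ring
  rw [project, project, project, hj, hf.edgeMean_add_smul hg h z w hθ]
  ring

/-- Pieces are edges and vertices. -/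
def pieceEquiv (k : ℕ) : Piece k ≃ Edge k ⊕ Edge k where
  toFun i := match i with
    | .edge w => .inl w
    | .vertex w => .inr w
  invFun s := match s with
    | .inl w => .edge w
    | .inr w => .vertex w
  left_inv i := by cases i <;> rfl
  right_inv s := by cases s <;> rfl

instance : Countable (Piece k) := (pieceEquiv k).injective.countable

theorem tsum_piece (F : Piece k → ENNReal) :
    ∑' i, F i = (∑' w, F (.edge w)) + ∑' w, F (.vertex w) := by
  rw [← (pieceEquiv k).symm.tsum_eq, Summable.tsum_sum ENNReal.summable ENNReal.summable]
  rfl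

theorem tsum_near_le (F : Piece k → ENNReal) : ∑' w, near F w ≤ (k + 1) * ∑' i, F i := by
  have h1 : ∀ n, ∑ w : Word k (n + 1), near F w.1 = (∑ w : Word k (n + 1), F (.edge w.1)) +
        k * ∑ w : Word k n, (F (.vertex w.1) + F (.edge w.1)) := fun n => by
    rw [sum_vector_succ n (near F), sum_vector_succ n fun w => F (.edge w), mul_sum,
      ← sum_add_distrib]
    refine sum_congr rfl fun w _ => ?_
    simp only [near, add_assoc, sum_add_distrib, Finset.sum_const, Finset.card_univ,
      Fintype.card_fin, nsmul_eq_mul]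
    rw [mul_add]
  have h2 : ∑ w : Word k 0, near F w.1 = ∑ w : Word k 0, F (.edge w.1) :=
    sum_congr rfl fun w _ => by rw [List.length_eq_zero_iff.1 w.2, near]
  rw [tsum_edge, tsum_eq_zero_add' ENNReal.summable, h2]
  simp_rw [h1]
  rw [tsum_add, ← add_assoc, ← tsum_eq_zero_add' (f := fun n =>
    ∑ w : Word k n, F (.edge w.1)) ENNReal.summable, etsum_mul,
    ← tsum_edge fun w => F (.edge w), ← tsum_edge fun w => F (.vertex w) + F (.edge w),
    tsum_add, tsum_piece, add_mul, one_mul, add_comm]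
  refine add_le_add (le_of_eq (by rw [add_comm])) le_self_add

theorem Fits.scale_le_len (h : T.Fits ε) (w : Edge k) : T.scale ε w ≤ ℓ(T, w) := by
  have h1 := h.small w
  have h2 := T.one_le_slack
  have h3 := T.scale_pos h.pos w
  nlinarith

variable (T) in
/-- The radius of the tree. -/
def radius : ℝ := ∑' n, T.len n

theorem len_le_radius (T : Data d k) (n : ℕ) : T.len n ≤ T.radius :=
  T.len_summable.le_tsum n fun _ _ => (T.len_pos _).le

theorem radius_pos (T : Data d k) : 0 < T.radius := (T.len_pos 0).trans_le (T.len_le_radius 0)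

variable (T) in
theorem exists_lintegral_sub_edgeMean_le : T.Uniformly fun C ε u => ∀ w, ∫⁻ x in E(T, ε, w), ‖u
    (.edge w) x - T.edgeMean ε u w (axial x)‖² ≤
        C * (ofReal (T.scale ε w) * T.pieceEnergy ε u (.edge w)) := by
  obtain ⟨P, hP⟩ := T.exists_hasPoincare_cylinder none
  have hs := T.one_le_slack
  have hR := T.radius_pos
  refine ⟨toNNReal (T.radius * (2 * (2 * T.slack) * (2 * (2 * T.slack + P)))),
    fun ε h c u hu w => ?_⟩
  set t := T.scale ε w
  have ht := T.scale_pos h.pos w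
  have hPw : ∀ σ, HasPoincare volume (slab (t • T.Ω) (Ioo σ (σ + t)))
      (ofReal (t ^ 2) * P) := fun σ => by
    have h2 := slab_eq_image_sim T.Ω 1 σ ht
    rw [mul_one] at h2
    rw [h2]
    exact hP t ht (point 0 σ) (LinearIsometryEquiv.refl ℝ _)
  have hsub := Ioo_subset_Ioo (T.start_nonneg h.pos w) (T.finish_le h.pos w)
  have key := lintegral_enorm_sub_windowMean_le (isOpen_smul_Ω h.pos w) (isBounded_smul_Ω w)
    ht hPw (hu.contDiffOn (.edge w)) (hu.memLp (.edge w))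
    (r := 2 * T.slack * t) (by positivity)
    (fun θ hθ => by
      have h1 := h.edgePoint_mem w (Ioo_subset_Icc_self (hsub hθ))
      have h2 := h.edgePoint_near w (Ioo_subset_Icc_self (hsub hθ))
      exact ⟨h1.1, by linarith [h1.2], h2.1, h2.2⟩)
    ((hu.contDiffOn_edgeMean h w).continuousOn.mono (hsub.trans Ioo_subset_Icc_self))
    (mul_ne_top ofReal_ne_top ENNReal.coe_ne_top)
  refine (ENNReal.mul_le_mul_iff_right ((ENNReal.ofReal_pos.2 ht).ne') ofReal_ne_top).1
    (key.trans ?_)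
  have hPr : P = ofReal P := (ENNReal.ofReal_coe_nnreal).symm
  have hC : ((toNNReal (T.radius * (2 * (2 * T.slack) * (2 * (2 * T.slack + P)))) : NNReal) :
      ENNReal) = ofReal (T.radius * (2 * (2 * T.slack) * (2 * (2 * T.slack + P)))) := rfl
  have h2 : ∀ x, 2 * ofReal x = ofReal (2 * x) := fun x => by
    rw [ofReal_mul zero_le_two, ofReal_ofNat]
  rw [hC, hPr, ← ofReal_mul (by positivity), ← ofReal_add (by positivity) (by positivity), h2,
    ← ofReal_mul (by positivity), ← mul_assoc (ofReal (T.radius * _)),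
    ← ofReal_mul (by positivity), ← mul_assoc (ofReal t),
    ← ofReal_mul (by positivity)]
  refine mul_le_mul' (ofReal_le_ofReal ?_) (le_pieceEnergy Subset.rfl)
  have htR := (h.scale_le_len w).trans (T.len_le_radius _)
  have h1 : 0 ≤ t * t * (2 * (2 * T.slack) * (2 * (2 * T.slack + P))) := by positivity
  nlinarith

theorem enorm_ramp_le {L θ : ℝ} (hL : 0 < L) (hθ : θ ∈ Icc 0 L) (z : ℂ) :
    ‖((1 - θ / L : ℝ) : ℂ) * z‖² ≤ ‖z‖² := by
  have h1 := div_nonneg hθ.1 hL.le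
  have h2 := (div_le_one hL).2 hθ.2
  have h3 : ‖((1 - θ / L : ℝ) : ℂ) * z‖ ≤ ‖z‖ := by
    rw [norm_mul, norm_real, norm_eq_abs, abs_of_nonneg (by linarith)]
    exact mul_le_of_le_one_left (norm_nonneg _) (by linarith)
  exact pow_le_pow_left' (enorm_mono h3) 2

variable (T) in
theorem exists_lintegral_sub_project_le : T.Uniformly fun C ε u => ∀ w, ∫⁻ x in E(T, ε, w), ‖u
    (.edge w) x - T.project ε u w (axial x)‖² ≤
        C * (ofReal (T.scale ε w) * near (T.pieceEnergy ε u) w) := by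
  obtain ⟨C, hC⟩ := T.exists_lintegral_sub_edgeMean_le
  obtain ⟨C', hC'⟩ := T.exists_enorm_jump_le
  refine ⟨2 * C + 2 * (toNNReal T.radius * C'), fun ε h c u hu w => ?_⟩
  have hm : MeasurableSet (E(T, ε, w)) := (T.isOpen_region h.pos _).measurableSet
  have hvol : volume (E(T, ε, w)) ≤ volume (T.scale ε w • T.Ω) * ofReal T.radius := by
    rw [region_edge, volume_slab, volume_Ioo]
    refine mul_le_mul_right (ofReal_le_ofReal ?_) _
    linarith [T.finish_le h.pos w, T.start_nonneg h.pos w, T.len_le_radius w.length]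
  calc _ ≤ ∫⁻ x in E(T, ε, w),
        (2 * ‖u (.edge w) x - T.edgeMean ε u w (axial x)‖² + 2 * ‖T.jump ε u w‖²) := by
        refine setLIntegral_mono' hm fun x hx => ?_
        have hax : axial x ∈ Icc 0 ℓ(T, w) :=
          ⟨(T.start_nonneg h.pos w).trans hx.2.1.le, hx.2.2.le.trans (T.finish_le h.pos w)⟩
        rw [project, ← sub_sub, sub_eq_add_neg (_ - _)]
        refine (enorm_add_sq_le _ _).trans (add_le_add le_rfl (mul_le_mul_right ?_ _))
        rw [enorm_neg]
        exact enorm_ramp_le (T.len_pos _) hax _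
    _ = 2 * (∫⁻ x in E(T, ε, w), ‖u (.edge w) x - T.edgeMean ε u w (axial x)‖²) +
        2 * ‖T.jump ε u w‖² * volume (E(T, ε, w)) := by
        rw [lintegral_add_right _ measurable_const, setLIntegral_const,
          lintegral_const_mul' _ _ (by norm_num)]
    _ ≤ 2 * (C * (ofReal (T.scale ε w) * near (T.pieceEnergy ε u) w)) +
        2 * (ofReal T.radius * (C' * (ofReal (T.scale ε w) * near (T.pieceEnergy ε u) w))) := by
        refine add_le_add (mul_le_mul_right ((hC ε h c u hu w).trans ?_) _) ?_
        · exact mul_le_mul_right (mul_le_mul_right (edge_le_near _ w) _) _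
        · rw [mul_assoc]
          refine mul_le_mul_right ?_ _
          calc _ ≤ ‖T.jump ε u w‖² * (volume (T.scale ε w • T.Ω) * ofReal T.radius) :=
                mul_le_mul_right hvol _
            _ = ofReal T.radius * (volume (T.scale ε w • T.Ω) * ‖T.jump ε u w‖²) := by ring
            _ ≤ _ := mul_le_mul_right (hC' ε h c u hu w) _
    _ = _ := by
        push_cast
        simp only [ofReal]
        ring

variable (T) in
theorem exists_lintegral_project_le : T.Uniformly fun C ε u => ∀ w, volume (T.scale ε w • T.Ω) * ∫⁻
    θ in I(T, w), ‖T.project ε u w θ‖² ≤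
        4 * (∫⁻ x in E(T, ε, w), ‖u (.edge w) x‖²) + C * near (T.pieceEnergy ε u) w := by
  obtain ⟨C', hC'⟩ := T.exists_enorm_jump_le
  refine ⟨2 * (toNNReal T.radius * (C' * toNNReal T.radius)), fun ε h c u hu w => ?_⟩
  calc _ ≤ volume (T.scale ε w • T.Ω) * ∫⁻ θ in I(T, w),
        (2 * ‖T.edgeMean ε u w θ‖² + 2 * ‖T.jump ε u w‖²) := by
        refine mul_le_mul_right (setLIntegral_mono' measurableSet_Ioo fun θ hθ => ?_) _
        refine (enorm_add_sq_le _ _).trans (add_le_add le_rfl (mul_le_mul_right ?_ _))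
        exact enorm_ramp_le (T.len_pos _) (Ioo_subset_Icc_self hθ) _
    _ = 2 * (volume (T.scale ε w • T.Ω) * ∫⁻ θ in I(T, w), ‖T.edgeMean ε u w θ‖²) +
        2 * (ofReal ℓ(T, w) * (volume (T.scale ε w • T.Ω) * ‖T.jump ε u w‖²)) := by
        rw [lintegral_add_right _ measurable_const, setLIntegral_const,
          lintegral_const_mul' _ _ (by norm_num), volume_Ioo, sub_zero]
        ring
    _ ≤ 2 * (2 * ∫⁻ x in E(T, ε, w), ‖u (.edge w) x‖²) +
        2 * (ofReal T.radius * (C' * (ofReal T.radius * near (T.pieceEnergy ε u) w))) := by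
        refine add_le_add (mul_le_mul_right (hu.lintegral_edgeMean_le h w) _)
          (mul_le_mul_right (mul_le_mul' (ofReal_le_ofReal (T.len_le_radius _))
            ((hC' ε h c u hu w).trans (mul_le_mul_right (mul_le_mul_left
              (ofReal_le_ofReal ((h.scale_le_len w).trans (T.len_le_radius _))) _) _))) _)
    _ = _ := by
        push_cast
        simp only [ofReal]
        ring

theorem FiniteTest.deriv_project (hu : T.FiniteTest ε c u)
    (h : T.Fits ε) (w : Edge k) {θ : ℝ} (hθ : θ ∈ I(T, w)) :
    deriv (T.project ε u w) θ =
      deriv (T.edgeMean ε u w) θ + (((-ℓ(T, w)⁻¹ : ℝ) : ℂ) * T.jump ε u w) := by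
  have h1 : HasDerivAt (fun θ => ((1 - θ / ℓ(T, w) : ℝ) : ℂ)) ((-ℓ(T, w)⁻¹ : ℝ) : ℂ) θ := by
    have := ((hasDerivAt_id' θ).div_const ℓ(T, w)).const_sub 1
    rw [one_div] at this
    exact this.ofReal_comp
  have h2 := ((hu.contDiffOn_edgeMean h w).differentiableOn one_ne_zero).differentiableAt
      (Icc_mem_nhds hθ.1 hθ.2)
  exact (h2.hasDerivAt.add (h1.mul_const (T.jump ε u w))).deriv

variable (T) in
theorem exists_lintegral_deriv_project_le : T.Uniformly fun C ε u => ∀ s > 0, ∀ w, volume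
    (T.scale ε w • T.Ω) *
      ∫⁻ θ in I(T, w), ‖deriv (T.project ε u w) θ‖² ≤ ofReal (1 + s) * T.pieceEnergy ε u (.edge w) +
          ofReal (1 + 1 / s) * (C * (ofReal ε * near (T.pieceEnergy ε u) w)) := by
  obtain ⟨C', hC'⟩ := T.exists_enorm_jump_le
  obtain ⟨c₀, hc₀, hlen⟩ := T.len_ge
  refine ⟨C' * toNNReal c₀⁻¹, fun ε h c u hu s hs w => ?_⟩
  have hL := T.len_pos w.length
  have hδ := pow_pos T.δ_pos w.length
  calc _ ≤ volume (T.scale ε w • T.Ω) * ∫⁻ θ in I(T, w),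
        (ofReal (1 + s) * ‖deriv (T.edgeMean ε u w) θ‖² +
          ofReal (1 + 1 / s) * (ofReal (ℓ(T, w)⁻¹ ^ 2) * ‖T.jump ε u w‖²)) := by
        refine mul_le_mul_right (setLIntegral_mono' measurableSet_Ioo fun θ hθ => ?_) _
        rw [hu.deriv_project h w hθ]
        refine (enorm_add_sq_le_of_pos _ _ hs).trans (le_of_eq ?_)
        rw [enorm_mul, mul_pow, ← ofReal_norm_sq ((_ : ℝ) : ℂ), norm_real, norm_neg,
          norm_eq_abs, sq_abs]
    _ = ofReal (1 + s) * (volume (T.scale ε w • T.Ω) *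
          ∫⁻ θ in I(T, w), ‖deriv (T.edgeMean ε u w) θ‖²) +
        ofReal (1 + 1 / s) * (ofReal (ℓ(T, w)⁻¹) *
          (volume (T.scale ε w • T.Ω) * ‖T.jump ε u w‖²)) := by
        rw [lintegral_add_right _ measurable_const, setLIntegral_const,
          lintegral_const_mul' _ _ ofReal_ne_top, volume_Ioo, sub_zero]
        have h1 : ofReal (ℓ(T, w)⁻¹) = ofReal (ℓ(T, w)⁻¹ ^ 2) * ofReal ℓ(T, w) := by
          rw [← ofReal_mul (by positivity)]
          congr 1
          field_simp
        rw [h1]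
        ring
    _ ≤ ofReal (1 + s) * T.pieceEnergy ε u (.edge w) + ofReal (1 + 1 / s) * (ofReal (ℓ(T, w)⁻¹) *
          (C' * (ofReal (T.scale ε w) * near (T.pieceEnergy ε u) w))) :=
        add_le_add (mul_le_mul_right (hu.lintegral_deriv_edgeMean_le h w) _)
          (mul_le_mul_right (mul_le_mul_right (hC' ε h c u hu w) _) _)
    _ ≤ _ := by
        refine add_le_add le_rfl (mul_le_mul_right ?_ _)
        have h2 : ofReal (ℓ(T, w)⁻¹) * ofReal (T.scale ε w) ≤ ofReal c₀⁻¹ * ofReal ε := by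
          rw [← ofReal_mul (by positivity), ← ofReal_mul (by positivity)]
          refine ofReal_le_ofReal ?_
          rw [scale, ← div_eq_inv_mul, div_le_iff₀ hL, ← div_eq_inv_mul, div_mul_eq_mul_div,
            le_div_iff₀ hc₀, mul_assoc]
          refine mul_le_mul_of_nonneg_left ?_ h.pos.le
          rw [mul_comm]
          exact hlen _
        calc _ = C' * ((ofReal (ℓ(T, w)⁻¹) * ofReal (T.scale ε w)) *
              near (T.pieceEnergy ε u) w) := by ring
          _ ≤ C' * ((ofReal c₀⁻¹ * ofReal ε) * near (T.pieceEnergy ε u) w) :=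
              mul_le_mul_right (mul_le_mul_left h2 _) _
          _ = _ := by
              push_cast
              simp only [ofReal]
              ring

variable (T) in
theorem exists_lintegral_vertex_le : T.Uniformly fun C ε u => ∀ w,
      ∫⁻ x in V(T, ε, w), ‖u (.vertex w) x‖² ≤ C * (ofReal (T.scale ε w) *
          (T.pieceEnergy ε u (.vertex w) + T.pieceEnergy ε u (.edge w))) +
        C * (ofReal (T.scale ε w) * (volume (T.scale ε w • T.Ω) * ‖T.project ε u w ℓ(T, w)‖²)) := by
  obtain ⟨P, hP⟩ := T.exists_hasPoincare_vertex
  obtain ⟨C, hC⟩ := T.exists_average_sub_edgeMean_len_le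
  have hV : volume T.V ≠ ∞ := T.V_lipschitz.isBounded.measure_lt_top.ne
  have hΩ := T.volume_Ω_ne_zero
  set K : NNReal := (volume T.V).toNNReal
  set Q : NNReal := (volume T.Ω)⁻¹.toNNReal
  have hQ : Q = (volume T.Ω)⁻¹ := coe_toNNReal (by simpa using hΩ)
  refine ⟨2 * P * toNNReal T.radius + 4 * K * C * toNNReal T.radius + 4 * K * Q,
    fun ε h c u hu w => ?_⟩
  set t := T.scale ε w
  have ht := T.scale_pos h.pos w
  set m := ⨍ x in t • T.V, u (.vertex w) x
  set G := T.pieceEnergy ε u (.vertex w) + T.pieceEnergy ε u (.edge w)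
  have h1 : ∫⁻ x in V(T, ε, w), ‖u (.vertex w) x - m‖² ≤ ofReal (t ^ 2) * P * G := by
    refine (hP t ht _ (hu.contDiffOn (.vertex w)) (hu.memLp (.vertex w))).trans ?_
    refine mul_le_mul_right (le_trans ?_ le_self_add) _
    exact le_pieceEnergy Subset.rfl
  have hvol : volume (V(T, ε, w)) = ofReal (t ^ (d + 1)) * K := by
    rw [region_vertex, smul_eq_image_sim, volume_image_sim _ _ ht, coe_toNNReal hV]
  have hvolΩ : ofReal (t ^ d) = Q * volume (t • T.Ω) := by
    rw [smul_eq_image_sim, volume_image_sim _ _ ht, mul_left_comm, hQ,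
      ENNReal.inv_mul_cancel hΩ T.volume_Ω_ne_top, mul_one]
  have hm : ‖m‖² ≤ 2 * ‖m - T.edgeMean ε u w ℓ(T, w)‖² + 2 * ‖T.edgeMean ε u w ℓ(T, w)‖² := by
    have := InflatedTree.enorm_sub_sq_le m (T.edgeMean ε u w ℓ(T, w)) 0
    rwa [sub_zero, sub_zero] at this
  have ht2 : ofReal (t ^ 2) ≤ ofReal T.radius * ofReal t := by
    rw [← ofReal_mul T.radius_pos.le, sq]
    exact ofReal_le_ofReal (mul_le_mul_of_nonneg_right
      ((h.scale_le_len w).trans (T.len_le_radius _)) ht.le)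
  rw [project_len]
  set e := ‖T.edgeMean ε u w ℓ(T, w)‖²
  calc _ ≤ ∫⁻ x in V(T, ε, w), (2 * ‖u (.vertex w) x - m‖² + 2 * ‖m‖²) := by
        refine lintegral_mono fun x => ?_
        have := InflatedTree.enorm_sub_sq_le (u (.vertex w) x) m 0
        rwa [sub_zero, sub_zero] at this
    _ = 2 * (∫⁻ x in V(T, ε, w), ‖u (.vertex w) x - m‖²) +
        2 * ‖m‖² * (ofReal (t ^ (d + 1)) * K) := by
        rw [lintegral_add_right _ measurable_const, setLIntegral_const,
          lintegral_const_mul' _ _ (by norm_num), hvol]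
    _ ≤ 2 * (ofReal (t ^ 2) * P * G) + 2 * (2 * ‖m - T.edgeMean ε u w
          ℓ(T, w)‖² + 2 * e) * (ofReal (t ^ (d + 1)) * K) :=
        add_le_add (mul_le_mul_right h1 _) (mul_le_mul_left (mul_le_mul_right hm _) _)
    _ = 2 * P * (ofReal (t ^ 2) * G) +
        4 * K * (ofReal (t ^ (d + 1)) * ‖m - T.edgeMean ε u w ℓ(T, w)‖²) +
        4 * K * Q * (ofReal t * (volume (t • T.Ω) * e)) := by
        rw [pow_succ' t d, ofReal_mul ht.le, hvolΩ]
        ring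
    _ ≤ 2 * P * (ofReal (t ^ 2) * G) + 4 * K * (C * (ofReal (t ^ 2) * G)) +
        4 * K * Q * (ofReal t * (volume (t • T.Ω) * e)) :=
        add_le_add (add_le_add le_rfl (mul_le_mul_right (hC ε h c u hu w) _)) le_rfl
    _ = (2 * P + 4 * K * C) * (ofReal (t ^ 2) * G) +
        4 * K * Q * (ofReal t * (volume (t • T.Ω) * e)) := by ring
    _ ≤ (2 * P + 4 * K * C) * ((ofReal T.radius * ofReal t) * G) +
        4 * K * Q * (ofReal t * (volume (t • T.Ω) * e)) :=
        add_le_add (mul_le_mul_right (mul_le_mul_left ht2 _) _) le_rfl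
    _ = (2 * P * ofReal T.radius + 4 * K * C * ofReal T.radius) *
          (ofReal t * G) + 4 * K * Q * (ofReal t * (volume (t • T.Ω) * e)) := by ring
    _ ≤ _ := by
        push_cast
        exact add_le_add (mul_le_mul_left le_self_add _) (mul_le_mul_left le_add_self _)

variable (T ε) in
/-- The squared `L²` norm of a function on the inflated tree. -/
def inflatedMass (u : PieceFun d k) : ENNReal := ∑' i, ∫⁻ x in T.region ε i, ‖u i x‖²

variable (T ε) in
/-- The squared `L²` norm of the gradient of a function on the inflated tree. -/
def inflatedEnergy (u : PieceFun d k) : ENNReal := ∑' i, T.pieceEnergy ε u i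

variable (T ε) in
/-- The squared `L²` distance, near an edge, of a function on the inflated tree to one on the
one-dimensional tree. -/
def defect (u : PieceFun d k) (v : EdgeFun k) (w : Edge k) : ENNReal :=
  (∫⁻ x in E(T, ε, w), ‖u (.edge w) x - v w (axial x)‖²) + ∫⁻ x in V(T, ε, w), ‖u (.vertex w) x‖²

theorem ofReal_mul_treeMeasure (hε : 0 < ε) (w : Edge k) (F : ℝ → ENNReal) :
    ofReal (ε ^ d) * ∫⁻ θ, F θ ∂T.treeMeasure w =
      volume (T.scale ε w • T.Ω) * ∫⁻ θ in I(T, w), F θ := by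
  rw [lintegral_treeMeasure, volume_smul_Ω hε, mul_assoc]

theorem lintegral_edge_axial (w : Edge k) {F : ℝ → ENNReal}
    (hF : AEMeasurable (fun x => F (axial x)) (volume.restrict (E(T, ε, w)))) :
    ∫⁻ x in E(T, ε, w), F (axial x) = volume (T.scale ε w • T.Ω) * ∫⁻ θ in J(T, ε, w), F θ := by
  rw [region_edge, lintegral_slab hF]
  simp only [axial_point, setLIntegral_const]
  rw [lintegral_mul_const' _ _ (isBounded_smul_Ω w).measure_lt_top.ne, mul_comm]

theorem Ioo_start_finish_subset (T : Data d k) (hε : 0 < ε) (w : Edge k) : J(T, ε, w) ⊆ I(T, w) :=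
  Ioo_subset_Ioo (T.start_nonneg hε w) (T.finish_le hε w)

theorem IsTreeTest.aesm_axial {v : EdgeFun k} (hv : T.IsTreeTest c v)
    (hε : 0 < ε) (w : Edge k) : AEStronglyMeasurable (fun x => v w (axial x))
      (volume.restrict (E(T, ε, w))) :=
  ((hv.contDiff w).continuousOn.comp continuous_axial.continuousOn fun _ hx =>
    Ioo_subset_Icc_self (T.Ioo_start_finish_subset hε w hx.2)).aestronglyMeasurable
      (T.isOpen_region hε _).measurableSet

theorem IsTreeTest.lintegral_edge_axial_le {v : EdgeFun k} (hv : T.IsTreeTest c v)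
    (hε : 0 < ε) (w : Edge k) :
    ∫⁻ x in E(T, ε, w), ‖v w (axial x)‖² ≤ ofReal (ε ^ d) * ∫⁻ θ, ‖v w θ‖² ∂T.treeMeasure w := by
  rw [ofReal_mul_treeMeasure hε, lintegral_edge_axial w
    (F := fun θ => ‖v w θ‖²) ((hv.aesm_axial hε w).enorm.pow_const 2)]
  exact mul_le_mul_right (lintegral_mono_set (T.Ioo_start_finish_subset hε w)) _

theorem IsTreeTest.lintegral_edge_add_vertex_le {v : EdgeFun k} (hv : T.IsTreeTest c v)
    (hε : 0 < ε) (u : PieceFun d k) (w : Edge k) :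
    (∫⁻ x in E(T, ε, w), ‖u (.edge w) x‖²) + ∫⁻ x in V(T, ε, w), ‖u (.vertex w) x‖² ≤
      2 * T.defect ε u v w + 2 * (ofReal (ε ^ d) * ∫⁻ θ, ‖v w θ‖² ∂T.treeMeasure w) := by
  have h1 : ∫⁻ x in E(T, ε, w), ‖u (.edge w) x‖² ≤
      2 * (∫⁻ x in E(T, ε, w), ‖u (.edge w) x - v w (axial x)‖²) +
        2 * ∫⁻ x in E(T, ε, w), ‖v w (axial x)‖² := by
    rw [← lintegral_const_mul' _ _ (by norm_num), ← lintegral_const_mul' _ _ (by norm_num),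
      ← lintegral_add_right' _ (((hv.aesm_axial hε w).enorm.pow_const 2).const_mul _)]
    refine lintegral_mono fun x => ?_
    have := InflatedTree.enorm_sub_sq_le (u (.edge w) x) (v w (axial x)) 0
    rwa [sub_zero, sub_zero] at this
  rw [defect, mul_add, add_right_comm]
  refine add_le_add (h1.trans (add_le_add le_rfl (mul_le_mul_right
    (hv.lintegral_edge_axial_le hε w) _))) ?_
  rw [two_mul]
  exact le_self_add

theorem IsTreeTest.inflatedMass_le {v : EdgeFun k} (hv : T.IsTreeTest c v)
    (hε : 0 < ε) (u : PieceFun d k) :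
    T.inflatedMass ε u ≤ 2 * ∑' w, T.defect ε u v w + 2 * (ofReal (ε ^ d) * T.treeMass v) := by
  rw [inflatedMass, tsum_piece, ← tsum_add, treeMass, ← etsum_mul,
    ← etsum_mul, ← etsum_mul, ← tsum_add]
  exact tsum_le_tsum fun w => hv.lintegral_edge_add_vertex_le hε u w

theorem tsum_subtype_near_le (u : PieceFun d k) (S : Set (Edge k)) :
    ∑' w : S, near (T.pieceEnergy ε u) w ≤ (k + 1) * T.inflatedEnergy ε u :=
  (ENNReal.tsum_comp_le_tsum_of_injective Subtype.val_injective _).trans (tsum_near_le _)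

theorem scale_le_of_le_length (T : Data d k) (hε : 0 < ε) {N : ℕ} {w : Edge k} (h : N ≤ w.length) :
    ofReal (T.scale ε w) ≤ ofReal ε * ofReal (T.δ ^ N) := by
  rw [← ofReal_mul hε.le]
  exact ofReal_le_ofReal (mul_le_mul_of_nonneg_left
    (pow_le_pow_of_le_one T.δ_pos.le T.δ_lt_one.le h) hε.le)

theorem scale_mul_volume_le {c₀ : ℝ} (hc₀ : 0 < c₀) (hlen : ∀ n, c₀ * T.δ ^ n ≤ T.len n)
    (hε : 0 < ε) (w : Edge k) (z : ENNReal) :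
    ofReal (T.scale ε w) * (volume (T.scale ε w • T.Ω) * z) ≤
      ofReal ε * ofReal c₀⁻¹ * ofReal (ε ^ d) * (ofReal ℓ(T, w) * (T.weight w * z)) := by
  have h1 : ofReal (T.scale ε w) ≤ ofReal ε * ofReal c₀⁻¹ * ofReal ℓ(T, w) := by
    rw [← ofReal_mul hε.le, ← ofReal_mul (by positivity)]
    refine ofReal_le_ofReal ?_
    rw [scale, mul_assoc]
    refine mul_le_mul_of_nonneg_left ?_ hε.le
    rw [← div_eq_inv_mul, le_div_iff₀ hc₀, mul_comm]
    exact hlen _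
  rw [volume_smul_Ω hε]
  refine (mul_le_mul_left h1 _).trans (le_of_eq ?_)
  ring

variable (T) in
theorem exists_treeEnergy_project_le : T.Uniformly fun C ε u => T.inflatedMass ε u ≠ ∞ →
    T.inflatedEnergy ε u ≠ ∞ →
      T.treeMass (T.project ε u) ≠ ∞ ∧ ∀ s > 0, ofReal (ε ^ d) * T.treeEnergy (T.project ε u) ≤
          (ofReal (1 + s) + ofReal (1 + 1 / s) * (C * ofReal ε)) * T.inflatedEnergy ε u := by
  obtain ⟨C, hC⟩ := T.exists_lintegral_project_le
  obtain ⟨C', hC'⟩ := T.exists_lintegral_deriv_project_le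
  refine ⟨C' * (k + 1), fun ε h c u hu hM hE => ⟨?_, fun s hs => ?_⟩⟩
  · have h1 : ofReal (ε ^ d) * T.treeMass (T.project ε u) ≤
        4 * T.inflatedMass ε u + C * ((k + 1) * T.inflatedEnergy ε u) := by
      rw [treeMass, ← etsum_mul]
      calc _ ≤ ∑' w, (4 * (∫⁻ x in E(T, ε, w), ‖u (.edge w) x‖²) +
            C * near (T.pieceEnergy ε u) w) := by
            refine tsum_le_tsum fun w => ?_
            rw [ofReal_mul_treeMeasure h.pos]
            exact hC ε h c u hu w
        _ ≤ _ := by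
            rw [tsum_add, etsum_mul, etsum_mul]
            refine add_le_add (mul_le_mul_right ?_ _) (mul_le_mul_right (tsum_near_le _) _)
            rw [inflatedMass, tsum_piece]
            exact le_self_add
    intro hcon
    rw [hcon, mul_top ((ENNReal.ofReal_pos.2 (pow_pos h.pos d)).ne'), top_le_iff] at h1
    exact absurd h1 (by finiteness)
  · rw [treeEnergy, treeMass, ← etsum_mul]
    calc _ ≤ ∑' w, (ofReal (1 + s) * T.pieceEnergy ε u (.edge w) +
          ofReal (1 + 1 / s) * (C' * (ofReal ε * near (T.pieceEnergy ε u) w))) := by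
          refine tsum_le_tsum fun w => ?_
          rw [ofReal_mul_treeMeasure h.pos]
          exact hC' ε h c u hu s hs w
      _ ≤ ofReal (1 + s) * T.inflatedEnergy ε u + ofReal (1 + 1 / s) *
          (C' * (ofReal ε * ((k + 1) * T.inflatedEnergy ε u))) := by
          rw [tsum_add, etsum_mul, etsum_mul,
            etsum_mul, etsum_mul]
          refine add_le_add (mul_le_mul_right ?_ _) (mul_le_mul_right (mul_le_mul_right
            (mul_le_mul_right (tsum_near_le _) _) _) _)
          rw [inflatedEnergy, tsum_piece]
          exact le_self_add
      _ = _ := by push_cast; ring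

theorem Fits.le_radius (h : T.Fits ε) : ε ≤ T.radius := by
  have h1 := h.scale_le_len []
  rw [scale, List.length_nil, pow_zero, mul_one] at h1
  exact h1.trans (T.len_le_radius _)

variable (T) in
/-- Functions on the inflated tree are close to their projections, uniformly in the tails. -/
theorem exists_defect_project_le (hk : 1 ≤ k) : ∃ (C : NNReal) (R : ℕ → ENNReal),
    Tendsto R atTop (𝓝 0) ∧ (∀ N, R N ≠ ∞) ∧ ∀ ε, T.Fits ε → ∀ c u,
    T.FiniteTest ε c u → T.inflatedMass ε u ≠ ∞ → T.inflatedEnergy ε u ≠ ∞ →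
      T.treeEnergy (T.project ε u) ≠ ∞ ∧
      ofReal (ε ^ d) * T.treeEnergy (T.project ε u) ≤ C * T.inflatedEnergy ε u ∧
      ∀ N, ∑' w : {w : Edge k | N ≤ w.length}, T.defect ε u (T.project ε u) w ≤
        ofReal ε * R N * T.inflatedEnergy ε u := by
  obtain ⟨C₀, hC₀⟩ := T.exists_treeEnergy_project_le
  obtain ⟨C₁, hC₁⟩ := T.exists_lintegral_sub_project_le
  obtain ⟨C₂, hC₂⟩ := T.exists_lintegral_vertex_le
  obtain ⟨b, R, hR, hRfin, htail⟩ := T.exists_treeTail hk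
  obtain ⟨c₀, hc₀, hlen⟩ := T.len_ge
  set K : NNReal := 2 + 2 * (C₀ * toNNReal T.radius)
  refine ⟨K, fun N => (C₁ * (k + 1) + C₂ * 2) * ofReal (T.δ ^ N) +
    C₂ * ofReal c₀⁻¹ * K * R N, ?_, fun N => ?_, fun ε h c u hu hM hE => ?_⟩
  · have h1 : Tendsto (fun N => ofReal (T.δ ^ N)) atTop (𝓝 0) := by
      have := ENNReal.tendsto_ofReal (tendsto_pow_atTop_nhds_zero_of_lt_one T.δ_pos.le T.δ_lt_one)
      rwa [ENNReal.ofReal_zero] at this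
    have h2 := (ENNReal.Tendsto.const_mul (a := C₁ * (k + 1) + C₂ * 2) h1
      (Or.inr (by finiteness))).add (ENNReal.Tendsto.const_mul
        (a := C₂ * ofReal c₀⁻¹ * K) hR (Or.inr (by finiteness)))
    simpa using h2
  · have := hRfin N
    finiteness
  obtain ⟨hMv, hEv⟩ := hC₀ ε h c u hu hM hE
  have hEK : ofReal (ε ^ d) * T.treeEnergy (T.project ε u) ≤ K * T.inflatedEnergy ε u := by
    refine (hEv 1 one_pos).trans (mul_le_mul_left ?_ _)
    have h2 : ofReal (1 + 1) = 2 := by norm_num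
    rw [div_one, h2]
    simp
    exact add_le_add le_rfl (mul_le_mul_right (mul_le_mul_right (ofReal_le_ofReal h.le_radius) _) _)
  have hEv' : T.treeEnergy (T.project ε u) ≠ ∞ := fun hcon => by
    rw [hcon, mul_top (ENNReal.ofReal_pos.2 (pow_pos h.pos d)).ne', top_le_iff] at hEK
    exact absurd hEK (by finiteness)
  refine ⟨hEv', hEK, fun N => ?_⟩
  have htl := ((htail c _ (hu.isTreeTest_project h) hMv hEv').2 N).2
  rw [← tsum_subtype] at htl
  set S := {w : Edge k | N ≤ w.length}
  set E := T.inflatedEnergy ε u with hE_def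
  have hedges : ∑' w : S, (T.pieceEnergy ε u (.vertex w) + T.pieceEnergy ε u (.edge w)) ≤ 2 *
    E := by
    refine (ENNReal.tsum_comp_le_tsum_of_injective Subtype.val_injective
      fun w => T.pieceEnergy ε u (.vertex w) + T.pieceEnergy ε u (.edge w)).trans ?_
    rw [tsum_add, two_mul, hE_def, inflatedEnergy, tsum_piece]
    exact add_le_add le_add_self le_self_add
  calc _ ≤ ∑' w : S, (C₁ * (ofReal ε * ofReal (T.δ ^ N)) * near (T.pieceEnergy ε u) w +
        (C₂ * (ofReal ε * ofReal (T.δ ^ N)) *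
          (T.pieceEnergy ε u (.vertex w) + T.pieceEnergy ε u (.edge w)) +
        C₂ * (ofReal ε * ofReal c₀⁻¹ * ofReal (ε ^ d)) * (ofReal (T.len w.1.length) *
            (T.weight w * ‖T.project ε u w (T.len w.1.length)‖²)))) := by
        refine tsum_le_tsum fun w => ?_
        have hw := T.scale_le_of_le_length h.pos w.2
        refine add_le_add ((hC₁ ε h c u hu w).trans ?_)
          ((hC₂ ε h c u hu w).trans (add_le_add ?_ ?_))
        · rw [mul_assoc (C₁ : ENNReal)]
          exact mul_le_mul_right (mul_le_mul_left hw _) _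
        · rw [mul_assoc (C₂ : ENNReal)]
          exact mul_le_mul_right (mul_le_mul_left hw _) _
        · rw [mul_assoc (C₂ : ENNReal)]
          exact mul_le_mul_right (scale_mul_volume_le hc₀ hlen h.pos _ _) _
    _ ≤ C₁ * (ofReal ε * ofReal (T.δ ^ N)) * ((k + 1) * E) +
        (C₂ * (ofReal ε * ofReal (T.δ ^ N)) * (2 * E) +
        C₂ * (ofReal ε * ofReal c₀⁻¹ * ofReal (ε ^ d)) * (R N * T.treeEnergy (T.project ε u))) := by
        rw [tsum_add, tsum_add, etsum_mul, etsum_mul, etsum_mul]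
        exact add_le_add (mul_le_mul_right (tsum_subtype_near_le u S) _)
          (add_le_add (mul_le_mul_right hedges _) (mul_le_mul_right htl _))
    _ = ofReal ε * ((C₁ * (k + 1) + C₂ * 2) * ofReal (T.δ ^ N)) * E +
        ofReal ε * (C₂ * ofReal c₀⁻¹ * R N) *
          (ofReal (ε ^ d) * T.treeEnergy (T.project ε u)) := by ring
    _ ≤ ofReal ε * ((C₁ * (k + 1) + C₂ * 2) * ofReal (T.δ ^ N)) * E +
        ofReal ε * (C₂ * ofReal c₀⁻¹ * R N) * (K * E) :=
        add_le_add le_rfl (mul_le_mul_right hEK _)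
    _ = _ := by ring

end Data

/-- A smooth increasing map of the unit interval onto itself that is flat at the ends and close to
the identity in `C¹` away from the ends. -/
def flatten (N : ℕ) (s : ℝ) : ℝ :=
  (2 * N + 3) / (2 * N + 2) * s - ((2 * s - 1) ^ (2 * N + 3) + 1) / (2 * (2 * N + 2))

theorem hasDerivAt_flatten (N : ℕ) (s : ℝ) : HasDerivAt (flatten N)
    ((2 * N + 3) / (2 * N + 2) * (1 - (2 * s - 1) ^ (2 * N + 2))) s := by
  have h1 : HasDerivAt (fun s => 2 * s - 1) 2 s := by
    simpa using ((hasDerivAt_id' s).const_mul 2).sub_const 1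
  refine (((hasDerivAt_id' s).const_mul ((2 * N + 3) / (2 * N + 2) : ℝ)).sub
    (((h1.fun_pow (2 * N + 3)).add_const 1).div_const (2 * (2 * N + 2)))).congr_deriv ?_
  have : (2 * N + 3 - 1 : ℕ) = 2 * N + 2 := rfl
  rw [this]
  push_cast
  field_simp

theorem flatten_zero (N : ℕ) : flatten N 0 = 0 := by
  have : Odd (2 * N + 3) := ⟨N + 1, by ring⟩
  simp [flatten, this.neg_one_pow]

theorem flatten_one (N : ℕ) : flatten N 1 = 1 := by
  rw [flatten]
  norm_num
  field_simp
  ring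

theorem sq_le_one_of_mem {s : ℝ} (hs : s ∈ Icc (0 : ℝ) 1) : |2 * s - 1| ≤ 1 :=
  abs_le.2 ⟨by linarith [hs.1], by linarith [hs.2]⟩

theorem deriv_flatten_mem (N : ℕ) {s : ℝ} (hs : s ∈ Icc (0 : ℝ) 1) :
    (2 * N + 3) / (2 * N + 2) * (1 - (2 * s - 1) ^ (2 * N + 2)) ∈
      Icc (0 : ℝ) (1 + 1 / (2 * N + 2)) := by
  have h1 : (2 * s - 1) ^ (2 * N + 2) ≤ 1 := by
    refine (le_abs_self _).trans ?_
    rw [abs_pow]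
    exact pow_le_one₀ (abs_nonneg _) (sq_le_one_of_mem hs)
  have h2 : 0 ≤ (2 * s - 1) ^ (2 * N + 2) := Even.pow_nonneg ⟨N + 1, by ring⟩ _
  have h3 : (2 * N + 3) / (2 * N + 2) = (1 + 1 / (2 * N + 2) : ℝ) := by field_simp; ring
  refine ⟨mul_nonneg (by positivity) (by linarith), ?_⟩
  rw [h3]
  exact mul_le_of_le_one_right (by positivity) (by linarith)

theorem strictMonoOn_flatten (N : ℕ) : StrictMonoOn (flatten N) (Icc 0 1) := by
  refine strictMonoOn_of_deriv_pos (convex_Icc 0 1)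
    (fun s _ => (hasDerivAt_flatten N s).continuousAt.continuousWithinAt) fun s hs => ?_
  rw [interior_Icc] at hs
  rw [(hasDerivAt_flatten N s).deriv]
  refine mul_pos (by positivity) (sub_pos.2 ?_)
  have h1 : |2 * s - 1| < 1 := abs_lt.2 ⟨by linarith [hs.1], by linarith [hs.2]⟩
  refine (le_abs_self _).trans_lt ?_
  rw [abs_pow]
  exact pow_lt_one₀ (abs_nonneg _) h1 (by omega)

theorem abs_flatten_sub_le (N : ℕ) {s : ℝ} (hs : s ∈ Icc (0 : ℝ) 1) :
    |flatten N s - s| ≤ 1 / (2 * N + 2) := by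
  have h1 := sq_le_one_of_mem hs
  have h2 : |(2 * s - 1) ^ (2 * N + 3)| ≤ 1 := by
    rw [abs_pow]
    exact pow_le_one₀ (abs_nonneg _) h1
  have h3 : flatten N s - s = ((2 * s - 1) - (2 * s - 1) ^ (2 * N + 3)) / 2 * (1 / (2 * N +
    2)) := by
    rw [flatten]
    field_simp
    ring
  rw [h3, abs_mul, abs_of_pos (show (0 : ℝ) < 1 / (2 * N + 2) by positivity)]
  refine mul_le_of_le_one_left (by positivity) ?_
  rw [abs_le] at h1 h2 ⊢
  constructor <;> linarith

theorem contDiff_flatten (N : ℕ) : ContDiff ℝ 1 (flatten N) := by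
  unfold flatten
  fun_prop

namespace Data

variable (T ε) in
/-- A parametrisation of an edge of the tree by the coordinate of the inflated edge. -/
def stretch (w : Edge k) (σ : ℝ) : ℝ :=
  ℓ(T, w) * flatten ⌈1 / ε⌉₊ ((σ - T.start ε w) / Λ(T, ε, w))

variable (T ε) in
/-- The derivative of `stretch`. -/
def stretchDeriv (w : Edge k) (σ : ℝ) : ℝ := ℓ(T, w) * ((2 * ⌈1 / ε⌉₊ + 3) / (2 * ⌈1 / ε⌉₊ + 2) *
    (1 - (2 * ((σ - T.start ε w) / Λ(T, ε, w)) - 1) ^ (2 * ⌈1 / ε⌉₊ + 2)) *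
      (1 / Λ(T, ε, w)))

theorem hasDerivAt_stretch (w : Edge k) (σ : ℝ) :
    HasDerivAt (T.stretch ε w) (T.stretchDeriv ε w σ) σ :=
  ((hasDerivAt_flatten _ _).comp σ (((hasDerivAt_id' σ).sub_const (T.start ε w)).div_const
    Λ(T, ε, w))).const_mul _

theorem contDiff_stretch (w : Edge k) : ContDiff ℝ 1 (T.stretch ε w) :=
  contDiff_const.mul ((contDiff_flatten _).comp ((contDiff_id.sub contDiff_const).div_const _))

theorem Fits.ratio_mem (h : T.Fits ε) (w : Edge k) {σ : ℝ}
    (hσ : σ ∈ Icc (T.start ε w) (T.finish ε w)) :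
    (σ - T.start ε w) / Λ(T, ε, w) ∈ Icc (0 : ℝ) 1 := by
  have h1 := sub_pos.2 (h.start_lt_finish w)
  exact ⟨div_nonneg (by linarith [hσ.1]) h1.le, (div_le_one h1).2 (by linarith [hσ.2])⟩

theorem stretch_start (w : Edge k) : T.stretch ε w (T.start ε w) = 0 := by
  simp [stretch, flatten_zero]

theorem Fits.stretch_finish (h : T.Fits ε) (w : Edge k) :
    T.stretch ε w (T.finish ε w) = ℓ(T, w) := by
  rw [stretch, div_self (sub_pos.2 (h.start_lt_finish w)).ne', flatten_one, mul_one]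

theorem stretchDeriv_start (w : Edge k) : T.stretchDeriv ε w (T.start ε w) = 0 := by
  have : Even (2 * ⌈1 / ε⌉₊ + 2) := ⟨⌈1 / ε⌉₊ + 1, by ring⟩
  rw [stretchDeriv, sub_self, zero_div, mul_zero, zero_sub, this.neg_one_pow]
  simp

theorem Fits.stretchDeriv_finish (h : T.Fits ε) (w : Edge k) :
    T.stretchDeriv ε w (T.finish ε w) = 0 := by
  rw [stretchDeriv, div_self (sub_pos.2 (h.start_lt_finish w)).ne']
  norm_num

theorem Fits.strictMonoOn_stretch (h : T.Fits ε) (w : Edge k) :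
    StrictMonoOn (T.stretch ε w) (Icc (T.start ε w) (T.finish ε w)) := fun x hx y hy hxy => by
  refine mul_lt_mul_of_pos_left (strictMonoOn_flatten _ (h.ratio_mem w hx) (h.ratio_mem w hy) ?_)
    (T.len_pos _)
  exact div_lt_div_of_pos_right (by linarith) (sub_pos.2 (h.start_lt_finish w))

theorem Fits.stretch_mem (h : T.Fits ε) (w : Edge k) {σ : ℝ}
    (hσ : σ ∈ Icc (T.start ε w) (T.finish ε w)) :
    T.stretch ε w σ ∈ Icc 0 ℓ(T, w) := by
  have hm := (h.strictMonoOn_stretch w).monotoneOn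
  have hle := (h.start_lt_finish w).le
  have h1 := hm ⟨le_rfl, hle⟩ hσ hσ.1
  have h2 := hm hσ ⟨hle, le_rfl⟩ hσ.2
  rw [stretch_start] at h1
  rw [h.stretch_finish] at h2
  exact ⟨h1, h2⟩

theorem Fits.stretch_mem_Ioo (h : T.Fits ε) (w : Edge k) {σ : ℝ} (hσ : σ ∈ J(T, ε, w)) :
    T.stretch ε w σ ∈ I(T, w) := by
  have hle := (h.start_lt_finish w).le
  have h1 := h.strictMonoOn_stretch w ⟨le_rfl, hle⟩ (Ioo_subset_Icc_self hσ) hσ.1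
  have h2 := h.strictMonoOn_stretch w (Ioo_subset_Icc_self hσ) ⟨hle, le_rfl⟩ hσ.2
  rw [stretch_start] at h1
  rw [h.stretch_finish] at h2
  exact ⟨h1, h2⟩

theorem one_div_ceil_le (hε : 0 < ε) : 1 / (2 * (⌈1 / ε⌉₊ : ℝ) + 2) ≤ ε := by
  have h1 : 1 / ε ≤ ⌈1 / ε⌉₊ := Nat.le_ceil _
  rw [div_le_iff₀ (by positivity)]
  rw [div_le_iff₀ hε] at h1
  nlinarith

theorem Fits.abs_stretch_sub_le (h : T.Fits ε) (w : Edge k) {σ : ℝ}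
    (hσ : σ ∈ Icc (T.start ε w) (T.finish ε w)) :
    |T.stretch ε w σ - σ| ≤ (T.radius + T.slack) * ε := by
  set s := (σ - T.start ε w) / Λ(T, ε, w)
  have hs := h.ratio_mem w hσ
  have h1 : |ℓ(T, w) * (flatten ⌈1 / ε⌉₊ s - s)| ≤ T.radius * ε := by
    rw [abs_mul, abs_of_pos (T.len_pos w.length)]
    exact mul_le_mul (T.len_le_radius _) ((abs_flatten_sub_le _ hs).trans (one_div_ceil_le h.pos))
      (abs_nonneg _) T.radius_pos.le
  have hσs : σ = T.start ε w + Λ(T, ε, w) * s := by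
    have := (sub_pos.2 (h.start_lt_finish w)).ne'
    simp only [s]
    field_simp
    ring
  have hsc : T.scale ε w ≤ ε := mul_le_of_le_one_right h.pos.le
    (pow_le_one₀ T.δ_pos.le T.δ_lt_one.le)
  have hsl := T.one_le_slack
  have hpos := T.scale_pos h.pos w
  have h2 : |ℓ(T, w) * s - σ| ≤ T.slack * ε := by
    have ha := T.start_le h.pos w
    have ha' := T.start_nonneg h.pos w
    have hb := T.le_finish h.pos w
    have hb' := T.finish_le h.pos w
    have h3 : (T.slack - 1) * T.scale ε w ≤ T.slack * ε := by nlinarith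
    have h4 : ℓ(T, w) * s - σ = (ℓ(T, w) - T.finish ε w) * s - T.start ε w * (1 - s) := by
      rw [hσs]; ring
    rw [h4, abs_le]
    constructor
    · nlinarith [mul_nonneg (sub_nonneg.2 hb') hs.1, mul_nonneg ha' hs.1]
    · nlinarith [mul_nonneg (sub_nonneg.2 hb') (sub_nonneg.2 hs.2),
        mul_nonneg ha' (sub_nonneg.2 hs.2)]
  have h5 : T.stretch ε w σ - σ = ℓ(T, w) * (flatten ⌈1 / ε⌉₊ s - s) + (ℓ(T, w) * s - σ) := by
    simp only [stretch, s]; ring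
  rw [h5]
  refine (abs_add_le _ _).trans ?_
  linarith

variable (T) in
theorem exists_stretchDeriv_mem : ∃ C : NNReal, ∀ ε, T.Fits ε → ∀ w : Edge k,
    ∀ σ ∈ Icc (T.start ε w) (T.finish ε w),
      T.stretchDeriv ε w σ ∈ Icc (0 : ℝ) ((1 + C * ε) * (1 + ε)) := by
  obtain ⟨c₀, hc₀, hlen⟩ := T.len_ge
  have hsl := T.one_le_slack
  refine ⟨⟨4 * T.slack / c₀, by positivity⟩, fun ε h w σ hσ => ?_⟩
  have hL := T.len_pos w.length
  have hε := h.pos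
  have hpos := sub_pos.2 (h.start_lt_finish w)
  obtain ⟨h1, h2⟩ := deriv_flatten_mem ⌈1 / ε⌉₊ (h.ratio_mem w hσ)
  have h3 : ℓ(T, w) * (1 / Λ(T, ε, w)) ≤ 1 + 4 * T.slack / c₀ * ε := by
    rw [mul_one_div, div_le_iff₀ hpos]
    have h4 : ℓ(T, w) - Λ(T, ε, w) ≤ 2 * T.slack * T.scale ε w := by
      have ha := T.start_le h.pos w
      have hb := T.le_finish h.pos w
      have := T.scale_pos h.pos w
      nlinarith
    have h5 : c₀ * T.scale ε w ≤ ε * ℓ(T, w) := by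
      rw [scale, mul_left_comm]
      exact mul_le_mul_of_nonneg_left (hlen _) hε.le
    have h6 : ℓ(T, w) ≤ 2 * Λ(T, ε, w) := by
      linarith [h.len_le w, T.scale_pos h.pos w]
    have h7 : 2 * T.slack * T.scale ε w ≤ 4 * T.slack / c₀ * ε * Λ(T, ε, w) := by
      rw [div_mul_eq_mul_div, div_mul_eq_mul_div, le_div_iff₀ hc₀]
      have h8 := h5.trans (mul_le_mul_of_nonneg_left h6 hε.le)
      nlinarith
    linarith
  have h4 : T.stretchDeriv ε w σ = (ℓ(T, w) * (1 / Λ(T, ε, w))) *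
      ((2 * ⌈1 / ε⌉₊ + 3) / (2 * ⌈1 / ε⌉₊ + 2) *
    (1 - (2 * ((σ - T.start ε w) / Λ(T, ε, w)) - 1) ^ (2 * ⌈1 / ε⌉₊ + 2))) := by
    rw [stretchDeriv]; ring
  rw [h4]
  refine ⟨mul_nonneg (by positivity) h1, ?_⟩
  refine mul_le_mul h3 (h2.trans ?_) h1 ?_
  · linarith [one_div_ceil_le hε]
  · exact le_trans (by positivity) h3

variable (T ε) in
/-- The function on the inflated tree that belongs to a function on the one-dimensional tree. -/
def lift (v : EdgeFun k) : PieceFun d k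
  | .edge w => fun x => v w (T.stretch ε w (axial x))
  | .vertex w => fun _ => v w ℓ(T, w)

/-- The last coordinate as a linear form. -/
def axialCLM (d : ℕ) : Eucl (d + 1) →L[ℝ] ℝ := EuclideanSpace.proj (Fin.last d)

theorem fderivWithin_lift_eq_zero (h : T.Fits ε) (hv : T.IsTreeTest c v) (w : Edge k)
    {x : Eucl (d + 1)} (hx : x ∈ T.closedRegion ε (.edge w))
    (h0 : T.stretchDeriv ε w (axial x) = 0) :
    fderivWithin ℝ (T.lift ε v (.edge w)) (T.closedRegion ε (.edge w)) x = 0 := by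
  have h1 : HasDerivWithinAt (T.stretch ε w) 0 (Icc (T.start ε w) (T.finish ε w)) (axial x) :=
    h0 ▸ (hasDerivAt_stretch w (axial x)).hasDerivWithinAt
  have h3 := ((((hv.contDiff w).differentiableOn one_ne_zero) _
    (h.stretch_mem w hx.2)).hasDerivWithinAt).scomp (axial x) h1 fun σ hσ => h.stretch_mem w hσ
  rw [zero_smul] at h3
  have h5 := (h3.hasFDerivWithinAt.comp x (s := T.closedRegion ε (.edge w))
    (axialCLM d).hasFDerivWithinAt fun z hz => hz.2).fderivWithin
    (T.uniqueDiffOn_closedRegion h.pos (fun w => h.start_lt_finish w) _ x hx)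
  refine h5.trans ?_
  ext z
  simp

theorem isInflatedTest_lift (h : T.Fits ε) (hv : T.IsTreeTest c v) :
    T.IsInflatedTest ε c (T.lift ε v) := by
  have hle := fun w => (h.start_lt_finish w).le
  have hlow : ∀ w, ∀ y ∈ T.Ω, point (T.scale ε w • y) (T.finish ε w) ∈
      T.closedRegion ε (.edge w) := fun w y hy => by
    refine ⟨?_, ?_⟩
    · rw [cross_point]; exact smul_mem_smul_set hy
    · rw [axial_point]; exact ⟨hle w, le_rfl⟩
  have hup : ∀ w j, ∀ y ∈ T.δ • T.Ω, point (T.scale ε w • y)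
      (T.start ε (j :: w)) ∈ T.closedRegion ε (.edge (j :: w)) := fun w j y hy => by
    refine ⟨?_, ?_⟩
    · rw [cross_point, T.scale_cons, ← smul_smul]; exact smul_mem_smul_set hy
    · rw [axial_point]; exact ⟨le_rfl, hle _⟩
  constructor
  · intro i
    cases i with
    | edge w =>
      exact (hv.contDiff w).comp ((contDiff_stretch w).comp (axialCLM d).contDiff).contDiffOn
        fun x hx => h.stretch_mem w hx.2
    | vertex w => exact contDiffOn_const
  · intro w y hy
    simp only [lift, axial_point, h.stretch_finish]
  · intro w j y hy
    simp only [lift, axial_point, stretch_start, hv.continuous]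
  · intro w y hy a t
    rw [fderivWithin_lift_eq_zero h hv w (hlow w y hy) (by rw [axial_point, h.stretchDeriv_finish])]
    simp [lift]
  · intro w j y hy a t
    rw [fderivWithin_lift_eq_zero h hv (j :: w) (hup w j y hy)
      (by rw [axial_point, stretchDeriv_start])]
    simp [lift]
  · intro y hy
    have h1 : T.stretch ε ([] : Edge k) 0 = 0 := stretch_start []
    simp only [lift, axial_point, h1, hv.root]
  · intro hc
    obtain ⟨n, hn⟩ := hv.ends hc
    refine ⟨n, fun w hw => ⟨fun x hx => ?_, fun x hx => ?_⟩⟩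
    · exact hn w hw _ (h.stretch_mem w hx.2)
    · exact hn w hw _ ⟨(T.len_pos _).le, le_rfl⟩

theorem norm_grad_comp_axial {g : ℝ → ℂ} {x : Eucl (d + 1)} (hg : DifferentiableAt ℝ g (axial x)) :
    ‖grad (fun x => g (axial x)) x‖ = ‖deriv g (axial x)‖ := by
  have h1 : HasFDerivAt (fun x => g (axial x))
      ((ContinuousLinearMap.toSpanSingleton ℝ (deriv g (axial x))).comp (axialCLM d)) x :=
    hg.hasDerivAt.hasFDerivAt.comp x (axialCLM d).hasFDerivAt
  have h2 : grad (fun x => g (axial x)) x =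
      EuclideanSpace.single (Fin.last d) (deriv g (axial x)) := by
    ext i
    simp only [grad, h1.fderiv, axialCLM]
    by_cases hi : i = Fin.last d
    · subst hi; simp
    · simp [hi, Ne.symm hi]
  rw [h2]
  exact PiLp.norm_single 2 (fun _ => ℂ) _ _

variable (T) in
theorem exists_pieceEnergy_lift_le : ∃ C : NNReal, ∀ ε, T.Fits ε → ∀ c v, T.IsTreeTest c v →
    ∀ w, T.pieceEnergy ε (T.lift ε v) (.edge w) ≤ ofReal ((1 + C * ε) * (1 + ε)) *
      (ofReal (ε ^ d) * ∫⁻ θ, ‖deriv (v w) θ‖² ∂T.treeMeasure w) := by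
  obtain ⟨C, hC⟩ := T.exists_stretchDeriv_mem
  refine ⟨C, fun ε h c v hv w => ?_⟩
  set K := (1 + C * ε) * (1 + ε)
  set a := T.start ε w
  set b := T.finish ε w
  have hsub : Ioo a b ⊆ Icc a b := Ioo_subset_Icc_self
  set F : ℝ → ENNReal := fun σ => ofReal K *
    (ofReal (T.stretchDeriv ε w σ) * ‖deriv (v w) (T.stretch ε w σ)‖²)
  have hFm : Measurable F := by
    have h1 : Continuous (T.stretchDeriv ε w) := by unfold stretchDeriv; fun_prop
    exact measurable_const.mul (h1.measurable.ennreal_ofReal.mul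
      (((measurable_deriv (v w)).comp ((contDiff_stretch (T := T) (ε := ε)
        w).continuous.measurable)).enorm.pow_const 2))
  have h1 : T.pieceEnergy ε (T.lift ε v) (.edge w) ≤ ∫⁻ x in E(T, ε, w), F (axial x) := by
    refine setLIntegral_mono' (T.isOpen_region h.pos _).measurableSet fun x hx => ?_
    have hx' := hx.2
    have hs := hC ε h w _ (hsub hx')
    have hd := (hv.differentiableAt w (h.stretch_mem_Ioo w hx')).hasDerivAt.scomp _
        (hasDerivAt_stretch w (axial x))
    have hn := norm_grad_comp_axial hd.differentiableAt
    rw [hd.deriv] at hn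
    have hn' : ‖grad (T.lift ε v (.edge w)) x‖ₑ =
        ‖T.stretchDeriv ε w (axial x) • deriv (v w) (T.stretch ε w (axial x))‖ₑ :=
      le_antisymm (enorm_mono hn.le) (enorm_mono hn.ge)
    rw [hn', enorm_smul, mul_pow, Real.enorm_eq_ofReal hs.1, sq (ofReal _), mul_assoc]
    exact mul_le_mul_left (ofReal_le_ofReal hs.2) _
  have himg : ∫⁻ σ in Ioo a b, ofReal (T.stretchDeriv ε w σ) * ‖deriv (v w) (T.stretch ε w σ)‖² ≤
      ∫⁻ θ in I(T, w), ‖deriv (v w) θ‖² := by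
    rw [← lintegral_image_eq_lintegral_deriv_mul_of_monotoneOn measurableSet_Ioo
      (fun σ _ => (hasDerivAt_stretch w σ).hasDerivWithinAt)
      ((h.strictMonoOn_stretch w).monotoneOn.mono hsub) fun θ => ‖deriv (v w) θ‖²]
    refine lintegral_mono_set ?_
    rintro _ ⟨σ, hσ, rfl⟩
    exact h.stretch_mem_Ioo w hσ
  refine h1.trans ?_
  rw [lintegral_edge_axial w (hFm.comp continuous_axial.measurable).aemeasurable,
    ofReal_mul_treeMeasure h.pos, lintegral_const_mul' _ _ ofReal_ne_top,
    mul_left_comm]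
  exact mul_le_mul_right (mul_le_mul_right himg _) _

variable (T) in
theorem exists_lintegral_lift_sub_le : ∃ C : NNReal, ∀ ε, T.Fits ε → ∀ c v, T.IsTreeTest c v →
    ∀ w, ∫⁻ x in E(T, ε, w), ‖T.lift ε v (.edge w) x - v w (axial x)‖² ≤ C * ofReal ε *
        (ofReal (ε ^ d) * ∫⁻ θ, ‖deriv (v w) θ‖² ∂T.treeMeasure w) := by
  have hR := T.radius_pos
  have hS := T.one_le_slack
  refine ⟨toNNReal (T.radius * (T.radius + T.slack)), fun ε h c v hv w => ?_⟩
  set I := ∫⁻ θ in I(T, w), ‖deriv (v w) θ‖²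
  have hvol : volume (E(T, ε, w)) ≤ volume (T.scale ε w • T.Ω) * ofReal T.radius := by
    rw [region_edge, volume_slab, volume_Ioo]
    refine mul_le_mul_right (ofReal_le_ofReal ?_) _
    linarith [T.finish_le h.pos w, T.start_nonneg h.pos w, T.len_le_radius w.length]
  calc _ ≤ ∫⁻ x in E(T, ε, w), ofReal ((T.radius + T.slack) * ε) * I := by
        refine setLIntegral_mono' (T.isOpen_region h.pos _).measurableSet fun x hx => ?_
        have hx' := Ioo_subset_Icc_self hx.2
        refine (hv.enorm_sub_sq_le w (h.stretch_mem w hx') (Ioo_subset_Icc_self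
          (T.Ioo_start_finish_subset h.pos w hx.2))).trans ?_
        exact mul_le_mul_left (ofReal_le_ofReal (h.abs_stretch_sub_le w hx')) _
    _ = ofReal ((T.radius + T.slack) * ε) * I * volume (E(T, ε, w)) := by rw [setLIntegral_const]
    _ ≤ ofReal ((T.radius + T.slack) * ε) * I *
        (volume (T.scale ε w • T.Ω) * ofReal T.radius) := mul_le_mul_right hvol _
    _ = _ := by
        rw [ofReal_mul_treeMeasure h.pos, ofReal_mul (by positivity)]
        have : ((toNNReal (T.radius * (T.radius + T.slack)) : NNReal) : ENNReal) =
          ofReal (T.radius * (T.radius + T.slack)) := rfl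
        rw [this, ofReal_mul hR.le]
        ring

theorem measurable_grad (f : Eucl (d + 1) → ℂ) : Measurable (grad f) :=
  (WithLp.measurable_toLp 2 _).comp (measurable_pi_lambda _ fun i =>
    measurable_fderiv_apply_const ℝ f (EuclideanSpace.single i 1))

variable (T) in
/-- Functions on the one-dimensional tree are close to their lifts. -/
theorem exists_lift_le (hk : 1 ≤ k) : ∃ C : NNReal, ∀ ε, T.Fits ε → ∀ c v, T.IsTreeTest c v →
    T.treeMass v ≠ ∞ → T.treeEnergy v ≠ ∞ →
      T.inflatedMass ε (T.lift ε v) ≠ ∞ ∧ T.FiniteTest ε c (T.lift ε v) ∧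
      T.inflatedEnergy ε (T.lift ε v) ≤
        ofReal ((1 + C * ε) * (1 + ε)) * (ofReal (ε ^ d) * T.treeEnergy v) ∧
      ∑' w, T.defect ε (T.lift ε v) v w ≤ C * ofReal ε * (ofReal (ε ^ d) * T.treeEnergy v) := by
  obtain ⟨C₁, h₁⟩ := T.exists_pieceEnergy_lift_le
  obtain ⟨C₂, h₂⟩ := T.exists_lintegral_lift_sub_le
  obtain ⟨b, R, hR, hRfin, htail⟩ := T.exists_treeTail hk
  obtain ⟨c₀, hc₀, hlen⟩ := T.len_ge
  have hV : volume T.V ≠ ∞ := T.V_lipschitz.isBounded.measure_lt_top.ne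
  have hΩ := T.volume_Ω_ne_zero
  set K : NNReal := (volume T.V * (volume T.Ω)⁻¹).toNNReal
  have hK : K = volume T.V * (volume T.Ω)⁻¹ := coe_toNNReal (mul_ne_top hV (by simpa using hΩ))
  set C := C₁ + C₂ + K * toNNReal c₀⁻¹ * (R 0).toNNReal with hC
  refine ⟨C, fun ε h c v hv hM hE => ?_⟩
  have hε := h.pos
  have hen0 : ∀ w, T.pieceEnergy ε (T.lift ε v) (.vertex w) = 0 := fun w => by
    rw [pieceEnergy, lintegral_eq_zero_iff']
    · refine of_forall fun x => ?_
      have : grad (fun _ => v w ℓ(T, w)) x = 0 := by ext i; simp [grad]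
      simp [lift, this]
    · have : grad (fun _ : Eucl (d + 1) => v w ℓ(T, w)) = fun _ => 0 := by
        funext x; ext i; simp [grad]
      simp only [lift, this]
      exact aemeasurable_const
  have henergy : T.inflatedEnergy ε (T.lift ε v) ≤
      ofReal ((1 + C₁ * ε) * (1 + ε)) * (ofReal (ε ^ d) * T.treeEnergy v) := by
    rw [inflatedEnergy, tsum_piece, treeEnergy, treeMass, ← etsum_mul,
      ← etsum_mul]
    simp only [hen0, tsum_zero, add_zero]
    exact tsum_le_tsum fun w => h₁ ε h c v hv w
  have hvert : ∀ w, ∫⁻ x in V(T, ε, w), ‖T.lift ε v (.vertex w) x‖² =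
      K * (ofReal (T.scale ε w) * (volume (T.scale ε w • T.Ω) * ‖v w ℓ(T, w)‖²)) := fun w => by
    have ht := T.scale_pos hε w
    simp only [lift, setLIntegral_const]
    rw [region_vertex, smul_eq_image_sim, smul_eq_image_sim,
      volume_image_sim _ _ ht, volume_image_sim _ _ ht, pow_succ' (T.scale ε w),
      ofReal_mul ht.le, hK]
    calc _ = ofReal (T.scale ε w) * (ofReal (T.scale ε w ^ d) *
          ‖v w ℓ(T, w)‖²) * (volume T.V) * 1 := by ring
      _ = _ := by
        rw [← ENNReal.inv_mul_cancel hΩ T.volume_Ω_ne_top]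
        ring
  have hdef : ∑' w, T.defect ε (T.lift ε v) v w ≤
      C * ofReal ε * (ofReal (ε ^ d) * T.treeEnergy v) := by
    have htl := ((htail c v hv hM hE).2 0).2
    have huniv : {w : Edge k | 0 ≤ w.length} = univ := by simp
    rw [huniv] at htl
    simp at htl
    calc _ ≤ ∑' w, (C₂ * ofReal ε * (ofReal (ε ^ d) * ∫⁻ θ, ‖deriv (v w) θ‖² ∂T.treeMeasure w) +
          K * (ofReal ε * ofReal c₀⁻¹ * ofReal (ε ^ d)) * (ofReal ℓ(T, w) *
              (T.weight w * ‖v w ℓ(T, w)‖²))) := by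
          refine tsum_le_tsum fun w => add_le_add (h₂ ε h c v hv w) ?_
          rw [hvert, mul_assoc (K : ENNReal)]
          exact mul_le_mul_right (scale_mul_volume_le hc₀ hlen hε _ _) _
      _ ≤ C₂ * ofReal ε * (ofReal (ε ^ d) * T.treeEnergy v) +
          K * (ofReal ε * ofReal c₀⁻¹ * ofReal (ε ^ d)) * (R 0 * T.treeEnergy v) := by
          rw [tsum_add, etsum_mul, etsum_mul, etsum_mul]
          exact add_le_add le_rfl (mul_le_mul_right htl _)
      _ = (C₂ + K * ofReal c₀⁻¹ * R 0) * ofReal ε * (ofReal (ε ^ d) * T.treeEnergy v) := by ring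
      _ ≤ _ := by
          refine mul_le_mul_left (mul_le_mul_left ?_ _) _
          rw [hC]
          push_cast
          rw [coe_toNNReal (hRfin 0), add_assoc]
          exact le_add_self
  have hmass : T.inflatedMass ε (T.lift ε v) ≠ ∞ := by
    refine ne_top_of_le_ne_top ?_ (hv.inflatedMass_le hε (T.lift ε v))
    have := ne_top_of_le_ne_top (by finiteness) hdef
    finiteness
  have htest := isInflatedTest_lift h hv
  refine ⟨hmass, ⟨htest, fun i => ?_, fun i => ?_⟩, henergy.trans ?_, hdef⟩
  · rw [memLp_two_iff (((htest.contDiff i).continuousOn.mono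
      (T.region_subset ε i)).aestronglyMeasurable (T.isOpen_region hε i).measurableSet)]
    exact (ne_top_of_le_ne_top hmass (le_tsum i)).lt_top
  · rw [memLp_two_iff]
    · exact (ne_top_of_le_ne_top (ne_top_of_le_ne_top (by finiteness) henergy) (le_tsum i)).lt_top
    · exact (measurable_grad _).aestronglyMeasurable
  · refine mul_le_mul_left (ofReal_le_ofReal ?_) _
    have hle : C₁ ≤ C := by
      rw [hC, add_assoc]
      exact_mod_cast le_self_add
    gcongr

theorem eventually_tsum_lintegral_le (hk : 1 ≤ k) {m : ℝ → Edge k → ℝ → ℝ} {K : ℝ}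
    (hm : ∀ ε > 0, ∀ w, AEMeasurable (m ε w) (volume.restrict (I(T, w))))
    (hK : ∀ ε > 0, ∀ w, ∀ θ ∈ I(T, w), |m ε w θ| ≤ K)
    (hlim : ∀ w, ∀ᵐ θ ∂volume.restrict (I(T, w)),
      Tendsto (fun ε => m ε w θ) (𝓝[>] 0) (𝓝 0)) {η : ℝ} (hη : 0 < η) :
    ∀ᶠ ε in 𝓝[>] 0, ∀ c v, T.IsTreeTest c v → T.treeMass v ≠ ∞ → T.treeEnergy v ≠ ∞ →
      ∑' w, ∫⁻ θ, ‖m ε w θ‖ₑ * ‖v w θ‖² ∂T.treeMeasure w ≤ ofReal η * T.treeEnergy v := by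
  obtain ⟨b, R, hR, hRfin, htail⟩ := T.exists_treeTail hk
  have hη2 := ENNReal.ofReal_pos.2 (half_pos hη)
  obtain ⟨N, hN⟩ : ∃ N, ofReal K * R N ≤ ofReal (η / 2) := by
    have h1 := ENNReal.Tendsto.const_mul (a := ofReal K) hR (Or.inr ofReal_ne_top)
    rw [mul_zero] at h1
    exact (h1.eventually_le_const hη2).exists
  have hfin : {w : Edge k | w.length < N}.Finite := List.finite_length_lt _ _
  set F := hfin.toFinset
  have hsmall : Tendsto (fun ε => ∑ w ∈ F, ofReal (b w.length) *
      ∫⁻ θ in I(T, w), ‖m ε w θ‖ₑ) (𝓝[>] 0) (𝓝 0) := by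
    have h0 : 0 = ∑ _w ∈ F, (0 : ENNReal) := by simp
    rw [h0]
    refine tendsto_finsetSum _ fun w _ => ?_
    have h1 : Tendsto (fun ε => ∫⁻ θ in I(T, w), ‖m ε w θ‖ₑ) (𝓝[>] 0) (𝓝 0) := by
      have h2 : 0 = ∫⁻ θ in I(T, w), 0 := by simp
      rw [h2]
      refine tendsto_lintegral_filter_of_dominated_convergence' (fun _ => ofReal K) ?_ ?_ ?_ ?_
      · filter_upwards [self_mem_nhdsWithin] with ε hε
        exact (hm ε hε w).enorm
      · filter_upwards [self_mem_nhdsWithin] with ε hε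
        filter_upwards [ae_restrict_mem measurableSet_Ioo] with θ hθ
        rw [Real.enorm_eq_ofReal_abs]
        exact ofReal_le_ofReal (hK ε hε w θ hθ)
      · rw [setLIntegral_const, volume_Ioo]
        finiteness
      · filter_upwards [hlim w] with θ hθ
        simpa using hθ.enorm
    simpa using ENNReal.Tendsto.const_mul h1 (Or.inr ofReal_ne_top)
  filter_upwards [hsmall.eventually_le_const hη2, self_mem_nhdsWithin] with ε hε hpos c v hv hM hE
  obtain ⟨hpt, htl⟩ := htail c v hv hM hE
  set A : Edge k → ENNReal := fun w => ∫⁻ θ, ‖m ε w θ‖ₑ * ‖v w θ‖² ∂T.treeMeasure w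
  have h1 := Summable.tsum_add_tsum_compl (f := A) (s := F) ENNReal.summable ENNReal.summable
  rw [Finset.tsum_subtype' F A] at h1
  have hF : (F : Set (Edge k))ᶜ = {w : Edge k | N ≤ w.length} := by ext w; simp [F]
  rw [hF] at h1
  have h2 : ∑ w ∈ F, A w ≤ ofReal (η / 2) * T.treeEnergy v := by
    refine le_trans ?_ (mul_le_mul_left hε _)
    rw [Finset.sum_mul]
    refine sum_le_sum fun w _ => ?_
    simp only [A]
    rw [lintegral_treeMeasure, ← lintegral_const_mul' _ _ (T.weight_ne_top w), mul_right_comm,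
      ← lintegral_const_mul'' _ (hm ε hpos w).enorm]
    refine setLIntegral_mono' measurableSet_Ioo fun θ hθ => ?_
    rw [mul_left_comm, mul_comm]
    exact mul_le_mul_left (hpt w θ (Ioo_subset_Icc_self hθ)) _
  have h3 : ∑' w : {w : Edge k | N ≤ w.length}, A w ≤ ofReal (η / 2) * T.treeEnergy v := by
    have h4 := (htl N).1
    rw [← tsum_subtype] at h4
    refine le_trans ?_ ((mul_le_mul_right h4 (ofReal K)).trans ?_)
    · rw [← etsum_mul]
      refine tsum_le_tsum fun w => ?_
      simp only [A]
      rw [← lintegral_const_mul' _ _ ofReal_ne_top, lintegral_treeMeasure, lintegral_treeMeasure]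
      refine mul_le_mul_right (setLIntegral_mono' measurableSet_Ioo
        fun θ hθ => mul_le_mul_left ?_ _) _
      rw [Real.enorm_eq_ofReal_abs]
      exact ofReal_le_ofReal (hK ε hpos w θ hθ)
    · rw [← mul_assoc]
      exact mul_le_mul_left hN _
  rw [← h1]
  refine (add_le_add h2 h3).trans (le_of_eq ?_)
  rw [← add_mul, ← ofReal_add (by positivity) (by positivity), add_halves]

variable {A : Piece k → Eucl (d + 1) → ℝ} {W : Edge k → ℝ → ℝ} {C : ℝ}

variable (T ε A W) in
/-- The difference between the section averages of a potential on the inflated tree and a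
potential on the one-dimensional tree. -/
def potentialError (w : Edge k) (θ : ℝ) : ℝ :=
  (J(T, ε, w)).indicator (T.sectionAverage ε A w) θ - W w θ

theorem volume_real_smul_Ω (hε : 0 < ε) (w : Edge k) :
    volume.real (T.scale ε w • T.Ω) = ε ^ d * (T.weight w).toReal := by
  rw [measureReal_def, volume_smul_Ω hε, toReal_mul, toReal_ofReal (by positivity)]

variable (T ε) in
/-- A potential on the inflated tree that is continuous and bounded by `C` on the pieces. -/
def IsPot (A : Piece k → Eucl (d + 1) → ℝ) (C : ℝ) : Prop :=
  (∀ i, ContinuousOn (A i) (T.region ε i)) ∧ ∀ i, ∀ x ∈ T.region ε i, |A i x| ≤ C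

variable (T) in
/-- A measurable potential on the one-dimensional tree that is bounded by `C`. -/
def IsTreePot (W : Edge k → ℝ → ℝ) (C : ℝ) : Prop :=
  (∀ w, Measurable (W w)) ∧ ∀ w, ∀ θ ∈ I(T, w), |W w θ| ≤ C

theorem setIntegral_section (hε : 0 < ε) (w : Edge k) (θ : ℝ) :
    ∫ s in T.scale ε w • T.Ω, A (.edge w) (point s θ) =
      volume.real (T.scale ε w • T.Ω) * T.sectionAverage ε A w θ := by
  have h : volume.real (T.scale ε w • T.Ω) ≠ 0 := by
    rw [volume_real_smul_Ω hε]
    exact mul_ne_zero (by positivity)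
      (ENNReal.toReal_ne_zero.2 ⟨T.weight_ne_zero w, T.weight_ne_top w⟩)
  rw [sectionAverage, setAverage_eq, smul_eq_mul, mul_inv_cancel_left₀ h]

theorem abs_sectionAverage_le (hC : 0 ≤ C)
    (hA : T.IsPot ε A C) (w : Edge k) {θ : ℝ}
    (hθ : θ ∈ J(T, ε, w)) : |T.sectionAverage ε A w θ| ≤ C := by
  rw [sectionAverage, setAverage_eq, smul_eq_mul, abs_mul, abs_of_nonneg (by positivity)]
  have h := norm_setIntegral_le_of_norm_le_const (μ := volume)
    (f := fun s => A (.edge w) (point s θ)) (isBounded_smul_Ω w).measure_lt_top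
    fun s hs => hA.2 (.edge w) _ ⟨by simpa using hs, by simpa using hθ⟩
  refine (mul_le_mul_of_nonneg_left h (by positivity)).trans ?_
  rw [mul_comm C, ← mul_assoc]
  exact mul_le_of_le_one_left hC inv_mul_le_one

theorem abs_potentialError_le (hC : 0 ≤ C) (hA : T.IsPot ε A C)
    (hW : T.IsTreePot W C) (w : Edge k) {θ : ℝ}
    (hθ : θ ∈ I(T, w)) : |T.potentialError ε A W w θ| ≤ 2 * C := by
  have h1 : |(J(T, ε, w)).indicator (T.sectionAverage ε A w) θ| ≤ C := by
    by_cases h : θ ∈ J(T, ε, w)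
    · rw [indicator_of_mem h]
      exact abs_sectionAverage_le hC hA w h
    · rwa [indicator_of_notMem h, abs_zero]
  exact (abs_sub _ _).trans (by linarith [hW.2 w θ hθ])

theorem integrableOn_of_abs_le (hε : 0 < ε) (hA : T.IsPot ε A C) (i : Piece k) :
    IntegrableOn (A i) (T.region ε i) :=
  have hm := (T.isOpen_region hε i).measurableSet
  IntegrableOn.of_bound (T.isBounded_region ε i).measure_lt_top
    ((hA.1 i).aestronglyMeasurable hm) C ((ae_restrict_mem hm).mono fun x hx => hA.2 i x hx)

theorem integrable_prod_edge {w : Edge k} {F : Eucl (d + 1) → ℝ}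
    (hF : IntegrableOn F (E(T, ε, w))) : Integrable (fun p : Eucl d × ℝ => F (point p.1 p.2))
      ((volume.restrict (T.scale ε w • T.Ω)).prod (volume.restrict (J(T, ε, w)))) :=
  (point_slab _ _).integrable_comp_of_integrable hF

theorem setIntegral_edge {w : Edge k} {F : Eucl (d + 1) → ℝ}
    (hF : IntegrableOn F (E(T, ε, w))) : ∫ x in E(T, ε, w), F x =
      ∫ θ in J(T, ε, w), ∫ s in T.scale ε w • T.Ω, F (point s θ) := by
  rw [region_edge, ← (point_slab _ _).integral_comp measEmb_point,
    integral_prod_symm _ (integrable_prod_edge hF)]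

theorem aemeasurable_potentialError (hε : 0 < ε) (hA : T.IsPot ε A C) (hW : T.IsTreePot W C)
    (w : Edge k) :
    AEMeasurable (T.potentialError ε A W w) := by
  refine AEMeasurable.sub ((aemeasurable_indicator_iff measurableSet_Ioo).2 ?_)
    (hW.1 w).aemeasurable
  refine (((integrable_prod_edge (integrableOn_of_abs_le hε hA
    (.edge w))).integral_prod_right.aestronglyMeasurable).aemeasurable.const_mul
    (volume.real (T.scale ε w • T.Ω))⁻¹).congr
    (ae_of_all _ fun θ => ?_)
  rw [sectionAverage, setAverage_eq, smul_eq_mul]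

theorem tendsto_potentialError {A : ℝ → Piece k → Eucl (d + 1) → ℝ} {w : Edge k} {θ : ℝ}
    (hθ : θ ∈ I(T, w))
    (h : Tendsto (fun ε => T.sectionAverage ε (A ε) w θ) (𝓝[>] 0) (𝓝 (W w θ))) :
    Tendsto (fun ε => T.potentialError ε (A ε) W w θ) (𝓝[>] 0) (𝓝 0) := by
  have h' := h.sub_const (W w θ)
  rw [sub_self] at h'
  refine h'.congr' ?_
  have h0 : Tendsto (fun ε => (T.slack - 1) * T.scale ε w) (𝓝[>] 0) (𝓝 0) := by
    refine tendsto_nhdsWithin_of_tendsto_nhds ?_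
    have : Continuous fun ε => (T.slack - 1) * T.scale ε w := by unfold scale; fun_prop
    simpa [scale] using this.tendsto 0
  filter_upwards [self_mem_nhdsWithin, h0.eventually_lt_const hθ.1,
    h0.eventually_lt_const (sub_pos.2 hθ.2)] with ε hε h1 h2
  rw [potentialError, indicator_of_mem]
  exact ⟨(T.start_le hε w).trans_lt h1, by linarith [T.le_finish hε w]⟩

theorem IsTreeTest.integrableOn_mul_norm_sq (hv : T.IsTreeTest c v) {w : Edge k} {m : ℝ → ℝ}
    (hm : AEMeasurable m (volume.restrict (I(T, w))))
    (hC : ∀ θ ∈ I(T, w), |m θ| ≤ C) :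
    IntegrableOn (fun θ => m θ * ‖v w θ‖ ^ 2) (I(T, w)) := by
  have h : IntegrableOn (fun θ => ‖v w θ‖ ^ 2) (Icc 0 ℓ(T, w)) :=
    ((hv.contDiff w).continuousOn.norm.pow 2).integrableOn_Icc
  exact (h.mono_set Ioo_subset_Icc_self).bdd_mul hm.aestronglyMeasurable
    ((ae_restrict_mem measurableSet_Ioo).mono fun θ hθ => hC θ hθ)

theorem IsTreeTest.integrableOn_edge (hv : T.IsTreeTest c v) (hε : 0 < ε)
    (hA : T.IsPot ε A C)
    (w : Edge k) : IntegrableOn (fun x => A (.edge w) x * ‖v w (axial x)‖ ^ 2) (E(T, ε, w)) := by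
  obtain ⟨K, hK⟩ := isCompact_Icc.exists_bound_of_continuousOn (hv.contDiff w).continuousOn
  refine (integrableOn_of_abs_le hε hA (.edge w)).mul_bdd (c := K ^ 2)
    ((hv.aesm_axial hε w).norm.pow 2) ?_
  filter_upwards [ae_restrict_mem (T.isOpen_region hε (.edge w)).measurableSet] with x hx
  rw [norm_pow, norm_norm]
  exact pow_le_pow_left₀ (norm_nonneg _)
    (hK _ (Ioo_subset_Icc_self (T.Ioo_start_finish_subset hε w hx.2))) 2

theorem IsTreeTest.enorm_setIntegral_edge_sub_le (hv : T.IsTreeTest c v) (hε : 0 < ε) (hC : 0 ≤ C)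
    (hA : T.IsPot ε A C)
    (hW : T.IsTreePot W C)
    (w : Edge k) :
    ‖(∫ x in E(T, ε, w), A (.edge w) x * ‖v w (axial x)‖ ^ 2) -
      ε ^ d * ∫ θ, W w θ * ‖v w θ‖ ^ 2 ∂T.treeMeasure w‖ₑ ≤
      ofReal (ε ^ d) * ∫⁻ θ, ‖T.potentialError ε A W w θ‖ₑ * ‖v w θ‖² ∂T.treeMeasure w := by
  set m := T.potentialError ε A W w
  have e1 : (∫ x in E(T, ε, w), A (.edge w) x * ‖v w (axial x)‖ ^ 2) =
      volume.real (T.scale ε w • T.Ω) * ∫ θ in I(T, w), (m θ + W w θ) * ‖v w θ‖ ^ 2 := by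
    rw [setIntegral_edge (hv.integrableOn_edge hε hA w), ← integral_const_mul]
    have h1 : ∀ θ, (volume.real (T.scale ε w • T.Ω) * ((m θ + W w θ) * ‖v w θ‖ ^ 2)) =
        (J(T, ε, w)).indicator (fun θ => ∫ s in T.scale ε w • T.Ω,
          A (.edge w) (point s θ) * ‖v w (axial (point s θ))‖ ^ 2) θ := fun θ => by
      simp only [m, potentialError, sub_add_cancel, axial_point, integral_mul_const,
        setIntegral_section hε]
      by_cases h : θ ∈ J(T, ε, w)
      · rw [indicator_of_mem h, indicator_of_mem h, mul_assoc]
      · rw [indicator_of_notMem h, indicator_of_notMem h, zero_mul, mul_zero]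
    simp only [h1]
    rw [setIntegral_indicator measurableSet_Ioo, inter_eq_right.2 (T.Ioo_start_finish_subset hε w)]
  have e2 : ε ^ d * ∫ θ, W w θ * ‖v w θ‖ ^ 2 ∂T.treeMeasure w = volume.real (T.scale ε w • T.Ω) *
        ∫ θ in I(T, w), W w θ * ‖v w θ‖ ^ 2 := by
    rw [treeMeasure, integral_smul_measure, volume_real_smul_Ω hε, smul_eq_mul, mul_assoc]
  have hmb : ∀ θ ∈ I(T, w), |m θ| ≤ 2 * C := fun θ hθ =>
    abs_potentialError_le hC hA hW w hθ
  have e3 : ∫ θ in I(T, w), (m θ + W w θ) * ‖v w θ‖ ^ 2 = (∫ θ in I(T, w), m θ * ‖v w θ‖ ^ 2) +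
        ∫ θ in I(T, w), W w θ * ‖v w θ‖ ^ 2 := by
    simp only [add_mul]
    exact integral_add (hv.integrableOn_mul_norm_sq (aemeasurable_potentialError hε hA hW
      w).restrict hmb) (hv.integrableOn_mul_norm_sq (hW.1 w).aemeasurable (hW.2 w))
  rw [e1, e2, e3, mul_add, add_sub_cancel_right, enorm_mul, ofReal_mul_treeMeasure hε]
  refine mul_le_mul' (le_of_eq ?_) ((enorm_integral_le_lintegral_enorm _).trans (le_of_eq ?_))
  · rw [Real.enorm_of_nonneg measureReal_nonneg]
    exact ofReal_measureReal (isBounded_smul_Ω w).measure_lt_top.ne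
  · simp

end Data

theorem enorm_sq_sub_sq_le {s : ℝ} (hs : 0 < s) (a b : ℂ) : ‖‖a‖ ^ 2 - ‖b‖ ^ 2‖ₑ ≤
    ofReal s * ‖b‖² + ofReal (1 + 1 / s) * ‖a - b‖² := by
  have h : |‖a‖ ^ 2 - ‖b‖ ^ 2| ≤ s * ‖b‖ ^ 2 + (1 + 1 / s) * ‖a - b‖ ^ 2 := by
    have h1 : 2 * (‖b‖ * ‖a - b‖) ≤ s * ‖b‖ ^ 2 + 1 / s * ‖a - b‖ ^ 2 := by
      have h3 : s * ‖b‖ ^ 2 + 1 / s * ‖a - b‖ ^ 2 - 2 * (‖b‖ * ‖a - b‖) =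
          (s * ‖b‖ - ‖a - b‖) ^ 2 / s := by field_simp; ring
      linarith [div_nonneg (sq_nonneg (s * ‖b‖ - ‖a - b‖)) hs.le]
    have h2 := abs_norm_sub_norm_le a b
    have e1 : ‖a‖ ^ 2 - ‖b‖ ^ 2 = (‖a‖ - ‖b‖) * (‖a‖ + ‖b‖) := by ring
    have h4 : ‖a‖ ≤ ‖b‖ + ‖a - b‖ := by linarith [(abs_le.1 h2).2]
    rw [e1, abs_mul, abs_of_nonneg (add_nonneg (norm_nonneg a) (norm_nonneg b))]
    refine (mul_le_mul h2 (add_le_add_left h4 _) (by positivity) (norm_nonneg _)).trans ?_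
    nlinarith
  rw [Real.enorm_eq_ofReal_abs, ← ofReal_norm_sq, ← ofReal_norm_sq, ← ofReal_mul hs.le,
    ← ofReal_mul (by positivity), ← ofReal_add (by positivity) (by positivity)]
  exact ofReal_le_ofReal h

namespace Data

variable {A : Piece k → Eucl (d + 1) → ℝ} {W : Edge k → ℝ → ℝ} {C : ℝ}

theorem integrableOn_mul_norm_sq_region (hε : 0 < ε) (hA : T.IsPot ε A C) {i : Piece k}
    (hu : MemLp (u i) 2 (T.inflatedMeasure ε i)) :
    IntegrableOn (fun x => A i x * ‖u i x‖ ^ 2) (T.region ε i) :=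
  have hm := (T.isOpen_region hε i).measurableSet
  integrable_mul_norm_sq ((hA.1 i).aestronglyMeasurable hm)
    ((ae_restrict_mem hm).mono fun x hx => hA.2 i x hx) hu

theorem IsTreeTest.enorm_integral_edge_sub_le (hv : T.IsTreeTest c v) (hε : 0 < ε) (hC : 0 ≤ C)
    (hA : T.IsPot ε A C)
    (hW : T.IsTreePot W C)
    (hu : ∀ i, MemLp (u i) 2 (T.inflatedMeasure ε i)) {s : ℝ} (hs : 0 < s) (w : Edge k) :
    ‖(∫ x in E(T, ε, w), A (.edge w) x * ‖u (.edge w) x‖ ^ 2) +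
      (∫ x in V(T, ε, w), A (.vertex w) x * ‖u (.vertex w) x‖ ^ 2) -
      ε ^ d * ∫ θ, W w θ * ‖v w θ‖ ^ 2 ∂T.treeMeasure w‖ₑ ≤
      ofReal C * (ofReal s * (ofReal (ε ^ d) * ∫⁻ θ, ‖v w θ‖² ∂T.treeMeasure w) +
          ofReal (1 + 1 / s) * T.defect ε u v w) + ofReal (ε ^ d) *
        ∫⁻ θ, ‖T.potentialError ε A W w θ‖ₑ * ‖v w θ‖² ∂T.treeMeasure w := by
  have hbound : ∀ i, ∀ x ∈ T.region ε i, ‖A i x‖ₑ ≤ ofReal C := fun i x hx => by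
    rw [Real.enorm_eq_ofReal_abs]; exact ofReal_le_ofReal (hA.2 i x hx)
  have h1 : ‖(∫ x in E(T, ε, w), A (.edge w) x * ‖u (.edge w) x‖ ^ 2) -
      ∫ x in E(T, ε, w), A (.edge w) x * ‖v w (axial x)‖ ^ 2‖ₑ ≤
      ofReal C * (ofReal s * (ofReal (ε ^ d) * ∫⁻ θ, ‖v w θ‖² ∂T.treeMeasure w) +
          ofReal (1 + 1 / s) * ∫⁻ x in E(T, ε, w), ‖u (.edge w) x - v w (axial x)‖²) := by
    rw [← integral_sub (integrableOn_mul_norm_sq_region hε hA (hu _))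
      (hv.integrableOn_edge hε hA w)]
    refine (enorm_integral_le_lintegral_enorm _).trans ?_
    refine le_trans ?_ (mul_le_mul_right (add_le_add_left (mul_le_mul_right
      (hv.lintegral_edge_axial_le hε w) _) _) _)
    rw [← lintegral_const_mul' _ _ ofReal_ne_top, ← lintegral_const_mul' _ _ ofReal_ne_top,
      ← lintegral_add_left' (((hv.aesm_axial hε w).enorm.pow_const 2).const_mul _),
      ← lintegral_const_mul' _ _ ofReal_ne_top]
    refine setLIntegral_mono' (T.isOpen_region hε _).measurableSet fun x hx => ?_
    rw [← mul_sub, enorm_mul]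
    exact mul_le_mul' (hbound _ x hx) (enorm_sq_sub_sq_le hs _ _)
  have h2 : ‖∫ x in V(T, ε, w), A (.vertex w) x * ‖u (.vertex w) x‖ ^ 2‖ₑ ≤
      ofReal C * (ofReal (1 + 1 / s) * ∫⁻ x in V(T, ε, w), ‖u (.vertex w) x‖²) := by
    refine (enorm_integral_le_lintegral_enorm _).trans ?_
    have h3 : 1 ≤ ofReal (1 + 1 / s) := by
      rw [← ofReal_one]
      exact ofReal_le_ofReal (le_add_of_nonneg_right (by positivity))
    refine le_trans ?_ (mul_le_mul_right (le_mul_of_one_le_left' h3) _)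
    rw [← lintegral_const_mul' _ _ ofReal_ne_top]
    refine setLIntegral_mono' (T.isOpen_region hε _).measurableSet fun x hx => ?_
    rw [enorm_mul, enorm_pow, enorm_norm]
    exact mul_le_mul_left (hbound _ x hx) _
  have e : ∀ a b b' e : ℝ, a + b - e = ((a - b') + b) + (b' - e) := fun _ _ _ _ => by ring
  rw [e _ _ (∫ x in E(T, ε, w), A (.edge w) x * ‖v w (axial x)‖ ^ 2) _, defect, mul_add
    (ofReal (1 + 1 / s)), ← add_assoc, mul_add (ofReal C)]
  exact (enorm_add_le _ _).trans (add_le_add ((enorm_add_le _ _).trans (add_le_add h1 h2))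
    (hv.enorm_setIntegral_edge_sub_le hε hC hA hW w))

theorem hasSum_edge_add_vertex {f : Piece k → ℝ} {a : ℝ} (hf : HasSum f a) :
    HasSum (fun w => f (.edge w) + f (.vertex w)) a := by
  have h1 := hf.summable.comp_injective fun _ _ h => Piece.edge.inj h
  have h2 := hf.summable.comp_injective fun _ _ h => Piece.vertex.inj h
  have h3 := (h1.hasSum.add h2.hasSum)
  have h4 : a = (∑' w, f (.edge w)) + ∑' w, f (.vertex w) := by
    rw [← hf.tsum_eq, ← (pieceEquiv k).symm.tsum_eq]
    exact Summable.tsum_sum h1 h2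
  rwa [h4]

theorem IsTreeTest.enorm_integral_sub_le (hv : T.IsTreeTest c v) (hε : 0 < ε) (hC : 0 ≤ C)
    (hA : T.IsPot ε A C)
    (hW : T.IsTreePot W C)
    (hu : MemLp (fun x => u x.1 x.2) 2 M(T, ε))
    (hvL : MemLp (fun x => v x.1 x.2) 2 (sigmaMeasure T.treeMeasure)) {s : ℝ} (hs : 0 < s) :
    ‖(∫ x, A x.1 x.2 * ‖u x.1 x.2‖ ^ 2 ∂M(T, ε)) -
      ε ^ d * ∫ x, W x.1 x.2 * ‖v x.1 x.2‖ ^ 2 ∂sigmaMeasure T.treeMeasure‖ₑ ≤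
      ofReal C * (ofReal s * (ofReal (ε ^ d) * T.treeMass v) +
          ofReal (1 + 1 / s) * ∑' w, T.defect ε u v w) + ofReal (ε ^ d) *
        ∑' w, ∫⁻ θ, ‖T.potentialError ε A W w θ‖ₑ * ‖v w θ‖² ∂T.treeMeasure w := by
  have hm := fun i => (T.isOpen_region hε i).measurableSet
  have h1 := hasSum_edge_add_vertex (hasSum_integral_sigma (μ := T.inflatedMeasure ε)
    (integrable_mul_norm_sq
    (W := fun x => A x.1 x.2)
    (aesm_sigma_iff.2 fun i => (hA.1 i).aestronglyMeasurable (hm i))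
    (ae_sigma_iff.2 fun i => (ae_restrict_mem (hm i)).mono fun x hx => hA.2 i x hx) hu))
  have h2 := (hasSum_integral_sigma (integrable_mul_norm_sq (W := fun x => W x.1 x.2)
    (aesm_sigma_iff.2 fun w => (hW.1 w).aestronglyMeasurable)
    (ae_sigma_iff.2 fun w => Measure.ae_smul_measure ((ae_restrict_mem measurableSet_Ioo).mono
      fun x hx => hW.2 w x hx) _) hvL)).mul_left (ε ^ d)
  rw [← (h1.sub h2).tsum_eq]
  refine enorm_tsum_le_tsum_enorm.trans ((tsum_le_tsum fun w =>
    hv.enorm_integral_edge_sub_le hε hC hA hW (fun i => memLp_sigma_mk hu i) hs w).trans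
      (le_of_eq ?_))
  rw [tsum_add, etsum_mul, etsum_mul, tsum_add,
    etsum_mul, etsum_mul, etsum_mul]
  rfl

/-- Corresponding functions on the inflated tree and on the one-dimensional tree have almost the
same potential energy. -/
theorem eventually_enorm_integral_sub_le (hk : 1 ≤ k) {A : ℝ → Piece k → Eucl (d + 1) → ℝ}
    (hC : 0 ≤ C) (hA : ∀ ε > 0, T.IsPot ε (A ε) C)
    (hW : T.IsTreePot W C)
    (hlim : ∀ w, ∀ᵐ θ ∂volume.restrict (I(T, w)),
      Tendsto (fun ε => T.sectionAverage ε (A ε) w θ) (𝓝[>] 0) (𝓝 (W w θ))) {η : ℝ} (hη : 0 < η) :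
    ∃ K : NNReal, ∀ᶠ ε in 𝓝[>] 0, ∀ c v u, T.IsTreeTest c v → T.treeEnergy v ≠ ∞ →
      MemLp (fun x => v x.1 x.2) 2 (sigmaMeasure T.treeMeasure) →
      MemLp (fun x => u x.1 x.2) 2 M(T, ε) →
      ‖(∫ x, A ε x.1 x.2 * ‖u x.1 x.2‖ ^ 2 ∂M(T, ε)) -
        ε ^ d * ∫ x, W x.1 x.2 * ‖v x.1 x.2‖ ^ 2 ∂sigmaMeasure T.treeMeasure‖ₑ ≤
      ofReal η * (ofReal (ε ^ d) * (T.treeMass v + T.treeEnergy v)) +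
        K * ∑' w, T.defect ε u v w := by
  have hs : 0 < η / (C + 1) := by positivity
  have hCs : ofReal C * ofReal (η / (C + 1)) ≤ ofReal η := by
    rw [← ofReal_mul hC, mul_div_assoc']
    refine ofReal_le_ofReal ((div_le_iff₀ (by positivity)).2 ?_)
    nlinarith
  refine ⟨C.toNNReal * (1 + 1 / (η / (C + 1))).toNNReal, ?_⟩
  filter_upwards [eventually_tsum_lintegral_le hk
    (fun ε hε w => (aemeasurable_potentialError hε (hA ε hε) hW w).restrict)
    (fun ε hε w θ hθ => abs_potentialError_le hC (hA ε hε) hW w hθ)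
    (fun w => by
      filter_upwards [hlim w, ae_restrict_mem measurableSet_Ioo] with θ h1 h2
      exact tendsto_potentialError h2 h1) hη, self_mem_nhdsWithin] with ε h hε c v u hv hE hvL huL
  have hmass : T.treeMass v ≠ ∞ := by
    rw [treeMass, ← lintegral_sigma (F := fun x : Σ _ : Edge k, ℝ => ‖v x.1 x.2‖²)]
    exact ((memLp_two_iff hvL.1).1 hvL).ne
  refine (hv.enorm_integral_sub_le hε hC (hA ε hε) hW huL hvL hs).trans ?_
  refine (add_le_add_right (mul_le_mul_right (h c v hv hmass hE) _) _).trans ?_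
  rw [mul_add, ← mul_assoc, mul_add (ofReal (ε ^ d)), mul_add (ofReal η),
    ← mul_assoc (ofReal C) (ofReal (1 + _)), add_right_comm]
  refine add_le_add (add_le_add (mul_le_mul_left hCs _) (le_of_eq (mul_left_comm _ _ _)))
    (le_of_eq ?_)
  rw [ENNReal.coe_mul]
  rfl

end Data

section FormDomain

variable {ι X G V : Type*} [Countable ι] [MeasurableSpace X] [NormedAddCommGroup G]
  [InnerProductSpace ℂ G] [AddCommGroup V] [Module ℂ V] {μ : ι → Measure X}
  {D : (X → ℂ) → X → G}

/-- The linear relation between vectors and the pairs of the function and the gradient that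
belong to them. -/
def formGraph (C : Submodule ℂ V) (a : V → ι → X → ℂ)
    (ha : IsAELinearOn C (sigmaMeasure μ) fun f x => a f x.1 x.2)
    (hD : IsAELinearOn C (sigmaMeasure μ) fun f x => D (a f x.1) x.2) :
    Submodule ℂ (V × (L²(μ) × Lp G 2 (sigmaMeasure μ))) :=
  joinRel (aeGraph C _ _ ha) (aeGraph C _ _ hD)

theorem mem_formGraph {C : Submodule ℂ V} {a : V → ι → X → ℂ}
    {ha : IsAELinearOn C (sigmaMeasure μ) fun f x => a f x.1 x.2}
    {hD : IsAELinearOn C (sigmaMeasure μ) fun f x => D (a f x.1) x.2}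
    {z : V × (L²(μ) × Lp G 2 (sigmaMeasure μ))} :
    z ∈ formGraph C a ha hD ↔ z.1 ∈ C ∧ z.2.1 =ᵐ[sigmaMeasure μ] (fun x => a z.1 x.1 x.2) ∧
      z.2.2 =ᵐ[sigmaMeasure μ] fun x => D (a z.1 x.1) x.2 :=
  ⟨fun h => ⟨h.1.1, h.1.2, h.2.2⟩, fun h => ⟨⟨h.1, h.2.1⟩, ⟨h.1, h.2.2⟩⟩⟩

theorem isAELinearOn_apply (C : Submodule ℂ (ι → X → ℂ)) (μ : ι → Measure X) :
    IsAELinearOn C (sigmaMeasure μ) fun f x => f x.1 x.2 :=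
  fun _ _ _ _ _ => of_forall fun _ => rfl

/-- The pairs of a function and its gradient. -/
def formDomain (C : Submodule ℂ (ι → X → ℂ))
    (hD : IsAELinearOn C (sigmaMeasure μ) fun f x => D (f x.1) x.2) :
    Submodule ℂ (L²(μ) × Lp G 2 (sigmaMeasure μ)) :=
  rangeRel (formGraph C id (isAELinearOn_apply C μ) hD)

variable {C : Submodule ℂ (ι → X → ℂ)}
  {hD : IsAELinearOn C (sigmaMeasure μ) fun f x => D (f x.1) x.2}

theorem mem_formDomain {p : L²(μ) × Lp G 2 (sigmaMeasure μ)} :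
    p ∈ formDomain C hD ↔ ∃ f ∈ C, p.1 =ᵐ[sigmaMeasure μ] (fun x => f x.1 x.2) ∧
      p.2 =ᵐ[sigmaMeasure μ] fun x => D (f x.1) x.2 := by
  simp only [formDomain, mem_rangeRel, mem_formGraph]
  rfl

theorem topologicalClosure_formDomain :
    ((formDomain C hD).topologicalClosure : Set _) = sobolev μ D C := by
  rw [Submodule.topologicalClosure_coe, sobolev]
  congr 1
  ext p
  exact mem_formDomain

/-- The functions with square integrable values and gradients. -/
def finitePart (C : Submodule ℂ (ι → X → ℂ))
    (hD : IsAELinearOn C (sigmaMeasure μ) fun f x => D (f x.1) x.2) :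
    Submodule ℂ (ι → X → ℂ) :=
  (formGraph C id (isAELinearOn_apply C μ) hD).map (LinearMap.fst ℂ _ _)

theorem mem_finitePart {f : ι → X → ℂ} : f ∈ finitePart C hD ↔ f ∈ C ∧
    MemLp (fun x => f x.1 x.2) 2 (sigmaMeasure μ) ∧
      MemLp (fun x => D (f x.1) x.2) 2 (sigmaMeasure μ) := by
  simp only [finitePart, Submodule.mem_map]
  constructor
  · rintro ⟨z, hz, rfl⟩
    obtain ⟨h1, h2, h3⟩ := mem_formGraph.1 hz
    exact ⟨h1, (memLp_congr_ae h2).1 (Lp.memLp _), (memLp_congr_ae h3).1 (Lp.memLp _)⟩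
  · rintro ⟨h1, h2, h3⟩
    exact ⟨(f, h2.toLp _, h3.toLp _), mem_formGraph.2 ⟨h1, h2.coeFn_toLp, h3.coeFn_toLp⟩, rfl⟩

theorem memLp_sigma_of_single {F : Type*} [NormedAddCommGroup F] {φ : (Σ _ : ι, X) → F} (i : ι)
    (h1 : MemLp (fun x => φ ⟨i, x⟩) 2 (μ i)) (h2 : ∀ j ≠ i, ∀ x, φ ⟨j, x⟩ = 0) :
    MemLp φ 2 (sigmaMeasure μ) := by
  refine memLp_two_sigma (fun j => ?_) ?_
  · rcases eq_or_ne j i with rfl | hj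
    · exact h1.1
    · simp only [h2 j hj]; exact aestronglyMeasurable_const
  · rw [tsum_eq_single i fun j hj => by simp [h2 j hj]]
    exact (memLp_two_iff h1.1).1 h1

theorem formDomain_dense [NormedAddCommGroup X] [NormedSpace ℝ X] [FiniteDimensional ℝ X]
    [BorelSpace X] [∀ i, IsFiniteMeasure (μ i)] {U : ι → Set X} (hU : ∀ i, IsOpen (U i))
    (hμU : ∀ i, ∀ᵐ x ∂μ i, x ∈ U i) (hD0 : D 0 = 0)
    (hbump : ∀ i, ∀ g : X → ℝ, ContDiff ℝ 1 g → HasCompactSupport g → tsupport g ⊆ U i →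
      (∃ f ∈ C, f i = (fun x => (g x : ℂ)) ∧ ∀ j ≠ i, f j = 0) ∧
        MemLp (D fun x => (g x : ℂ)) 2 (μ i))
    {x : L²(μ)} (hx : ∀ p ∈ formDomain C hD, inner ℂ p.1 x = 0) : x = 0 := by
  refine Lp.eq_zero_iff_ae_eq_zero.2 (ae_sigma_iff.2 fun i => ?_)
  have h := (hU i).ae_eq_zero_of_integral_contDiff_smul_eq_zero
    (((memLp_sigma_mk (Lp.memLp x) i).integrable one_le_two).locallyIntegrable.locallyIntegrableOn
      _) ?_
  · filter_upwards [h, hμU i] with y h1 h2 using h1 h2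
  intro g hg hgc hgU
  obtain ⟨⟨f, hf, hfi, hfj⟩, hDg⟩ := hbump i g (hg.of_le (by exact_mod_cast le_top)) hgc hgU
  have hgL : MemLp (fun x => (g x : ℂ)) 2 (μ i) :=
    (Complex.continuous_ofReal.comp hg.continuous).memLp_of_hasCompactSupport
      (hgc.comp_left ofReal_zero)
  have hf1 : MemLp (fun x => f x.1 x.2) 2 (sigmaMeasure μ) :=
    memLp_sigma_of_single i (by simpa only [hfi] using hgL) fun j hj x => by simp [hfj j hj]
  have hf2 : MemLp (fun x => D (f x.1) x.2) 2 (sigmaMeasure μ) :=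
    memLp_sigma_of_single i (by simpa only [hfi] using hDg) fun j hj x => by simp [hfj j hj, hD0]
  have h0 := hx (hf1.toLp _, hf2.toLp _) (mem_formDomain.2 ⟨f, hf, hf1.coeFn_toLp, hf2.coeFn_toLp⟩)
  rw [L2.inner_def] at h0
  have hs := hasSum_integral_sigma (L2.integrable_inner (𝕜 := ℂ) (hf1.toLp _) x)
  rw [h0] at hs
  have e : ∀ j, ∫ y, inner ℂ (hf1.toLp _ ⟨j, y⟩) (x ⟨j, y⟩) ∂μ j =
      ∫ y, inner ℂ (f j y) (x ⟨j, y⟩) ∂μ j := fun j => integral_congr_ae <| by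
    filter_upwards [ae_sigma_iff.1 hf1.coeFn_toLp j] with y hy
    rw [hy]
  simp only [e] at hs
  have hs' := hasSum_single (f := fun j => ∫ y, inner ℂ (f j y) (x ⟨j, y⟩) ∂μ j) i fun j hj => by
    simp [hfj j hj]
  rw [← hs'.unique hs]
  refine integral_congr_ae (of_forall fun y => ?_)
  simp [hfi, mul_comm]

theorem not_finiteDimensional_Lp_sigma [Infinite ι] [∀ i, IsFiniteMeasure (μ i)]
    (hμ : ∀ i, μ i ≠ 0) : ¬ FiniteDimensional ℂ L²(μ) := by
  classical
  intro _
  have hm : ∀ i, MeasurableSet (Sigma.mk (β := fun _ : ι => X) i '' univ) := fun i =>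
    (measEmb_sigmaMk i).measurableSet_image.2 MeasurableSet.univ
  have hf : ∀ i, sigmaMeasure μ (Sigma.mk i '' univ) ≠ ∞ := fun i => by
    rw [sigmaMeasure_image_mk]; exact measure_ne_top _ _
  obtain ⟨e, he⟩ : ∃ e : ι → L²(μ),
      ∀ i, e i = indicatorConstLp 2 (hm i) (hf i) 1 := ⟨_, fun _ => rfl⟩
  have hin : ∀ i j, inner ℂ (e i) (e j) = if i = j then ((μ i).real univ : ℂ) else 0 := by
    intro i j
    rw [he, he, inner_indicatorConstLp_sigma (hm i) (hf i) MeasurableSet.univ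
      (f := fun i _ => if i = j then 1 else 0)]
    · split_ifs <;> simp
    · filter_upwards [indicatorConstLp_coeFn (c := (1 : ℂ))] with x hx
      rw [hx]
      obtain ⟨l, y⟩ := x
      rcases eq_or_ne l j with rfl | h
      · simp
      · simp [h]
  have hli := linearIndependent_of_ne_zero_of_inner_eq_zero (fun i h => by
      have h1 := hin i i
      rw [h, inner_zero_left, if_pos rfl] at h1
      have h2 : (μ i).real univ = 0 := by exact_mod_cast h1.symm
      exact hμ i (Measure.measure_univ_eq_zero.1
        ((measureReal_eq_zero_iff (measure_ne_top _ _)).1 h2)))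
    (fun i j hij => (hin i j).trans (if_neg hij))
  exact Infinite.not_finite hli.finite

theorem IsFormEigenvector.mem_operatorGraph
    {S : Submodule ℂ (L²(μ) × Lp G 2 (sigmaMeasure μ))} {W : ι → X → ℝ}
    {hW : AEStronglyMeasurable (fun x : Σ _ : ι, X => W x.1 x.2) (sigmaMeasure μ)} {K : ℝ}
    {hK : ∀ᵐ x : (Σ _ : ι, X) ∂sigmaMeasure μ, |(fun x : Σ _ : ι, X => W x.1 x.2) x| ≤ K} {l : ℝ}
      {x : L²(μ)}
    (h : IsFormEigenvector S (mulOp (fun x : Σ _ : ι, X => W x.1 x.2) hW K hK) l x) :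
    (x, (l : ℂ) • x) ∈ operatorGraph μ (SetLike.coe S) W := by
  obtain ⟨g, hg, h⟩ := h
  refine ⟨g, hg, fun q hq => ?_⟩
  rw [← h q hq, inner_mulOp]

end FormDomain

theorem formDomain_compact {ι X G : Type*} [Countable ι] [MeasurableSpace X] [NormedAddCommGroup G]
    [InnerProductSpace ℂ G] {μ : ι → Measure X} {D : (X → ℂ) → X → G}
    {C : Submodule ℂ (ι → X → ℂ)}
    {hD : IsAELinearOn C (sigmaMeasure μ) fun f x => D (f x.1) x.2}
    (hpiece : ∀ i, ∀ η > 0, ∃ (n : ℕ) (Q : Fin n → Set X) (c : Fin n → NNReal),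
      (∀ l, MeasurableSet (Q l) ∧ μ i (Q l) ≠ ∞) ∧ ∀ f ∈ C, MemLp (f i) 2 (μ i) →
        ∫⁻ x, ‖f i x‖² ∂μ i ≤ ofReal η * ((∫⁻ x, ‖f i x‖² ∂μ i) + ∫⁻ x, ‖D (f i) x‖² ∂μ i) +
          ∑ l, c l * ‖∫ x in Q l, f i x ∂μ i‖²)
    (htail : ∀ η > 0, ∃ F : Finset ι, ∀ f ∈ C, (∀ i, MemLp (f i) 2 (μ i)) →
      ∑' i, (F : Set ι)ᶜ.indicator (fun i => ∫⁻ x, ‖f i x‖² ∂μ i) i ≤ ofReal η *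
        ((∑' i, ∫⁻ x, ‖f i x‖² ∂μ i) + ∑' i, ∫⁻ x, ‖D (f i) x‖² ∂μ i))
    {η : ℝ} (hη : 0 < η) :
    ∃ (n : ℕ) (h : Fin n → L²(μ)), ∀ p ∈ formDomain C hD,
      ‖p.1‖ ^ 2 ≤ η * (‖p.1‖ ^ 2 + ‖p.2‖ ^ 2) + ∑ i, ‖inner ℂ (h i) p.1‖ ^ 2 := by
  obtain ⟨n, h, hh⟩ := exists_functionals D (C : Set (ι → X → ℂ)) hpiece htail hη
  refine ⟨n, h, fun p hp => ?_⟩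
  obtain ⟨f, hf, h1, h2⟩ := mem_formDomain.1 hp
  exact hh p f hf h1 h2

section CompactPieces

variable {E G : Type*} [NormedAddCommGroup E] [NormedSpace ℝ E] [FiniteDimensional ℝ E]
  [MeasurableSpace E] [BorelSpace E] [NormedAddCommGroup G] {μ : Measure E} [μ.IsAddHaarMeasure]

theorem HasCompactCore.exists_integrals {U : Set E} (hU : IsOpen U) (h : HasCompactCore μ U)
    {D : (E → ℂ) → E → G} (hD : ∀ f x, ‖∇ f x‖ₑ ≤ ‖D f x‖ₑ) {a : ENNReal} (ha0 : a ≠ 0)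
    (ha : a ≠ ∞) {η : ℝ} (hη : 0 < η) :
    ∃ (n : ℕ) (Q : Fin n → Set E) (c : Fin n → NNReal),
      (∀ l, MeasurableSet (Q l) ∧ (a • μ.restrict U) (Q l) ≠ ∞) ∧
      ∀ u : E → ℂ, ContDiffOn ℝ 1 u U → ∫⁻ x, ‖u x‖² ∂(a • μ.restrict U) ≤
        ofReal η * ((∫⁻ x, ‖u x‖² ∂(a • μ.restrict U)) + ∫⁻ x, ‖D u x‖² ∂(a • μ.restrict U)) +
          ∑ l, c l * ‖∫ x in Q l, u x ∂(a • μ.restrict U)‖² := by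
  obtain ⟨n, Q, hQ, hball, hb⟩ := h.exists_averages μ hU hη
  have hfin : ∀ i, μ (Q i) ≠ ∞ := fun i => by
    obtain ⟨y, ρ, -, h1, -⟩ := hball i
    exact (measure_mono h1).trans_lt measure_ball_lt_top |>.ne
  have hQU : ∀ i, Q i ⊆ U := fun i => by
    obtain ⟨y, ρ, -, h1, h2⟩ := hball i
    exact h1.trans h2
  refine ⟨n, Q, fun l => (a * (2 * μ (Q l) * ‖(μ.real (Q l))⁻¹ * a.toReal⁻¹‖²)).toNNReal,
    fun l => ⟨hQ l, ?_⟩, fun u hu => ?_⟩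
  · rw [Measure.smul_apply, smul_eq_mul]
    exact mul_ne_top ha (ne_top_of_le_ne_top (hfin l) (Measure.restrict_apply_le _ _))
  have hi : ∀ l, ⨍ y in Q l, u y ∂μ =
      ((μ.real (Q l))⁻¹ * a.toReal⁻¹) • ∫ x in Q l, u x ∂(a • μ.restrict U) := fun l => by
    rw [Measure.restrict_smul, Measure.restrict_restrict (hQ l), inter_eq_left.2 (hQU l),
      integral_smul_measure, smul_smul, mul_assoc,
      inv_mul_cancel₀ (ENNReal.toReal_ne_zero.2 ⟨ha0, ha⟩), mul_one, setAverage_eq]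
  rw [lintegral_smul_measure, lintegral_smul_measure, smul_eq_mul, smul_eq_mul]
  refine (mul_le_mul_right ((hb u hu).trans (add_le_add_left
    (mul_le_mul_right (add_le_add_right (lintegral_mono fun x => pow_le_pow_left₀ zero_le (hD u x)
    2) _) _) _)) a).trans (le_of_eq ?_)
  rw [mul_add a, mul_left_comm, mul_add a, mul_sum]
  congr 1
  refine sum_congr rfl fun l _ => ?_
  rw [coe_toNNReal (by have := hfin l; finiteness), hi l, enorm_smul, mul_pow]
  ring

end CompactPieces

namespace Data

variable (T c) in
/-- The test functions on the one-dimensional tree as a space. -/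
def treeTests : Submodule ℂ (EdgeFun k) where
  carrier := {f | T.IsTreeTest c f}
  zero_mem' := ⟨fun _ => contDiffOn_const, fun _ _ => rfl, rfl, fun _ => ⟨0, fun _ _ _ _ => rfl⟩⟩
  add_mem' {f g} hf hg := ⟨fun w => (hf.contDiff w).add (hg.contDiff w),
    fun w j => congrArg₂ (· + ·) (hf.continuous w j) (hg.continuous w j),
    by simp [hf.root, hg.root], fun hc => by
      obtain ⟨n, hn⟩ := hf.ends hc
      obtain ⟨m, hm⟩ := hg.ends hc
      exact ⟨max n m, fun w hw θ hθ => by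
        simp [hn w (le_of_max_le_left hw) θ hθ, hm w (le_of_max_le_right hw) θ hθ]⟩⟩
  smul_mem' z f hf := ⟨fun w => (hf.contDiff w).const_smul z,
    fun w j => congrArg (z • ·) (hf.continuous w j), by simp [hf.root], fun hc => by
      obtain ⟨n, hn⟩ := hf.ends hc
      exact ⟨n, fun w hw θ hθ => by simp [hn w hw θ hθ]⟩⟩

theorem ae_treeMeasure (w : Edge k) : ∀ᵐ θ ∂T.treeMeasure w, θ ∈ I(T, w) :=
  Measure.ae_smul_measure (ae_restrict_mem measurableSet_Ioo) _

instance (w : Edge k) : IsFiniteMeasure (T.treeMeasure w) := ⟨by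
    rw [treeMeasure, Measure.smul_apply, smul_eq_mul, restrict_apply_univ, volume_Ioo]
    exact ENNReal.mul_lt_top (T.weight_ne_top w).lt_top ENNReal.ofReal_lt_top⟩

theorem treeMeasure_ne_zero (w : Edge k) : T.treeMeasure w ≠ 0 := by
  intro h
  have h1 : T.treeMeasure w univ = 0 := by rw [h]; rfl
  rw [treeMeasure, Measure.smul_apply, smul_eq_mul, restrict_apply_univ, volume_Ioo,
    mul_eq_zero, ENNReal.ofReal_eq_zero] at h1
  rcases h1 with h1 | h1
  · exact T.weight_ne_zero w h1
  · linarith [T.len_pos w.length]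

theorem IsTreeTest.deriv_eq_add_smul {f g h : EdgeFun k} (hf : T.IsTreeTest c f)
    (hg : T.IsTreeTest c g) {z : ℂ} {w : Edge k}
    (hh : ∀ θ ∈ Icc 0 ℓ(T, w), h w θ = f w θ + z * g w θ) {θ : ℝ}
    (hθ : θ ∈ I(T, w)) : deriv (h w) θ = deriv (f w) θ + z * deriv (g w) θ := by
  have h1 : h w =ᶠ[𝓝 θ] fun θ => f w θ + z * g w θ := by
    filter_upwards [Ioo_mem_nhds hθ.1 hθ.2] with t ht using hh t (Ioo_subset_Icc_self ht)
  rw [h1.deriv_eq, deriv_fun_add (hf.differentiableAt w hθ)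
    ((hg.differentiableAt w hθ).const_mul z), deriv_const_mul _ (hg.differentiableAt w hθ)]

theorem isAELinearOn_deriv : IsAELinearOn (T.treeTests c) (sigmaMeasure T.treeMeasure)
    fun f x => deriv (f x.1) x.2 := by
  refine fun f hf g hg z => ae_sigma_iff.2 fun w => ?_
  filter_upwards [T.ae_treeMeasure w] with θ hθ
  exact IsTreeTest.deriv_eq_add_smul hf hg (fun _ _ => rfl) hθ

variable (T c) in
/-- The pairs of a test function on the one-dimensional tree and its derivative. -/
def treeDomain : Submodule ℂ (L²(T.treeMeasure) × L²(T.treeMeasure)) :=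
  formDomain (T.treeTests c) isAELinearOn_deriv

theorem treeDomain_dense {x : L²(T.treeMeasure)}
    (hx : ∀ p ∈ T.treeDomain c, inner ℂ p.1 x = 0) : x = 0 := by
  classical
  refine formDomain_dense (fun _ => isOpen_Ioo)
    T.ae_treeMeasure (by funext x; exact deriv_const x _) (fun w g hg hgc hgU => ⟨?_, ?_⟩) hx
  · have hz : ∀ w', (update (0 : EdgeFun k) w fun x => (g x : ℂ)) w' 0 = 0 ∧
        (update (0 : EdgeFun k) w fun x => (g x : ℂ)) w' (T.len w'.length) = 0 := fun w' => by
      rcases eq_or_ne w' w with rfl | hw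
      · simp [image_eq_zero_of_notMem_tsupport fun h => (hgU h).1.false,
          image_eq_zero_of_notMem_tsupport fun h => (hgU h).2.false]
      · simp [update_of_ne hw]
    refine ⟨update 0 w fun x => (g x : ℂ), ⟨fun w' => ?_, fun w' j => ?_, (hz _).1,
      fun _ => ⟨w.length + 1, fun w' hw' θ _ => ?_⟩⟩, update_self .., fun j hj =>
        update_of_ne hj ..⟩
    · rcases eq_or_ne w' w with rfl | hw
      · rw [update_self]
        exact (Complex.ofRealCLM.contDiff.comp hg).contDiffOn
      · rw [update_of_ne hw]
        exact contDiffOn_const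
    · rw [(hz _).1, (hz _).2]
    · rw [update_of_ne (by rintro rfl; omega)]
      rfl
  · exact ((Complex.ofRealCLM.contDiff.comp hg).continuous_deriv le_rfl).memLp_of_hasCompactSupport
      (hgc.comp_left ofReal_zero).deriv

theorem treeDomain_compact (hk : 1 ≤ k) {η : ℝ} (hη : 0 < η) :
    ∃ (n : ℕ) (h : Fin n → L²(T.treeMeasure)), ∀ p ∈ T.treeDomain c,
      ‖p.1‖ ^ 2 ≤ η * (‖p.1‖ ^ 2 + ‖p.2‖ ^ 2) + ∑ i, ‖inner ℂ (h i) p.1‖ ^ 2 := by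
  refine formDomain_compact (fun w η hη => ?_) (fun η hη => ?_) hη
  · obtain ⟨n, Q, b, hQ, hb⟩ := (hasCompactCore_Ioo 0 ℓ(T, w)).exists_integrals isOpen_Ioo
      (fun f x => enorm_mono norm_deriv_eq_norm_fderiv.ge)
      (T.weight_ne_zero w) (T.weight_ne_top w) hη
    exact ⟨n, Q, b, hQ, fun f hf _ => hb _ ((hf.contDiff w).mono Ioo_subset_Icc_self)⟩
  · obtain ⟨b, R, hR, hRfin, htail⟩ := T.exists_treeTail hk
    obtain ⟨N, hN⟩ := (hR.eventually_le_const (ENNReal.ofReal_pos.2 hη)).exists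
    have hfin : {w : Edge k | w.length < N}.Finite := List.finite_length_lt _ _
    refine ⟨hfin.toFinset, fun v hv _ => ?_⟩
    by_cases hM : T.treeMass v = ∞
    · exact le_top.trans_eq (by rw [← treeMass, hM, top_add, mul_top (ENNReal.ofReal_pos.2 hη).ne'])
    by_cases hE : T.treeEnergy v = ∞
    · exact le_top.trans_eq (by
        rw [← treeMass, ← treeMass, ← treeEnergy, hE, add_top,
          mul_top (ENNReal.ofReal_pos.2 hη).ne'])
    have hF : ((hfin.toFinset : Finset (Edge k)) : Set (Edge k))ᶜ = {w : Edge k | N ≤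
      w.length} := by
      ext w; simp
    rw [hF]
    exact (((htail c v hv hM hE).2 N).1).trans (mul_le_mul' hN le_add_self)

section Membership

variable (T)

theorem point_finish_mem (h : T.Fits ε) (w : Edge k) {y : Eucl d} (hy : y ∈ T.Ω) :
    point (T.scale ε w • y) (T.finish ε w) ∈ T.closedRegion ε (.edge w) :=
  ⟨by rw [cross_point]; exact smul_mem_smul_set hy,
    by rw [axial_point]; exact ⟨(h.start_lt_finish w).le, le_rfl⟩⟩

theorem point_start_mem (h : T.Fits ε) (j : Fin k) (w : Edge k) {y : Eucl d} (hy : y ∈ T.δ • T.Ω) :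
    point (T.scale ε w • y) (T.start ε (j :: w)) ∈ T.closedRegion ε (.edge (j :: w)) :=
  ⟨by rw [cross_point, scale_cons, ← smul_smul]; exact smul_mem_smul_set hy,
    by rw [axial_point]; exact ⟨le_rfl, (h.start_lt_finish _).le⟩⟩

theorem sec_mem_closedRegion (j : Option (Fin k)) (w : Edge k) {y : Eucl d}
    (hy : y ∈ j.elim T.Ω fun _ => T.δ • T.Ω) :
    T.scale ε w • T.sec j y ∈ T.closedRegion ε (.vertex w) :=
  smul_mem_smul_set (Or.inr (mem_iUnion.2 ⟨j, mem_image_of_mem _ hy⟩))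

theorem sec_notMem_region (hε : 0 < ε) (j : Option (Fin k)) (w : Edge k) {y : Eucl d}
    (hy : y ∈ j.elim T.Ω fun _ => T.δ • T.Ω) :
    T.scale ε w • T.sec j y ∉ V(T, ε, w) := fun h => by
  have h2 := T.sec_frontier j (mem_image_of_mem _ hy)
  rw [T.isOpen_V.frontier_eq] at h2
  exact h2.2 ((smul_mem_smul_set_iff₀ (T.scale_pos hε w).ne' _ _).1 h)

end Membership

theorem IsInflatedTest.add_smul {f g : PieceFun d k} (h : T.Fits ε)
    (hf : T.IsInflatedTest ε c f) (hg : T.IsInflatedTest ε c g) (z : ℂ) :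
    T.IsInflatedTest ε c (f + z • g) := by
  have hd : ∀ i, ∀ x ∈ T.closedRegion ε i, fderivWithin ℝ ((f + z • g) i) (T.closedRegion ε i) x =
      fderivWithin ℝ (f i) (T.closedRegion ε i) x +
        z • fderivWithin ℝ (g i) (T.closedRegion ε i) x := fun i x hx => by
    have hU := T.uniqueDiffOn_closedRegion h.pos h.start_lt_finish i x hx
    have h2 := ((hg.contDiff i).differentiableOn one_ne_zero) x hx
    rw [Pi.add_apply, Pi.smul_apply, fderivWithin_add hU
      (((hf.contDiff i).differentiableOn one_ne_zero) x hx) (h2.const_smul z),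
      fderivWithin_const_smul hU h2]
  refine ⟨fun i => (hf.contDiff i).add ((hg.contDiff i).const_smul z), fun w y hy => ?_,
    fun w j y hy => ?_, fun w y hy a t => ?_, fun w j y hy a t => ?_, fun y hy => ?_, fun hc => ?_⟩
  · simp [hf.value_lower w y hy, hg.value_lower w y hy]
  · simp [hf.value_upper w j y hy, hg.value_upper w j y hy]
  · rw [hd _ _ (T.point_finish_mem h w hy), hd _ _ (T.sec_mem_closedRegion none w hy)]
    simp only [add_apply, smul_apply]
    rw [hf.deriv_lower w y hy, hg.deriv_lower w y hy]
  · rw [hd _ _ (T.point_start_mem h j w hy), hd _ _ (T.sec_mem_closedRegion (some j) w hy)]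
    simp only [add_apply, smul_apply]
    rw [hf.deriv_upper w j y hy, hg.deriv_upper w j y hy]
  · simp [hf.root y hy, hg.root y hy]
  · obtain ⟨n, hn⟩ := hf.ends hc
    obtain ⟨m, hm⟩ := hg.ends hc
    refine ⟨max n m, fun w hw => ⟨fun x hx => ?_, fun x hx => ?_⟩⟩
    · simp [(hn w (le_of_max_le_left hw)).1 x hx, (hm w (le_of_max_le_right hw)).1 x hx]
    · simp [(hn w (le_of_max_le_left hw)).2 x hx, (hm w (le_of_max_le_right hw)).2 x hx]

theorem isInflatedTest_of_support (h : T.Fits ε) {f : PieceFun d k}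
    (hf : ∀ i, ContDiff ℝ 1 (f i)) (hs : ∀ i, tsupport (f i) ⊆ T.region ε i) {n : ℕ}
    (hn : ∀ w : Edge k, n ≤ w.length → f (.edge w) = 0 ∧ f (.vertex w) = 0) :
    T.IsInflatedTest ε c f := by
  have h0 : ∀ {i x}, x ∉ T.region ε i → f i x = 0 := fun hx =>
    image_eq_zero_of_notMem_tsupport fun h => hx (hs _ h)
  have h1 : ∀ {i x s}, x ∉ T.region ε i → fderivWithin ℝ (f i) s x = 0 := fun {i x s} hx => by
    have h2 : f i =ᶠ[𝓝 x] fun _ => 0 := notMem_tsupport_iff_eventuallyEq.1 fun h => hx (hs _ h)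
    rw [(h2.filter_mono nhdsWithin_le_nhds).fderivWithin_eq h2.self_of_nhds, fderivWithin_fun_const]
    rfl
  have ha : ∀ w y, point y (T.finish ε w) ∉ E(T, ε, w) := fun w y hy => by
    have := hy.2.2; simp at this
  have hb : ∀ w y, point y (T.start ε w) ∉ E(T, ε, w) := fun w y hy => by
    have := hy.2.1; simp at this
  refine ⟨fun i => (hf i).contDiffOn, fun w y hy => ?_, fun w j y hy => ?_, fun w y hy a t => ?_,
    fun w j y hy a t => ?_, fun y hy => h0 (hb [] _), fun _ => ⟨n, fun w hw => ?_⟩⟩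
  · rw [h0 (ha _ _), h0 (T.sec_notMem_region h.pos none w hy)]
  · rw [h0 (hb _ _), h0 (T.sec_notMem_region h.pos (some j) w hy)]
  · rw [h1 (ha _ _), h1 (T.sec_notMem_region h.pos none w hy)]
    rfl
  · rw [h1 (hb _ _), h1 (T.sec_notMem_region h.pos (some j) w hy)]
    rfl
  · rw [(hn w hw).1, (hn w hw).2]
    exact ⟨fun _ _ => rfl, fun _ _ => rfl⟩

variable (c) in
/-- The test functions on the inflated tree as a space. -/
def inflatedTests (h : T.Fits ε) : Submodule ℂ (PieceFun d k) :=
  have h0 : T.IsInflatedTest ε c 0 := isInflatedTest_of_support h (fun _ => contDiff_const)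
    (fun i => by simp [tsupport]) (n := 0) fun _ _ => ⟨rfl, rfl⟩
  { carrier := {f | T.IsInflatedTest ε c f}
    zero_mem' := h0
    add_mem' := fun hf hg => by simpa using IsInflatedTest.add_smul h hf hg 1
    smul_mem' := fun z f hf => by simpa using IsInflatedTest.add_smul h h0 hf z }

theorem ae_inflatedMeasure (hε : 0 < ε) (i : Piece k) :
    ∀ᵐ x ∂T.inflatedMeasure ε i, x ∈ T.region ε i :=
  ae_restrict_mem (T.isOpen_region hε i).measurableSet

instance (i : Piece k) : IsFiniteMeasure (T.inflatedMeasure ε i) := ⟨by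
    rw [inflatedMeasure, restrict_apply_univ]
    exact (T.isBounded_region ε i).measure_lt_top⟩

theorem inflatedMeasure_ne_zero (h : T.Fits ε) (i : Piece k) : T.inflatedMeasure ε i ≠ 0 := by
  rw [inflatedMeasure, Ne, Measure.restrict_eq_zero]
  refine ((T.isOpen_region h.pos i).measure_pos volume ?_).ne'
  cases i with
  | edge w =>
    obtain ⟨t, ht⟩ := nonempty_Ioo.2 (h.start_lt_finish w)
    exact ⟨point 0 t, by rw [cross_point]; exact ⟨0, T.zero_mem_Ω, smul_zero _⟩, by simpa using ht⟩
  | vertex w => exact ⟨0, 0, T.zero_mem_V, smul_zero _⟩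

theorem IsInflatedTest.differentiableAt {f : PieceFun d k}
    (hf : T.IsInflatedTest ε c f) (hε : 0 < ε) {i : Piece k} {x : Eucl (d + 1)}
    (hx : x ∈ T.region ε i) : DifferentiableAt ℝ (f i) x :=
  ((hf.contDiff i).differentiableOn one_ne_zero).differentiableAt (mem_of_superset
    ((T.isOpen_region hε i).mem_nhds hx) (T.region_subset ε i))

theorem isAELinearOn_grad (h : T.Fits ε) : IsAELinearOn (inflatedTests c h) M(T, ε)
      fun f x => grad (f x.1) x.2 := by
  refine fun f hf g hg z => ae_sigma_iff.2 fun i => ?_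
  filter_upwards [ae_inflatedMeasure h.pos i] with x hx
  have h2 := IsInflatedTest.differentiableAt hg h.pos hx
  ext j
  simp [grad, fderiv_add (IsInflatedTest.differentiableAt hf h.pos hx) (h2.const_smul z),
    fderiv_const_smul h2]

variable (c) in
/-- The pairs of a test function on the inflated tree and its gradient. -/
def inflatedDomain (h : T.Fits ε) : Submodule ℂ (L²(T.inflatedMeasure ε) ×
    Lp (EuclideanSpace ℂ (Fin (d + 1))) 2 M(T, ε)) :=
  formDomain (inflatedTests c h) (isAELinearOn_grad h)

theorem inflatedDomain_dense (h : T.Fits ε) {x : L²(T.inflatedMeasure ε)}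
    (hx : ∀ p ∈ inflatedDomain c h, inner ℂ p.1 x = 0) : x = 0 := by
  classical
  refine formDomain_dense (T.isOpen_region h.pos) (ae_inflatedMeasure h.pos)
    (by funext x; ext j; simp [grad]) (fun i g hg hgc hgU => ⟨?_, ?_⟩) hx
  · have hgC := Complex.ofRealCLM.contDiff.comp hg
    obtain ⟨n, hn⟩ : ∃ n, ∀ w, n ≤ w.length → i ≠ .edge w ∧ i ≠ .vertex w := by
      cases i with
      | edge w => exact ⟨w.length + 1, fun w' hw' =>
          ⟨by rintro ⟨⟩; omega, by rintro ⟨⟩⟩⟩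
      | vertex w => exact ⟨w.length + 1, fun w' hw' =>
          ⟨by rintro ⟨⟩, by rintro ⟨⟩; omega⟩⟩
    refine ⟨update 0 i fun x => (g x : ℂ), isInflatedTest_of_support h (fun j => ?_)
      (fun j => ?_) fun w hw => ⟨update_of_ne (hn w hw).1.symm ..,
        update_of_ne (hn w hw).2.symm ..⟩, update_self ..,
        fun j hj => update_of_ne hj ..⟩
    · rcases eq_or_ne j i with rfl | hj
      · rwa [update_self]
      · rw [update_of_ne hj]
        exact contDiff_const
    · rcases eq_or_ne j i with rfl | hj
      · rw [update_self]
        exact (closure_mono (Function.support_comp_subset ofReal_zero g)).trans hgU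
      · rw [update_of_ne hj]
        simp
  · have hc : Continuous fun L : Eucl (d + 1) →L[ℝ] ℂ =>
        (toLp 2 fun i => L (EuclideanSpace.single i 1) :
          EuclideanSpace ℂ (Fin (d + 1))) := by fun_prop
    exact (hc.comp ((Complex.ofRealCLM.contDiff.comp hg).continuous_fderiv
      one_ne_zero)).memLp_of_hasCompactSupport
      (((hgc.comp_left ofReal_zero).fderiv ℝ).comp_left (by ext; simp))

theorem inflatedDomain_compact (hk : 1 ≤ k) (h : T.Fits ε) {η : ℝ} (hη : 0 < η) :
    ∃ (n : ℕ) (f : Fin n → L²(T.inflatedMeasure ε)), ∀ p ∈ inflatedDomain c h,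
        ‖p.1‖ ^ 2 ≤ η * (‖p.1‖ ^ 2 + ‖p.2‖ ^ 2) + ∑ i, ‖inner ℂ (f i) p.1‖ ^ 2 := by
  classical
  refine formDomain_compact (fun i η hη => ?_) (fun η hη => ?_) hη
  · obtain ⟨n, Q, b, hQ, hb⟩ := (T.hasCompactCore_region h.pos i).exists_integrals
      (T.isOpen_region h.pos i)
      (fun f x => enorm_mono (norm_fderiv_le_grad f x)) one_ne_zero
      ENNReal.one_ne_top hη
    simp at hQ hb
    exact ⟨n, Q, b, hQ, fun f hf _ => hb _ (((hf).contDiff i).mono (T.region_subset ε i))⟩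
  · obtain ⟨b, R, hR, hRfin, htail⟩ := T.exists_treeTail hk
    obtain ⟨C, R', hR', -, hdef⟩ := T.exists_defect_project_le hk
    have hlim : Tendsto (fun N => 2 * (ofReal ε * R' N) + 2 * (R N * C)) atTop (𝓝 0) := by
      simpa using (ENNReal.Tendsto.const_mul (a := 2) (ENNReal.Tendsto.const_mul (a := ofReal ε) hR'
        (Or.inr ofReal_ne_top)) (Or.inr ENNReal.ofNat_ne_top)).add
        (ENNReal.Tendsto.const_mul (a := 2) (ENNReal.Tendsto.mul_const (b := C) hR
        (Or.inr ENNReal.coe_ne_top)) (Or.inr ENNReal.ofNat_ne_top))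
    obtain ⟨N, hN⟩ := (hlim.eventually_le_const (ENNReal.ofReal_pos.2 hη)).exists
    have hfin : {w : Edge k | w.length < N}.Finite := List.finite_length_lt _ _
    refine ⟨hfin.toFinset.image .edge ∪ hfin.toFinset.image .vertex, fun u hu hL => ?_⟩
    by_cases hM : T.inflatedMass ε u = ∞
    · exact le_top.trans_eq (by
        change _ = _ * (T.inflatedMass ε u + _)
        rw [hM, top_add, mul_top (ENNReal.ofReal_pos.2 hη).ne'])
    by_cases hE : T.inflatedEnergy ε u = ∞
    · exact le_top.trans_eq (by
        change _ = _ * (_ + T.inflatedEnergy ε u)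
        rw [hE, add_top, mul_top (ENNReal.ofReal_pos.2 hη).ne'])
    have hfinu : T.FiniteTest ε c u := ⟨hu, hL, fun i =>
      (memLp_two_iff (measurable_grad _).aestronglyMeasurable).2
        (ne_top_of_le_ne_top hE (le_tsum i)).lt_top⟩
    obtain ⟨hE', hE1, hdef⟩ := hdef ε h c u hfinu hM hE
    obtain ⟨C', hC'⟩ := T.exists_treeEnergy_project_le
    have hv := hfinu.isTreeTest_project h
    have ht := ((htail c _ hv (hC' ε h c u hfinu hM hE).1 hE').2 N).1
    rw [tsum_piece, ← tsum_add]
    calc _ = ∑' w, {w : Edge k | N ≤ w.length}.indicator (fun w =>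
          (∫⁻ x in E(T, ε, w), ‖u (.edge w) x‖²) + ∫⁻ x in V(T, ε, w), ‖u (.vertex w) x‖²) w := by
          refine tsum_congr fun w => ?_
          by_cases hw : N ≤ w.length
          · simp [hw, inflatedMeasure]
          · simp [hw]
      _ ≤ 2 * ∑' w : {w : Edge k | N ≤ w.length}, T.defect ε u (T.project ε u) w +
          2 * (ofReal (ε ^ d) * ∑' w : {w : Edge k | N ≤ w.length},
            ∫⁻ θ, ‖T.project ε u w θ‖² ∂T.treeMeasure w) := by
          rw [← tsum_subtype, ← etsum_mul, ← etsum_mul,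
            ← etsum_mul, ← tsum_add]
          exact tsum_le_tsum fun w => hv.lintegral_edge_add_vertex_le h.pos u w
      _ ≤ 2 * (ofReal ε * R' N * T.inflatedEnergy ε u) +
          2 * (R N * (C * T.inflatedEnergy ε u)) := by
          rw [← tsum_subtype] at ht
          refine add_le_add (mul_le_mul_right (hdef N) _) (mul_le_mul_right
            ((mul_le_mul_right ht _).trans ?_) _)
          rw [mul_left_comm]
          exact mul_le_mul_right hE1 _
      _ = (2 * (ofReal ε * R' N) + 2 * (R N * C)) * T.inflatedEnergy ε u := by ring
      _ ≤ _ := mul_le_mul' hN le_add_self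

end Data

theorem form_comparison_le {H K H' K' : Type*} [NormedAddCommGroup H] [InnerProductSpace ℂ H]
    [NormedAddCommGroup K] [InnerProductSpace ℂ K] [NormedAddCommGroup H'] [InnerProductSpace ℂ H']
    [NormedAddCommGroup K'] [InnerProductSpace ℂ K'] {B : H →L[ℂ] H} {B' : H' →L[ℂ] H'} {M : ℝ}
    (hM0 : 0 ≤ M) (hM : ∀ x, ‖x‖ ^ 2 ≤ (inner ℂ x (B x)).re + M * ‖x‖ ^ 2) {p : H × K}
    {p' : H' × K'} {s η : ℝ} (hη : 0 ≤ η) (h1 : s * ‖p'.2‖ ^ 2 ≤ (1 + η) * ‖p.2‖ ^ 2)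
    (h2 : |s * (inner ℂ p'.1 (B' p'.1)).re - (inner ℂ p.1 (B p.1)).re| ≤ η * ‖p.2‖ ^ 2)
    (h3 : |s * ‖p'.1‖ ^ 2 - ‖p.1‖ ^ 2| ≤ η * ‖p.2‖ ^ 2) :
    ‖p.1‖ ^ 2 - (2 + M) * η * formEnergy B M p ≤ s * ‖p'.1‖ ^ 2 ∧
      s * formEnergy B' M p' ≤ (1 + (2 + M) * η) * formEnergy B M p := by
  have h4 : ‖p.2‖ ^ 2 ≤ formEnergy B M p := le_trans (by nlinarith) (norm_sq_le_formEnergy hM p)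
  have h5 := mul_le_mul_of_nonneg_left h4 hη
  have h6 := mul_le_mul_of_nonneg_left ((abs_le.1 h3).2.trans h5) hM0
  have h7 : 0 ≤ M * (η * formEnergy B M p) := by
    have : 0 ≤ formEnergy B M p := le_trans (by positivity) h4
    positivity
  have h8 := le_trans (by positivity) h5
  constructor
  · linarith [(abs_le.1 h3).1]
  · have e : formEnergy B M p = ‖p.2‖ ^ 2 + (inner ℂ p.1 (B p.1)).re + M * ‖p.1‖ ^ 2 := rfl
    have e' : formEnergy B' M p' = ‖p'.2‖ ^ 2 + (inner ℂ p'.1 (B' p'.1)).re + M * ‖p'.1‖ ^ 2 := rfl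
    rw [e']
    linarith [(abs_le.1 h2).2]

section Comparison

variable {ι X G ι' X' G' : Type*} [Countable ι] [MeasurableSpace X] [NormedAddCommGroup G]
  [InnerProductSpace ℂ G] {μ : ι → Measure X} {D : (X → ℂ) → X → G} [Countable ι']
  [MeasurableSpace X'] [NormedAddCommGroup G'] [InnerProductSpace ℂ G'] {μ' : ι' → Measure X'}
  {D' : (X' → ℂ) → X' → G'}

theorem IsAELinearOn.mono {V α F : Type*} [AddCommGroup V] [Module ℂ V] [MeasurableSpace α]
    [NormedAddCommGroup F] [NormedSpace ℂ F] {C C₀ : Submodule ℂ V} {ν : Measure α}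
    {a : V → α → F} (h : IsAELinearOn C ν a) (hC : C₀ ≤ C) : IsAELinearOn C₀ ν a :=
  fun f hf g hg => h f (hC hf) g (hC hg)

theorem formEigenvalue_comparison_of_map {C : Submodule ℂ (ι → X → ℂ)}
    {hD : IsAELinearOn C (sigmaMeasure μ) fun f x => D (f x.1) x.2}
    {C' : Submodule ℂ (ι' → X' → ℂ)}
    {hD' : IsAELinearOn C' (sigmaMeasure μ') fun f x => D' (f x.1) x.2}
    (P : (ι → X → ℂ) → ι' → X' → ℂ)
    (hP : ∀ f ∈ finitePart C hD, P f ∈ finitePart C' hD')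
    (hP1 : IsAELinearOn (finitePart C hD) (sigmaMeasure μ') fun f x => P f x.1 x.2)
    (hP2 : IsAELinearOn (finitePart C hD) (sigmaMeasure μ') fun f x => D' (P f x.1) x.2)
    {B : L²(μ) →L[ℂ] L²(μ)}
    {B' : L²(μ') →L[ℂ] L²(μ')} {M : ℝ} (hM0 : 0 ≤ M)
    (hM : ∀ x, ‖x‖ ^ 2 ≤ (inner ℂ x (B x)).re + M * ‖x‖ ^ 2)
    (hB' : (B' : L²(μ') →ₗ[ℂ] L²(μ')).IsSymmetric)
    (hM' : ∀ x, ‖x‖ ^ 2 ≤ (inner ℂ x (B' x)).re + M * ‖x‖ ^ 2)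
    {b : HilbertBasis ℕ ℂ L²(μ)} {l : ℕ → ℝ} (hl : Monotone l)
    (hbl : ∀ m, IsFormEigenvector (formDomain C hD).topologicalClosure B (l m) (b m))
    {b' : HilbertBasis ℕ ℂ L²(μ')} {l' : ℕ → ℝ} (hl' : Monotone l')
    (hbl' : ∀ m, IsFormEigenvector (formDomain C' hD').topologicalClosure B' (l' m) (b' m))
    {s η : ℝ} (hs : 0 < s) (hη : 0 ≤ η)
    (hcmp : ∀ f ∈ finitePart C hD, ∀ (p : L²(μ) × Lp G 2 (sigmaMeasure μ))
      (p' : L²(μ') × Lp G' 2 (sigmaMeasure μ')),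
      p.1 =ᵐ[sigmaMeasure μ] (fun x => f x.1 x.2) →
      p.2 =ᵐ[sigmaMeasure μ] (fun x => D (f x.1) x.2) →
      p'.1 =ᵐ[sigmaMeasure μ'] (fun x => P f x.1 x.2) →
      p'.2 =ᵐ[sigmaMeasure μ'] (fun x => D' (P f x.1) x.2) →
      s * ‖p'.2‖ ^ 2 ≤ (1 + η) * ‖p.2‖ ^ 2 ∧
      |s * (inner ℂ p'.1 (B' p'.1)).re - (inner ℂ p.1 (B p.1)).re| ≤ η * ‖p.2‖ ^ 2 ∧
      |s * ‖p'.1‖ ^ 2 - ‖p.1‖ ^ 2| ≤ η * ‖p.2‖ ^ 2) (m : ℕ) :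
    0 < l m + M ∧ 0 < l' m + M ∧ ((l m + M)⁻¹ - (2 + M) * η) * (l' m + M) ≤ 1 + (2 + M) * η := by
  have hle : finitePart C hD ≤ C := fun f hf => (mem_finitePart.1 hf).1
  let R := rangeRel (joinRel (formGraph (finitePart C hD) id ((isAELinearOn_apply C μ).mono hle)
    (hD.mono hle)) (formGraph (finitePart C hD) P hP1 hP2))
  have hR : ∀ r ∈ R, ∃ f ∈ finitePart C hD, (r.1.1 =ᵐ[sigmaMeasure μ] (fun x => f x.1 x.2)) ∧
      (r.1.2 =ᵐ[sigmaMeasure μ] (fun x => D (f x.1) x.2)) ∧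
      (r.2.1 =ᵐ[sigmaMeasure μ'] (fun x => P f x.1 x.2)) ∧
      r.2.2 =ᵐ[sigmaMeasure μ'] (fun x => D' (P f x.1) x.2) := fun r hr => by
    obtain ⟨f, hf⟩ := mem_rangeRel.1 hr
    obtain ⟨h1, h2⟩ := mem_joinRel.1 hf
    obtain ⟨h3, h4, h5⟩ := mem_formGraph.1 h1
    exact ⟨f, h3, h4, h5, (mem_formGraph.1 h2).2⟩
  have hc : ∀ r ∈ R, ‖r.1.1‖ ^ 2 - (2 + M) * η * formEnergy B M r.1 ≤ s * ‖r.2.1‖ ^ 2 ∧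
      s * formEnergy B' M r.2 ≤ (1 + (2 + M) * η) * formEnergy B M r.1 := fun r hr => by
    obtain ⟨f, hf, h1, h2, h3, h4⟩ := hR r hr
    obtain ⟨c1, c2, c3⟩ := hcmp f hf r.1 r.2 h1 h2 h3 h4
    exact form_comparison_le hM0 hM hη c1 c2 c3
  refine formEigenvalue_comparison hM b.orthonormal hl hbl hB' hM' b' hl' hbl' R ?_ (fun r hr => ?_)
    hs (by positivity) (fun r hr => (hc r hr).1) (fun r hr => (hc r hr).2) m
  · rw [Submodule.topologicalClosure_coe]
    refine closure_mono fun p hp => ?_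
    obtain ⟨f, hf, h1, h2⟩ := mem_formDomain.1 hp
    have hfin : f ∈ finitePart C hD := mem_finitePart.2 ⟨hf, (memLp_congr_ae h1).1 (Lp.memLp _),
      (memLp_congr_ae h2).1 (Lp.memLp _)⟩
    obtain ⟨-, h3, h4⟩ := mem_finitePart.1 (hP f hfin)
    exact ⟨(p, h3.toLp _, h4.toLp _), mem_rangeRel.2 ⟨f, mem_joinRel.2
      ⟨mem_formGraph.2 ⟨hfin, h1, h2⟩, mem_formGraph.2 ⟨hfin, h3.coeFn_toLp, h4.coeFn_toLp⟩⟩⟩, rfl⟩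
  · obtain ⟨f, hf, -, -, h3, h4⟩ := hR r hr
    exact Submodule.le_topologicalClosure _
      (mem_formDomain.2 ⟨P f, (mem_finitePart.1 (hP f hf)).1, h3, h4⟩)

end Comparison

namespace Data

theorem mem_treeTests {c : EndCondition} {v : EdgeFun k} :
    v ∈ finitePart (treeTests T c) isAELinearOn_deriv ↔
      T.IsTreeTest c v ∧ T.treeMass v ≠ ∞ ∧ T.treeEnergy v ≠ ∞ := by
  rw [mem_finitePart]
  refine and_congr_right fun hv : T.IsTreeTest c v => and_congr ?_ ?_
  · have hm : AEStronglyMeasurable (fun x : Σ _ : Edge k, ℝ => v x.1 x.2)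
        (sigmaMeasure T.treeMeasure) := aesm_sigma_iff.2 fun w =>
      (((hv.contDiff w).continuousOn.mono Ioo_subset_Icc_self).aestronglyMeasurable
        measurableSet_Ioo).smul_measure _
    rw [memLp_two_iff hm, lintegral_sigma, lt_top_iff_ne_top]
    rfl
  · have hm : AEStronglyMeasurable (fun x : Σ _ : Edge k, ℝ => deriv (v x.1) x.2)
        (sigmaMeasure T.treeMeasure) := aesm_sigma_iff.2 fun w =>
      (measurable_deriv (v w)).aestronglyMeasurable
    rw [memLp_two_iff hm, lintegral_sigma, lt_top_iff_ne_top]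
    rfl

theorem mem_inflatedTests {ε : ℝ} (h : T.Fits ε) {c : EndCondition} {u : PieceFun d k} :
    u ∈ finitePart (inflatedTests c h) (isAELinearOn_grad h) ↔
      T.FiniteTest ε c u ∧ T.inflatedMass ε u ≠ ∞ ∧ T.inflatedEnergy ε u ≠ ∞ := by
  rw [mem_finitePart]
  constructor
  · rintro ⟨h1, h2, h3⟩
    refine ⟨⟨h1, fun i => memLp_sigma_mk h2 i, fun i => memLp_sigma_mk h3 i⟩, ?_, ?_⟩
    · have := ((memLp_two_iff h2.1).1 h2).ne
      rwa [lintegral_sigma] at this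
    · have := ((memLp_two_iff h3.1).1 h3).ne
      rwa [lintegral_sigma] at this
  · rintro ⟨h1, h2, h3⟩
    exact ⟨h1.test, memLp_two_sigma (fun i => (h1.memLp i).1) h2.lt_top,
      memLp_two_sigma (fun i => (h1.memLp_grad i).1) h3.lt_top⟩

theorem eventually_integral_close (hk : 1 ≤ k) {A : ℝ → Piece k → Eucl (d + 1) → ℝ}
    {W : Edge k → ℝ → ℝ} {C : ℝ}
    (hC : 0 ≤ C) (hA : ∀ ε > 0, T.IsPot ε (A ε) C)
    (hW : T.IsTreePot W C)
    (hlim : ∀ w, ∀ᵐ θ ∂volume.restrict (I(T, w)),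
      Tendsto (fun ε => T.sectionAverage ε (A ε) w θ) (𝓝[>] 0) (𝓝 (W w θ))) {η : ℝ} (hη : 0 < η) :
    ∀ᶠ ε in 𝓝[>] 0, T.Fits ε ∧ ∀ c, (∀ u, T.FiniteTest ε c u → T.inflatedMass ε u ≠ ∞ →
      T.inflatedEnergy ε u ≠ ∞ →
      ofReal (ε ^ d) * T.treeEnergy (T.project ε u) ≤ ofReal (1 + η) * T.inflatedEnergy ε u ∧
      ‖(∫ x, A ε x.1 x.2 * ‖u x.1 x.2‖ ^ 2 ∂M(T, ε)) -
        ε ^ d * ∫ x, W x.1 x.2 * ‖T.project ε u x.1 x.2‖ ^ 2 ∂sigmaMeasure T.treeMeasure‖ₑ ≤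
        ofReal η * T.inflatedEnergy ε u) ∧
      ∀ v, T.IsTreeTest c v → T.treeMass v ≠ ∞ → T.treeEnergy v ≠ ∞ →
      T.inflatedEnergy ε (T.lift ε v) ≤ ofReal (1 + η) * (ofReal (ε ^ d) * T.treeEnergy v) ∧
      ‖(∫ x, A ε x.1 x.2 * ‖T.lift ε v x.1 x.2‖ ^ 2 ∂M(T, ε)) -
        ε ^ d * ∫ x, W x.1 x.2 * ‖v x.1 x.2‖ ^ 2 ∂sigmaMeasure T.treeMeasure‖ₑ ≤
        ofReal η * (ofReal (ε ^ d) * T.treeEnergy v) := by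
  obtain ⟨C₁, hC₁⟩ := T.exists_treeEnergy_project_le
  obtain ⟨C₂, R, -, hRfin, hC₂⟩ := T.exists_defect_project_le hk
  obtain ⟨C₃, hC₃⟩ := T.exists_lift_le hk
  obtain ⟨b, Q, -, hQfin, htail⟩ := T.exists_treeTail hk
  have hmass : ∀ c v, T.IsTreeTest c v → T.treeMass v ≠ ∞ → T.treeEnergy v ≠ ∞ →
      T.treeMass v ≤ Q 0 * T.treeEnergy v := fun c v hv hM hE => by
    refine le_trans (le_of_eq ?_) ((htail c v hv hM hE).2 0).1
    simp [treeMass]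
  set Y : ENNReal := (Q 0 + 1) * (C₂ + 1)
  have hY : Y ≠ ∞ := by have := hQfin 0; finiteness
  obtain ⟨K, hK⟩ := eventually_enorm_integral_sub_le hk hC hA hW hlim
    (show 0 < η / 2 / (Y.toReal + 1) by positivity)
  have hY2 : ofReal (η / 2 / (Y.toReal + 1)) * Y ≤ ofReal (η / 2) := by
    refine (congrArg _ (ofReal_toReal hY).symm).trans_le ?_
    rw [← ofReal_mul (by positivity)]
    refine ofReal_le_ofReal ?_
    rw [div_mul_eq_mul_div]
    exact (div_le_iff₀ (by positivity)).2 (mul_le_mul_of_nonneg_left (by linarith) (by positivity))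
  set Z : ENNReal := K * (R 0 + C₃) + ofReal (1 + 1 / (η / 2)) * C₁
  have hZ : Z ≠ ∞ := by have := hRfin 0; finiteness
  have hε0 : Tendsto (fun ε : ℝ => ε) (𝓝[>] 0) (𝓝 0) := nhdsWithin_le_nhds
  have hlim1 : Tendsto (fun ε => ofReal ε * Z) (𝓝[>] 0) (𝓝 0) := by
    simpa using (ENNReal.Tendsto.mul_const (ENNReal.tendsto_ofReal hε0) (Or.inr hZ))
  have hlim2 : Tendsto (fun ε => (1 + (C₃ : ℝ) * ε) * (1 + ε)) (𝓝[>] 0) (𝓝 1) := by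
    simpa using ((hε0.const_mul (C₃ : ℝ)).const_add 1).mul (hε0.const_add 1)
  have hη2 : ofReal (η / 2) + ofReal (η / 2) = ofReal η := by
    rw [← ofReal_add (by positivity) (by positivity), add_halves]
  have hsum : ∀ {ε : ℝ} {a e r : ENNReal}, ofReal ε * Z ≤ ofReal (η / 2) →
      a ≤ Y * e → r ≤ ofReal ε * (R 0 + C₃) * e →
      ofReal (η / 2 / (Y.toReal + 1)) * a + K * r ≤ ofReal η * e := by
    intro ε a e r h1 h2 h3
    rw [← hη2, add_mul]
    refine add_le_add ((mul_le_mul_right h2 _).trans ?_) ((mul_le_mul_right h3 _).trans ?_)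
    · rw [← mul_assoc]
      exact mul_le_mul_left hY2 _
    · rw [← mul_assoc, mul_left_comm]
      exact mul_le_mul_left ((mul_le_mul_right le_self_add _).trans h1) _
  filter_upwards [hK, T.eventually_fits, hlim1.eventually_le_const (ENNReal.ofReal_pos.2
    (half_pos hη)), hlim2.eventually_le_const (show 1 < 1 + η by linarith)] with ε hK h hε1 hε2
  have hmul : ∀ c v, T.IsTreeTest c v → T.treeMass v ≠ ∞ → T.treeEnergy v ≠ ∞ →
      ofReal (ε ^ d) * (T.treeMass v + T.treeEnergy v) ≤
        (Q 0 + 1) * (ofReal (ε ^ d) * T.treeEnergy v) := fun c v hv hM hE => by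
    rw [mul_left_comm, add_mul, one_mul]
    exact mul_le_mul_right (add_le_add_left (hmass c v hv hM hE) _) _
  refine ⟨h, fun c => ⟨fun u hu hM hE => ?_, fun v hv hM hE => ?_⟩⟩
  · obtain ⟨hM', h1⟩ := hC₁ ε h c u hu hM hE
    obtain ⟨hE', h2, h3⟩ := hC₂ ε h c u hu hM hE
    have hv := hu.isTreeTest_project h
    refine ⟨(h1 (η / 2) (half_pos hη)).trans (mul_le_mul_left ?_ _),
      (hK c _ u hv hE' (mem_finitePart.1 (mem_treeTests.2 ⟨hv, hM', hE'⟩)).2.1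
        (mem_finitePart.1 ((mem_inflatedTests h).2 ⟨hu, hM, hE⟩)).2.1).trans (hsum hε1 ?_ ?_)⟩
    · rw [ofReal_add zero_le_one hη.le, ofReal_add zero_le_one (by positivity), ← hη2, ← add_assoc]
      refine add_le_add_right (le_trans ?_ hε1) _
      rw [← mul_assoc, mul_comm (ofReal ε)]
      exact mul_le_mul_left le_add_self _
    · refine (hmul c _ hv hM' hE').trans ?_
      rw [mul_assoc]
      exact mul_le_mul_right (h2.trans (mul_le_mul_left le_self_add _)) _
    · refine le_trans (le_of_eq ?_) ((h3 0).trans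
        (mul_le_mul_left (mul_le_mul_right le_self_add _) _))
      rw [tsum_subtype {w : Edge k | 0 ≤ w.length} (fun w => T.defect ε u (T.project ε u) w)]
      simp
  · obtain ⟨h1, h2, h3, h4⟩ := hC₃ ε h c v hv hM hE
    refine ⟨h3.trans (mul_le_mul_left (ofReal_le_ofReal hε2) _),
      (hK c v _ hv hE (mem_finitePart.1 (mem_treeTests.2 ⟨hv, hM, hE⟩)).2.1
        (memLp_two_sigma (fun i => (h2.memLp i).1) h1.lt_top)).trans (hsum hε1 ?_ ?_)⟩
    · refine (hmul c _ hv hM hE).trans ?_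
      rw [mul_assoc]
      exact mul_le_mul_right (le_mul_of_one_le_left' le_add_self) _
    · refine h4.trans (mul_le_mul_left ?_ _)
      rw [mul_comm]
      exact mul_le_mul_right le_add_self _

end Data

theorem tendsto_of_inv_comparison {α : Type*} {F : Filter α} {x : α → ℝ} {y : ℝ} (hy : 0 < y)
    (h : ∀ η > 0, ∀ᶠ ε in F, 0 < x ε ∧ ((x ε)⁻¹ - η) * y ≤ 1 + η ∧ (y⁻¹ - η) * x ε ≤ 1 + η) :
    Tendsto x F (𝓝 y) := by
  have hinv : Tendsto (fun ε => (x ε)⁻¹) F (𝓝 y⁻¹) := by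
    rw [Metric.tendsto_nhds]
    intro r hr
    have hY : 0 < 2 + 2 * y⁻¹ := by positivity
    set η := min 1 (r / (2 * (2 + 2 * y⁻¹)))
    have hη : 0 < η := by positivity
    have hη1 : η ≤ 1 := min_le_left _ _
    have hη2 : η * (2 + 2 * y⁻¹) < r := by
      have h1 : η * (2 * (2 + 2 * y⁻¹)) ≤ r := (le_div_iff₀ (by positivity)).1 (min_le_right _ _)
      nlinarith
    filter_upwards [h η hη] with ε hε
    obtain ⟨h0, h1, h2⟩ := hε
    have h3 : (x ε)⁻¹ - η ≤ (1 + η) * y⁻¹ := by rw [← div_eq_mul_inv]; exact (le_div_iff₀ hy).2 h1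
    have h4 : y⁻¹ - η ≤ (1 + η) * (x ε)⁻¹ := by rw [← div_eq_mul_inv]; exact (le_div_iff₀ h0).2 h2
    have hyi := inv_pos.2 hy
    have h5 := mul_le_mul_of_nonneg_left (by nlinarith) hη.le
    rw [Real.dist_eq, abs_lt]
    constructor <;> nlinarith
  have := hinv.inv₀ (inv_pos.2 hy).ne'
  simpa using this

theorem abs_le_of_enorm_le {a η e : ℝ} (hη : 0 ≤ η) (he : 0 ≤ e)
    (h : ‖a‖ₑ ≤ ofReal η * ofReal e) : |a| ≤ η * e := by
  rw [Real.enorm_eq_ofReal_abs, ← ofReal_mul hη] at h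
  exact le_of_enorm_sq_le (by positivity) h

theorem abs_inv_mul_sub_le {a b s η e : ℝ} (hs : 0 < s) (h : |a - s * b| ≤ η * (s * e)) :
    |s⁻¹ * a - b| ≤ η * e := by
  have e1 : s⁻¹ * a - b = s⁻¹ * (a - s * b) := by field_simp
  rw [e1, abs_mul, abs_of_pos (inv_pos.2 hs)]
  refine (mul_le_mul_of_nonneg_left h (inv_pos.2 hs).le).trans (le_of_eq ?_)
  field_simp

theorem integral_mul_norm_sq_congr {α F : Type*} [MeasurableSpace α] {ν : Measure α}
    [NormedAddCommGroup F] {f g : α → F} (h : f =ᵐ[ν] g) (W : α → ℝ) :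
    ∫ x, W x * ‖f x‖ ^ 2 ∂ν = ∫ x, W x * ‖g x‖ ^ 2 ∂ν :=
  integral_congr_ae (h.mono fun x hx => by simp only [hx])

theorem norm_sq_eq_integral_of_ae {α F : Type*} [MeasurableSpace α] {ν : Measure α}
    [NormedAddCommGroup F] {f : Lp F 2 ν} {g : α → F} (h : f =ᵐ[ν] g) :
    ‖f‖ ^ 2 = ∫ x, 1 * ‖g x‖ ^ 2 ∂ν := by
  rw [← integral_mul_norm_sq_congr h, norm_sq_eq_integral]
  simp

namespace Data

theorem isAELinearOn_project (h : T.Fits ε) :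
    IsAELinearOn (finitePart (inflatedTests c h) (isAELinearOn_grad h))
      (sigmaMeasure T.treeMeasure) (fun f x => T.project ε f x.1 x.2) ∧
    IsAELinearOn (finitePart (inflatedTests c h) (isAELinearOn_grad h))
      (sigmaMeasure T.treeMeasure) (fun f x => deriv (T.project ε f x.1) x.2) := by
  constructor
  all_goals
    refine fun f hf g hg z => ae_sigma_iff.2 fun w => ?_
    have hf := ((mem_inflatedTests h).1 hf).1
    have hg := ((mem_inflatedTests h).1 hg).1
    filter_upwards [T.ae_treeMeasure w] with θ hθ
  · exact hf.project_add_smul hg h z w (Ioo_subset_Icc_self hθ)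
  · exact (hf.isTreeTest_project h).deriv_eq_add_smul (hg.isTreeTest_project h)
      (fun θ hθ => hf.project_add_smul hg h z w hθ) hθ

theorem isAELinearOn_lift (h : T.Fits ε) :
    IsAELinearOn (finitePart (treeTests T c) isAELinearOn_deriv)
      M(T, ε) (fun f x => T.lift ε f x.1 x.2) ∧
    IsAELinearOn (finitePart (treeTests T c) isAELinearOn_deriv)
      M(T, ε) (fun f x => grad (T.lift ε f x.1) x.2) := by
  have e : ∀ f g (z : ℂ), T.lift ε (f + z • g) = T.lift ε f + z • T.lift ε g := fun f g z => by
    funext i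
    cases i <;> rfl
  have hm : ∀ f ∈ finitePart (treeTests T c) isAELinearOn_deriv,
      T.lift ε f ∈ inflatedTests c h := fun f hf =>
    isInflatedTest_lift h (mem_treeTests.1 hf).1
  refine ⟨fun f hf g hg z => ?_, fun f hf g hg z => ?_⟩
  · filter_upwards with x
    rw [e]
    rfl
  · have := isAELinearOn_grad h (T.lift ε f) (hm f hf) (T.lift ε g) (hm g hg) z
    rwa [← e] at this

variable (T) {C : ℝ}

/-- Multiplication by a potential on the one-dimensional tree. -/
def treePotential (W : Edge k → ℝ → ℝ) (hW : T.IsTreePot W C) :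
    L²(T.treeMeasure) →L[ℂ] L²(T.treeMeasure) :=
  mulOp (fun x : Σ _ : Edge k, ℝ => W x.1 x.2)
    (aesm_sigma_iff.2 fun w => (hW.1 w).aestronglyMeasurable) C
    (ae_sigma_iff.2 fun w => (T.ae_treeMeasure w).mono fun x hx => hW.2 w x hx)

/-- Multiplication by a potential on the inflated tree. -/
def inflatedPotential (hε : 0 < ε) (A : Piece k → Eucl (d + 1) → ℝ)
    (hA : T.IsPot ε A C) :
    L²(T.inflatedMeasure ε) →L[ℂ] L²(T.inflatedMeasure ε) :=
  mulOp (fun x : Σ _ : Piece k, Eucl (d + 1) => A x.1 x.2) (aesm_sigma_iff.2 fun i =>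
      (hA.1 i).aestronglyMeasurable (T.isOpen_region hε i).measurableSet) C
    (ae_sigma_iff.2 fun i => (ae_inflatedMeasure hε i).mono fun x hx => hA.2 i x hx)

theorem re_inner_treePotential {W : Edge k → ℝ → ℝ} (hW : T.IsTreePot W C)
    {p : L²(T.treeMeasure)} {v : EdgeFun k}
    (hp : p =ᵐ[sigmaMeasure T.treeMeasure] fun x => v x.1 x.2) :
    (inner ℂ p (T.treePotential W hW p)).re =
      ∫ x, W x.1 x.2 * ‖v x.1 x.2‖ ^ 2 ∂sigmaMeasure T.treeMeasure :=
  (re_inner_mulOp p).trans (integral_mul_norm_sq_congr hp _)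

theorem re_inner_inflatedPotential (hε : 0 < ε) {A : Piece k → Eucl (d + 1) → ℝ}
    (hA : T.IsPot ε A C)
    {p : L²(T.inflatedMeasure ε)} {u : PieceFun d k}
    (hp : p =ᵐ[M(T, ε)] fun x => u x.1 x.2) :
    (inner ℂ p (T.inflatedPotential hε A hA p)).re =
      ∫ x, A x.1 x.2 * ‖u x.1 x.2‖ ^ 2 ∂M(T, ε) :=
  (re_inner_mulOp p).trans (integral_mul_norm_sq_congr hp _)

theorem infinite_piece (hk : 1 ≤ k) : Infinite (Edge k) ∧ Infinite (Piece k) := by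
  have : Nonempty (Fin k) := ⟨⟨0, hk⟩⟩
  exact ⟨inferInstance, Infinite.of_injective Piece.edge fun _ _ h => Piece.edge.inj h⟩

/-- The eigenvalues of the operators on the inflated and on the one-dimensional tree are close. -/
theorem eventually_eigenvalue_comparison (hk : 1 ≤ k) {c : EndCondition}
    {A : ℝ → Piece k → Eucl (d + 1) → ℝ} {W : Edge k → ℝ → ℝ}
    (hC : 0 ≤ C) (hA : ∀ ε > 0, T.IsPot ε (A ε) C)
    (hW : T.IsTreePot W C)
    (hlim : ∀ w, ∀ᵐ θ ∂volume.restrict (I(T, w)),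
      Tendsto (fun ε => T.sectionAverage ε (A ε) w θ) (𝓝[>] 0) (𝓝 (W w θ)))
    {b : HilbertBasis ℕ ℂ L²(T.treeMeasure)} {l : ℕ → ℝ} (hl : Monotone l)
    (hbl : ∀ m, IsFormEigenvector (T.treeDomain c).topologicalClosure (T.treePotential W hW)
      (l m) (b m)) {η : ℝ} (hη : 0 < η) :
    ∀ᶠ ε in 𝓝[>] 0, ∀ (h : T.Fits ε) (b' : HilbertBasis ℕ ℂ L²(T.inflatedMeasure ε)) (l' : ℕ → ℝ),
      Monotone l' → (∀ m, IsFormEigenvector (inflatedDomain c h).topologicalClosure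
        (T.inflatedPotential h.pos (A ε) (hA ε h.pos)) (l' m) (b' m)) →
      ∀ m, 0 < l m + (C + 1) ∧ 0 < l' m + (C + 1) ∧
        ((l' m + (C + 1))⁻¹ - (2 + (C + 1)) * η) * (l m + (C + 1)) ≤ 1 + (2 + (C + 1)) * η ∧
        ((l m + (C + 1))⁻¹ - (2 + (C + 1)) * η) * (l' m + (C + 1)) ≤ 1 + (2 + (C + 1)) * η := by
  have hlim1 : ∀ w, ∀ᵐ θ ∂volume.restrict (I(T, w)), Tendsto
      (fun ε => T.sectionAverage ε (fun _ _ => 1) w θ) (𝓝[>] 0) (𝓝 1) := fun w =>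
    of_forall fun θ => tendsto_const_nhds.congr' <| by
      filter_upwards [self_mem_nhdsWithin] with ε (hε : 0 < ε)
      refine (setAverage_const ?_ (isBounded_smul_Ω w).measure_lt_top.ne 1).symm
      rw [volume_smul_Ω hε]
      exact mul_ne_zero (ENNReal.ofReal_pos.2 (by positivity)).ne' (T.weight_ne_zero w)
  filter_upwards [eventually_integral_close hk hC hA hW hlim hη,
    eventually_integral_close hk zero_le_one
      (fun _ _ => ⟨fun _ => continuousOn_const, fun _ _ _ => by simp⟩)
      ⟨fun _ => measurable_const, fun _ _ _ => by simp⟩ hlim1 hη] with ε ⟨h, h1⟩ ⟨_, h2⟩ h' b' l'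
        hl' hbl' m
  have hs := pow_pos h.pos d
  have hM0 : 0 ≤ C + 1 := by linarith
  have c1 := formEigenvalue_comparison_of_map (T.project ε) (fun f hf => by
      obtain ⟨hu, hM, hE⟩ := (mem_inflatedTests h).1 hf
      obtain ⟨K, hK⟩ := T.exists_treeEnergy_project_le
      obtain ⟨K', R, -, -, hK'⟩ := T.exists_defect_project_le hk
      exact mem_treeTests.2 ⟨hu.isTreeTest_project h, (hK ε h c f hu hM hE).1,
        (hK' ε h c f hu hM hE).1⟩) (isAELinearOn_project h).1 (isAELinearOn_project h).2 hM0
    (fun x => norm_sq_le_re_inner_mulOp x) isSymmetric_mulOp (fun x => norm_sq_le_re_inner_mulOp x)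
    hl' hbl' hl hbl hs hη.le (fun f hf p p' hp1 hp2 hp1' hp2' => by
      obtain ⟨hu, hM, hE⟩ := (mem_inflatedTests h).1 hf
      obtain ⟨e1, e2⟩ := (h1 c).1 f hu hM hE
      have e3 := ((h2 c).1 f hu hM hE).2
      have n1 : T.inflatedEnergy ε f = ofReal (‖p.2‖ ^ 2) := by
        rw [ofReal_norm_sq, enorm_sq_sigma (f := fun i => grad (f i)) hp2]; rfl
      have n2 : T.treeEnergy (T.project ε f) = ofReal (‖p'.2‖ ^ 2) := by
        rw [ofReal_norm_sq, enorm_sq_sigma (f := fun w => deriv (T.project ε f w)) hp2']; rfl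
      rw [n1] at e1 e2 e3
      rw [n2, ← ofReal_mul hs.le, ← ofReal_mul (by positivity)] at e1
      have e2 := abs_le_of_enorm_le hη.le (by positivity) e2
      have e3 := abs_le_of_enorm_le hη.le (by positivity) e3
      rw [← T.re_inner_treePotential hW hp1',
        ← T.re_inner_inflatedPotential h.pos (hA ε h.pos) hp1, abs_sub_comm] at e2
      rw [← norm_sq_eq_integral_of_ae hp1, ← norm_sq_eq_integral_of_ae hp1', abs_sub_comm] at e3
      exact ⟨le_of_enorm_sq_le (by positivity) e1, e2, e3⟩) m
  have c2 := formEigenvalue_comparison_of_map (T.lift ε) (fun f hf => by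
      obtain ⟨hv, hM, hE⟩ := mem_treeTests.1 hf
      obtain ⟨K, hK⟩ := T.exists_lift_le hk
      obtain ⟨a1, a2, a3, -⟩ := hK ε h c f hv hM hE
      exact (mem_inflatedTests h).2 ⟨a2, a1, ne_top_of_le_ne_top (by finiteness) a3⟩)
    (isAELinearOn_lift h).1 (isAELinearOn_lift h).2 hM0
    (fun x => norm_sq_le_re_inner_mulOp x) isSymmetric_mulOp (fun x => norm_sq_le_re_inner_mulOp x)
    hl hbl hl' hbl' (inv_pos.2 hs) hη.le (fun f hf p p' hp1 hp2 hp1' hp2' => by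
      obtain ⟨hv, hM, hE⟩ := mem_treeTests.1 hf
      obtain ⟨e1, e2⟩ := (h1 c).2 f hv hM hE
      have e3 := ((h2 c).2 f hv hM hE).2
      have n1 : T.treeEnergy f = ofReal (‖p.2‖ ^ 2) := by
        rw [ofReal_norm_sq, enorm_sq_sigma (f := fun w => deriv (f w)) hp2]; rfl
      have n2 : T.inflatedEnergy ε (T.lift ε f) = ofReal (‖p'.2‖ ^ 2) := by
        rw [ofReal_norm_sq, enorm_sq_sigma (f := fun i => grad (T.lift ε f i)) hp2']; rfl
      rw [n1, ← ofReal_mul hs.le] at e1 e2 e3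
      rw [n2, ← ofReal_mul (by positivity)] at e1
      have e1 := le_of_enorm_sq_le (by positivity) e1
      have e2 := abs_inv_mul_sub_le hs (abs_le_of_enorm_le hη.le (by positivity) e2)
      have e3 := abs_inv_mul_sub_le hs (abs_le_of_enorm_le hη.le (by positivity) e3)
      rw [← T.re_inner_treePotential hW hp1,
        ← T.re_inner_inflatedPotential h.pos (hA ε h.pos) hp1'] at e2
      rw [← norm_sq_eq_integral_of_ae hp1, ← norm_sq_eq_integral_of_ae hp1'] at e3
      refine ⟨(inv_mul_le_iff₀ hs).2 ?_, e2, e3⟩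
      rwa [mul_left_comm]) m
  exact ⟨c1.2.1, c1.1, c1.2.2, c2.2.2⟩

end Data

end InflatedTree

end

theorem mainTheorem1 (d k : ℕ) (hd : 1 ≤ d) (hk : 1 ≤ k) (T : InflatedTree.Data d k)
    (c : InflatedTree.EndCondition)
    (Wε : ℝ → InflatedTree.Data.Piece k → InflatedTree.Eucl (d + 1) → ℝ)
    (W : InflatedTree.Edge k → ℝ → ℝ) (CW : ℝ)
    (hWε_cont : ∀ ε > 0, ∀ i, ContinuousOn (Wε ε i) (T.region ε i))
    (hWε_bdd : ∀ ε > 0, ∀ i, ∀ x ∈ T.region ε i, |Wε ε i x| ≤ CW)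
    (hW_meas : ∀ w, Measurable (W w))
    (hW_bdd : ∀ w, ∀ θ ∈ Ioo 0 (T.len w.length), |W w θ| ≤ CW)
    (hW_lim : ∀ w, ∀ᵐ θ ∂volume.restrict (Ioo 0 (T.len w.length)),
      Tendsto (fun ε => T.sectionAverage ε (Wε ε) w θ) (𝓝[>] 0) (𝓝 (W w θ))) :
    ∃ (ν : ℝ → ℕ → ℝ) (ev : ℕ → ℝ),
      (∀ᶠ ε in 𝓝[>] 0, InflatedTree.HasEigenvalues (T.inflatedMeasure ε)
        (T.inflatedOperator ε c (Wε ε)) (ν ε)) ∧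
      InflatedTree.HasEigenvalues T.treeMeasure (T.treeOperator c W) ev ∧
      ∀ m, Tendsto (fun ε => ν ε m) (𝓝[>] 0) (𝓝 (ev m)) := by
  have hC := (abs_nonneg _).trans (hW_bdd [] (T.len 0 / 2)
    ⟨half_pos (T.len_pos 0), half_lt_self (T.len_pos 0)⟩)
  have := (InflatedTree.Data.infinite_piece hk).1
  have := (InflatedTree.Data.infinite_piece hk).2
  obtain ⟨b, ev, hev, hlim, hb⟩ := InflatedTree.exists_hilbertBasis_formEigenvectors
    (InflatedTree.not_finiteDimensional_Lp_sigma T.treeMeasure_ne_zero) (T.treeDomain c)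
    (T.treePotential W ⟨hW_meas, hW_bdd⟩) InflatedTree.isSymmetric_mulOp
    (fun _ hx => InflatedTree.Data.treeDomain_dense hx)
    (fun η hη => InflatedTree.Data.treeDomain_compact hk hη)
  have hup : ∀ ε h, ∃ (b : HilbertBasis ℕ ℂ
      (Lp ℂ 2 (InflatedTree.sigmaMeasure (T.inflatedMeasure ε)))) (l : ℕ → ℝ),
      Monotone l ∧ Tendsto l atTop atTop ∧ ∀ m, InflatedTree.IsFormEigenvector
        (InflatedTree.Data.inflatedDomain c h).topologicalClosure (T.inflatedPotential h.pos (Wε ε)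
          ⟨hWε_cont ε h.pos, hWε_bdd ε h.pos⟩) (l m) (b m) := fun ε h =>
    InflatedTree.exists_hilbertBasis_formEigenvectors (InflatedTree.not_finiteDimensional_Lp_sigma
        (InflatedTree.Data.inflatedMeasure_ne_zero h)) _ _ InflatedTree.isSymmetric_mulOp
      (fun _ hx => InflatedTree.Data.inflatedDomain_dense h hx)
      (fun η hη => InflatedTree.Data.inflatedDomain_compact hk h hη)
  choose b' l' hl' hlim' hb' using hup
  classical
  refine ⟨fun ε => if h : T.Fits ε then l' ε h else 0, ev, ?_, ⟨hev, hlim, b, fun m => ?_⟩,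
    fun m => ?_⟩
  · filter_upwards [T.eventually_fits] with ε h
    rw [dif_pos h]
    refine ⟨hl' ε h, hlim' ε h, b' ε h, fun m => ?_⟩
    have := (hb' ε h m).mem_operatorGraph
    rwa [InflatedTree.Data.inflatedDomain, InflatedTree.topologicalClosure_formDomain] at this
  · have := (hb m).mem_operatorGraph
    rwa [InflatedTree.Data.treeDomain, InflatedTree.topologicalClosure_formDomain] at this
  · have hcmp := fun η (hη : 0 < η) => T.eventually_eigenvalue_comparison hk (c := c) hC
      (fun ε h => ⟨hWε_cont ε h, hWε_bdd ε h⟩) ⟨hW_meas, hW_bdd⟩ hW_lim hev hb hη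
    have hpos : 0 < ev m + (CW + 1) := by
      obtain ⟨ε, hε, h⟩ := ((hcmp 1 one_pos).and T.eventually_fits).exists
      exact (hε h (b' ε h) (l' ε h) (hl' ε h) (hb' ε h) m).1
    have key := InflatedTree.tendsto_of_inv_comparison (F := 𝓝[>] 0)
      (x := fun ε => (if h : T.Fits ε then l' ε h else 0) m + (CW + 1)) hpos fun η hη => by
        filter_upwards [hcmp (η / (2 + (CW + 1))) (by positivity), T.eventually_fits] with ε hε h
        have h1 := hε h (b' ε h) (l' ε h) (hl' ε h) (hb' ε h) m
        rw [mul_div_cancel₀ η (by positivity)] at h1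
        rw [dif_pos h]
        exact h1.2
    simpa using key.sub_const (CW + 1)
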